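/- Let $\mathbb R^6_1$ carry $\langle x,y\rangle=-x_0y_0+\sum_{j=1}^5x_jy_j$, let $[X]=(X_1,\dots,X_5)/X_0\in S^4\subset\mathbb R^5$ for a null vector $X\neq0$, and let $\lambda\in S^1$, $r=|z|$. Consider on $\mathbb C$ the potential $$\eta=\lambda^{-1}\begin{pmatrix}0&\hat B_1\\-\hat B_1^tI_{1,1}&0\end{pmatrix}dz,\qquad \hat B_1=\frac12\begin{pmatrix} i&-1&-i&1\\ i&-1&i&-1\end{pmatrix},\qquad I_{1,1}=\mathrm{diag}(-1,1),$$ and, with $\varsigma=1-\frac{r^4}{4}$, the vectors $$Y=\frac{\sqrt2}{2\varsigma}\begin{pmatrix}(1+\frac{r^2}2)^2\\-(1-\frac{r^2}2)^2\\ i(\lambda^{-1}z-\lambda\bar z)\\-\lambda^{-1}z-\lambda\bar z\\-\frac{ir^2}2(\lambda^{-1}z-\lambda\bar z)\\ \frac{r^2}2(\lambda^{-1}z+\lambda\bar z)\end{pmatrix},\qquad \hat Y=\frac{\sqrt2}{2\varsigma}\begin{pmatrix}(1+\frac{r^2}2)^2\\(1-\frac{r^2}2)^2\\ \frac{ir^2}2(\lambda^{-1}z-\lambda\bar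 z)\\-\frac{r^2}2(\lambda^{-1}z+\lambda\bar z)\\-i(\lambda^{-1}z-\lambda\bar z)\\ \lambda^{-1}z+\lambda\bar z\end{pmatrix}.$$ On $\{\varsigma\ne0\}$ the associated family of harmonic maps into $SO^+(1,5)/(SO^+(1,1)\times SO(4))$ obtained from $\eta$ (solve $F_-^{-1}dF_-=\eta$, $F_-(0,\lambda)=I$; Iwasawa-split $F_-=F\cdot V_+$ with $F$ a twisted loop in $SO^+(1,5)$ and $V_+$ a twisted loop in $SO(1,5,\mathbb C)$ extending holomorphically to $|\lambda|\le 1$ with $V_+|_{\lambda=0}\in SO(1,1,\mathbb C)\times SO(4,\mathbb C)$; project $F$; a loop $A$ is twisted if $DA(\lambda)D=A(-\lambda)$, $D=\mathrm{diag}(-1,-1,1,1,1,1)$) is $Y\wedge\hat Y$. For each $\lambda\in S^1$, $Y\wedge\hat Y$ is there an isotropic harmonic map, i.e. it is harmonic and $[\hat Y]$ is an adjoint transform of $[Y]$. (Let $\mathbf Y$ be the canonical lift of $[Y]$, i.e. the positive multiple of $(1,[Y])$ with $\langle\mathbf Y_z,\mathbf Y_{\bar z}\rangle=\frac12$; let $V$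 be the bundle spanned by $\mathbf Y,\mathbf Y_z,\mathbf Y_{\bar z},\mathbf Y_{z\bar z}$, let $N$ be its section with $\langle N,N\rangle=\langle N,\mathbf Y_z\rangle=\langle N,\mathbf Y_{\bar z}\rangle=0$, $\langle N,\mathbf Y\rangle=-1$, let $D$ be the connection of $V^\perp$, and write $\mathbf Y_{zz}=-\frac s2\mathbf Y+\kappa$ with $\kappa\in V^\perp_{\mathbb C}$. Adjoint transform means: for a smooth complex function $\mu$ with $\mu_z-\frac{\mu^2}2-s=0$ and $\langle D_{\bar z}\kappa+\frac{\bar\mu}2\kappa,D_{\bar z}\kappa+\frac{\bar\mu}2\kappa\rangle=0$, $\hat Y$ is a real multiple of $N+\bar\mu\mathbf Y_z+\mu\mathbf Y_{\bar z}+\frac{|\mu|^2}2\mathbf Y$.) Moreover, for each $\lambda\in S^1$, $[Y]$ and $[\hat Y]$ extend to maps $y,\hat y:S^2=\mathbb C\cup\{\infty\}\to S^4$ with the following properties. 0. $y$ and $\hat y$ are conformally equivalent: they differ by a conformal transformation of $S^4$ induced by an element of $O(1,5)$. 1. $y$ is an H-totally isotropic Willmore immersion from $S^2$ to $S^4$ with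 metric $\langle y_z,y_{\bar z}\rangle|dz|^2=\dfrac{2+\frac{r^4}2}{(1+\frac{r^2}2)^4}|dz|^2$ on $\mathbb C$. Here *H-totally isotropic* means that $y$ is a conformal immersion, all $z$-derivatives of order $\ge1$ of $y$ (with respect to a local complex coordinate $z$) are isotropic and mutually orthogonal for the complex bilinear product, and locally there are isotropic sections $E_1,E_2$ with $\langle E_j,\bar E_l\rangle=2\delta_{jl}$, $\langle E_1,E_2\rangle=0$, such that, for the lift $(1,y)$, $(1,y)_z\in\mathrm{Span}\{(1,y),E_1\}$ and $(1,y)_{zz}\in\mathrm{Span}\{(1,y),E_1,E_2\}$, $\{E_2,\bar E_2\}$ is a basis of the complexified conformal normal bundle (the orthogonal complement of the span of $(1,y)$ and its derivatives by $z$, $\bar z$, $z\bar z$), and $D_{\bar z}E_2\in\mathrm{Span}\{E_2\}$ for the normal connection $D$. *Willmore* means critical, for all smooth variations $S^2\to S^4$, of the Willmore functional $\int(|H|^2-K+1)\,dA$. 2. On $\mathbb C\setminus\{0\}$, $y$ is conformally equivalent (through stereographic projection and an element of $O(1,5)$) to the conformally immersed minimal surface in $\mathbb R^4$ $$x=\Big(\tfrac{2i\lambda^{-1}}{\bar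 z}-\tfrac{2i\lambda}{z},\ -\tfrac{2\lambda^{-1}}{\bar z}-\tfrac{2\lambda}{z},\ -i\lambda^{-1}z+i\lambda\bar z,\ \lambda^{-1}z+\lambda\bar z\Big)^t .$$ 3. The harmonic map $Y\wedge\hat Y$ has no definition on the curve $1-\frac{r^4}4=0$: there $y=\hat y$, and $Y\wedge\hat Y$ has no limit in the symmetric space at any point of the curve. Nevertheless both $y$ and $\hat y$ are Willmore immersions on the whole two-sphere $S^2$. -/

import Mathlib

open scoped ContDiff Matrix Topology Laplacian

noncomputable section

namespace WillmorePair

/-! ### Minkowski space and Wirtinger derivatives -/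

/-- The bilinear form `-x₀y₀ + x₁y₁ + ⋯ + xₙyₙ` on `Rⁿ⁺¹` (`R = ℝ`: the Minkowski metric;
`R = ℂ`: its complex bilinear extension). -/
def mink {n : ℕ} {R : Type*} [CommRing R] (x y : Fin (n + 1) → R) : R :=
  -(x 0 * y 0) + ∑ i : Fin n, x i.succ * y i.succ

/-- The matrix `I_{1,5} = diag(-1, 1, …, 1)`. -/
def metricMatrix (R : Type*) [CommRing R] : Matrix (Fin 6) (Fin 6) R :=
  Matrix.diagonal ![-1, 1, 1, 1, 1, 1]

/-- The matrix `D = diag(-1, -1, 1, 1, 1, 1)`, which defines the involution `A ↦ D A D⁻¹`. -/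
def involutionMatrix (R : Type*) [CommRing R] : Matrix (Fin 6) (Fin 6) R :=
  Matrix.diagonal ![-1, -1, 1, 1, 1, 1]

/-- `∂f/∂z = (f_u - i f_v) / 2` for `z = u + i v`. -/
def dz {E : Type*} [NormedAddCommGroup E] [NormedSpace ℂ E] (f : ℂ → E) : ℂ → E :=
  fun z => (1 / 2 : ℂ) • (fderiv ℝ f z 1 - Complex.I • fderiv ℝ f z Complex.I)

/-- `∂f/∂z̄ = (f_u + i f_v) / 2` for `z = u + i v`. -/
def dzbar {E : Type*} [NormedAddCommGroup E] [NormedSpace ℂ E] (f : ℂ → E) : ℂ → E :=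
  fun z => (1 / 2 : ℂ) • (fderiv ℝ f z 1 + Complex.I • fderiv ℝ f z Complex.I)

/-! ### The loop group construction of harmonic maps from potentials -/

/-- Membership in `SO⁺(1,5)`. -/
def IsSOPlus (A : Matrix (Fin 6) (Fin 6) ℝ) : Prop :=
  Aᵀ * metricMatrix ℝ * A = metricMatrix ℝ ∧ A.det = 1 ∧ 0 < A 0 0

/-- Membership in `SO(1,5,ℂ)`. -/
def IsSOComplex (A : Matrix (Fin 6) (Fin 6) ℂ) : Prop :=
  Aᵀ * metricMatrix ℂ * A = metricMatrix ℂ ∧ A.det = 1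

/-- The bivector `x ∧ y ∈ Λ²ℝ⁶`, as an antisymmetric matrix. -/
def wedge (x y : Fin 6 → ℝ) : Matrix (Fin 6) (Fin 6) ℝ :=
  Matrix.vecMulVec x y - Matrix.vecMulVec y x

/-- The symmetric space `SO⁺(1,5)/(SO⁺(1,1) × SO(4))`, as the `SO⁺(1,5)`-orbit in `Λ²ℝ⁶` of the
bivector `ε₀ ∧ ε₁` of the first two basis vectors, whose stabilizer is `SO⁺(1,1) × SO(4)`. The
class of `g` is the wedge product of the first two columns of `g`. -/
def symmetricSpace : Set (Matrix (Fin 6) (Fin 6) ℝ) :=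
  {A | ∃ g, IsSOPlus g ∧ A = wedge (g.col 0) (g.col 1)}

/-- The matrix `η₋₁ = (0, B; -Bᵗ I_{1,1}, 0)` of a potential. -/
def potentialMatrix (B : Matrix (Fin 2) (Fin 4) ℂ) : Matrix (Fin 6) (Fin 6) ℂ :=
  Matrix.reindex (finSumFinEquiv (m := 2) (n := 4)) (finSumFinEquiv (m := 2) (n := 4))
    (Matrix.fromBlocks 0 B (-(Bᵀ * (Matrix.diagonal ![-1, 1] : Matrix (Fin 2) (Fin 2) ℂ))) 0)

/-- `G = F · V` on the unit circle is an Iwasawa splitting of the loop `G`: `F` is a twisted loop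
in `SO⁺(1,5)`, and `V` is a twisted loop in `SO(1,5,ℂ)` which extends holomorphically to the unit
disk, with `V(0) ∈ SO(1,1,ℂ) × SO(4,ℂ)`. (`V(0)` is block diagonal by the twisting condition.)
Such an `F` is unique up to right multiplication by an element of `SO⁺(1,1) × SO(4)`. -/
structure IsIwasawaSplitting (G : ℂ → Matrix (Fin 6) (Fin 6) ℂ)
    (F : ℂ → Matrix (Fin 6) (Fin 6) ℝ) (V : ℂ → Matrix (Fin 6) (Fin 6) ℂ) : Prop where
  real_mem : ∀ l : ℂ, ‖l‖ = 1 → IsSOPlus (F l)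
  real_twisted : ∀ l : ℂ, ‖l‖ = 1 → involutionMatrix ℝ * F l * involutionMatrix ℝ = F (-l)
  plus_holomorphic : ∀ i j, DiffContOnCl ℂ (fun l => V l i j) (Metric.ball 0 1)
  plus_mem : ∀ l : ℂ, ‖l‖ ≤ 1 → IsSOComplex (V l)
  plus_twisted : ∀ l : ℂ, ‖l‖ ≤ 1 → involutionMatrix ℂ * V l * involutionMatrix ℂ = V (-l)
  plus_zero : ((V 0).submatrix (Fin.castAdd 4 : Fin 2 → Fin 6) (Fin.castAdd 4)).det = 1
  factor : ∀ l : ℂ, ‖l‖ = 1 → G l = (F l).map Complex.ofReal * V l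

/-- `Φ l z` (`‖l‖ = 1`, `z ∈ U`) is the associated family of maps into the symmetric space that is
generated by the potential `η = λ⁻¹ η₋₁ dz`: solve `F₋⁻¹ dF₋ = η`, `F₋(0, λ) = I`, split
`F₋ = F · V₊` at each point of `U`, and project the extended frame `F` (with `F(0, λ) = I`). -/
def IsAssociatedFamily (B : ℂ → Matrix (Fin 2) (Fin 4) ℂ) (U : Set ℂ)
    (Φ : ℂ → ℂ → Matrix (Fin 6) (Fin 6) ℝ) : Prop :=
  ∃ (G : ℂ → ℂ → Matrix (Fin 6) (Fin 6) ℂ) (F : ℂ → ℂ → Matrix (Fin 6) (Fin 6) ℝ)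
    (V : ℂ → ℂ → Matrix (Fin 6) (Fin 6) ℂ),
    (∀ l : ℂ, l ≠ 0 → G l 0 = 1 ∧ ∀ z i j,
      HasDerivAt (fun w => G l w i j) ((l⁻¹ • (G l z * potentialMatrix (B z))) i j) z) ∧
    (∀ z ∈ U, IsIwasawaSplitting (fun l => G l z) (fun l => F l z) (fun l => V l z)) ∧
    ∀ l : ℂ, ‖l‖ = 1 →
      F l 0 = 1 ∧
      (∀ i j, ContDiffOn ℝ ∞ (fun z => F l z i j) U) ∧
      ∀ z ∈ U, Φ l z = wedge ((F l z).col 0) ((F l z).col 1)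

/-- The (indefinite) inner product on `Λ²ℝ⁶` induced by the Minkowski metric, up to a constant
factor. -/
def bivectorInner (A B : Matrix (Fin 6) (Fin 6) ℝ) : ℝ :=
  (Aᵀ * metricMatrix ℝ * B * metricMatrix ℝ).trace

/-- `Φ` is a harmonic map from the open set `U` into the symmetric space, a pseudo-Riemannian
submanifold of `Λ²ℝ⁶`: its tension field, the tangential part of the Laplacian of `Φ`, vanishes.
The tangent space at `A` consists of the vectors `X A + A Xᵗ` with `X ∈ so(1,5)`. -/
structure IsHarmonicMapOn (U : Set ℂ) (Φ : ℂ → Matrix (Fin 6) (Fin 6) ℝ) : Prop where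
  mem : ∀ z ∈ U, Φ z ∈ symmetricSpace
  smooth : ∀ i j, ContDiffOn ℝ ∞ (fun z => Φ z i j) U
  tension : ∀ z ∈ U, ∀ X : Matrix (Fin 6) (Fin 6) ℝ, Xᵀ * metricMatrix ℝ + metricMatrix ℝ * X = 0 →
    bivectorInner (Matrix.of fun i j => Δ (fun w => Φ w i j) z) (X * Φ z + Φ z * Xᵀ) = 0

/-! ### Surfaces in spheres, light cone lifts and adjoint transforms -/

/-- The lift `(1, y)` of a point `y` of the unit sphere to the light cone. -/
def coneLift {n : ℕ} (y : EuclideanSpace ℝ (Fin n)) : Fin (n + 1) → ℝ :=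
  Fin.cons 1 fun i => y i

/-- The point `(Y₁, …, Yₙ) / Y₀` of the sphere represented by a light cone vector `Y`. -/
def toSphere {n : ℕ} (Y : Fin (n + 1) → ℝ) : EuclideanSpace ℝ (Fin n) :=
  WithLp.toLp 2 fun i => Y i.succ / Y 0

/-- The complexified lift `(1, y)` of a map `y` into the sphere. -/
def complexLift {n : ℕ} (y : ℂ → EuclideanSpace ℝ (Fin n)) : ℂ → Fin (n + 1) → ℂ :=
  fun z i => (coneLift (y z) i : ℂ)

/-- The canonical lift `Y = e^{-ω} (1, y)`, where `⟨y_z, y_z̄⟩ = e^{2ω} / 2`. -/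
def canonicalLift {n : ℕ} (y : ℂ → EuclideanSpace ℝ (Fin n)) : ℂ → Fin (n + 1) → ℂ :=
  fun z =>
    (((Real.sqrt (2 * (mink (dz (complexLift y) z) (dzbar (complexLift y) z)).re))⁻¹ : ℝ) : ℂ) •
      complexLift y z

section Invariants

variable {n : ℕ} (Y : ℂ → Fin (n + 1) → ℂ)

/-- The section `N` of the mean curvature sphere bundle spanned by `Y, Y_z, Y_z̄, Y_{zz̄}`, for a
canonical lift `Y`: it satisfies `⟨N, N⟩ = ⟨N, Y_z⟩ = ⟨N, Y_z̄⟩ = 0` and `⟨N, Y⟩ = -1`. -/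
def sectionN : ℂ → Fin (n + 1) → ℂ := fun z =>
  (2 : ℂ) • dzbar (dz Y) z + (2 * mink (dzbar (dz Y) z) (dzbar (dz Y) z)) • Y z

/-- The Schwarzian `s` in `Y_zz = -(s/2) Y + κ`. -/
def schwarzian : ℂ → ℂ := fun z => 2 * mink (dz (dz Y) z) (sectionN Y z)

/-- The conformal Hopf differential `κ` in `Y_zz = -(s/2) Y + κ`. -/
def hopf : ℂ → Fin (n + 1) → ℂ := fun z => dz (dz Y) z + (schwarzian Y z / 2) • Y z

/-- The orthogonal projection onto the normal bundle `V^⊥`, `V = Span {Y, Y_z, Y_z̄, N}`. -/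
def normalProj (z : ℂ) (v : Fin (n + 1) → ℂ) : Fin (n + 1) → ℂ :=
  v + mink v (sectionN Y z) • Y z + mink v (Y z) • sectionN Y z
    - (2 * mink v (dzbar Y z)) • dz Y z - (2 * mink v (dz Y z)) • dzbar Y z

/-- `D_z̄ κ`, with `D` the normal connection. -/
def dzbarHopf : ℂ → Fin (n + 1) → ℂ := fun z => normalProj Y z (dzbar (hopf Y) z)

end Invariants

/-- `[Yh]` is an adjoint transform on `U` of the surface `y`: for a function `μ` it is represented
by `N + μ̄ Y_z + μ Y_z̄ + |μ|²/2 Y` (`Y` the canonical lift of `y`), where `μ_z - μ²/2 - s = 0` and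
`⟨D_z̄ κ + μ̄/2 κ, D_z̄ κ + μ̄/2 κ⟩ = 0`. -/
def IsAdjointTransformOn {n : ℕ} (U : Set ℂ) (y : ℂ → EuclideanSpace ℝ (Fin n))
    (Yh : ℂ → Fin (n + 1) → ℝ) : Prop :=
  ∃ μ : ℂ → ℂ, ContDiffOn ℝ ∞ μ U ∧ ∀ z ∈ U,
    (∃ c : ℝ, c ≠ 0 ∧ (fun i => ((c * Yh z i : ℝ) : ℂ)) =
      sectionN (canonicalLift y) z + star (μ z) • dz (canonicalLift y) z
        + μ z • dzbar (canonicalLift y) z + (μ z * star (μ z) / 2) • canonicalLift y z) ∧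
    dz μ z - μ z ^ 2 / 2 - schwarzian (canonicalLift y) z = 0 ∧
    mink (dzbarHopf (canonicalLift y) z + (star (μ z) / 2) • hopf (canonicalLift y) z)
      (dzbarHopf (canonicalLift y) z + (star (μ z) / 2) • hopf (canonicalLift y) z) = 0

/-! ### Fundamental forms -/

section FundamentalForms

variable {n : ℕ} (f : ℂ → EuclideanSpace ℝ (Fin n))

/-- The partial derivatives with respect to `u` (index `0`) and `v` (index `1`), `z = u + i v`. -/
def pd (i : Fin 2) (f : ℂ → EuclideanSpace ℝ (Fin n)) : ℂ → EuclideanSpace ℝ (Fin n) :=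
  fun z => fderiv ℝ f z (![1, Complex.I] i)

/-- The first fundamental form. -/
def firstForm (z : ℂ) : Matrix (Fin 2) (Fin 2) ℝ :=
  Matrix.of fun i j => inner ℝ (pd i f z) (pd j f z)

/-- The second fundamental form of an immersion into Euclidean space: the component of the second
derivatives orthogonal to the tangent plane. -/
def flatSecondForm (z : ℂ) (i j : Fin 2) : EuclideanSpace ℝ (Fin n) :=
  pd i (pd j f) z -
    ∑ k, ∑ l, ((firstForm f z)⁻¹ k l * inner ℝ (pd i (pd j f) z) (pd k f z)) • pd l f z

/-- The second fundamental form of an immersion into the unit sphere: the component of the second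
derivatives orthogonal to the tangent plane and to the position vector. -/
def sphereSecondForm (z : ℂ) (i j : Fin 2) : EuclideanSpace ℝ (Fin n) :=
  flatSecondForm f z i j - inner ℝ (pd i (pd j f) z) (f z) • f z

/-- The mean curvature vector `½ g^{ij} A_{ij}` of a second fundamental form `A`. -/
def meanCurvature (A : ℂ → Fin 2 → Fin 2 → EuclideanSpace ℝ (Fin n)) (z : ℂ) :
    EuclideanSpace ℝ (Fin n) :=
  (1 / 2 : ℝ) • ∑ i, ∑ j, (firstForm f z)⁻¹ i j • A z i j

/-- The trace-free second fundamental form of an immersion into the unit sphere. -/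
def traceFreeForm (z : ℂ) (i j : Fin 2) : EuclideanSpace ℝ (Fin n) :=
  sphereSecondForm f z i j - firstForm f z i j • meanCurvature f (sphereSecondForm f) z

/-- The Willmore density `½ |A°|² dA = (|H|² - K + 1) dA` with respect to `du dv`. It equals
`4 ⟨κ, κ̄⟩ du dv` (that is, `2i ⟨κ, κ̄⟩ dz ∧ dz̄`) if `z` is a conformal coordinate. -/
def willmoreDensity (z : ℂ) : ℝ :=
  (1 / 2) * (∑ i, ∑ j, ∑ k, ∑ l, (firstForm f z)⁻¹ i k * (firstForm f z)⁻¹ j l *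
    inner ℝ (traceFreeForm f z i j) (traceFreeForm f z k l)) * Real.sqrt (firstForm f z).det

end FundamentalForms

/-- A minimal surface in Euclidean space, conformally immersed on `S ⊆ ℂ`. -/
structure IsMinimalSurfaceOn {n : ℕ} (S : Set ℂ) (x : ℂ → EuclideanSpace ℝ (Fin n)) : Prop where
  smooth : ContDiffOn ℝ ∞ x S
  conformal : ∀ z ∈ S, ConformalAt x z
  minimal : ∀ z ∈ S, meanCurvature x (flatSecondForm x) z = 0

/-! ### Surfaces parametrized by the Riemann sphere -/

/-- The two standard coordinates `z` and `w = 1/z` of the Riemann sphere `ℂ ∪ {∞} = S²`, as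
parametrizations `ℂ → ℂ ∪ {∞}`. -/
def sphereChart (a : Fin 2) (z : ℂ) : OnePoint ℂ :=
  if a = 0 then (z : OnePoint ℂ) else if z = 0 then OnePoint.infty else ((z⁻¹ : ℂ) : OnePoint ℂ)

/-- A conformal immersion of `S²` into the unit sphere of `ℝⁿ`. -/
structure IsConformalImmersion {n : ℕ} (y : OnePoint ℂ → EuclideanSpace ℝ (Fin n)) : Prop where
  mem : ∀ p, ‖y p‖ = 1
  smooth : ∀ a, ContDiff ℝ ∞ fun z => y (sphereChart a z)
  conformal : ∀ a z, ConformalAt (fun z => y (sphereChart a z)) z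

/-- The Willmore functional `∫ ½ |A°|² dA = ∫ (|H|² - K + 1) dA` of an immersion of `S²` into the
unit sphere. (`S²` is the disjoint union of `|z| ≤ 1` and `|w| < 1`.) -/
def willmoreFunctional {n : ℕ} (y : OnePoint ℂ → EuclideanSpace ℝ (Fin n)) : ℝ :=
  (∫ z in Metric.closedBall (0 : ℂ) 1, willmoreDensity (fun z => y (sphereChart 0 z)) z) +
    ∫ w in Metric.ball (0 : ℂ) 1, willmoreDensity (fun w => y (sphereChart 1 w)) w

/-- A Willmore immersion of `S²` into the unit sphere of `ℝⁿ`: a (conformal) immersion which is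
critical for the Willmore functional with respect to all smooth variations. -/
structure IsWillmoreImmersion {n : ℕ} (y : OnePoint ℂ → EuclideanSpace ℝ (Fin n)) : Prop where
  immersion : IsConformalImmersion y
  critical : ∀ v : ℝ → OnePoint ℂ → EuclideanSpace ℝ (Fin n),
    v 0 = y → (∀ t p, ‖v t p‖ = 1) →
    (∀ a, ContDiff ℝ ∞ fun q : ℝ × ℂ => v q.1 (sphereChart a q.2)) →
    HasDerivAt (fun t => willmoreFunctional (v t)) 0 0

/-- The complexification of the mean curvature sphere bundle `V`. -/
def bundleV {n : ℕ} (Y : ℂ → Fin (n + 1) → ℂ) (z : ℂ) : Submodule ℂ (Fin (n + 1) → ℂ) :=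
  Submodule.span ℂ {Y z, dz Y z, dzbar Y z, dzbar (dz Y) z}

/-- A surface `y` in `S^{2m}`, given in a conformal coordinate `z ∈ ℂ`, is H-totally isotropic:
all `z`-derivatives of a lift `Y` are isotropic, and near each point there is an isotropic frame
`E₁, …, E_m` (indexed from `0` here) with `⟨E_j, Ē_l⟩ = 2δ_{jl}`,
`Y_z^{(j)} ∈ Span {E_j} mod Span {Y, E₁, …, E_{j-1}}`, with `{E_j, Ē_j}_{j ≥ 2}` a basis of the
complexified normal bundle, and with `D_z̄ E_j ∈ Span {E₂, …, E_m}` for `j ≥ 2`, where `D_z̄ E_j` is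
the component of `∂_z̄ E_j` in `V^⊥` along `V`. -/
structure IsHTotallyIsotropicInChart (m : ℕ) (y : ℂ → EuclideanSpace ℝ (Fin (2 * m + 1))) :
    Prop where
  totally_isotropic : ∀ z, ∀ j l : ℕ, 1 ≤ j → 1 ≤ l →
    mink (dz^[j] (complexLift y) z) (dz^[l] (complexLift y) z) = 0
  frame : ∀ z₀ : ℂ, ∃ O : Set ℂ, IsOpen O ∧ z₀ ∈ O ∧
    ∃ E : Fin m → ℂ → Fin (2 * m + 1 + 1) → ℂ,
      (∀ j, ContDiffOn ℝ ∞ (E j) O) ∧ ∀ z ∈ O,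
        (∀ j l, mink (E j z) (E l z) = 0) ∧
        (∀ j l, mink (E j z) (star (E l z)) = if j = l then 2 else 0) ∧
        (∀ j : Fin m, dz^[(j : ℕ) + 1] (complexLift y) z ∈
          Submodule.span ℂ ({complexLift y z} ∪ {e | ∃ l ≤ j, e = E l z})) ∧
        LinearIndependent ℂ
          (Sum.elim (fun j : {j : Fin m // 0 < (j : ℕ)} => E j z)
            (fun j : {j : Fin m // 0 < (j : ℕ)} => star (E j z))) ∧
        (∀ x : Fin (2 * m + 1 + 1) → ℂ,
          x ∈ Submodule.span ℂ ({e | ∃ j : Fin m, 0 < (j : ℕ) ∧ (e = E j z ∨ e = star (E j z))}) ↔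
            ∀ v ∈ bundleV (complexLift y) z, mink x v = 0) ∧
        ∀ j : Fin m, 0 < (j : ℕ) → dzbar (E j) z ∈
          Submodule.span ℂ {e | ∃ l : Fin m, 0 < (l : ℕ) ∧ e = E l z} ⊔
            bundleV (complexLift y) z

/-- An H-totally isotropic (conformally immersed) surface `S² → S^{2m}`. -/
structure IsHTotallyIsotropic (m : ℕ) (y : OnePoint ℂ → EuclideanSpace ℝ (Fin (2 * m + 1))) :
    Prop where
  immersion : IsConformalImmersion y
  isotropic : ∀ a, IsHTotallyIsotropicInChart m fun z => y (sphereChart a z)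

/-- Two maps into the projective light cone, given by lifts, are conformally (Möbius) equivalent on
`S`: they differ by a transformation in `O(1,5)`. -/
def ConformallyEquivalentOn {P : Type*} (S : Set P) (A B : P → Fin 6 → ℝ) : Prop :=
  ∃ T : Matrix (Fin 6) (Fin 6) ℝ, Tᵀ * metricMatrix ℝ * T = metricMatrix ℝ ∧
    ∀ p ∈ S, ∃ c : ℝ, c ≠ 0 ∧ T *ᵥ A p = c • B p

/-- The light cone lift `((1+|x|²)/2, (1-|x|²)/2, x)` of `x ∈ ℝ⁴`, which represents the image of
`x` under inverse stereographic projection `ℝ⁴ → S⁴`. -/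
def stereoLift (x : EuclideanSpace ℝ (Fin 4)) : Fin 6 → ℝ :=
  ![(1 + ‖x‖ ^ 2) / 2, (1 - ‖x‖ ^ 2) / 2, x 0, x 1, x 2, x 3]

/-! ### The explicit example -/

/-- The constant potential matrix. -/
def exampleB : Matrix (Fin 2) (Fin 4) ℂ :=
  (1 / 2 : ℂ) • !![Complex.I, -1, -Complex.I, 1; Complex.I, -1, Complex.I, -1]

/-- The set of points with `1 - r⁴/4 ≠ 0`, `r = |z|`. -/
def exampleU : Set ℂ := {z | 1 - ‖z‖ ^ 4 / 4 ≠ 0}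

/-- The vector `Y` of the example, as a complex vector. -/
def exampleYC (l z : ℂ) : Fin 6 → ℂ :=
  ((Real.sqrt 2 / (2 * (1 - ‖z‖ ^ 4 / 4)) : ℝ) : ℂ) •
    ![(1 + (‖z‖ : ℂ) ^ 2 / 2) ^ 2,
      -(1 - (‖z‖ : ℂ) ^ 2 / 2) ^ 2,
      Complex.I * (l⁻¹ * z - l * star z),
      -l⁻¹ * z - l * star z,
      -(Complex.I * (‖z‖ : ℂ) ^ 2 / 2) * (l⁻¹ * z - l * star z),
      (‖z‖ : ℂ) ^ 2 / 2 * (l⁻¹ * z + l * star z)]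

/-- The vector `Ŷ` of the example, as a complex vector. -/
def exampleYhC (l z : ℂ) : Fin 6 → ℂ :=
  ((Real.sqrt 2 / (2 * (1 - ‖z‖ ^ 4 / 4)) : ℝ) : ℂ) •
    ![(1 + (‖z‖ : ℂ) ^ 2 / 2) ^ 2,
      (1 - (‖z‖ : ℂ) ^ 2 / 2) ^ 2,
      (Complex.I * (‖z‖ : ℂ) ^ 2 / 2) * (l⁻¹ * z - l * star z),
      -((‖z‖ : ℂ) ^ 2 / 2) * (l⁻¹ * z + l * star z),
      -Complex.I * (l⁻¹ * z - l * star z),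
      l⁻¹ * z + l * star z]

/-- The minimal surface of the example, as a complex vector. -/
def exampleXC (l z : ℂ) : Fin 4 → ℂ :=
  ![2 * Complex.I * l⁻¹ / star z - 2 * Complex.I * l / z,
    -(2 * l⁻¹) / star z - 2 * l / z,
    -Complex.I * l⁻¹ * z + Complex.I * l * star z,
    l⁻¹ * z + l * star z]

/-- The real vector `Y`; for `‖l‖ = 1` the entries of `exampleYC` are real. -/
def exampleY (l z : ℂ) : Fin 6 → ℝ := fun i => (exampleYC l z i).re

/-- The real vector `Ŷ`; for `‖l‖ = 1` the entries of `exampleYhC` are real. -/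
def exampleYh (l z : ℂ) : Fin 6 → ℝ := fun i => (exampleYhC l z i).re

/-- The real vector `x`; for `‖l‖ = 1` the entries of `exampleXC` are real. -/
def exampleX (l z : ℂ) : EuclideanSpace ℝ (Fin 4) := WithLp.toLp 2 fun i => (exampleXC l z i).re

theorem exampleYC_real {l : ℂ} (hl : ‖l‖ = 1) (z : ℂ) (i : Fin 6) :
    (exampleY l z i : ℂ) = exampleYC l z i := by
  have h : l⁻¹ = (starRingEnd ℂ) l := Complex.inv_eq_conj hl
  have h2 : (starRingEnd ℂ) 2 = 2 := map_ofNat _ 2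
  refine Complex.conj_eq_iff_re.mp ?_
  simp only [exampleYC, h, Pi.smul_apply, smul_eq_mul, map_mul, Complex.conj_ofReal]
  congr 1
  fin_cases i <;> simp [h2, -mul_eq_mul_left_iff, -mul_eq_mul_right_iff] <;> ring

theorem exampleYhC_real {l : ℂ} (hl : ‖l‖ = 1) (z : ℂ) (i : Fin 6) :
    (exampleYh l z i : ℂ) = exampleYhC l z i := by
  have h : l⁻¹ = (starRingEnd ℂ) l := Complex.inv_eq_conj hl
  have h2 : (starRingEnd ℂ) 2 = 2 := map_ofNat _ 2
  refine Complex.conj_eq_iff_re.mp ?_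
  simp only [exampleYhC, h, Pi.smul_apply, smul_eq_mul, map_mul, Complex.conj_ofReal]
  congr 1
  fin_cases i <;> simp [h2, -mul_eq_mul_left_iff, -mul_eq_mul_right_iff] <;> ring

theorem exampleXC_real {l : ℂ} (hl : ‖l‖ = 1) (z : ℂ) (i : Fin 4) :
    (exampleX l z i : ℂ) = exampleXC l z i := by
  have h : l⁻¹ = (starRingEnd ℂ) l := Complex.inv_eq_conj hl
  have h2 : (starRingEnd ℂ) 2 = 2 := map_ofNat _ 2
  refine Complex.conj_eq_iff_re.mp ?_
  simp only [exampleXC, h]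
  fin_cases i <;> simp [h2, -mul_eq_mul_left_iff, -mul_eq_mul_right_iff] <;> ring

end WillmorePair

end

/-!
# A pair of Willmore two-spheres in `S⁴` generated by a nilpotent potential

With `ζ = λ⁻¹ z` the parameter `λ` only rotates the coordinate, so everything is a statement about
the surface `modelSurface` in the variable `ζ`.

**Isotropy.** The `ζ`-derivative of `modelSurface` lies in an isotropic plane of `ℂ⁵` which depends
polynomially on `ζ̄` only (`isIsotropicSurface_modelSurface`). The plane is therefore closed under
`∂_ζ`, and contains all `ζ`-derivatives. In the coordinate `1 / z` the surface is, up to an isometry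
of `ℝ⁵` and a dilation of the coordinate, again the model surface (`exampleSurface_chart_one`), and
the dual surface is the image of the surface under an orientation reversing isometry of `ℝ⁵`. Hence
both are isotropic on the whole sphere; the frame required by H-total isotropy is built in
`IsIsotropicSurface.isHTotallyIsotropicInChart`.

**The Willmore property.** No Euler-Lagrange equation is needed. For an immersion into `S⁴` the
density `½ |A°|²` is bounded below by the absolute value of the curvature `k` of the normal bundle
(`abs_curvatureForm_le_willmoreDensity`), and for an isotropic surface it is equal to `ε k` with a
constant sign `ε` (`IsIsotropicSurface.willmoreDensity_eq`). Along a variation, the difference of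
the density and `ε k` has a minimum at time `0`, so that both have the same first variation there.
But `k = tr (J dJ dJ)`, with `J` the rotation by a right angle in the normal planes, is a closed
two-form in space and time (`curvatureForm_closed`), so its time derivative is exact. By Green's
theorem on the two coordinate disks the first variation of the functional is a sum of two boundary
terms, which cancel (`isWillmoreImmersion_of_density_eq`).

**The potential.** The space `ℝ⁶` is the orthogonal sum of two three-dimensional subspaces which
are preserved by the potential, one Lorentzian and one Euclidean. On each of them the potential is
nilpotent of order three, so that the solution `F₋` is quadratic in `λ⁻¹ z`, and the real factor of
its splitting is a boost and a rotation, respectively (`blockSolution_factor`); the remaining factor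
is polynomial in `λ z̄`. For `r² > 2` the boost must be corrected by two reflections in order to
preserve the time orientation. The first two columns of the frame are, up to a common sign,
`timelikeUnit` and `spacelikeUnit`, and span the plane of `Y ∧ Ŷ` (`wedge_example`).

**Harmonicity and the exceptional curve.** These two unit vectors take values in the two orthogonal
subspaces, and the Laplacian of each is a multiple of the vector itself. This implies that the plane
which they span is harmonic (`tension_wedge_eq_zero`). Two of the entries of `Y ∧ Ŷ` are
`Im ζ / (1 - r²/2)` and `Re ζ / (1 - r²/2)`, which excludes a limit at points with `r² = 2`.

**The adjoint transform.** The canonical lift of the surface is `(4 + r⁴)^(-1/2)` times a polynomial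
vector, and its invariants are computed explicitly; the function `μ` is `modelMu`. The vector
`D_z̄ κ + (μ̄ / 2) κ` is isotropic because `κ` is a section of an isotropic line bundle which is
preserved by `D_z̄` (`mink_dzbarHopf`).
-/

namespace WillmorePair

section

/-! ### Rotations of planes in `ℝⁿ` -/

section PlaneRotation

variable {ι : Type*} [Fintype ι]

/-- `J` is the rotation by a right angle in an oriented plane, extended by zero on the orthogonal
complement of the plane. -/
def IsPlaneRotation (J : Matrix ι ι ℝ) : Prop :=
  ∃ n m : ι → ℝ, n ⬝ᵥ n = 1 ∧ m ⬝ᵥ m = 1 ∧ n ⬝ᵥ m = 0 ∧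
    J = Matrix.vecMulVec n m - Matrix.vecMulVec m n

theorem IsPlaneRotation.transpose {J : Matrix ι ι ℝ} (h : IsPlaneRotation J) : Jᵀ = -J := by
  obtain ⟨n, m, -, -, -, rfl⟩ := h
  rw [Matrix.transpose_sub, Matrix.transpose_vecMulVec, Matrix.transpose_vecMulVec, neg_sub]

theorem IsPlaneRotation.trace_mul_self {J : Matrix ι ι ℝ} (h : IsPlaneRotation J) :
    (J * J).trace = -2 := by
  obtain ⟨n, m, hn, hm, hnm, rfl⟩ := h
  have hmn : m ⬝ᵥ n = 0 := by rw [dotProduct_comm, hnm]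
  simp only [Matrix.sub_mul, Matrix.mul_sub, Matrix.vecMulVec_mul_vecMulVec, hn, hm, hnm, hmn,
    Matrix.trace_sub, Matrix.trace_vecMulVec, zero_smul, Matrix.vecMulVec_zero, one_smul, sub_zero,
    zero_sub]
  rw [Matrix.trace_neg, Matrix.trace_vecMulVec, hm]
  norm_num

/-- The compression of a skew-symmetric matrix to the rotation plane is a multiple of the
rotation. -/
theorem IsPlaneRotation.mul_mul_of_skew {J X : Matrix ι ι ℝ} (h : IsPlaneRotation J)
    (hX : Xᵀ = -X) : J * X * J = ((J * X).trace / 2) • J := by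
  obtain ⟨n, m, hn, hm, hnm, rfl⟩ := h
  have key : ∀ a b : ι → ℝ, a ⬝ᵥ X *ᵥ b = -(b ⬝ᵥ X *ᵥ a) := fun a b => by
    rw [Matrix.dotProduct_mulVec, ← Matrix.mulVec_transpose, hX, Matrix.neg_mulVec, neg_dotProduct,
      dotProduct_comm]
  have h0 : ∀ a : ι → ℝ, a ⬝ᵥ X *ᵥ a = 0 := fun a => by linarith [key a a]
  have e : ∀ a b c d : ι → ℝ, Matrix.vecMulVec a b * X * Matrix.vecMulVec c d =
      (b ⬝ᵥ X *ᵥ c) • Matrix.vecMulVec a d := fun a b c d => by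
    rw [Matrix.vecMulVec_mul, Matrix.vecMulVec_mul_vecMulVec, Matrix.dotProduct_mulVec,
      Matrix.vecMulVec_smul]
  have t : ∀ a b : ι → ℝ, (Matrix.vecMulVec a b * X).trace = b ⬝ᵥ X *ᵥ a := fun a b => by
    rw [Matrix.vecMulVec_mul, Matrix.trace_vecMulVec, Matrix.dotProduct_mulVec, dotProduct_comm]
  simp only [Matrix.sub_mul, Matrix.mul_sub, e, h0, zero_smul, Matrix.trace_sub, t]
  rw [key m n, ← sub_eq_zero]
  module

theorem IsPlaneRotation.mul_mul_self {J : Matrix ι ι ℝ} (h : IsPlaneRotation J) :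
    J * J * J = -J := by
  rw [h.mul_mul_of_skew h.transpose, h.trace_mul_self]
  norm_num

/-- A product of three matrices which interchange the image and the kernel of a projection has
trace zero. -/
theorem trace_mul_mul_eq_zero_of_offDiagonal [DecidableEq ι] {P X Y Z : Matrix ι ι ℝ} (hP : P * P =
    P)
    (hX : P * X + X * P = X) (hY : P * Y + Y * P = Y) (hZ : P * Z + Z * P = Z) :
    (X * Y * Z).trace = 0 := by
  have e1 : P * X = X * (1 - P) := by rw [mul_sub, mul_one, eq_sub_iff_add_eq, hX]
  have e2 : P * Y = Y * (1 - P) := by rw [mul_sub, mul_one, eq_sub_iff_add_eq, hY]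
  have e3 : P * Z = Z * (1 - P) := by rw [mul_sub, mul_one, eq_sub_iff_add_eq, hZ]
  have f2 : (1 - P) * Y = Y * P := by
    rw [sub_mul, one_mul, e2, mul_sub, mul_one, sub_sub_cancel]
  have e : P * (X * Y * Z) = X * Y * Z * (1 - P) := by
    calc P * (X * Y * Z) = P * X * Y * Z := by noncomm_ring
      _ = X * ((1 - P) * Y) * Z := by rw [e1]; noncomm_ring
      _ = X * Y * (P * Z) := by rw [f2]; noncomm_ring
      _ = X * Y * Z * (1 - P) := by rw [e3]; noncomm_ring
  have z : ((P * P) * (X * Y * Z)).trace = 0 := by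
    rw [mul_assoc, e, ← mul_assoc, Matrix.trace_mul_comm, ← mul_assoc, sub_mul, one_mul, hP,
      sub_self, zero_mul, Matrix.trace_zero]
  have z1 : (P * (X * Y * Z)).trace = 0 := by rw [← hP, z]
  have z2 : (X * Y * Z * (1 - P)).trace = 0 := by rw [← e, z1]
  rw [Matrix.mul_sub, mul_one, Matrix.trace_sub, Matrix.trace_mul_comm _ P, z1, sub_zero] at z2
  exact z2

end PlaneRotation

/-! ### The curvature form of a family of planes -/

section CurvatureForm

variable {ι : Type*}
variable {X : Type*} [NormedAddCommGroup X] [NormedSpace ℝ X]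

/-- The entrywise derivative of a matrix valued function in the direction `a`. -/
noncomputable def matDeriv (a : X) (J : X → Matrix ι ι ℝ) (x : X) : Matrix ι ι ℝ :=
  Matrix.of fun i j => fderiv ℝ (fun y => J y i j) x a

/-- Entrywise differentiability of a matrix valued function. -/
def MatDiff (n : WithTop ℕ∞) (J : X → Matrix ι ι ℝ) (x : X) : Prop :=
  ∀ i j, ContDiffAt ℝ n (fun y => J y i j) x

theorem MatDiff.differentiableAt {J : X → Matrix ι ι ℝ} {x : X} (h : MatDiff 1 J x) (i j : ι) :
    DifferentiableAt ℝ (fun y => J y i j) x :=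
  (h i j).differentiableAt one_ne_zero

theorem MatDiff.mono {m n : WithTop ℕ∞} {J : X → Matrix ι ι ℝ} {x : X} (h : MatDiff n J x)
    (hmn : m ≤ n) : MatDiff m J x := fun i j => (h i j).of_le hmn

theorem MatDiff.matDeriv {m n : WithTop ℕ∞} {J : X → Matrix ι ι ℝ} {x : X} (h : MatDiff n J x)
    (hmn : m + 1 ≤ n) (a : X) : MatDiff m (matDeriv a J) x := fun i j =>
  ((h i j).fderiv_right hmn).clm_apply contDiffAt_const

theorem matDeriv_neg (J : X → Matrix ι ι ℝ) (x a : X) :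
    matDeriv a (fun y => -J y) x = -matDeriv a J x := by
  ext i j
  simp [matDeriv, fderiv_fun_neg]

theorem matDeriv_transpose (J : X → Matrix ι ι ℝ) (x a : X) :
    matDeriv a (fun y => (J y)ᵀ) x = (matDeriv a J x)ᵀ := rfl

theorem matDeriv_congr {J K : X → Matrix ι ι ℝ} {x : X} (h : ∀ᶠ y in 𝓝 x, J y = K y) (a : X) :
    matDeriv a J x = matDeriv a K x := by
  ext i j
  have h' : (fun y => J y i j) =ᶠ[𝓝 x] fun y => K y i j := h.mono fun y hy =>
    congrArg (fun A : Matrix ι ι ℝ => A i j) hy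
  simp only [matDeriv, Matrix.of_apply]
  rw [h'.fderiv_eq]

/-- Symmetry of the second derivative. -/
theorem matDeriv_comm {J : X → Matrix ι ι ℝ} {x : X} (hJ : MatDiff 2 J x) (a b : X) :
    matDeriv a (matDeriv b J) x = matDeriv b (matDeriv a J) x := by
  ext i j
  have hD : DifferentiableAt ℝ (fderiv ℝ fun y => J y i j) x :=
    ((hJ i j).fderiv_right (m := 1) (by norm_num)).differentiableAt one_ne_zero
  have e : ∀ v w, fderiv ℝ (fun y => fderiv ℝ (fun y => J y i j) y v) x w =
      fderiv ℝ (fderiv ℝ fun y => J y i j) x w v := fun v w => by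
    rw [fderiv_clm_apply hD (differentiableAt_const v)]
    simp
  simp only [matDeriv, Matrix.of_apply]
  rw [e, e]
  exact (hJ i j).isSymmSndFDerivAt (by simp) a b

variable [Fintype ι]

theorem MatDiff.mul {n : WithTop ℕ∞} {J K : X → Matrix ι ι ℝ} {x : X} (hJ : MatDiff n J x)
    (hK : MatDiff n K x) : MatDiff n (fun y => J y * K y) x := fun i j => by
  simp only [Matrix.mul_apply]
  exact ContDiffAt.sum fun k _ => (hJ i k).mul (hK k j)

theorem matDeriv_mul {J K : X → Matrix ι ι ℝ} {x : X} (hJ : MatDiff 1 J x) (hK : MatDiff 1 K x)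
    (a : X) : matDeriv a (fun y => J y * K y) x = matDeriv a J x * K x + J x * matDeriv a K x := by
  ext i j
  have h : HasFDerivAt (fun y => ∑ k, J y i k * K y k j) _ x := HasFDerivAt.fun_sum fun k _ =>
    (hJ.differentiableAt i k).hasFDerivAt.mul (hK.differentiableAt k j).hasFDerivAt
  simp only [matDeriv, Matrix.of_apply, Matrix.mul_apply, Matrix.add_apply]
  rw [h.fderiv, ← Finset.sum_add_distrib]
  simp only [sum_apply, add_apply, smul_apply, smul_eq_mul]
  exact Finset.sum_congr rfl fun k _ => by ring

theorem MatDiff.trace {n : WithTop ℕ∞} {J : X → Matrix ι ι ℝ} {x : X} (hJ : MatDiff n J x) :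
    ContDiffAt ℝ n (fun y => (J y).trace) x :=
  ContDiffAt.sum fun k _ => hJ k k

theorem fderiv_trace {J : X → Matrix ι ι ℝ} {x : X} (hJ : MatDiff 1 J x) (a : X) :
    fderiv ℝ (fun y => (J y).trace) x a = (matDeriv a J x).trace := by
  have h : HasFDerivAt (fun y => ∑ k, J y k k) _ x := HasFDerivAt.fun_sum fun k _ =>
    (hJ.differentiableAt k k).hasFDerivAt
  have h' : HasFDerivAt (fun y => (J y).trace) _ x := h
  rw [h'.fderiv, sum_apply]
  rfl

/-- The derivative of a family of plane rotations is skew-symmetric. -/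
theorem transpose_matDeriv_of_isPlaneRotation {J : X → Matrix ι ι ℝ} {x : X}
    (hJ : ∀ᶠ y in 𝓝 x, IsPlaneRotation (J y)) (a : X) : (matDeriv a J x)ᵀ = -matDeriv a J x := by
  rw [← matDeriv_transpose, ← matDeriv_neg]
  exact matDeriv_congr (hJ.mono fun y hy => hy.transpose) a

variable [DecidableEq ι]

/-- The derivative of a family of plane rotations `J` interchanges the plane and its orthogonal
complement; `-J²` is the orthogonal projection onto the plane. -/
theorem matDeriv_offDiagonal_of_isPlaneRotation {J : X → Matrix ι ι ℝ} {x : X}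
    (hJ : ∀ᶠ y in 𝓝 x, IsPlaneRotation (J y)) (hd : MatDiff 1 J x) (a : X) :
    -(J x * J x) * matDeriv a J x + matDeriv a J x * -(J x * J x) = matDeriv a J x := by
  set Y := matDeriv a J x with hY
  have e1 : (J x * Y).trace = 0 := by
    have h1 := fderiv_trace (hd.mul hd) a
    have h2 : (fun y => (J y * J y).trace) =ᶠ[𝓝 x] fun _ => (-2 : ℝ) :=
      hJ.mono fun y hy => hy.trace_mul_self
    rw [h2.fderiv_eq, matDeriv_mul hd hd, Matrix.trace_add, ← hY, Matrix.trace_mul_comm Y] at h1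
    simp only [fderiv_fun_const, Pi.zero_apply, zero_apply] at h1
    linarith
  have e2 : J x * Y * J x = 0 := by
    rw [hJ.self_of_nhds.mul_mul_of_skew (transpose_matDeriv_of_isPlaneRotation hJ a), e1]
    simp
  have h5 := matDeriv_congr (hJ.mono fun y hy => hy.mul_mul_self) a
  rw [matDeriv_mul (hd.mul hd) hd, matDeriv_mul hd hd, matDeriv_neg, ← hY, add_mul, e2,
    add_zero] at h5
  rw [neg_mul, mul_neg, ← neg_add, add_comm, ← mul_assoc Y, h5, neg_neg]

/-- The curvature form `tr (J dJ dJ)` of a family of plane rotations, evaluated on two vectors.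
Up to sign it is the curvature of the bundle of planes. -/
noncomputable def curvatureForm (J : X → Matrix ι ι ℝ) (a b : X) (x : X) : ℝ :=
  (J x * matDeriv a J x * matDeriv b J x).trace

/-- The curvature form of a family of planes is closed: the terms `tr (dJ dJ dJ)` vanish because
`dJ` is off-diagonal, and the terms with second derivatives of `J` cancel in pairs. -/
theorem curvatureForm_closed {J : X → Matrix ι ι ℝ} {x : X}
    (hJ : ∀ᶠ y in 𝓝 x, IsPlaneRotation (J y)) (hd : MatDiff 2 J x) (a b c : X) :
    fderiv ℝ (curvatureForm J b c) x a =
      fderiv ℝ (curvatureForm J a c) x b - fderiv ℝ (curvatureForm J a b) x c := by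
  have hd1 : MatDiff 1 J x := hd.mono (by norm_num)
  have hD : ∀ v, MatDiff 1 (matDeriv v J) x := hd.matDeriv (by norm_num)
  have main : ∀ u v w, fderiv ℝ (curvatureForm J v w) x u =
      (matDeriv u J x * matDeriv v J x * matDeriv w J x).trace
      + (J x * matDeriv u (matDeriv v J) x * matDeriv w J x).trace
      + (J x * matDeriv v J x * matDeriv u (matDeriv w J) x).trace := fun u v w => by
    refine (fderiv_trace ((hd1.mul (hD v)).mul (hD w)) u).trans ?_
    rw [matDeriv_mul (hd1.mul (hD v)) (hD w), matDeriv_mul hd1 (hD v), add_mul, Matrix.trace_add,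
      Matrix.trace_add]
  have hP : -(J x * J x) * -(J x * J x) = -(J x * J x) := by
    have h3 := hJ.self_of_nhds.mul_mul_self
    calc -(J x * J x) * -(J x * J x) = (J x * J x * J x) * J x := by noncomm_ring
      _ = _ := by rw [h3, neg_mul]
  have off := matDeriv_offDiagonal_of_isPlaneRotation hJ hd1
  have tr0 : ∀ u v w, (matDeriv u J x * matDeriv v J x * matDeriv w J x).trace = 0 :=
    fun u v w => trace_mul_mul_eq_zero_of_offDiagonal hP (off u) (off v) (off w)
  have skew := transpose_matDeriv_of_isPlaneRotation hJ
  have skew2 : ∀ u v, (matDeriv u (matDeriv v J) x)ᵀ = -matDeriv u (matDeriv v J) x := by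
    intro u v
    rw [← matDeriv_transpose, ← matDeriv_neg]
    exact matDeriv_congr
      (hJ.eventually_nhds.mono fun y hy => transpose_matDeriv_of_isPlaneRotation hy v) u
  -- transposing a product of three skew-symmetric matrices changes the sign of its trace
  have flip : ∀ u v w, (J x * matDeriv u J x * matDeriv v (matDeriv w J) x).trace =
      -(J x * matDeriv v (matDeriv w J) x * matDeriv u J x).trace := fun u v w => by
    rw [← Matrix.trace_transpose, Matrix.transpose_mul, Matrix.transpose_mul, skew, skew2,
      hJ.self_of_nhds.transpose]
    rw [show -matDeriv v (matDeriv w J) x * (-matDeriv u J x * -J x) =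
      -(matDeriv v (matDeriv w J) x * matDeriv u J x * J x) by noncomm_ring, Matrix.trace_neg,
      Matrix.trace_mul_comm, mul_assoc]
  rw [main, main, main, tr0, tr0, tr0, flip b a c, flip a b c, flip a c b,
    matDeriv_comm hd c a, matDeriv_comm hd b a, matDeriv_comm hd c b]
  ring

end CurvatureForm

end

/-! ### Orthonormal normal frames -/

/-- The determinant of five vectors in `ℝ⁵`. -/
noncomputable def det5 {R : Type*} [CommRing R] (x y p q r : Fin 5 → R) : R :=
  (Matrix.of ![x, y, p, q, r]).det

theorem exists_orthonormal_pair_orthogonal (p q r : Fin 5 → ℝ) :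
    ∃ n m : Fin 5 → ℝ, n ⬝ᵥ n = 1 ∧ m ⬝ᵥ m = 1 ∧ n ⬝ᵥ m = 0 ∧
      (n ⬝ᵥ p = 0 ∧ n ⬝ᵥ q = 0 ∧ n ⬝ᵥ r = 0) ∧ (m ⬝ᵥ p = 0 ∧ m ⬝ᵥ q = 0 ∧ m ⬝ᵥ r = 0) := by
  let P : Fin 3 → EuclideanSpace ℝ (Fin 5) := ![WithLp.toLp 2 p, WithLp.toLp 2 q, WithLp.toLp 2 r]
  let K : Submodule ℝ (EuclideanSpace ℝ (Fin 5)) := Submodule.span ℝ (Set.range P)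
  have hK : Module.finrank ℝ K ≤ 3 := by
    exact (finrank_range_le_card (R := ℝ) P).trans (by simp)
  have hK2 : 2 ≤ Module.finrank ℝ Kᗮ := by
    have h := Submodule.finrank_add_finrank_orthogonal K
    rw [finrank_euclideanSpace, Fintype.card_fin] at h
    omega
  let b := stdOrthonormalBasis ℝ Kᗮ
  let i0 : Fin (Module.finrank ℝ Kᗮ) := ⟨0, by omega⟩
  let i1 : Fin (Module.finrank ℝ Kᗮ) := ⟨1, by omega⟩
  have hne : i0 ≠ i1 := by simp [i0, i1]
  have ho := b.orthonormal
  have hin : ∀ x y : EuclideanSpace ℝ (Fin 5), x.ofLp ⬝ᵥ y.ofLp = inner ℝ x y := fun x y => by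
    rw [EuclideanSpace.inner_eq_star_dotProduct, star_trivial, dotProduct_comm]
  have hperp : ∀ (i) (j : Fin 3), inner ℝ (b i : EuclideanSpace ℝ (Fin 5)) (P j) = 0 := fun i j =>
    (Submodule.mem_orthogonal' K _).1 (b i).2 _ (Submodule.subset_span ⟨j, rfl⟩)
  refine ⟨(b i0 : EuclideanSpace ℝ (Fin 5)).ofLp, (b i1 : EuclideanSpace ℝ (Fin 5)).ofLp,
    ?_, ?_, ?_, ⟨?_, ?_, ?_⟩, ?_, ?_, ?_⟩
  · rw [hin, ← Submodule.coe_inner, real_inner_self_eq_norm_sq, ho.1]; norm_num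
  · rw [hin, ← Submodule.coe_inner, real_inner_self_eq_norm_sq, ho.1]; norm_num
  · rw [hin, ← Submodule.coe_inner, ho.2 hne]
  · exact (hin _ (P 0)).trans (hperp _ 0)
  · exact (hin _ (P 1)).trans (hperp _ 1)
  · exact (hin _ (P 2)).trans (hperp _ 2)
  · exact (hin _ (P 0)).trans (hperp _ 0)
  · exact (hin _ (P 1)).trans (hperp _ 1)
  · exact (hin _ (P 2)).trans (hperp _ 2)

/-- An adapted frame at a point of a surface in the unit sphere of `ℝ⁵`, with position vector `p`
and tangent vectors `q`, `r`: the vectors `n`, `m` are a positively oriented orthonormal basis of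
the normal plane. -/
structure IsNormalFrame (p q r n m : Fin 5 → ℝ) : Prop where
  nn : n ⬝ᵥ n = 1
  mm : m ⬝ᵥ m = 1
  nm : n ⬝ᵥ m = 0
  np : n ⬝ᵥ p = 0
  nq : n ⬝ᵥ q = 0
  nr : n ⬝ᵥ r = 0
  mp : m ⬝ᵥ p = 0
  mq : m ⬝ᵥ q = 0
  mr : m ⬝ᵥ r = 0
  det : ∀ x y, det5 x y p q r = Real.sqrt ((q ⬝ᵥ q) * (r ⬝ᵥ r) - (q ⬝ᵥ r) ^ 2) *
    ((n ⬝ᵥ x) * (m ⬝ᵥ y) - (m ⬝ᵥ x) * (n ⬝ᵥ y))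
  complete : ∀ x, x = (n ⬝ᵥ x) • n + (m ⬝ᵥ x) • m + (p ⬝ᵥ x) • p +
    ((q ⬝ᵥ q) * (r ⬝ᵥ r) - (q ⬝ᵥ r) ^ 2)⁻¹ •
      (((r ⬝ᵥ r) * (q ⬝ᵥ x) - (q ⬝ᵥ r) * (r ⬝ᵥ x)) • q +
        ((q ⬝ᵥ q) * (r ⬝ᵥ x) - (q ⬝ᵥ r) * (q ⬝ᵥ x)) • r)

/-- The product of the determinants is the determinant of the matrix of inner products, which is
block triangular. -/
theorem det5_mul_det5_of_orthogonal (x y n m p q r : Fin 5 → ℝ) (hp : p ⬝ᵥ p = 1)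
    (hpq : p ⬝ᵥ q = 0) (hpr : p ⬝ᵥ r = 0)
    (hn : n ⬝ᵥ p = 0 ∧ n ⬝ᵥ q = 0 ∧ n ⬝ᵥ r = 0) (hm : m ⬝ᵥ p = 0 ∧ m ⬝ᵥ q = 0 ∧ m ⬝ᵥ r = 0) :
    det5 x y p q r * det5 n m p q r = ((n ⬝ᵥ x) * (m ⬝ᵥ y) - (m ⬝ᵥ x) * (n ⬝ᵥ y)) *
      ((q ⬝ᵥ q) * (r ⬝ᵥ r) - (q ⬝ᵥ r) ^ 2) := by
  have e : (Matrix.of ![x, y, p, q, r]) * (Matrix.of ![n, m, p, q, r])ᵀ =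
      !![n ⬝ᵥ x, m ⬝ᵥ x, p ⬝ᵥ x, q ⬝ᵥ x, r ⬝ᵥ x;
         n ⬝ᵥ y, m ⬝ᵥ y, p ⬝ᵥ y, q ⬝ᵥ y, r ⬝ᵥ y;
         0, 0, 1, 0, 0; 0, 0, 0, q ⬝ᵥ q, q ⬝ᵥ r; 0, 0, 0, q ⬝ᵥ r, r ⬝ᵥ r] := by
    have hs : ∀ a b : Fin 5 → ℝ, a ⬝ᵥ b = b ⬝ᵥ a := dotProduct_comm
    ext i j
    rw [Matrix.mul_apply']
    fin_cases i <;> fin_cases j <;>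
      first
      | exact hs _ _
      | exact hp
      | exact hpq
      | exact hpr
      | exact hn.1
      | exact (hs _ _).trans hpq
      | exact (hs _ _).trans hpr
      | exact (hs _ _).trans hn.1
      | exact (hs _ _).trans hn.2.1
      | exact (hs _ _).trans hn.2.2
      | exact (hs _ _).trans hm.1
      | exact (hs _ _).trans hm.2.1
      | exact (hs _ _).trans hm.2.2
      | rfl
  rw [det5, det5, ← Matrix.det_transpose (Matrix.of ![n, m, p, q, r]), ← Matrix.det_mul, e]
  simp [Matrix.det_succ_row_zero, Fin.sum_univ_succ, Fin.succAbove]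
  ring

theorem det5_swap (n m p q r : Fin 5 → ℝ) : det5 m n p q r = -det5 n m p q r := by
  have h := Matrix.det_permute (Equiv.swap (0 : Fin 5) 1) (Matrix.of ![n, m, p, q, r])
  rw [Equiv.Perm.sign_swap (by decide)] at h
  have e : (Matrix.of ![n, m, p, q, r]).submatrix (Equiv.swap (0 : Fin 5) 1) id =
      Matrix.of ![m, n, p, q, r] := by
    ext i j
    fin_cases i <;> rfl
  rw [e] at h
  rw [det5, det5, h]
  simp

theorem exists_isNormalFrame {p q r : Fin 5 → ℝ} (hp : p ⬝ᵥ p = 1) (hpq : p ⬝ᵥ q = 0)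
    (hpr : p ⬝ᵥ r = 0) (hD : 0 < (q ⬝ᵥ q) * (r ⬝ᵥ r) - (q ⬝ᵥ r) ^ 2) :
    ∃ n m, IsNormalFrame p q r n m := by
  set D := (q ⬝ᵥ q) * (r ⬝ᵥ r) - (q ⬝ᵥ r) ^ 2 with hDdef
  -- after interchanging the two vectors if necessary, the frame is positively oriented
  obtain ⟨n, m, hnn, hmm, hnm, hn, hm, hpos⟩ : ∃ n m : Fin 5 → ℝ, n ⬝ᵥ n = 1 ∧ m ⬝ᵥ m = 1 ∧
      n ⬝ᵥ m = 0 ∧ (n ⬝ᵥ p = 0 ∧ n ⬝ᵥ q = 0 ∧ n ⬝ᵥ r = 0) ∧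
      (m ⬝ᵥ p = 0 ∧ m ⬝ᵥ q = 0 ∧ m ⬝ᵥ r = 0) ∧ 0 ≤ det5 n m p q r := by
    obtain ⟨n, m, h1, h2, h3, h4, h5⟩ := exists_orthonormal_pair_orthogonal p q r
    rcases le_total 0 (det5 n m p q r) with h | h
    · exact ⟨n, m, h1, h2, h3, h4, h5, h⟩
    · refine ⟨m, n, h2, h1, by rw [dotProduct_comm, h3], h5, h4, ?_⟩
      rw [det5_swap]
      linarith
  have hmn : m ⬝ᵥ n = 0 := by rw [dotProduct_comm, hnm]
  have hsq : det5 n m p q r * det5 n m p q r = D := by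
    rw [det5_mul_det5_of_orthogonal n m n m p q r hp hpq hpr hn hm, hnn, hmm, hmn]
    ring
  have hsqrt : det5 n m p q r = Real.sqrt D := by
    rw [← hsq, Real.sqrt_mul_self hpos]
  have hne : det5 n m p q r ≠ 0 := fun h => by rw [h] at hsq; linarith
  refine ⟨n, m, hnn, hmm, hnm, hn.1, hn.2.1, hn.2.2, hm.1, hm.2.1, hm.2.2, fun x y => ?_,
    fun x => ?_⟩
  · have h := det5_mul_det5_of_orthogonal x y n m p q r hp hpq hpr hn hm
    rw [← hDdef, ← hsq] at h
    rw [← hDdef, ← hsqrt]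
    have h' : det5 n m p q r * (det5 x y p q r - det5 n m p q r *
      ((n ⬝ᵥ x) * (m ⬝ᵥ y) - (m ⬝ᵥ x) * (n ⬝ᵥ y))) = 0 := by linear_combination h
    rcases mul_eq_zero.1 h' with h0 | h0
    · exact absurd h0 hne
    · linarith
  · rw [← sub_eq_zero]
    -- the difference is orthogonal to the five independent vectors `n, m, p, q, r`
    refine Matrix.eq_zero_of_mulVec_eq_zero (M := Matrix.of ![n, m, p, q, r]) hne ?_
    have hDne : D ≠ 0 := hD.ne'
    have hqp : q ⬝ᵥ p = 0 := by rw [dotProduct_comm, hpq]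
    have hrp : r ⬝ᵥ p = 0 := by rw [dotProduct_comm, hpr]
    have hrq : r ⬝ᵥ q = q ⬝ᵥ r := dotProduct_comm _ _
    have c1 : p ⬝ᵥ n = 0 := by rw [dotProduct_comm, hn.1]
    have c2 : q ⬝ᵥ n = 0 := by rw [dotProduct_comm, hn.2.1]
    have c3 : r ⬝ᵥ n = 0 := by rw [dotProduct_comm, hn.2.2]
    have c4 : p ⬝ᵥ m = 0 := by rw [dotProduct_comm, hm.1]
    have c5 : q ⬝ᵥ m = 0 := by rw [dotProduct_comm, hm.2.1]
    have c6 : r ⬝ᵥ m = 0 := by rw [dotProduct_comm, hm.2.2]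
    funext i
    rw [Pi.zero_apply]
    fin_cases i
    · change n ⬝ᵥ _ = 0
      simp only [dotProduct_sub, dotProduct_add, dotProduct_smul, hnn, hnm, hn.1, hn.2.1, hn.2.2,
        smul_eq_mul]
      ring
    · change m ⬝ᵥ _ = 0
      simp only [dotProduct_sub, dotProduct_add, dotProduct_smul, hmm, hmn, hm.1, hm.2.1, hm.2.2,
        smul_eq_mul]
      ring
    · change p ⬝ᵥ _ = 0
      simp only [dotProduct_sub, dotProduct_add, dotProduct_smul, c1, c4, hp, hpq, hpr,
        smul_eq_mul]
      ring
    · change q ⬝ᵥ _ = 0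
      simp only [dotProduct_sub, dotProduct_add, dotProduct_smul, c2, c5, hqp, smul_eq_mul]
      rw [← hDdef]
      field_simp
      rw [hDdef]
      ring
    · change r ⬝ᵥ _ = 0
      simp only [dotProduct_sub, dotProduct_add, dotProduct_smul, c3, c6, hrp, hrq, smul_eq_mul]
      rw [← hDdef]
      field_simp
      rw [hDdef]
      ring

/-! ### The Willmore density and the curvature of the normal bundle -/

/-- The squared norm of the trace-free part of the symmetric form `a, b, c` with respect to the
metric `E, F, G` (with `S² = E G - F²`), in terms of its two components in the orthonormal frame
`∂_u / √E`, `(∂_v - (F / E) ∂_u) √E / S`. -/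
theorem traceFree_norm_sq {E F G S a b c : ℝ} (hE : E ≠ 0) (hS : S ≠ 0)
    (hD : S ^ 2 = E * G - F ^ 2) :
    ∑ i : Fin 2, ∑ j : Fin 2, ∑ k : Fin 2, ∑ l : Fin 2,
      ((S ^ 2)⁻¹ • !![G, -F; -F, E]) i k * ((S ^ 2)⁻¹ • !![G, -F; -F, E]) j l *
        ((!![a, b; b, c] i j - !![E, F; F, G] i j * ((1 / 2) * ((G * a - 2 * F * b + E * c) / S ^
            2)))
        * (!![a, b; b, c] k l -
            !![E, F; F, G] k l * ((1 / 2) * ((G * a - 2 * F * b + E * c) / S ^ 2)))) =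
      2 * (((a - E * ((1 / 2) * ((G * a - 2 * F * b + E * c) / S ^ 2))) / E) ^ 2 +
        ((b - F * ((1 / 2) * ((G * a - 2 * F * b + E * c) / S ^ 2)) -
          F / E * (a - E * ((1 / 2) * ((G * a - 2 * F * b + E * c) / S ^ 2)))) / S) ^ 2) := by
  have hG : G = (S ^ 2 + F ^ 2) / E := by field_simp; linarith
  simp only [Fin.sum_univ_two, Matrix.smul_apply, smul_eq_mul, Matrix.of_apply, Matrix.cons_val',
    Matrix.cons_val_zero, Matrix.cons_val_one, Matrix.cons_val_fin_one]
  subst hG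
  field_simp
  ring

/-- The normal curvature of the pair of symmetric forms `a, b, c` and `a', b', c'` depends only on
their trace-free parts. The components on the right-hand side are those of `traceFree_norm_sq`. -/
theorem normalCurvature_eq {E F G S a b c a' b' c' : ℝ} (hE : E ≠ 0) (hS : S ≠ 0)
    (hD : S ^ 2 = E * G - F ^ 2) :
    (S ^ 2)⁻¹ * (G * (a * b' - a' * b) - F * (a * c' - a' * c) + E * (b * c' - b' * c)) =
    2 * S * ((a - E * ((1 / 2) * ((G * a - 2 * F * b + E * c) / S ^ 2))) / E *
      ((b' - F * ((1 / 2) * ((G * a' - 2 * F * b' + E * c') / S ^ 2)) -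
          F / E * (a' - E * ((1 / 2) * ((G * a' - 2 * F * b' + E * c') / S ^ 2)))) / S) -
      (a' - E * ((1 / 2) * ((G * a' - 2 * F * b' + E * c') / S ^ 2))) / E *
      ((b - F * ((1 / 2) * ((G * a - 2 * F * b + E * c) / S ^ 2)) -
          F / E * (a - E * ((1 / 2) * ((G * a - 2 * F * b + E * c) / S ^ 2)))) / S)) := by
  have hG : G = (S ^ 2 + F ^ 2) / E := by field_simp; linarith
  subst hG
  field_simp
  ring

section

/-! ### The rotation of the normal planes of a surface -/

theorem inner_eq_dotProduct {n : ℕ} (x y : EuclideanSpace ℝ (Fin n)) :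
    inner ℝ x y = x.ofLp ⬝ᵥ y.ofLp := by
  rw [EuclideanSpace.inner_eq_star_dotProduct, star_trivial, dotProduct_comm]

/-- The rotation by a right angle in the orthogonal complement of `p`, `q`, `r` in `ℝ⁵`, where `p`
is a unit vector orthogonal to `q` and `r`. -/
noncomputable def planeRotation (p q r : Fin 5 → ℝ) : Matrix (Fin 5) (Fin 5) ℝ :=
  Matrix.of fun i j => (Real.sqrt ((q ⬝ᵥ q) * (r ⬝ᵥ r) - (q ⬝ᵥ r) ^ 2))⁻¹ *
    det5 (Pi.single i 1) (Pi.single j 1) p q r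

theorem IsNormalFrame.planeRotation_eq {p q r n m : Fin 5 → ℝ} (h : IsNormalFrame p q r n m)
    (hD : 0 < (q ⬝ᵥ q) * (r ⬝ᵥ r) - (q ⬝ᵥ r) ^ 2) :
    planeRotation p q r = Matrix.vecMulVec n m - Matrix.vecMulVec m n := by
  have hs := (Real.sqrt_pos.2 hD).ne'
  ext i j
  simp only [planeRotation, Matrix.of_apply, h.det, Matrix.sub_apply, Matrix.vecMulVec_apply,
    dotProduct_single, mul_one]
  field_simp

theorem IsNormalFrame.isPlaneRotation {p q r n m : Fin 5 → ℝ} (h : IsNormalFrame p q r n m)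
    (hD : 0 < (q ⬝ᵥ q) * (r ⬝ᵥ r) - (q ⬝ᵥ r) ^ 2) : IsPlaneRotation (planeRotation p q r) :=
  ⟨n, m, h.nn, h.mm, h.nm, h.planeRotation_eq hD⟩

section Smoothness

variable {X : Type*} [NormedAddCommGroup X] [NormedSpace ℝ X]

theorem contDiffAt_det {m : WithTop ℕ∞} {k : ℕ} {M : X → Matrix (Fin k) (Fin k) ℝ} {x : X}
    (h : ∀ i j, ContDiffAt ℝ m (fun y => M y i j) x) : ContDiffAt ℝ m (fun y => (M y).det) x := by
  simp only [Matrix.det_apply]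
  exact ContDiffAt.sum fun σ _ => (contDiffAt_prod fun i _ => h _ _).const_smul _

theorem contDiffAt_dotProduct {m : WithTop ℕ∞} {k : ℕ} {u v : X → EuclideanSpace ℝ (Fin k)} {x : X}
    (hu : ContDiffAt ℝ m u x) (hv : ContDiffAt ℝ m v x) :
    ContDiffAt ℝ m (fun y => (u y).ofLp ⬝ᵥ (v y).ofLp) x := by
  simp only [← inner_eq_dotProduct]
  exact hu.inner ℝ hv

theorem matDiff_planeRotation {m : WithTop ℕ∞} {p q r : X → EuclideanSpace ℝ (Fin 5)} {x : X}
    (hp : ContDiffAt ℝ m p x) (hq : ContDiffAt ℝ m q x) (hr : ContDiffAt ℝ m r x)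
    (hD : 0 < ((q x).ofLp ⬝ᵥ (q x).ofLp) * ((r x).ofLp ⬝ᵥ (r x).ofLp) -
      ((q x).ofLp ⬝ᵥ (r x).ofLp) ^ 2) :
    MatDiff m (fun y => planeRotation (p y).ofLp (q y).ofLp (r y).ofLp) x := fun i j => by
  simp only [planeRotation, Matrix.of_apply]
  refine ContDiffAt.mul (ContDiffAt.inv (ContDiffAt.sqrt ?_ hD.ne') (Real.sqrt_pos.2 hD).ne') ?_
  · exact ((contDiffAt_dotProduct hq hq).mul (contDiffAt_dotProduct hr hr)).sub
      ((contDiffAt_dotProduct hq hr).pow 2)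
  · refine contDiffAt_det fun a b => ?_
    fin_cases a
    · exact contDiffAt_const
    · exact contDiffAt_const
    · exact (contDiffAt_piLp 2).1 hp b
    · exact (contDiffAt_piLp 2).1 hq b
    · exact (contDiffAt_piLp 2).1 hr b

end Smoothness

variable {h : ℂ → EuclideanSpace ℝ (Fin 5)}

/-- The rotation by a right angle in the normal planes of a surface in the unit sphere of `ℝ⁵`. -/
noncomputable def normalRotation (h : ℂ → EuclideanSpace ℝ (Fin 5)) (z : ℂ) :
    Matrix (Fin 5) (Fin 5) ℝ :=
  planeRotation (h z).ofLp (pd 0 h z).ofLp (pd 1 h z).ofLp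

/-- The determinant of the first fundamental form. -/
noncomputable def gram {n : ℕ} (h : ℂ → EuclideanSpace ℝ (Fin n)) (z : ℂ) : ℝ :=
  ((pd 0 h z).ofLp ⬝ᵥ (pd 0 h z).ofLp) * ((pd 1 h z).ofLp ⬝ᵥ (pd 1 h z).ofLp) -
    ((pd 0 h z).ofLp ⬝ᵥ (pd 1 h z).ofLp) ^ 2

theorem contDiff_pd {n : ℕ} {h : ℂ → EuclideanSpace ℝ (Fin n)} (hs : ContDiff ℝ ∞ h) (i : Fin 2) :
    ContDiff ℝ ∞ (pd i h) :=
  (hs.fderiv_right (m := ∞) le_rfl).clm_apply contDiff_const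

theorem pd_comm {n : ℕ} {h : ℂ → EuclideanSpace ℝ (Fin n)} (hs : ContDiff ℝ ∞ h) (z : ℂ)
    (i j : Fin 2) : pd i (pd j h) z = pd j (pd i h) z := by
  have hD : DifferentiableAt ℝ (fderiv ℝ h) z :=
    (hs.fderiv_right (m := ∞) le_rfl).differentiable (by simp) z
  have e : ∀ v w : ℂ, fderiv ℝ (fun y => fderiv ℝ h y v) z w = fderiv ℝ (fderiv ℝ h) z w v :=
    fun v w => by
      rw [fderiv_clm_apply hD (differentiableAt_const v)]
      simp
  exact (e _ _).trans (((contDiff_infty.1 hs 2).contDiffAt.isSymmSndFDerivAt (by simp) _ _).trans (e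
      _ _).symm)

theorem dotProduct_pd_of_norm_eq_one (hs : ContDiff ℝ ∞ h) (hu : ∀ z, ‖h z‖ = 1) (z : ℂ)
    (i : Fin 2) : (h z).ofLp ⬝ᵥ (pd i h z).ofLp = 0 := by
  have hd : HasFDerivAt h (fderiv ℝ h z) z := (hs.differentiable (by simp) z).hasFDerivAt
  have h1 := hd.norm_sq
  have h2 : (fun z => ‖h z‖ ^ 2) = fun _ => (1 : ℝ) := by funext w; rw [hu w]; norm_num
  rw [h2] at h1
  have h3 := congrArg (fun L : ℂ →L[ℝ] ℝ => L (![1, Complex.I] i))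
    (h1.unique (hasFDerivAt_const (1 : ℝ) z))
  simp only [smul_apply, ContinuousLinearMap.comp_apply, zero_apply, innerSL_apply_apply,
    inner_eq_dotProduct, nsmul_eq_mul] at h3
  simpa [pd] using h3

theorem exists_isNormalFrame_of_surface (hs : ContDiff ℝ ∞ h) (hu : ∀ z, ‖h z‖ = 1) {z : ℂ}
    (hD : 0 < gram h z) :
    ∃ n m, IsNormalFrame (h z).ofLp (pd 0 h z).ofLp (pd 1 h z).ofLp n m := by
  refine exists_isNormalFrame ?_ (dotProduct_pd_of_norm_eq_one hs hu z 0)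
    (dotProduct_pd_of_norm_eq_one hs hu z 1) hD
  rw [← inner_eq_dotProduct, real_inner_self_eq_norm_sq, hu z]
  norm_num

theorem isPlaneRotation_normalRotation (hs : ContDiff ℝ ∞ h) (hu : ∀ z, ‖h z‖ = 1) {z : ℂ}
    (hD : 0 < gram h z) : IsPlaneRotation (normalRotation h z) := by
  obtain ⟨n, m, hf⟩ := exists_isNormalFrame_of_surface hs hu hD
  exact hf.isPlaneRotation hD

theorem matDiff_normalRotation (hs : ContDiff ℝ ∞ h) {z : ℂ}
    (hD : 0 < gram h z) : MatDiff ∞ (normalRotation h) z :=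
  matDiff_planeRotation hs.contDiffAt (contDiff_pd hs 0).contDiffAt (contDiff_pd hs 1).contDiffAt hD

theorem continuous_gram {n : ℕ} {h : ℂ → EuclideanSpace ℝ (Fin n)} (hs : ContDiff ℝ ∞ h) :
    Continuous (gram h) := by
  have c : ∀ i j, Continuous fun z => (pd i h z).ofLp ⬝ᵥ (pd j h z).ofLp := fun i j => by
    simp only [← inner_eq_dotProduct]
    exact (contDiff_pd hs i).continuous.inner (contDiff_pd hs j).continuous
  exact ((c 0 0).mul (c 1 1)).sub ((c 0 1).pow 2)

/-- Differentiation of `J v = 0`. -/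
theorem matDeriv_mulVec_of_mulVec_eq_zero {J : ℂ → Matrix (Fin 5) (Fin 5) ℝ}
    {v : ℂ → EuclideanSpace ℝ (Fin 5)} {z : ℂ} (hJ : MatDiff 1 J z) (hv : ContDiff ℝ ∞ v)
    (h0 : ∀ᶠ w in 𝓝 z, J w *ᵥ (v w).ofLp = 0) (a : ℂ) :
    matDeriv a J z *ᵥ (v z).ofLp = -(J z *ᵥ (fderiv ℝ v z a).ofLp) := by
  funext i
  have hvd : ∀ j, HasFDerivAt (fun w => (v w).ofLp j)
      ((EuclideanSpace.proj j : EuclideanSpace ℝ (Fin 5) →L[ℝ] ℝ).comp (fderiv ℝ v z)) z :=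
    fun j => (EuclideanSpace.proj j : EuclideanSpace ℝ (Fin 5) →L[ℝ] ℝ).hasFDerivAt.comp z
      (hv.differentiable (by simp) z).hasFDerivAt
  have h1 : HasFDerivAt (fun w => ∑ j, J w i j * (v w).ofLp j) _ z := HasFDerivAt.fun_sum fun j _ =>
    (hJ.differentiableAt i j).hasFDerivAt.mul (hvd j)
  have h2 : (fun w => ∑ j, J w i j * (v w).ofLp j) =ᶠ[𝓝 z] fun _ => (0 : ℝ) :=
    h0.mono fun w hw => congrFun hw i
  have h3 := congrArg (fun L : ℂ →L[ℝ] ℝ => L a)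
    ((h1.congr_of_eventuallyEq h2.symm).unique (hasFDerivAt_const (0 : ℝ) z))
  simp only [sum_apply, add_apply, smul_apply, smul_eq_mul, ContinuousLinearMap.comp_apply,
    zero_apply, Finset.sum_add_distrib] at h3
  simp only [Matrix.mulVec, dotProduct, Pi.neg_apply, matDeriv, Matrix.of_apply]
  have e1 : ∀ x : Fin 5, fderiv ℝ (fun y => J y i x) z a * (v z).ofLp x =
      (v z).ofLp x * fderiv ℝ (fun y => J y i x) z a := fun x => mul_comm _ _
  simp only [e1]
  have e2 : ∑ x, J z i x * (fderiv ℝ v z a).ofLp x =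
      ∑ x, J z i x * (EuclideanSpace.proj x : EuclideanSpace ℝ (Fin 5) →L[ℝ] ℝ) (fderiv ℝ v z a) :=
    rfl
  rw [e2]
  linarith

/-- The curvature form of the normal planes of a surface in terms of the second fundamental form
(the Ricci equation). -/
theorem curvatureForm_normalRotation (hs : ContDiff ℝ ∞ h) (hu : ∀ z, ‖h z‖ = 1) {z : ℂ}
    (hD : 0 < gram h z) {n m : Fin 5 → ℝ}
    (hf : IsNormalFrame (h z).ofLp (pd 0 h z).ofLp (pd 1 h z).ofLp n m) :
    curvatureForm (normalRotation h) 1 Complex.I z = (gram h z)⁻¹ *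
      (((pd 1 h z).ofLp ⬝ᵥ (pd 1 h z).ofLp) *
        ((n ⬝ᵥ (pd 0 (pd 0 h) z).ofLp) * (m ⬝ᵥ (pd 0 (pd 1 h) z).ofLp) -
          (m ⬝ᵥ (pd 0 (pd 0 h) z).ofLp) * (n ⬝ᵥ (pd 0 (pd 1 h) z).ofLp)) -
      ((pd 0 h z).ofLp ⬝ᵥ (pd 1 h z).ofLp) *
        ((n ⬝ᵥ (pd 0 (pd 0 h) z).ofLp) * (m ⬝ᵥ (pd 1 (pd 1 h) z).ofLp) -
          (m ⬝ᵥ (pd 0 (pd 0 h) z).ofLp) * (n ⬝ᵥ (pd 1 (pd 1 h) z).ofLp)) +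
      ((pd 0 h z).ofLp ⬝ᵥ (pd 0 h z).ofLp) *
        ((n ⬝ᵥ (pd 0 (pd 1 h) z).ofLp) * (m ⬝ᵥ (pd 1 (pd 1 h) z).ofLp) -
          (m ⬝ᵥ (pd 0 (pd 1 h) z).ofLp) * (n ⬝ᵥ (pd 1 (pd 1 h) z).ofLp))) := by
  have hev : ∀ᶠ w in 𝓝 z, 0 < gram h w :=
    (continuous_gram hs).continuousAt.eventually (lt_mem_nhds hD)
  have hrot : ∀ᶠ w in 𝓝 z, IsPlaneRotation (normalRotation h w) :=
    hev.mono fun w hw => isPlaneRotation_normalRotation hs hu hw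
  have hd : MatDiff 1 (normalRotation h) z := (matDiff_normalRotation hs hD).mono (by simp)
  have kill : ∀ᶠ w in 𝓝 z, normalRotation h w *ᵥ (h w).ofLp = 0 ∧
      ∀ i, normalRotation h w *ᵥ (pd i h w).ofLp = 0 := by
    filter_upwards [hev] with w hw
    obtain ⟨n', m', hf'⟩ := exists_isNormalFrame_of_surface hs hu hw
    have e : normalRotation h w = _ := hf'.planeRotation_eq hw
    have aux : ∀ x : Fin 5 → ℝ, n' ⬝ᵥ x = 0 → m' ⬝ᵥ x = 0 → normalRotation h w *ᵥ x = 0 := by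
      intro x h1 h2
      rw [e, Matrix.sub_mulVec, Matrix.vecMulVec_mulVec, Matrix.vecMulVec_mulVec, h1, h2]
      simp
    refine ⟨aux _ hf'.np hf'.mp, fun i => ?_⟩
    fin_cases i
    · exact aux _ hf'.nq hf'.mq
    · exact aux _ hf'.nr hf'.mr
  set J := normalRotation h with hJdef
  have hJ : J z = Matrix.vecMulVec n m - Matrix.vecMulVec m n := hf.planeRotation_eq hD
  have hmn : m ⬝ᵥ n = 0 := by rw [dotProduct_comm, hf.nm]
  have hJn : J z *ᵥ n = -m := by
    rw [hJ, Matrix.sub_mulVec, Matrix.vecMulVec_mulVec, Matrix.vecMulVec_mulVec, hmn, hf.nn]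
    simp
  have hJm : J z *ᵥ m = n := by
    rw [hJ, Matrix.sub_mulVec, Matrix.vecMulVec_mulVec, Matrix.vecMulVec_mulVec, hf.mm, hf.nm]
    simp
  have skew := fun a => transpose_matDeriv_of_isPlaneRotation hrot a
  have skew' : ∀ a (x y : Fin 5 → ℝ), x ⬝ᵥ matDeriv a J z *ᵥ y = -(y ⬝ᵥ matDeriv a J z *ᵥ x) :=
    fun a x y => by
      rw [Matrix.dotProduct_mulVec, ← Matrix.mulVec_transpose, skew a, Matrix.neg_mulVec,
        neg_dotProduct, dotProduct_comm]
  have hself : ∀ a (x : Fin 5 → ℝ), x ⬝ᵥ matDeriv a J z *ᵥ x = 0 := fun a x => by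
    linarith [skew' a x x]
  have hmXn : ∀ a, m ⬝ᵥ matDeriv a J z *ᵥ n = 0 := fun a => by
    have ho := congrArg (fun A => m ⬝ᵥ A *ᵥ n) (matDeriv_offDiagonal_of_isPlaneRotation hrot hd a)
    have hJt : ∀ x : Fin 5 → ℝ, m ⬝ᵥ J z *ᵥ x = -(n ⬝ᵥ x) := fun x => by
      rw [hJ, Matrix.sub_mulVec, Matrix.vecMulVec_mulVec, Matrix.vecMulVec_mulVec]
      simp [dotProduct_sub, hmn, hf.mm]
    have hJt' : ∀ x : Fin 5 → ℝ, n ⬝ᵥ J z *ᵥ x = m ⬝ᵥ x := fun x => by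
      rw [hJ, Matrix.sub_mulVec, Matrix.vecMulVec_mulVec, Matrix.vecMulVec_mulVec]
      simp [dotProduct_sub, hf.nm, hf.nn]
    simp only [Matrix.add_mulVec, Matrix.neg_mulVec, ← Matrix.mulVec_mulVec, dotProduct_add,
      neg_mul, mul_neg, dotProduct_neg, hJn, Matrix.mulVec_neg, hJm, hJt, hJt'] at ho
    linarith
  -- inner products of the derivatives of the frame with the tangent vectors
  have hp : ∀ a, fderiv ℝ h z a ∈ Submodule.span ℝ {pd 0 h z, pd 1 h z} := fun a => by
    have : a = a.re • (1 : ℂ) + a.im • Complex.I := by simp [Complex.re_add_im]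
    rw [this, map_add, map_smul, map_smul]
    exact add_mem (Submodule.smul_mem _ _ (Submodule.subset_span (by simp [pd])))
      (Submodule.smul_mem _ _ (Submodule.subset_span (by simp [pd])))
  have killz := kill.self_of_nhds
  have hXp : ∀ a, matDeriv a J z *ᵥ (h z).ofLp = 0 := fun a => by
    rw [matDeriv_mulVec_of_mulVec_eq_zero hd hs (kill.mono fun w hw => hw.1) a]
    obtain ⟨s, t, hst⟩ := Submodule.mem_span_pair.1 (hp a)
    rw [← hst]
    simp [Matrix.mulVec_add, Matrix.mulVec_smul, killz.2]
  have hXq : ∀ a i, matDeriv a J z *ᵥ (pd i h z).ofLp =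
      -(J z *ᵥ (fderiv ℝ (pd i h) z a).ofLp) := fun a i =>
    matDeriv_mulVec_of_mulVec_eq_zero hd (contDiff_pd hs i) (kill.mono fun w hw => hw.2 i) a
  have hpn : ∀ a (x : Fin 5 → ℝ), (h z).ofLp ⬝ᵥ matDeriv a J z *ᵥ x = 0 := fun a x => by
    rw [skew', hXp, dotProduct_zero, neg_zero]
  have hqn : ∀ a i, (pd i h z).ofLp ⬝ᵥ matDeriv a J z *ᵥ n = m ⬝ᵥ (fderiv ℝ (pd i h) z a).ofLp :=
    fun a i => by
      rw [skew', hXq, hJ, Matrix.sub_mulVec, Matrix.vecMulVec_mulVec, Matrix.vecMulVec_mulVec]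
      simp [dotProduct_sub, hf.nm, hf.nn]
  have hqm : ∀ a i, (pd i h z).ofLp ⬝ᵥ matDeriv a J z *ᵥ m =
      -(n ⬝ᵥ (fderiv ℝ (pd i h) z a).ofLp) := fun a i => by
      rw [skew', hXq, hJ, Matrix.sub_mulVec, Matrix.vecMulVec_mulVec, Matrix.vecMulVec_mulVec]
      simp [dotProduct_sub, hmn, hf.mm]
  have htr : ∀ a b, curvatureForm J a b z =
      (matDeriv a J z *ᵥ n) ⬝ᵥ (matDeriv b J z *ᵥ m) -
        (matDeriv a J z *ᵥ m) ⬝ᵥ (matDeriv b J z *ᵥ n) := fun a b => by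
    have t : ∀ x y : Fin 5 → ℝ, (Matrix.vecMulVec x y * (matDeriv a J z * matDeriv b J z)).trace =
        -((matDeriv a J z *ᵥ y) ⬝ᵥ (matDeriv b J z *ᵥ x)) := fun x y => by
      rw [Matrix.vecMulVec_mul, Matrix.trace_vecMulVec, dotProduct_comm, ← Matrix.dotProduct_mulVec,
        ← Matrix.mulVec_mulVec, Matrix.dotProduct_mulVec, ← Matrix.mulVec_transpose, skew,
        Matrix.neg_mulVec, neg_dotProduct]
    rw [curvatureForm, mul_assoc, hJ, Matrix.sub_mul, Matrix.trace_sub, t, t]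
    ring
  rw [htr, hf.complete (matDeriv Complex.I J z *ᵥ m), hf.complete (matDeriv Complex.I J z *ᵥ n)]
  have c : ∀ x y : Fin 5 → ℝ, x ⬝ᵥ y = y ⬝ᵥ x := dotProduct_comm
  simp only [dotProduct_add, dotProduct_smul, hself, hpn, hmXn, skew' _ n m, smul_eq_mul,
    c (matDeriv 1 J z *ᵥ n) (pd 0 h z).ofLp, c (matDeriv 1 J z *ᵥ n) (pd 1 h z).ofLp,
    c (matDeriv 1 J z *ᵥ m) (pd 0 h z).ofLp, c (matDeriv 1 J z *ᵥ m) (pd 1 h z).ofLp, hqn, hqm]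
  have q00 : fderiv ℝ (pd 0 h) z 1 = pd 0 (pd 0 h) z := rfl
  have q01 : fderiv ℝ (pd 0 h) z Complex.I = pd 0 (pd 1 h) z := pd_comm hs z 1 0
  have q10 : fderiv ℝ (pd 1 h) z 1 = pd 0 (pd 1 h) z := rfl
  have q11 : fderiv ℝ (pd 1 h) z Complex.I = pd 1 (pd 1 h) z := rfl
  simp only [q00, q01, q10, q11]
  change _ = ((((pd 0 h z).ofLp ⬝ᵥ (pd 0 h z).ofLp) * ((pd 1 h z).ofLp ⬝ᵥ (pd 1 h z).ofLp) -
    ((pd 0 h z).ofLp ⬝ᵥ (pd 1 h z).ofLp) ^ 2))⁻¹ * _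
  ring

end

section

/-! ### Comparison of the Willmore density with the normal curvature -/

theorem firstForm_eq {n : ℕ} (h : ℂ → EuclideanSpace ℝ (Fin n)) (z : ℂ) :
    firstForm h z =
      !![(pd 0 h z).ofLp ⬝ᵥ (pd 0 h z).ofLp, (pd 0 h z).ofLp ⬝ᵥ (pd 1 h z).ofLp;
        (pd 0 h z).ofLp ⬝ᵥ (pd 1 h z).ofLp, (pd 1 h z).ofLp ⬝ᵥ (pd 1 h z).ofLp] := by
  ext i j
  fin_cases i <;> fin_cases j <;>
    simp [firstForm, inner_eq_dotProduct, dotProduct_comm]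

theorem det_firstForm {n : ℕ} (h : ℂ → EuclideanSpace ℝ (Fin n)) (z : ℂ) :
    (firstForm h z).det = gram h z := by
  rw [firstForm_eq, Matrix.det_fin_two_of, gram]
  ring

theorem inv_firstForm {n : ℕ} (h : ℂ → EuclideanSpace ℝ (Fin n)) (z : ℂ) :
    (firstForm h z)⁻¹ = (gram h z)⁻¹ •
      !![(pd 1 h z).ofLp ⬝ᵥ (pd 1 h z).ofLp, -((pd 0 h z).ofLp ⬝ᵥ (pd 1 h z).ofLp);
        -((pd 0 h z).ofLp ⬝ᵥ (pd 1 h z).ofLp), (pd 0 h z).ofLp ⬝ᵥ (pd 0 h z).ofLp] := by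
  rw [Matrix.inv_def, det_firstForm, Ring.inverse_eq_inv', firstForm_eq, Matrix.adjugate_fin_two_of]

variable {h : ℂ → EuclideanSpace ℝ (Fin 5)}

/-- The second fundamental form in the sphere is the component of the second derivatives in the
normal plane. -/
theorem sphereSecondForm_eq {z : ℂ} {n m : Fin 5 → ℝ}
    (hf : IsNormalFrame (h z).ofLp (pd 0 h z).ofLp (pd 1 h z).ofLp n m) (i j : Fin 2) :
    sphereSecondForm h z i j = (n ⬝ᵥ (pd i (pd j h) z).ofLp) • WithLp.toLp 2 n +
      (m ⬝ᵥ (pd i (pd j h) z).ofLp) • WithLp.toLp 2 m := by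
  have hc := congrArg (WithLp.toLp 2) (hf.complete (pd i (pd j h) z).ofLp)
  simp only [WithLp.toLp_add, WithLp.toLp_smul, WithLp.toLp_ofLp] at hc
  rw [sphereSecondForm, flatSecondForm, inv_firstForm]
  nth_rewrite 1 [hc]
  simp only [Fin.sum_univ_two, Matrix.smul_apply, smul_eq_mul, Matrix.of_apply, Matrix.cons_val',
    Matrix.cons_val_zero, Matrix.cons_val_one, Matrix.cons_val_fin_one, inner_eq_dotProduct,
    dotProduct_comm (pd i (pd j h) z).ofLp]
  rw [gram]
  module

/-- With `(x, y)` and `(x', y')` the components of the trace-free second fundamental form in the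
normal directions `n` and `m`, the Willmore density is `√g (x² + y² + x'² + y'²)`, and the normal
curvature is `2 √g (x y' - x' y)`. The last clause gives the components in conformal coordinates. -/
theorem willmoreDensity_eq (hs : ContDiff ℝ ∞ h) {z : ℂ} (hD : 0 < gram h z)
    (hE : (pd 0 h z).ofLp ⬝ᵥ (pd 0 h z).ofLp ≠ 0)
    {n m : Fin 5 → ℝ} (hf : IsNormalFrame (h z).ofLp (pd 0 h z).ofLp (pd 1 h z).ofLp n m) :
    ∃ x y x' y' : ℝ, willmoreDensity h z = Real.sqrt (gram h z) * (x ^ 2 + y ^ 2 + x' ^ 2 + y' ^ 2)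
        ∧
      (gram h z)⁻¹ *
      (((pd 1 h z).ofLp ⬝ᵥ (pd 1 h z).ofLp) *
        ((n ⬝ᵥ (pd 0 (pd 0 h) z).ofLp) * (m ⬝ᵥ (pd 0 (pd 1 h) z).ofLp) -
          (m ⬝ᵥ (pd 0 (pd 0 h) z).ofLp) * (n ⬝ᵥ (pd 0 (pd 1 h) z).ofLp)) -
      ((pd 0 h z).ofLp ⬝ᵥ (pd 1 h z).ofLp) *
        ((n ⬝ᵥ (pd 0 (pd 0 h) z).ofLp) * (m ⬝ᵥ (pd 1 (pd 1 h) z).ofLp) -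
          (m ⬝ᵥ (pd 0 (pd 0 h) z).ofLp) * (n ⬝ᵥ (pd 1 (pd 1 h) z).ofLp)) +
      ((pd 0 h z).ofLp ⬝ᵥ (pd 0 h z).ofLp) *
        ((n ⬝ᵥ (pd 0 (pd 1 h) z).ofLp) * (m ⬝ᵥ (pd 1 (pd 1 h) z).ofLp) -
          (m ⬝ᵥ (pd 0 (pd 1 h) z).ofLp) * (n ⬝ᵥ (pd 1 (pd 1 h) z).ofLp))) =
        2 * Real.sqrt (gram h z) * (x * y' - x' * y) ∧
      (((pd 0 h z).ofLp ⬝ᵥ (pd 1 h z).ofLp) = 0 →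
        ((pd 0 h z).ofLp ⬝ᵥ (pd 0 h z).ofLp) = ((pd 1 h z).ofLp ⬝ᵥ (pd 1 h z).ofLp) →
        2 * ((pd 0 h z).ofLp ⬝ᵥ (pd 0 h z).ofLp) * x =
          n ⬝ᵥ (pd 0 (pd 0 h) z).ofLp - n ⬝ᵥ (pd 1 (pd 1 h) z).ofLp ∧
        2 * ((pd 0 h z).ofLp ⬝ᵥ (pd 0 h z).ofLp) * x' =
          m ⬝ᵥ (pd 0 (pd 0 h) z).ofLp - m ⬝ᵥ (pd 1 (pd 1 h) z).ofLp ∧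
        ((pd 0 h z).ofLp ⬝ᵥ (pd 0 h z).ofLp) * y = n ⬝ᵥ (pd 0 (pd 1 h) z).ofLp ∧
        ((pd 0 h z).ofLp ⬝ᵥ (pd 0 h z).ofLp) * y' = m ⬝ᵥ (pd 0 (pd 1 h) z).ofLp) := by
  have hsq : Real.sqrt (gram h z) ^ 2 = gram h z := Real.sq_sqrt hD.le
  have hS : Real.sqrt (gram h z) ≠ 0 := (Real.sqrt_pos.2 hD).ne'
  have hII := sphereSecondForm_eq hf
  have hsymm : pd 1 (pd 0 h) z = pd 0 (pd 1 h) z := pd_comm hs z 1 0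
  set S := Real.sqrt (gram h z)
  set E := (pd 0 h z).ofLp ⬝ᵥ (pd 0 h z).ofLp with hEdef
  set F := (pd 0 h z).ofLp ⬝ᵥ (pd 1 h z).ofLp with hFdef
  set G := (pd 1 h z).ofLp ⬝ᵥ (pd 1 h z).ofLp with hGdef
  have hgram : S ^ 2 = E * G - F ^ 2 := hsq
  set a := n ⬝ᵥ (pd 0 (pd 0 h) z).ofLp with ha
  set b := n ⬝ᵥ (pd 0 (pd 1 h) z).ofLp with hb
  set c := n ⬝ᵥ (pd 1 (pd 1 h) z).ofLp with hc
  set a' := m ⬝ᵥ (pd 0 (pd 0 h) z).ofLp with ha'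
  set b' := m ⬝ᵥ (pd 0 (pd 1 h) z).ofLp with hb'
  set c' := m ⬝ᵥ (pd 1 (pd 1 h) z).ofLp with hc'
  have hII' : ∀ i j, sphereSecondForm h z i j =
      (!![a, b; b, c] i j) • WithLp.toLp 2 n + (!![a', b'; b', c'] i j) • WithLp.toLp 2 m := by
    intro i j
    rw [hII]
    fin_cases i <;> fin_cases j <;> simp [hsymm, ha, hb, hc, ha', hb', hc']
  have hg : firstForm h z = !![E, F; F, G] := firstForm_eq h z
  have hgi : (firstForm h z)⁻¹ = (S ^ 2)⁻¹ • !![G, -F; -F, E] := by rw [inv_firstForm, hsq]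
  have hH : meanCurvature h (sphereSecondForm h) z =
      ((1 / 2) * ((G * a - 2 * F * b + E * c) / S ^ 2)) • WithLp.toLp 2 n +
      ((1 / 2) * ((G * a' - 2 * F * b' + E * c') / S ^ 2)) • WithLp.toLp 2 m := by
    rw [meanCurvature, hgi]
    simp only [hII', Fin.sum_univ_two, Matrix.smul_apply, smul_eq_mul, Matrix.of_apply,
      Matrix.cons_val', Matrix.cons_val_zero, Matrix.cons_val_one, Matrix.cons_val_fin_one]
    module
  have htf : ∀ i j, traceFreeForm h z i j =
      (!![a, b; b, c] i j - !![E, F; F, G] i j *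
        ((1 / 2) * ((G * a - 2 * F * b + E * c) / S ^ 2))) • WithLp.toLp 2 n +
      (!![a', b'; b', c'] i j - !![E, F; F, G] i j *
        ((1 / 2) * ((G * a' - 2 * F * b' + E * c') / S ^ 2))) • WithLp.toLp 2 m := fun i j => by
    rw [traceFreeForm, hH, hII', hg]
    module
  have hinner : ∀ s t s' t' : ℝ, inner ℝ (s • WithLp.toLp 2 n + t • WithLp.toLp 2 m)
      (s' • WithLp.toLp 2 n + t' • WithLp.toLp 2 m) = s * s' + t * t' := fun s t s' t' => by
    have hmn : m ⬝ᵥ n = 0 := by rw [dotProduct_comm, hf.nm]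
    rw [inner_eq_dotProduct]
    simp only [WithLp.ofLp_add, WithLp.ofLp_smul, add_dotProduct, dotProduct_add,
      smul_dotProduct, dotProduct_smul, hf.nn, hf.mm, hf.nm, hmn, smul_eq_mul]
    ring
  refine ⟨(a - E * ((1 / 2) * ((G * a - 2 * F * b + E * c) / S ^ 2))) / E,
    (b - F * ((1 / 2) * ((G * a - 2 * F * b + E * c) / S ^ 2)) -
          F / E * (a - E * ((1 / 2) * ((G * a - 2 * F * b + E * c) / S ^ 2)))) / S,
    (a' - E * ((1 / 2) * ((G * a' - 2 * F * b' + E * c') / S ^ 2))) / E,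
    (b' - F * ((1 / 2) * ((G * a' - 2 * F * b' + E * c') / S ^ 2)) -
          F / E * (a' - E * ((1 / 2) * ((G * a' - 2 * F * b' + E * c') / S ^ 2)))) / S, ?_, ?_, ?_⟩
  · rw [willmoreDensity, det_firstForm]
    simp only [htf, hinner, mul_add, Finset.sum_add_distrib, hgi]
    simp only [← mul_assoc]
    have e1 := traceFree_norm_sq (a := a) (b := b) (c := c) hE hS hgram
    have e2 := traceFree_norm_sq (a := a') (b := b') (c := c') hE hS hgram
    simp only [← mul_assoc] at e1 e2
    rw [e1, e2]
    ring
  · rw [← hsq, ← normalCurvature_eq hE hS hgram]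
  · intro hF0 hEG
    rw [hF0, ← hEG] at hgram
    have hS2 : S ^ 2 = E * E := by rw [hgram]; ring
    have hSE : S = E := by
      have hEpos : 0 ≤ E := by
        rw [hEdef, ← inner_eq_dotProduct]; exact real_inner_self_nonneg
      exact (pow_left_inj₀ (Real.sqrt_nonneg _) hEpos two_ne_zero).1 (by rw [hS2]; ring)
    rw [hF0, ← hEG, hSE]
    refine ⟨?_, ?_, ?_, ?_⟩ <;> field_simp <;> ring

theorem dotProduct_self_pos_of_gram_pos {n : ℕ} {h : ℂ → EuclideanSpace ℝ (Fin n)} {z : ℂ}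
    (hD : 0 < gram h z) : (pd 0 h z).ofLp ⬝ᵥ (pd 0 h z).ofLp ≠ 0 := fun h0 => by
  rw [gram, h0, zero_mul] at hD
  nlinarith [sq_nonneg ((pd 0 h z).ofLp ⬝ᵥ (pd 1 h z).ofLp)]

/-- The Willmore density of a surface in the four-sphere is bounded below by the normal
curvature. -/
theorem abs_curvatureForm_le_willmoreDensity (hs : ContDiff ℝ ∞ h) (hu : ∀ z, ‖h z‖ = 1) {z : ℂ}
    (hD : 0 < gram h z) :
    |curvatureForm (normalRotation h) 1 Complex.I z| ≤ willmoreDensity h z := by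
  obtain ⟨n, m, hf⟩ := exists_isNormalFrame_of_surface hs hu hD
  obtain ⟨x, y, x', y', h1, h2, -⟩ := willmoreDensity_eq hs hD (dotProduct_self_pos_of_gram_pos hD)
      hf
  rw [curvatureForm_normalRotation hs hu hD hf, h1, h2, abs_le]
  have hS := Real.sqrt_nonneg (gram h z)
  -- `x² + y² + x'² + y'² ± 2 (x y' - x' y)` is the sum of squares `(x ± y')² + (y ∓ x')²`
  have k1 := mul_nonneg hS (add_nonneg (sq_nonneg (x + y')) (sq_nonneg (y - x')))
  have k2 := mul_nonneg hS (add_nonneg (sq_nonneg (x - y')) (sq_nonneg (y + x')))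
  constructor <;> nlinarith

/-- If `h` is conformal and the normal part of `h_zz` is isotropic, then the Willmore density is
equal to the normal curvature up to sign. The sign is that of the determinant of
`h_uu - h_vv, h_uv, h, h_u, h_v`. -/
theorem willmoreDensity_eq_curvatureForm (hs : ContDiff ℝ ∞ h) (hu : ∀ z, ‖h z‖ = 1) {z : ℂ}
    (hD : 0 < gram h z) (hF : (pd 0 h z).ofLp ⬝ᵥ (pd 1 h z).ofLp = 0)
    (hEG : (pd 0 h z).ofLp ⬝ᵥ (pd 0 h z).ofLp = (pd 1 h z).ofLp ⬝ᵥ (pd 1 h z).ofLp)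
    (hiso : ∀ n m, IsNormalFrame (h z).ofLp (pd 0 h z).ofLp (pd 1 h z).ofLp n m →
      ((n ⬝ᵥ (pd 0 (pd 0 h) z).ofLp - n ⬝ᵥ (pd 1 (pd 1 h) z).ofLp : ℝ) -
        2 * Complex.I * (n ⬝ᵥ (pd 0 (pd 1 h) z).ofLp : ℝ)) ^ 2 +
      ((m ⬝ᵥ (pd 0 (pd 0 h) z).ofLp - m ⬝ᵥ (pd 1 (pd 1 h) z).ofLp : ℝ) -
        2 * Complex.I * (m ⬝ᵥ (pd 0 (pd 1 h) z).ofLp : ℝ)) ^ 2 = 0)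
    {ε : ℝ} (hε : ε ^ 2 = 1)
    (hsign : 0 ≤ ε * det5 ((pd 0 (pd 0 h) z).ofLp - (pd 1 (pd 1 h) z).ofLp) (pd 0 (pd 1 h) z).ofLp
      (h z).ofLp (pd 0 h z).ofLp (pd 1 h z).ofLp) :
    willmoreDensity h z = ε * curvatureForm (normalRotation h) 1 Complex.I z := by
  obtain ⟨n, m, hf⟩ := exists_isNormalFrame_of_surface hs hu hD
  have hE := dotProduct_self_pos_of_gram_pos hD
  obtain ⟨x, y, x', y', h1, h2, h3⟩ := willmoreDensity_eq hs hD hE hf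
  obtain ⟨k1, k2, k3, k4⟩ := h3 hF hEG
  have hi := hiso n m hf
  rw [hf.det, dotProduct_sub, dotProduct_sub, ← k1, ← k2, ← k3, ← k4] at hsign
  rw [← k1, ← k2, ← k3, ← k4] at hi
  rw [curvatureForm_normalRotation hs hu hD hf, h1, h2]
  set E := (pd 0 h z).ofLp ⬝ᵥ (pd 0 h z).ofLp
  set S := Real.sqrt (gram h z) with hSdef
  have hSpos : 0 < S := Real.sqrt_pos.2 hD
  have hre := congrArg Complex.re hi
  have him := congrArg Complex.im hi
  simp only [pow_two, Complex.add_re, Complex.add_im, Complex.mul_re, Complex.mul_im,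
    Complex.sub_re, Complex.sub_im, Complex.ofReal_re, Complex.ofReal_im, Complex.I_re,
    Complex.I_im, Complex.re_ofNat, Complex.im_ofNat, Complex.zero_re, Complex.zero_im] at hre him
  have hE2 : 0 < 4 * E ^ 2 := by positivity
  have r1 : x ^ 2 + x' ^ 2 = y ^ 2 + y' ^ 2 :=
    mul_left_cancel₀ hE2.ne' (by linear_combination hre)
  have r2 : x * y + x' * y' = 0 :=
    mul_left_cancel₀ hE2.ne' (by linear_combination (-1 / 2) * him)
  have hs' : 0 ≤ ε * (x * y' - x' * y) := by
    have e : ε * (S * ((2 * E * x) * (E * y') - (2 * E * x') * (E * y))) =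
        (2 * E ^ 2 * S) * (ε * (x * y' - x' * y)) := by ring
    have hpos : 0 < 2 * E ^ 2 * S := by positivity
    refine nonneg_of_mul_nonneg_right ?_ hpos
    rw [← e]
    exact hsign
  -- two nonnegative numbers with the same square
  have hq : x ^ 2 + x' ^ 2 = ε * (x * y' - x' * y) := by
    refine (pow_left_inj₀ (by positivity) hs' two_ne_zero).1 ?_
    rw [mul_pow, hε]
    linear_combination (x ^ 2 + x' ^ 2) * r1 + (x * y + x' * y') * r2
  linear_combination 2 * S * hq - S * r1

end

/-! ### Green's theorem for the unit disk -/

/-- The integral over the unit disk in polar coordinates. -/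
theorem setIntegral_closedBall_eq_polar {f : ℂ → ℝ} (hf : Continuous f) :
    ∫ z in Metric.closedBall (0 : ℂ) 1, f z =
      ∫ r in (0 : ℝ)..1, ∫ θ in (-Real.pi)..Real.pi,
        r * f (r * (Real.cos θ + Real.sin θ * Complex.I)) := by
  have hc : Continuous fun p : ℝ × ℝ => p.1 * f (p.1 * (Real.cos p.2 + Real.sin p.2 * Complex.I)) :=
      by
    fun_prop
  rw [← MeasureTheory.integral_indicator Metric.isClosed_closedBall.measurableSet,
    ← Complex.integral_comp_polarCoord_symm]
  have e1 : ∀ p ∈ polarCoord.target,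
      p.1 • (Metric.closedBall (0 : ℂ) 1).indicator f (Complex.polarCoord.symm p) =
      (Set.Iic (1 : ℝ) ×ˢ Set.univ).indicator
        (fun p => p.1 * f (p.1 * (Real.cos p.2 + Real.sin p.2 * Complex.I))) p := by
    intro p hp
    rw [polarCoord_target] at hp
    have h0 : 0 < p.1 := hp.1
    have hmem : Complex.polarCoord.symm p ∈ Metric.closedBall (0 : ℂ) 1 ↔
        p ∈ Set.Iic (1 : ℝ) ×ˢ (Set.univ : Set ℝ) := by
      rw [mem_closedBall_zero_iff, Complex.norm_polarCoord_symm, abs_of_pos h0]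
      simp
    by_cases hp1 : p ∈ Set.Iic (1 : ℝ) ×ˢ (Set.univ : Set ℝ)
    · rw [Set.indicator_of_mem hp1, Set.indicator_of_mem (hmem.2 hp1),
        Complex.polarCoord_symm_apply, smul_eq_mul]
    · rw [Set.indicator_of_notMem hp1, Set.indicator_of_notMem (fun h => hp1 (hmem.1 h)), smul_zero]
  have hmeas : MeasurableSet (Set.Iic (1 : ℝ) ×ˢ (Set.univ : Set ℝ)) :=
    measurableSet_Iic.prod MeasurableSet.univ
  rw [MeasureTheory.setIntegral_congr_fun (by
    rw [polarCoord_target]; exact measurableSet_Ioi.prod measurableSet_Ioo) e1,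
    MeasureTheory.setIntegral_indicator hmeas, polarCoord_target, Set.prod_inter_prod,
    Set.inter_univ, Set.Ioi_inter_Iic]
  have hint : MeasureTheory.IntegrableOn
      (fun p : ℝ × ℝ => p.1 * f (p.1 * (Real.cos p.2 + Real.sin p.2 * Complex.I)))
      (Set.Ioc 0 1 ×ˢ Set.Ioo (-Real.pi) Real.pi) :=
    (hc.continuousOn.integrableOn_compact (isCompact_Icc.prod isCompact_Icc)).mono_set
      (Set.prod_mono Set.Ioc_subset_Icc_self Set.Ioo_subset_Icc_self)
  rw [MeasureTheory.Measure.volume_eq_prod, MeasureTheory.setIntegral_prod _ hint,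
    intervalIntegral.integral_of_le zero_le_one]
  refine MeasureTheory.setIntegral_congr_fun measurableSet_Ioc fun r _ => ?_
  rw [intervalIntegral.integral_of_le (by linarith [Real.pi_pos]),
      MeasureTheory.integral_Ioc_eq_integral_Ioo]

/-- Green's theorem for the unit disk. -/
theorem integral_curl_closedBall {P Q : ℂ → ℝ} (hP : ContDiff ℝ 1 P) (hQ : ContDiff ℝ 1 Q) :
    ∫ z in Metric.closedBall (0 : ℂ) 1, (fderiv ℝ Q z 1 - fderiv ℝ P z Complex.I) =
      ∫ θ in (-Real.pi)..Real.pi,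
        (Q (Real.cos θ + Real.sin θ * Complex.I) * Real.cos θ -
          P (Real.cos θ + Real.sin θ * Complex.I) * Real.sin θ) := by
  have hcont : Continuous fun z => fderiv ℝ Q z 1 - fderiv ℝ P z Complex.I :=
    ((hQ.continuous_fderiv one_ne_zero).clm_apply continuous_const).sub
      ((hP.continuous_fderiv one_ne_zero).clm_apply continuous_const)
  rw [setIntegral_closedBall_eq_polar hcont]
  set c : ℝ × ℝ → ℂ := fun p => p.1 * (Real.cos p.2 + Real.sin p.2 * Complex.I) with hc
  let c' : ℝ × ℝ → ℝ × ℝ →L[ℝ] ℂ := fun p =>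
    (ContinuousLinearMap.fst ℝ ℝ ℝ).smulRight (Real.cos p.2 + Real.sin p.2 * Complex.I : ℂ) +
    (ContinuousLinearMap.snd ℝ ℝ ℝ).smulRight
      (p.1 * (-Real.sin p.2 + Real.cos p.2 * Complex.I) : ℂ)
  have hcd : ∀ p, HasFDerivAt c (c' p) p := fun p => by
    have h1 : HasFDerivAt (fun p : ℝ × ℝ => p.1) (ContinuousLinearMap.fst ℝ ℝ ℝ) p :=
        hasFDerivAt_fst
    have h2 : HasFDerivAt (fun p : ℝ × ℝ => p.2) (ContinuousLinearMap.snd ℝ ℝ ℝ) p :=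
        hasFDerivAt_snd
    have h3 := Complex.ofRealCLM.hasFDerivAt.comp p h1
    have h4 := Complex.ofRealCLM.hasFDerivAt.comp p h2.cos
    have h5 := Complex.ofRealCLM.hasFDerivAt.comp p h2.sin
    have h6 := h3.mul (h4.add (h5.mul_const Complex.I))
    refine HasFDerivAt.congr_fderiv h6 ?_
    ext
    · simp [c']
    · simp [c']
      ring
  let A : ℝ × ℝ → ℝ := fun p => -(P (c p) * Real.cos p.2 + Q (c p) * Real.sin p.2)
  let B : ℝ × ℝ → ℝ := fun p => p.1 * (Q (c p) * Real.cos p.2 - P (c p) * Real.sin p.2)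
  have hPd : ∀ p, HasFDerivAt (fun p => P (c p)) ((fderiv ℝ P (c p)).comp (c' p)) p := fun p =>
    (hP.differentiable one_ne_zero (c p)).hasFDerivAt.comp p (hcd p)
  have hQd : ∀ p, HasFDerivAt (fun p => Q (c p)) ((fderiv ℝ Q (c p)).comp (c' p)) p := fun p =>
    (hQ.differentiable one_ne_zero (c p)).hasFDerivAt.comp p (hcd p)
  have hfst : ∀ p, HasFDerivAt (fun p : ℝ × ℝ => p.1) (ContinuousLinearMap.fst ℝ ℝ ℝ) p :=
    fun p => hasFDerivAt_fst
  have hsnd : ∀ p, HasFDerivAt (fun p : ℝ × ℝ => p.2) (ContinuousLinearMap.snd ℝ ℝ ℝ) p :=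
    fun p => hasFDerivAt_snd
  have hA : ∀ p, HasFDerivAt A _ p := fun p =>
    (((hPd p).mul (hsnd p).cos).add ((hQd p).mul (hsnd p).sin)).neg
  have hB : ∀ p, HasFDerivAt B _ p := fun p =>
    (hfst p).mul (((hQd p).mul (hsnd p).cos).sub ((hPd p).mul (hsnd p).sin))
  have key : ∀ p : ℝ × ℝ, fderiv ℝ B p (1, 0) + fderiv ℝ A p (0, 1) =
      p.1 * (fderiv ℝ Q (c p) 1 - fderiv ℝ P (c p) Complex.I) := fun p => by
    rw [(hA p).fderiv, (hB p).fderiv]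
    have hv : ∀ (L : ℂ →L[ℝ] ℝ) (x y : ℝ), L (x + y * Complex.I) = x * L 1 + y * L Complex.I := by
      intro L x y
      have : (x + y * Complex.I : ℂ) = x • (1 : ℂ) + y • Complex.I := by simp
      rw [this, map_add, map_smul, map_smul, smul_eq_mul, smul_eq_mul]
    have e1 : c' p (1, 0) = (Real.cos p.2 : ℂ) + (Real.sin p.2 : ℝ) * Complex.I := by simp [c']
    have e2 : c' p (0, 1) = ((-(p.1 * Real.sin p.2) : ℝ) : ℂ) +
      ((p.1 * Real.cos p.2 : ℝ) : ℂ) * Complex.I := by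
      simp only [c', add_apply, ContinuousLinearMap.smulRight_apply, ContinuousLinearMap.coe_fst',
        ContinuousLinearMap.coe_snd', zero_smul, one_smul, zero_add]
      push_cast
      ring
    simp only [add_apply, sub_apply, neg_apply, smul_apply, ContinuousLinearMap.comp_apply, e1, e2,
      hv, ContinuousLinearMap.coe_fst', ContinuousLinearMap.coe_snd', smul_eq_mul]
    have := Real.sin_sq_add_cos_sq p.2
    linear_combination (p.1 * (fderiv ℝ Q (c p) 1 - fderiv ℝ P (c p) Complex.I)) * this
  have hcc : Continuous c := continuous_iff_continuousAt.2 fun p => (hcd p).continuousAt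
  have hAc : Continuous A := continuous_iff_continuousAt.2 fun p => (hA p).continuousAt
  have hBc : Continuous B := continuous_iff_continuousAt.2 fun p => (hB p).continuousAt
  have div := MeasureTheory.integral2_divergence_prod_of_hasFDerivAt B A (fderiv ℝ B) (fderiv ℝ A)
    0 (-Real.pi) 1 Real.pi hBc.continuousOn hAc.continuousOn
    (fun p _ => (hB p).differentiableAt.hasFDerivAt)
    (fun p _ => (hA p).differentiableAt.hasFDerivAt) (by
      simp only [key]
      refine ContinuousOn.integrableOn_compact (isCompact_uIcc.prod isCompact_uIcc) ?_
      exact (continuous_fst.mul (hcont.comp hcc)).continuousOn)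
  simp only [key] at div
  rw [div]
  simp [A, B, c]

section

/-! ### Variations of surfaces -/

/-- Differentiation under the integral over a compact set. -/
theorem hasDerivAt_setIntegral_of_contDiffAt {f : ℝ × ℂ → ℝ} {K : Set ℂ} (hK : IsCompact K)
    (hf : ∀ z ∈ K, ContDiffAt ℝ 1 f (0, z)) :
    HasDerivAt (fun t => ∫ z in K, f (t, z)) (∫ z in K, fderiv ℝ f (0, z) (1, 0)) 0 := by
  set U : Set (ℝ × ℂ) := {p | ContDiffAt ℝ 1 f p} with hU
  have hUo : IsOpen U := isOpen_iff_eventually.2 fun p hp =>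
    ContDiffAt.eventually (n := 1) hp (by simp)
  obtain ⟨u, v, hu, -, h0u, hKv, huv⟩ := generalized_tube_lemma (isCompact_singleton (x := (0 : ℝ)))
    hK hUo (by
      rintro ⟨t, z⟩ ⟨ht, hz⟩
      obtain rfl : t = 0 := ht
      exact hf z hz)
  obtain ⟨δ, hδ, hδu⟩ := Metric.nhds_basis_closedBall.mem_iff.1 (hu.mem_nhds (h0u rfl))
  have hmem : ∀ t ∈ Metric.closedBall (0 : ℝ) δ, ∀ z ∈ K, ContDiffAt ℝ 1 f (t, z) :=
    fun t ht z hz => huv (Set.mk_mem_prod (hδu ht) (hKv hz))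
  have hcont : ContinuousOn (fun p => fderiv ℝ f p (1, 0)) (Metric.closedBall (0 : ℝ) δ ×ˢ K) := by
    rintro ⟨t, z⟩ ⟨ht, hz⟩
    have h := ((hmem t ht z hz).fderiv_right (m := 0) (by simp)).continuousAt
    exact (h.clm_apply continuousAt_const).continuousWithinAt
  obtain ⟨C, hC⟩ := ((isCompact_closedBall (0 : ℝ) δ).prod hK).exists_bound_of_continuousOn hcont
  have hder : ∀ t ∈ Metric.closedBall (0 : ℝ) δ, ∀ z ∈ K,
      HasDerivAt (fun s => f (s, z)) (fderiv ℝ f (t, z) (1, 0)) t := fun t ht z hz => by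
    have h1 := ((hmem t ht z hz).differentiableAt one_ne_zero).hasFDerivAt
    have h2 : HasDerivAt (fun s : ℝ => (s, z)) ((1, 0) : ℝ × ℂ) t :=
      (hasDerivAt_id t).prodMk (hasDerivAt_const t z)
    exact h1.comp_hasDerivAt t h2
  have hslice : ∀ t ∈ Metric.closedBall (0 : ℝ) δ, ContinuousOn (fun z => f (t, z)) K :=
    fun t ht z hz => ((hmem t ht z hz).continuousAt.comp
      (Continuous.prodMk_right t).continuousAt).continuousWithinAt
  have h0 : (0 : ℝ) ∈ Metric.closedBall (0 : ℝ) δ := Metric.mem_closedBall_self hδ.le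
  refine (hasDerivAt_integral_of_dominated_loc_of_deriv_le (s := Metric.ball 0 δ)
    (F' := fun t z => fderiv ℝ f (t, z) (1, 0)) (bound := fun _ => C)
    (Metric.ball_mem_nhds 0 hδ) ?_ ((hslice 0 h0).integrableOn_compact hK) ?_ ?_ ?_ ?_).2
  · filter_upwards [Metric.ball_mem_nhds (0 : ℝ) hδ] with t ht
    exact (hslice t (Metric.ball_subset_closedBall ht)).aestronglyMeasurable hK.measurableSet
  · exact (hcont.comp (f := fun z => ((0 : ℝ), z)) (by fun_prop)
      fun z hz => Set.mk_mem_prod h0 hz).aestronglyMeasurable hK.measurableSet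
  · exact MeasureTheory.ae_restrict_of_forall_mem hK.measurableSet fun z hz t ht =>
      hC (t, z) (Set.mk_mem_prod (Metric.ball_subset_closedBall ht) hz)
  · exact (continuousOn_const.integrableOn_compact hK)
  · exact MeasureTheory.ae_restrict_of_forall_mem hK.measurableSet fun z hz t ht =>
      hder t (Metric.ball_subset_closedBall ht) z hz

section Variation

variable {V : ℝ × ℂ → EuclideanSpace ℝ (Fin 5)}

/-- The surface at time `t` of a family of surfaces. -/
def slice {n : ℕ} (V : ℝ × ℂ → EuclideanSpace ℝ (Fin n)) (t : ℝ) : ℂ → EuclideanSpace ℝ (Fin n) :=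
  fun z => V (t, z)

theorem fderiv_slice {E : Type*} [NormedAddCommGroup E] [NormedSpace ℝ E] {f : ℝ × ℂ → E} {t : ℝ}
    {z : ℂ} (hf : DifferentiableAt ℝ f (t, z)) (b : ℂ) :
    fderiv ℝ (fun w => f (t, w)) z b = fderiv ℝ f (t, z) (0, b) := by
  have h2 : HasFDerivAt (fun w : ℂ => (t, w)) (ContinuousLinearMap.inr ℝ ℝ ℂ) z :=
    hasFDerivAt_prodMk_right t z
  have h3 : HasFDerivAt (fun w => f (t, w)) _ z := hf.hasFDerivAt.comp z h2
  rw [h3.fderiv]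
  simp

/-- The partial derivative of a family of surfaces in the coordinate direction `i`. -/
noncomputable def jointPd {n : ℕ} (i : Fin 2) (V : ℝ × ℂ → EuclideanSpace ℝ (Fin n)) (x : ℝ × ℂ) :
    EuclideanSpace ℝ (Fin n) :=
  fderiv ℝ V x (0, ![1, Complex.I] i)

theorem contDiff_jointPd {n : ℕ} {V : ℝ × ℂ → EuclideanSpace ℝ (Fin n)} (hV : ContDiff ℝ ∞ V)
    (i : Fin 2) : ContDiff ℝ ∞ (jointPd i V) :=
  (hV.fderiv_right (m := ∞) le_rfl).clm_apply contDiff_const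

theorem pd_slice {n : ℕ} {V : ℝ × ℂ → EuclideanSpace ℝ (Fin n)} (hV : ContDiff ℝ ∞ V)
    (i : Fin 2) (t : ℝ) : pd i (slice V t) = slice (jointPd i V) t := by
  funext z
  exact fderiv_slice (hV.differentiable (by simp) _) _

theorem contDiff_slice {n : ℕ} {V : ℝ × ℂ → EuclideanSpace ℝ (Fin n)} (hV : ContDiff ℝ ∞ V)
    (t : ℝ) : ContDiff ℝ ∞ (slice V t) :=
  hV.comp (contDiff_prodMk_right t)

theorem contDiffAt_willmoreDensity (hV : ContDiff ℝ ∞ V) {x : ℝ × ℂ}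
    (hD : 0 < gram (slice V x.1) x.2) :
    ContDiffAt ℝ ∞ (fun y : ℝ × ℂ => willmoreDensity (slice V y.1) y.2) x := by
  have c1 : ∀ i, ContDiffAt ℝ ∞ (fun y : ℝ × ℂ => pd i (slice V y.1) y.2) x := fun i => by
    simp only [pd_slice hV]
    exact (contDiff_jointPd hV i).contDiffAt
  have c2 : ∀ i j, ContDiffAt ℝ ∞ (fun y : ℝ × ℂ => pd i (pd j (slice V y.1)) y.2) x :=
    fun i j => by
      simp only [pd_slice hV, pd_slice (contDiff_jointPd hV j)]
      exact (contDiff_jointPd (contDiff_jointPd hV j) i).contDiffAt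
  have cV : ContDiffAt ℝ ∞ (fun y : ℝ × ℂ => slice V y.1 y.2) x := hV.contDiffAt
  have cdot : ∀ i j, ContDiffAt ℝ ∞ (fun y : ℝ × ℂ =>
      (pd i (slice V y.1) y.2).ofLp ⬝ᵥ (pd j (slice V y.1) y.2).ofLp) x := fun i j =>
    contDiffAt_dotProduct (c1 i) (c1 j)
  have cgram : ContDiffAt ℝ ∞ (fun y : ℝ × ℂ => gram (slice V y.1) y.2) x :=
    ((cdot 0 0).mul (cdot 1 1)).sub ((cdot 0 1).pow 2)
  have cg : ∀ i j, ContDiffAt ℝ ∞ (fun y : ℝ × ℂ => firstForm (slice V y.1) y.2 i j) x :=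
    fun i j => (c1 i).inner ℝ (c1 j)
  have cgi : ∀ i j, ContDiffAt ℝ ∞ (fun y : ℝ × ℂ => (firstForm (slice V y.1) y.2)⁻¹ i j) x :=
    fun i j => by
      simp only [inv_firstForm, Matrix.smul_apply, smul_eq_mul]
      refine (cgram.inv hD.ne').mul ?_
      fin_cases i <;> fin_cases j
      · exact cdot 1 1
      · exact (cdot 0 1).neg
      · exact (cdot 0 1).neg
      · exact cdot 0 0
  have cII : ∀ i j, ContDiffAt ℝ ∞ (fun y : ℝ × ℂ => sphereSecondForm (slice V y.1) y.2 i j) x :=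
    fun i j => by
      unfold sphereSecondForm flatSecondForm
      exact ((c2 i j).sub (ContDiffAt.sum fun k _ => ContDiffAt.sum fun l _ =>
        ((cgi k l).mul ((c2 i j).inner ℝ (c1 k))).smul (c1 l))).sub
        (((c2 i j).inner ℝ cV).smul cV)
  have cH : ContDiffAt ℝ ∞ (fun y : ℝ × ℂ =>
      meanCurvature (slice V y.1) (sphereSecondForm (slice V y.1)) y.2) x := by
    unfold meanCurvature
    exact (ContDiffAt.sum fun i _ => ContDiffAt.sum fun j _ => (cgi i j).smul (cII i j)).const_smul
        _
  have ctf : ∀ i j, ContDiffAt ℝ ∞ (fun y : ℝ × ℂ => traceFreeForm (slice V y.1) y.2 i j) x :=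
    fun i j => (cII i j).sub ((cg i j).smul cH)
  unfold willmoreDensity
  refine (contDiffAt_const.mul (ContDiffAt.sum fun i _ => ContDiffAt.sum fun j _ =>
    ContDiffAt.sum fun k _ => ContDiffAt.sum fun l _ =>
      ((cgi i k).mul (cgi j l)).mul ((ctf i j).inner ℝ (ctf k l)))).mul ?_
  simp only [det_firstForm]
  exact cgram.sqrt hD.ne'

/-- The rotation of the normal planes of a family of surfaces. -/
noncomputable def jointRotation (V : ℝ × ℂ → EuclideanSpace ℝ (Fin 5)) (x : ℝ × ℂ) :
    Matrix (Fin 5) (Fin 5) ℝ :=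
  normalRotation (slice V x.1) x.2

theorem matDiff_jointRotation (hV : ContDiff ℝ ∞ V) {x : ℝ × ℂ}
    (hD : 0 < gram (slice V x.1) x.2) : MatDiff ∞ (jointRotation V) x := by
  have e : jointRotation V = fun y => planeRotation (V y).ofLp (jointPd 0 V y).ofLp
      (jointPd 1 V y).ofLp := by
    funext y
    simp only [jointRotation, normalRotation, pd_slice hV]
    rfl
  rw [e]
  refine matDiff_planeRotation hV.contDiffAt (contDiff_jointPd hV 0).contDiffAt
    (contDiff_jointPd hV 1).contDiffAt ?_
  rw [gram, pd_slice hV, pd_slice hV] at hD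
  exact hD

theorem eventually_gram_pos (hV : ContDiff ℝ ∞ V) {x : ℝ × ℂ} (hD : 0 < gram (slice V x.1) x.2) :
    ∀ᶠ y in 𝓝 x, 0 < gram (slice V y.1) y.2 := by
  have c : Continuous fun y : ℝ × ℂ => gram (slice V y.1) y.2 := by
    have cd : ∀ i j, Continuous fun y : ℝ × ℂ =>
        (pd i (slice V y.1) y.2).ofLp ⬝ᵥ (pd j (slice V y.1) y.2).ofLp := fun i j => by
      simp only [← inner_eq_dotProduct, pd_slice hV]
      exact (contDiff_jointPd hV i).continuous.inner (contDiff_jointPd hV j).continuous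
    exact ((cd 0 0).mul (cd 1 1)).sub ((cd 0 1).pow 2)
  exact c.continuousAt.eventually (lt_mem_nhds hD)

theorem curvatureForm_jointRotation (hV : ContDiff ℝ ∞ V) {x : ℝ × ℂ}
    (hD : 0 < gram (slice V x.1) x.2) (b c : ℂ) :
    curvatureForm (jointRotation V) (0, b) (0, c) x =
      curvatureForm (normalRotation (slice V x.1)) b c x.2 := by
  have hd : MatDiff 1 (jointRotation V) x := (matDiff_jointRotation hV hD).mono (by simp)
  have e : ∀ b, matDeriv ((0, b) : ℝ × ℂ) (jointRotation V) x =
      matDeriv b (normalRotation (slice V x.1)) x.2 := fun b => by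
    ext i j
    exact (fderiv_slice (f := fun y => jointRotation V y i j) (t := x.1) (z := x.2)
      (hd.differentiableAt i j) b).symm
  rw [curvatureForm, curvatureForm, e, e]
  rfl

theorem contDiffAt_curvatureForm {X : Type*} [NormedAddCommGroup X] [NormedSpace ℝ X]
    {J : X → Matrix (Fin 5) (Fin 5) ℝ} {x : X} (hJ : MatDiff 2 J x) (a b : X) :
    ContDiffAt ℝ 1 (curvatureForm J a b) x :=
  (((hJ.mono (by norm_num)).mul (hJ.matDeriv (by norm_num) a)).mul
    (hJ.matDeriv (by norm_num) b)).trace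

/-- If `k ≤ f`, with equality at time `0`, then `f` and `k` have the same time derivative there. -/
theorem fderiv_eq_of_le_of_eq {f k : ℝ × ℂ → ℝ} {z : ℂ} (hf : DifferentiableAt ℝ f (0, z))
    (hk : DifferentiableAt ℝ k (0, z)) (hle : ∀ᶠ s in 𝓝 (0 : ℝ), k (s, z) ≤ f (s, z))
    (heq : f (0, z) = k (0, z)) : fderiv ℝ f (0, z) (1, 0) = fderiv ℝ k (0, z) (1, 0) := by
  have h2 : HasDerivAt (fun s : ℝ => (s, z)) ((1, 0) : ℝ × ℂ) 0 :=
    (hasDerivAt_id 0).prodMk (hasDerivAt_const 0 z)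
  have h3 : HasDerivAt (fun s => f (s, z) - k (s, z))
      (fderiv ℝ f (0, z) (1, 0) - fderiv ℝ k (0, z) (1, 0)) 0 :=
    (hf.hasFDerivAt.comp_hasDerivAt (0 : ℝ) h2).sub (hk.hasFDerivAt.comp_hasDerivAt (0 : ℝ) h2)
  have hmin : IsLocalMin (fun s => f (s, z) - k (s, z)) 0 := by
    filter_upwards [hle] with s hs
    rw [heq, sub_self]
    linarith
  exact sub_eq_zero.1 (hmin.hasDerivAt_eq_zero h3)

/-- The first variation of the Willmore density at a surface where it is equal to the normal
curvature: as the density is bounded below by the normal curvature, the difference has a minimum,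
and the first variation of the normal curvature is exact. -/
theorem fderiv_willmoreDensity (hV : ContDiff ℝ ∞ V) (hu : ∀ x, ‖V x‖ = 1) {z : ℂ}
    (hD : 0 < gram (slice V 0) z) {ε : ℝ} (hε : ε ^ 2 = 1)
    (heq : willmoreDensity (slice V 0) z =
      ε * curvatureForm (normalRotation (slice V 0)) 1 Complex.I z) :
    fderiv ℝ (fun y : ℝ × ℂ => willmoreDensity (slice V y.1) y.2) (0, z) (1, 0) =
      ε * (fderiv ℝ (curvatureForm (jointRotation V) (1, 0) (0, Complex.I)) (0, z) (0, 1) -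
        fderiv ℝ (curvatureForm (jointRotation V) (1, 0) (0, 1)) (0, z) (0, Complex.I)) := by
  have hev := eventually_gram_pos hV (x := (0, z)) hD
  have hrot : ∀ᶠ y in 𝓝 ((0, z) : ℝ × ℂ), IsPlaneRotation (jointRotation V y) :=
    hev.mono fun y hy => isPlaneRotation_normalRotation (contDiff_slice hV _) (fun _ => hu _) hy
  have hd : MatDiff 2 (jointRotation V) (0, z) :=
    (matDiff_jointRotation hV (x := (0, z)) hD).mono ENat.LEInfty.out
  rw [← curvatureForm_closed hrot hd]
  have d1 : DifferentiableAt ℝ (fun y : ℝ × ℂ => willmoreDensity (slice V y.1) y.2) (0, z) :=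
    (contDiffAt_willmoreDensity hV (x := (0, z)) hD).differentiableAt (by simp)
  have d2 : DifferentiableAt ℝ (curvatureForm (jointRotation V) (0, 1) (0, Complex.I)) (0, z) :=
    (contDiffAt_curvatureForm hd _ _).differentiableAt one_ne_zero
  have h := fderiv_eq_of_le_of_eq d1 (d2.const_mul ε) ?_ ?_
  · rw [h, fderiv_const_mul d2]
    rfl
  · filter_upwards [(Continuous.prodMk_left z).continuousAt.eventually hev] with s hs
    rw [curvatureForm_jointRotation hV (x := (s, z)) hs]
    have hle := abs_curvatureForm_le_willmoreDensity (contDiff_slice hV s) (fun _ => hu _) hs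
    have habs : |ε| = 1 := by rw [← sq_eq_sq₀ (abs_nonneg _) zero_le_one, sq_abs, hε, one_pow]
    have := le_abs_self (ε * curvatureForm (normalRotation (slice V s)) 1 Complex.I z)
    rw [abs_mul, habs, one_mul] at this
    exact this.trans hle
  · rw [curvatureForm_jointRotation hV (x := (0, z)) hD, heq]

end Variation

end

section

/-! ### A criterion for Willmore spheres -/

theorem det5_linearCombination (x y p q r : Fin 5 → ℝ) (a b : ℝ) :
    det5 x y p (a • q - b • r) (b • q + a • r) = (a ^ 2 + b ^ 2) * det5 x y p q r := by
  have e : Matrix.of ![x, y, p, a • q - b • r, b • q + a • r] =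
      !![1, 0, 0, 0, 0; 0, 1, 0, 0, 0; 0, 0, 1, 0, 0; 0, 0, 0, a, -b; 0, 0, 0, b, a] *
        Matrix.of ![x, y, p, q, r] := by
    ext i j
    fin_cases i <;> (simp [Matrix.mul_apply, Fin.sum_univ_succ]; try ring)
  rw [det5, e, Matrix.det_mul, det5]
  congr 1
  simp [Matrix.det_succ_row_zero, Fin.sum_univ_succ, Fin.succAbove]
  ring

/-- The rotation of the normal plane depends on the oriented conformal class of the tangent frame
only. -/
theorem planeRotation_linearCombination (p q r : Fin 5 → ℝ) {a b : ℝ} (hab : 0 < a ^ 2 + b ^ 2) :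
    planeRotation p (a • q - b • r) (b • q + a • r) = planeRotation p q r := by
  have e : ((a • q - b • r) ⬝ᵥ (a • q - b • r)) * ((b • q + a • r) ⬝ᵥ (b • q + a • r)) -
      ((a • q - b • r) ⬝ᵥ (b • q + a • r)) ^ 2 =
      (a ^ 2 + b ^ 2) ^ 2 * ((q ⬝ᵥ q) * (r ⬝ᵥ r) - (q ⬝ᵥ r) ^ 2) := by
    simp only [sub_dotProduct, dotProduct_sub, add_dotProduct, dotProduct_add, smul_dotProduct,
      dotProduct_smul, smul_eq_mul, dotProduct_comm r q]
    ring
  ext i j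
  simp only [planeRotation, Matrix.of_apply, det5_linearCombination]
  rw [e, Real.sqrt_mul (by positivity), Real.sqrt_sq hab.le, mul_inv]
  field_simp

theorem sphereChart_one_eq {w : ℂ} (hw : w ≠ 0) : sphereChart 1 w = sphereChart 0 w⁻¹ := by
  simp [sphereChart, hw]

/-- The rotations of the normal planes in the two coordinates `z` and `w = 1/z` of the sphere
agree. -/
theorem normalRotation_chart {y : OnePoint ℂ → EuclideanSpace ℝ (Fin 5)}
    (hs : ContDiff ℝ ∞ fun z => y (sphereChart 0 z)) {w : ℂ} (hw : w ≠ 0) :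
    normalRotation (fun z => y (sphereChart 1 z)) w =
      normalRotation (fun z => y (sphereChart 0 z)) w⁻¹ := by
  set h := fun z => y (sphereChart 0 z) with hh
  have hev : (fun z => y (sphereChart 1 z)) =ᶠ[𝓝 w] fun z => h z⁻¹ := by
    filter_upwards [isOpen_ne.mem_nhds hw] with z hz
    rw [sphereChart_one_eq hz]
  have hd : HasFDerivAt h (fderiv ℝ h w⁻¹) w⁻¹ := (hs.differentiable (by simp) _).hasFDerivAt
  have hinv : HasFDerivAt (fun z : ℂ => z⁻¹) _ w :=
    (hasDerivAt_inv hw).hasFDerivAt.restrictScalars ℝ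
  have hc := (hd.comp w hinv).congr_of_eventuallyEq hev
  set c : ℂ := -(w ^ 2)⁻¹ with hcdef
  have hf : ∀ v : ℂ, fderiv ℝ (fun z => y (sphereChart 1 z)) w v = fderiv ℝ h w⁻¹ (v * c) :=
    fun v => by
      rw [hc.fderiv]
      simp [hcdef]
  have hlin : ∀ s t : ℝ, fderiv ℝ h w⁻¹ (s + t * Complex.I) = s • pd 0 h w⁻¹ + t • pd 1 h w⁻¹ :=
    fun s t => by
      have : (s + t * Complex.I : ℂ) = s • (1 : ℂ) + t • Complex.I := by simp
      rw [this, map_add, map_smul, map_smul]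
      rfl
  have h0 : pd 0 (fun z => y (sphereChart 1 z)) w =
      c.re • pd 0 h w⁻¹ - (-c.im) • pd 1 h w⁻¹ := by
    change fderiv ℝ _ w 1 = _
    rw [hf, one_mul, ← Complex.re_add_im c, hlin]
    simp
  have h1 : pd 1 (fun z => y (sphereChart 1 z)) w =
      (-c.im) • pd 0 h w⁻¹ + c.re • pd 1 h w⁻¹ := by
    change fderiv ℝ _ w Complex.I = _
    have e : Complex.I * c = ((-c.im : ℝ) : ℂ) + (c.re : ℝ) * Complex.I := by
      apply Complex.ext <;> simp
    rw [hf, e, hlin]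
  have hcne : c ≠ 0 := by simp [hcdef, hw]
  have hpos : 0 < c.re ^ 2 + (-c.im) ^ 2 := by
    have := Complex.normSq_pos.2 hcne
    rw [Complex.normSq_apply] at this
    linarith
  rw [normalRotation, h0, h1, WithLp.ofLp_sub, WithLp.ofLp_add, WithLp.ofLp_smul, WithLp.ofLp_smul,
    WithLp.ofLp_smul, WithLp.ofLp_smul, planeRotation_linearCombination _ _ _ hpos, normalRotation]
  rw [sphereChart_one_eq hw]

theorem gram_pos_of_conformalAt {n : ℕ} {h : ℂ → EuclideanSpace ℝ (Fin n)} {z : ℂ}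
    (hc : ConformalAt h z) : 0 < gram h z ∧ (pd 0 h z).ofLp ⬝ᵥ (pd 1 h z).ofLp = 0 ∧
      (pd 0 h z).ofLp ⬝ᵥ (pd 0 h z).ofLp = (pd 1 h z).ofLp ⬝ᵥ (pd 1 h z).ofLp := by
  obtain ⟨c, hc0, hc⟩ := conformalAt_iff'.1 hc
  have e00 : (pd 0 h z).ofLp ⬝ᵥ (pd 0 h z).ofLp = c := by
    rw [← inner_eq_dotProduct]
    exact (hc 1 1).trans (by simp)
  have e01 : (pd 0 h z).ofLp ⬝ᵥ (pd 1 h z).ofLp = 0 := by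
    rw [← inner_eq_dotProduct]
    exact (hc 1 Complex.I).trans (by simp [Complex.inner])
  have e11 : (pd 1 h z).ofLp ⬝ᵥ (pd 1 h z).ofLp = c := by
    rw [← inner_eq_dotProduct]
    exact (hc Complex.I Complex.I).trans (by simp)
  refine ⟨?_, e01, e00.trans e11.symm⟩
  rw [gram, e00, e01, e11]
  simpa using mul_pos hc0 hc0

section Linearity

variable {X : Type*} [NormedAddCommGroup X] [NormedSpace ℝ X]

theorem curvatureForm_add_smul_right (J : X → Matrix (Fin 5) (Fin 5) ℝ) (a b c : X) (s t : ℝ)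
    (x : X) : curvatureForm J a (s • b + t • c) x =
      s * curvatureForm J a b x + t * curvatureForm J a c x := by
  have e : matDeriv (s • b + t • c) J x = s • matDeriv b J x + t • matDeriv c J x := by
    ext i j
    simp [matDeriv]
  rw [curvatureForm, e, Matrix.mul_add, Matrix.trace_add, Matrix.mul_smul, Matrix.mul_smul,
    Matrix.trace_smul, Matrix.trace_smul]
  rfl

end Linearity

/-- An integral over the open unit disk is an integral over the closed unit disk. -/
theorem setIntegral_ball_eq_closedBall (f : ℂ → ℝ) :
    ∫ z in Metric.ball (0 : ℂ) 1, f z = ∫ z in Metric.closedBall (0 : ℂ) 1, f z := by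
  refine MeasureTheory.setIntegral_congr_set ?_
  refine MeasureTheory.ae_eq_of_subset_of_measure_ge Metric.ball_subset_closedBall ?_
    Metric.isOpen_ball.measurableSet.nullMeasurableSet ?_
  · rw [MeasureTheory.Measure.addHaar_closedBall_eq_addHaar_ball]
  · exact (isCompact_closedBall (0 : ℂ) 1).measure_lt_top.ne

/-- A conformal immersion of the two-sphere into the four-sphere whose Willmore density is equal to
the curvature of the normal bundle, up to a global sign, is a Willmore surface. -/
theorem isWillmoreImmersion_of_density_eq {y : OnePoint ℂ → EuclideanSpace ℝ (Fin 5)}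
    (hy : IsConformalImmersion y) {ε : ℝ} (hε : ε ^ 2 = 1)
    (heq : ∀ a z, willmoreDensity (fun z => y (sphereChart a z)) z =
      ε * curvatureForm (normalRotation fun z => y (sphereChart a z)) 1 Complex.I z) :
    IsWillmoreImmersion y := by
  refine ⟨hy, fun v hv0 hvu hvs => ?_⟩
  set V : Fin 2 → ℝ × ℂ → EuclideanSpace ℝ (Fin 5) := fun a q => v q.1 (sphereChart a q.2) with hV
  have hslice0 : ∀ a, slice (V a) 0 = fun z => y (sphereChart a z) := fun a => by
    funext z
    simp [slice, hV, hv0]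
  have hgram : ∀ a z, 0 < gram (slice (V a) 0) z := fun a z => by
    rw [hslice0]
    exact (gram_pos_of_conformalAt (hy.conformal a z)).1
  -- the one-form `P du + Q dv` whose exterior derivative is the first variation
  set P : Fin 2 → ℂ → ℝ := fun a z => curvatureForm (jointRotation (V a)) (1, 0) (0, 1) (0, z)
    with hPdef
  set Q : Fin 2 → ℂ → ℝ := fun a z => curvatureForm (jointRotation (V a)) (1, 0) (0, Complex.I) (0,
      z)
    with hQdef
  have hmat : ∀ a z, MatDiff 2 (jointRotation (V a)) (0, z) := fun a z =>
    (matDiff_jointRotation (hvs a) (x := (0, z)) (hgram a z)).mono ENat.LEInfty.out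
  have hcurv : ∀ a z b c, ContDiffAt ℝ 1 (curvatureForm (jointRotation (V a)) b c) (0, z) :=
    fun a z b c => contDiffAt_curvatureForm (hmat a z) b c
  have hP : ∀ a, ContDiff ℝ 1 (P a) := fun a => contDiff_iff_contDiffAt.2 fun z =>
    (hcurv a z _ _).comp z (contDiff_prodMk_right (0 : ℝ)).contDiffAt
  have hQ : ∀ a, ContDiff ℝ 1 (Q a) := fun a => contDiff_iff_contDiffAt.2 fun z =>
    (hcurv a z _ _).comp z (contDiff_prodMk_right (0 : ℝ)).contDiffAt
  have hfirst : ∀ a z,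
      fderiv ℝ (fun x : ℝ × ℂ => willmoreDensity (slice (V a) x.1) x.2) (0, z) (1, 0) =
      ε * (fderiv ℝ (Q a) z 1 - fderiv ℝ (P a) z Complex.I) := fun a z => by
    rw [fderiv_willmoreDensity (hvs a) (fun x => hvu _ _) (hgram a z) hε
      (by rw [hslice0]; exact heq a z),
      ← fderiv_slice ((hcurv a z _ _).differentiableAt one_ne_zero),
      ← fderiv_slice ((hcurv a z _ _).differentiableAt one_ne_zero)]
  have hder : ∀ a, HasDerivAt
      (fun t => ∫ z in Metric.closedBall (0 : ℂ) 1, willmoreDensity (slice (V a) t) z)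
      (ε * ∫ θ in (-Real.pi)..Real.pi, (Q a (Real.cos θ + Real.sin θ * Complex.I) * Real.cos θ -
          P a (Real.cos θ + Real.sin θ * Complex.I) * Real.sin θ)) 0 := fun a => by
    have h := hasDerivAt_setIntegral_of_contDiffAt
      (f := fun x : ℝ × ℂ => willmoreDensity (slice (V a) x.1) x.2)
      (isCompact_closedBall (0 : ℂ) 1) fun z _ =>
        (contDiffAt_willmoreDensity (hvs a) (x := (0, z)) (hgram a z)).of_le ENat.LEInfty.out
    simp only [hfirst, MeasureTheory.integral_const_mul] at h
    rwa [integral_curl_closedBall (hP a) (hQ a)] at h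
  -- The boundary terms of the two disks cancel: the rotations of the normal planes in the two
  -- coordinates agree, and `w ↦ 1 / w` reverses the orientation of the unit circle.
  have hglue : ∀ θ : ℝ, Q 1 (Real.cos θ + Real.sin θ * Complex.I) * Real.cos θ -
        P 1 (Real.cos θ + Real.sin θ * Complex.I) * Real.sin θ =
      -(Q 0 (Real.cos (-θ) + Real.sin (-θ) * Complex.I) * Real.cos (-θ) -
        P 0 (Real.cos (-θ) + Real.sin (-θ) * Complex.I) * Real.sin (-θ)) := fun θ => by
    set w : ℂ := Real.cos θ + Real.sin θ * Complex.I with hw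
    have hsq : (Real.cos θ : ℂ) ^ 2 + (Real.sin θ : ℂ) ^ 2 = 1 := by
      exact_mod_cast Real.cos_sq_add_sin_sq θ
    have hmul : w * (Real.cos θ - Real.sin θ * Complex.I) = 1 := by
      rw [hw]
      linear_combination hsq - (Real.sin θ : ℂ) ^ 2 * Complex.I_sq
    have hw0 : w ≠ 0 := left_ne_zero_of_mul_eq_one hmul
    have hinv : w⁻¹ = Real.cos θ - Real.sin θ * Complex.I :=
      inv_eq_of_mul_eq_one_right hmul
    have hev : ∀ᶠ x in 𝓝 ((0, w) : ℝ × ℂ),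
        jointRotation (V 1) x = jointRotation (V 0) (x.1, x.2⁻¹) := by
      filter_upwards [(isOpen_ne.preimage continuous_snd).mem_nhds hw0] with x hx
      exact normalRotation_chart (contDiff_slice (hvs 0) x.1) hx
    have hφ : HasFDerivAt (fun x : ℝ × ℂ => (x.1, x.2⁻¹)) _ (0, w) :=
      (hasFDerivAt_fst (p := ((0, w) : ℝ × ℂ))).prodMk
        (((hasDerivAt_inv hw0).hasFDerivAt.restrictScalars ℝ).comp ((0, w) : ℝ × ℂ)
          (hasFDerivAt_snd (p := ((0, w) : ℝ × ℂ))))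
    have hmd : ∀ s : ℝ, ∀ b : ℂ, matDeriv (s, b) (jointRotation (V 1)) (0, w) =
        matDeriv (s, -(w ^ 2)⁻¹ * b) (jointRotation (V 0)) (0, w⁻¹) := fun s b => by
      rw [matDeriv_congr hev]
      ext i j
      have h1 := (((hmat 0 w⁻¹).mono one_le_two).differentiableAt i j).hasFDerivAt
      have h2 := HasFDerivAt.comp (g := fun x => jointRotation (V 0) x i j)
        (f := fun x : ℝ × ℂ => (x.1, x.2⁻¹)) ((0, w) : ℝ × ℂ) h1 hφ
      change fderiv ℝ ((fun x => jointRotation (V 0) x i j) ∘ fun x : ℝ × ℂ => (x.1, x.2⁻¹))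
        (0, w) (s, b) = fderiv ℝ (fun x => jointRotation (V 0) x i j) _ _
      rw [h2.fderiv]
      simp [mul_comm]
    have hval : jointRotation (V 1) (0, w) = jointRotation (V 0) (0, w⁻¹) := hev.self_of_nhds
    have hform : ∀ b, curvatureForm (jointRotation (V 1)) (1, 0) (0, b) (0, w) =
        curvatureForm (jointRotation (V 0)) (1, 0) (0, -(w ^ 2)⁻¹ * b) (0, w⁻¹) := fun b => by
      rw [curvatureForm, curvatureForm, hmd, hmd, hval, mul_zero]
    have hdecomp : ∀ (a : Fin 2) (u : ℂ) (s t : ℝ), t * Q a u + s * P a u =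
        curvatureForm (jointRotation (V a)) (1, 0) (0, s + t * Complex.I) (0, u) :=
      fun a u s t => by
        have : ((0, s + t * Complex.I) : ℝ × ℂ) = s • ((0, 1) : ℝ × ℂ) + t • ((0, Complex.I) : ℝ ×
            ℂ) := by
          ext <;> simp
        rw [this, curvatureForm_add_smul_right]
        simp only [hPdef, hQdef]
        ring
    have hneg : (Real.cos (-θ) + Real.sin (-θ) * Complex.I : ℂ) = w⁻¹ := by
      rw [hinv, Real.cos_neg, Real.sin_neg, Complex.ofReal_neg]
      ring
    rw [hneg]
    have l1 := hdecomp 1 w (-Real.sin θ) (Real.cos θ)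
    have l0 := hdecomp 0 w⁻¹ (-Real.sin θ) (-Real.cos θ)
    rw [hform] at l1
    -- the inversion maps the tangent vector `i w` of the circle at `w` to `-i w⁻¹` at `w⁻¹`
    have e : -(w ^ 2)⁻¹ * ((-Real.sin θ : ℝ) + (Real.cos θ : ℝ) * Complex.I) =
        (((-Real.sin θ : ℝ) : ℂ) + ((-Real.cos θ : ℝ) : ℂ) * Complex.I) := by
      have e1 : ((-Real.sin θ : ℝ) + (Real.cos θ : ℝ) * Complex.I : ℂ) = Complex.I * w := by
        rw [hw, Complex.ofReal_neg]
        linear_combination -(Real.sin θ : ℂ) * Complex.I_sq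
      have e2 : -(w ^ 2)⁻¹ * (Complex.I * w) = -Complex.I * w⁻¹ := by field_simp
      rw [e1, e2, hinv, Complex.ofReal_neg, Complex.ofReal_neg]
      linear_combination (Real.sin θ : ℂ) * Complex.I_sq
    rw [e, ← l0] at l1
    rw [Real.cos_neg, Real.sin_neg]
    linarith
  have hsum : (ε * ∫ θ in (-Real.pi)..Real.pi, (Q 0 (Real.cos θ + Real.sin θ * Complex.I) * Real.cos
      θ -
          P 0 (Real.cos θ + Real.sin θ * Complex.I) * Real.sin θ)) +
      (ε * ∫ θ in (-Real.pi)..Real.pi, (Q 1 (Real.cos θ + Real.sin θ * Complex.I) * Real.cos θ -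
          P 1 (Real.cos θ + Real.sin θ * Complex.I) * Real.sin θ)) = 0 := by
    simp only [hglue, intervalIntegral.integral_neg]
    rw [intervalIntegral.integral_comp_neg (fun θ : ℝ =>
      Q 0 (Real.cos θ + Real.sin θ * Complex.I) * Real.cos θ -
        P 0 (Real.cos θ + Real.sin θ * Complex.I) * Real.sin θ), neg_neg]
    ring
  have htotal := (hder 0).add (hder 1)
  rw [hsum] at htotal
  refine htotal.congr_of_eventuallyEq (Filter.Eventually.of_forall fun t => ?_)
  simp only [willmoreFunctional, setIntegral_ball_eq_closedBall]
  rfl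

end

section

/-! ### Wirtinger calculus -/

section Wirtinger

variable {E : Type*} [NormedAddCommGroup E] [NormedSpace ℂ E]

/-- The real linear map `v ↦ v a + v̄ b`. -/
noncomputable def wirtingerMap (a b : E) : ℂ →L[ℝ] E :=
  (ContinuousLinearMap.toSpanSingleton ℂ a).restrictScalars ℝ +
    ((ContinuousLinearMap.toSpanSingleton ℂ b).restrictScalars ℝ).comp
      (Complex.conjCLE : ℂ →L[ℝ] ℂ)

theorem wirtingerMap_apply (a b : E) (v : ℂ) :
    wirtingerMap a b v = v • a + (starRingEnd ℂ) v • b := rfl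

/-- `f` is real differentiable at `z`, with `∂f/∂z = a` and `∂f/∂z̄ = b`. -/
def HasWirtingerAt (f : ℂ → E) (a b : E) (z : ℂ) : Prop :=
  HasFDerivAt (𝕜 := ℝ) f (wirtingerMap a b) z

theorem HasWirtingerAt.dz_eq {f : ℂ → E} {a b : E} {z : ℂ} (h : HasWirtingerAt f a b z) :
    dz f z = a := by
  rw [dz, HasFDerivAt.fderiv h, wirtingerMap_apply, wirtingerMap_apply]
  simp only [map_one, one_smul, Complex.conj_I, neg_smul, smul_add, smul_neg, smul_smul,
      Complex.I_mul_I]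
  module

theorem HasWirtingerAt.dzbar_eq {f : ℂ → E} {a b : E} {z : ℂ} (h : HasWirtingerAt f a b z) :
    dzbar f z = b := by
  rw [dzbar, HasFDerivAt.fderiv h, wirtingerMap_apply, wirtingerMap_apply]
  simp only [map_one, one_smul, Complex.conj_I, neg_smul, smul_add, smul_neg, smul_smul,
      Complex.I_mul_I]
  module

theorem hasWirtingerAt_of_differentiableAt {f : ℂ → E} {z : ℂ} (h : DifferentiableAt ℝ f z) :
    HasWirtingerAt f (dz f z) (dzbar f z) z := by
  refine h.hasFDerivAt.congr_fderiv (ContinuousLinearMap.ext fun v => ?_)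
  have e : fderiv ℝ f z v = (v.re : ℂ) • fderiv ℝ f z 1 + (v.im : ℂ) • fderiv ℝ f z Complex.I := by
    have hv : v = v.re • (1 : ℂ) + v.im • Complex.I := by simp [Complex.re_add_im]
    conv_lhs => rw [hv, map_add, map_smul, map_smul]
    rw [Complex.coe_smul, Complex.coe_smul]
  have h1 : v = v.re + v.im * Complex.I := (Complex.re_add_im v).symm
  have h2 : (starRingEnd ℂ) v = v.re - v.im * Complex.I := by apply Complex.ext <;> simp
  rw [e, wirtingerMap_apply, h2, dz, dzbar]
  nth_rewrite 3 [h1]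
  have hI : ∀ x : E, Complex.I • Complex.I • x = -x := fun x => by
    rw [smul_smul, Complex.I_mul_I, neg_one_smul]
  simp only [smul_add, smul_sub, add_smul, sub_smul, mul_smul, hI, smul_comm Complex.I (1 / 2 : ℂ)]
  module

theorem hasWirtingerAt_const (c : E) (z : ℂ) : HasWirtingerAt (fun _ => c) 0 0 z :=
  (hasFDerivAt_const c z).congr_fderiv (ContinuousLinearMap.ext fun v => by
    simp [wirtingerMap_apply])

theorem hasWirtingerAt_id (z : ℂ) : HasWirtingerAt (fun w => w) 1 0 z :=
  (hasFDerivAt_id z).congr_fderiv (ContinuousLinearMap.ext fun v => by simp [wirtingerMap_apply])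

theorem hasWirtingerAt_conj (z : ℂ) : HasWirtingerAt (fun w => (starRingEnd ℂ) w) 0 1 z :=
  (Complex.conjCLE : ℂ →L[ℝ] ℂ).hasFDerivAt.congr_fderiv (ContinuousLinearMap.ext fun v => by
    simp [wirtingerMap_apply])

variable {f g : ℂ → E} {a b a' b' : E} {z : ℂ}

theorem HasWirtingerAt.add (hf : HasWirtingerAt f a b z) (hg : HasWirtingerAt g a' b' z) :
    HasWirtingerAt (fun w => f w + g w) (a + a') (b + b') z :=
  (HasFDerivAt.add hf hg).congr_fderiv (ContinuousLinearMap.ext fun v => by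
    simp only [wirtingerMap_apply, add_apply]
    module)

theorem HasWirtingerAt.sub (hf : HasWirtingerAt f a b z) (hg : HasWirtingerAt g a' b' z) :
    HasWirtingerAt (fun w => f w - g w) (a - a') (b - b') z :=
  (HasFDerivAt.sub hf hg).congr_fderiv (ContinuousLinearMap.ext fun v => by
    simp only [wirtingerMap_apply, sub_apply]
    module)

theorem HasWirtingerAt.neg (hf : HasWirtingerAt f a b z) :
    HasWirtingerAt (fun w => -f w) (-a) (-b) z :=
  (HasFDerivAt.neg hf).congr_fderiv (ContinuousLinearMap.ext fun v => by
    simp only [wirtingerMap_apply, neg_apply]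
    module)

theorem HasWirtingerAt.smul {c : ℂ → ℂ} {s t : ℂ} (hc : HasWirtingerAt c s t z)
    (hf : HasWirtingerAt f a b z) :
    HasWirtingerAt (fun w => c w • f w) (s • f z + c z • a) (t • f z + c z • b) z :=
  (HasFDerivAt.smul hc hf).congr_fderiv (ContinuousLinearMap.ext fun v => by
    simp only [wirtingerMap_apply, add_apply, smul_apply, ContinuousLinearMap.smulRight_apply,
      smul_eq_mul]
    module)

theorem HasWirtingerAt.mul {c d : ℂ → ℂ} {s t s' t' : ℂ} (hc : HasWirtingerAt c s t z)
    (hd : HasWirtingerAt d s' t' z) :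
    HasWirtingerAt (fun w => c w * d w) (s * d z + c z * s') (t * d z + c z * t') z :=
  hc.smul hd

theorem HasWirtingerAt.inv {c : ℂ → ℂ} {s t : ℂ} (hc : HasWirtingerAt c s t z) (h0 : c z ≠ 0) :
    HasWirtingerAt (fun w => (c w)⁻¹) (-s / c z ^ 2) (-t / c z ^ 2) z := by
  have h1 : HasFDerivAt (fun x : ℂ => x⁻¹) _ (c z) :=
    (hasDerivAt_inv h0).hasFDerivAt.restrictScalars ℝ
  refine (h1.comp z hc).congr_fderiv (ContinuousLinearMap.ext fun v => ?_)
  simp [wirtingerMap_apply]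
  ring

theorem HasWirtingerAt.comp_mul_left {c : ℂ} (hf : HasWirtingerAt f a b (c * z)) :
    HasWirtingerAt (fun w => f (c * w)) (c • a) ((starRingEnd ℂ) c • b) z := by
  have h1 : HasFDerivAt (𝕜 := ℝ) (fun w : ℂ => c * w) _ z :=
    ((hasFDerivAt_id z).const_mul c)
  refine (HasFDerivAt.comp z hf h1).congr_fderiv (ContinuousLinearMap.ext fun v => ?_)
  simp only [wirtingerMap_apply, ContinuousLinearMap.comp_apply, smul_apply,
    ContinuousLinearMap.coe_id', id_eq, smul_eq_mul, map_mul]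
  module

theorem hasWirtingerAt_pi {n : ℕ} {f : ℂ → Fin n → ℂ} {a b : Fin n → ℂ} {z : ℂ} :
    HasWirtingerAt f a b z ↔ ∀ i, HasWirtingerAt (fun w => f w i) (a i) (b i) z :=
  hasFDerivAt_pi'

theorem HasWirtingerAt.congr {a₁ b₁ : E} (hf : HasWirtingerAt f a b z) (ha : a = a₁) (hb : b = b₁) :
    HasWirtingerAt f a₁ b₁ z := by rwa [← ha, ← hb]

end Wirtinger

theorem dz_apply {n : ℕ} {f : ℂ → Fin n → ℂ} {z : ℂ} (h : DifferentiableAt ℝ f z) (i : Fin n) :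
    dz f z i = dz (fun w => f w i) z :=
  ((hasWirtingerAt_pi.1 (hasWirtingerAt_of_differentiableAt h)) i).dz_eq.symm

theorem dzbar_apply {n : ℕ} {f : ℂ → Fin n → ℂ} {z : ℂ} (h : DifferentiableAt ℝ f z) (i : Fin n) :
    dzbar f z i = dzbar (fun w => f w i) z :=
  ((hasWirtingerAt_pi.1 (hasWirtingerAt_of_differentiableAt h)) i).dzbar_eq.symm

theorem contDiff_dz {E : Type*} [NormedAddCommGroup E] [NormedSpace ℂ E] {f : ℂ → E}
    (h : ContDiff ℝ ∞ f) : ContDiff ℝ ∞ (dz f) := by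
  have c := h.fderiv_right (m := ∞) le_rfl
  exact ((c.clm_apply contDiff_const).sub ((c.clm_apply contDiff_const).const_smul _)).const_smul _

theorem contDiff_dzbar {E : Type*} [NormedAddCommGroup E] [NormedSpace ℂ E] {f : ℂ → E}
    (h : ContDiff ℝ ∞ f) : ContDiff ℝ ∞ (dzbar f) := by
  have c := h.fderiv_right (m := ∞) le_rfl
  exact ((c.clm_apply contDiff_const).add ((c.clm_apply contDiff_const).const_smul _)).const_smul _

/-! ### Complexification of real surfaces -/

/-- A map into `ℝⁿ`, regarded as a map into `ℂⁿ`. -/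
def complexify {n : ℕ} (h : ℂ → EuclideanSpace ℝ (Fin n)) : ℂ → Fin n → ℂ := fun z i => (h z i : ℂ)

theorem hasWirtingerAt_complexify {n : ℕ} {h : ℂ → EuclideanSpace ℝ (Fin n)} {z : ℂ}
    (hd : DifferentiableAt ℝ h z) :
    HasWirtingerAt (complexify h)
      (fun i => 1 / 2 * ((pd 0 h z i : ℂ) - Complex.I * pd 1 h z i))
      (fun i => 1 / 2 * ((pd 0 h z i : ℂ) + Complex.I * pd 1 h z i)) z := by
  refine hasWirtingerAt_pi.2 fun i => ?_
  have h1 : HasFDerivAt (fun w => h w i) ((EuclideanSpace.proj i :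
      EuclideanSpace ℝ (Fin n) →L[ℝ] ℝ).comp (fderiv ℝ h z)) z :=
    (EuclideanSpace.proj i : EuclideanSpace ℝ (Fin n) →L[ℝ] ℝ).hasFDerivAt.comp z hd.hasFDerivAt
  refine (Complex.ofRealCLM.hasFDerivAt.comp z h1).congr_fderiv (ContinuousLinearMap.ext fun v =>
      ?_)
  have hv : v = v.re • (1 : ℂ) + v.im • Complex.I := by simp [Complex.re_add_im]
  have e : fderiv ℝ h z v = v.re • pd 0 h z + v.im • pd 1 h z := by
    conv_lhs => rw [hv, map_add, map_smul, map_smul]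
    rfl
  have h2 : (starRingEnd ℂ) v = v.re - v.im * Complex.I := by apply Complex.ext <;> simp
  have pr : ∀ x : EuclideanSpace ℝ (Fin n),
      (EuclideanSpace.proj i : EuclideanSpace ℝ (Fin n) →L[ℝ] ℝ) x = x i := fun _ => rfl
  rw [wirtingerMap_apply, h2]
  nth_rewrite 2 [(Complex.re_add_im v).symm]
  simp only [ContinuousLinearMap.comp_apply, e, pr, PiLp.add_apply, PiLp.smul_apply,
    smul_eq_mul, Complex.ofRealCLM_apply, Complex.ofReal_add, Complex.ofReal_mul]
  linear_combination ((v.im : ℂ) * (pd 1 h z i : ℂ)) * Complex.I_sq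

theorem dz_complexify {n : ℕ} {h : ℂ → EuclideanSpace ℝ (Fin n)} (hs : ContDiff ℝ ∞ h) (z : ℂ)
    (i : Fin n) : dz (complexify h) z i = 1 / 2 * ((pd 0 h z i : ℂ) - Complex.I * pd 1 h z i) := by
  rw [(hasWirtingerAt_complexify (hs.differentiable (by simp) z)).dz_eq]

theorem dzbar_complexify {n : ℕ} {h : ℂ → EuclideanSpace ℝ (Fin n)} (hs : ContDiff ℝ ∞ h) (z : ℂ) :
    dzbar (complexify h) z = star (dz (complexify h) z) := by
  rw [(hasWirtingerAt_complexify (hs.differentiable (by simp) z)).dz_eq,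
    (hasWirtingerAt_complexify (hs.differentiable (by simp) z)).dzbar_eq]
  funext i
  simp only [Pi.star_apply, RCLike.star_def, map_mul, map_sub, Complex.conj_ofReal, Complex.conj_I,
    map_div₀, map_one, map_ofNat]
  ring

theorem dz_dz_complexify {n : ℕ} {h : ℂ → EuclideanSpace ℝ (Fin n)} (hs : ContDiff ℝ ∞ h) (z : ℂ)
    (i : Fin n) : dz (dz (complexify h)) z i =
      1 / 4 * ((pd 0 (pd 0 h) z i - pd 1 (pd 1 h) z i : ℝ) - 2 * Complex.I * pd 0 (pd 1 h) z i) :=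
          by
  have e : dz (complexify h) = fun z i =>
      1 / 2 * (complexify (pd 0 h) z i - Complex.I * complexify (pd 1 h) z i) := by
    funext z i
    exact dz_complexify hs z i
  have h0 := hasWirtingerAt_pi.1 (hasWirtingerAt_complexify
    ((contDiff_pd hs 0).differentiable (by simp) z)) i
  have h1 := hasWirtingerAt_pi.1 (hasWirtingerAt_complexify
    ((contDiff_pd hs 1).differentiable (by simp) z)) i
  have h2 := (hasWirtingerAt_const (1 / 2 : ℂ) z).mul
    (h0.sub ((hasWirtingerAt_const Complex.I z).mul h1))
  have hd : DifferentiableAt ℝ (dz (complexify h)) z := by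
    refine (contDiff_dz ?_).differentiable (by simp) z
    exact contDiff_pi.2 fun i => Complex.ofRealCLM.contDiff.comp ((contDiff_piLp 2).1 hs i)
  rw [dz_apply hd, e, h2.dz_eq, pd_comm hs z 1 0]
  push_cast
  linear_combination ((1 / 4) * (pd 1 (pd 1 h) z i : ℂ)) * Complex.I_sq

end

section

/-! ### Isotropic surfaces in the four-sphere -/

/-- `h` is a totally isotropic surface in the unit sphere of `ℝ⁵`: its `z`-derivative
`h_z = α e₁ + β e₂` lies in the isotropic plane spanned by `e₁` and `e₂`, which is orthogonal to `h`
and depends antiholomorphically on `z`. Moreover `h` is an immersion, and `e₁, e₂, ē₁, ē₂, h` is a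
basis of `ℂ⁵` whose orientation is given by the sign `ε`. -/
structure IsIsotropicSurface (ε : ℝ) (h : ℂ → EuclideanSpace ℝ (Fin 5)) (e₁ e₂ : ℂ → Fin 5 → ℂ)
    (α β : ℂ → ℂ) : Prop where
  smooth : ContDiff ℝ ∞ h
  norm : ∀ z, ‖h z‖ = 1
  smooth_e₁ : ContDiff ℝ ∞ e₁
  smooth_e₂ : ContDiff ℝ ∞ e₂
  smooth_α : ContDiff ℝ ∞ α
  smooth_β : ContDiff ℝ ∞ β
  dz_e₁ : ∀ z, dz e₁ z = 0
  dz_e₂ : ∀ z, dz e₂ z = 0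
  iso₁₁ : ∀ z, e₁ z ⬝ᵥ e₁ z = 0
  iso₁₂ : ∀ z, e₁ z ⬝ᵥ e₂ z = 0
  iso₂₂ : ∀ z, e₂ z ⬝ᵥ e₂ z = 0
  perp₁ : ∀ z, e₁ z ⬝ᵥ complexify h z = 0
  perp₂ : ∀ z, e₂ z ⬝ᵥ complexify h z = 0
  dz_h : ∀ z, dz (complexify h) z = α z • e₁ z + β z • e₂ z
  ne_zero : ∀ z, α z ≠ 0 ∨ β z ≠ 0
  det : ∀ z, ∃ d : ℝ, 0 < ε * d ∧
    det5 (e₁ z) (e₂ z) (star (e₁ z)) (star (e₂ z)) (complexify h z) = d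

theorem ofReal_dotProduct {n : ℕ} (x y : Fin n → ℝ) :
    (fun i => (x i : ℂ)) ⬝ᵥ (fun i => (y i : ℂ)) = ((x ⬝ᵥ y : ℝ) : ℂ) := by
  simp [dotProduct]

theorem ofReal_det5 (x y p q r : Fin 5 → ℝ) :
    ((det5 x y p q r : ℝ) : ℂ) = det5 (fun i => (x i : ℂ)) (fun i => (y i : ℂ)) (fun i => (p i : ℂ))
      (fun i => (q i : ℂ)) (fun i => (r i : ℂ)) := by
  rw [det5, det5]
  refine (RingHom.map_det Complex.ofRealHom _).trans (congrArg Matrix.det ?_)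
  ext i j
  fin_cases i <;> rfl

theorem contDiff_complexify {n : ℕ} {h : ℂ → EuclideanSpace ℝ (Fin n)} (hs : ContDiff ℝ ∞ h) :
    ContDiff ℝ ∞ (complexify h) :=
  contDiff_pi.2 fun i => Complex.ofRealCLM.contDiff.comp ((contDiff_piLp 2).1 hs i)

namespace IsIsotropicSurface

variable {ε : ℝ} {h : ℂ → EuclideanSpace ℝ (Fin 5)} {e₁ e₂ : ℂ → Fin 5 → ℂ} {α β : ℂ → ℂ}

theorem combination_ne_zero (S : IsIsotropicSurface ε h e₁ e₂ α β) (z : ℂ) {a b : ℂ}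
    (hab : a ≠ 0 ∨ b ≠ 0) : a • e₁ z + b • e₂ z ≠ 0 := fun h0 => by
  obtain ⟨d, hd, hdet⟩ := S.det z
  have hz : (Matrix.of ![e₁ z, e₂ z, star (e₁ z), star (e₂ z), complexify h z]).det = 0 := by
    refine Matrix.exists_vecMul_eq_zero_iff.1 ⟨![a, b, 0, 0, 0], fun hv => ?_, ?_⟩
    · rcases hab with ha | hb
      · exact ha (congrFun hv 0)
      · exact hb (congrFun hv 1)
    · funext i
      have := congrFun h0 i
      simpa [Matrix.vecMul, dotProduct, Fin.sum_univ_succ] using this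
  rw [det5, hz] at hdet
  have : d = 0 := by exact_mod_cast hdet.symm
  simp [this] at hd

theorem combination_dotProduct (S : IsIsotropicSurface ε h e₁ e₂ α β) (z a b c d : ℂ) :
    (a • e₁ z + b • e₂ z) ⬝ᵥ (c • e₁ z + d • e₂ z) = 0 := by
  have h21 : e₂ z ⬝ᵥ e₁ z = 0 := by rw [dotProduct_comm, S.iso₁₂]
  simp [add_dotProduct, dotProduct_add, S.iso₁₁, S.iso₁₂, S.iso₂₂, h21]

theorem combination_dotProduct_self (S : IsIsotropicSurface ε h e₁ e₂ α β) (z a b : ℂ) :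
    (a • e₁ z + b • e₂ z) ⬝ᵥ complexify h z = 0 := by
  simp [add_dotProduct, S.perp₁, S.perp₂]

/-- Differentiation of a section of the isotropic plane. -/
theorem dz_combination (S : IsIsotropicSurface ε h e₁ e₂ α β) {a b : ℂ → ℂ} {z : ℂ}
    (ha : DifferentiableAt ℝ a z) (hb : DifferentiableAt ℝ b z) :
    dz (fun w => a w • e₁ w + b w • e₂ w) z = dz a z • e₁ z + dz b z • e₂ z := by
  have w1 := hasWirtingerAt_of_differentiableAt (S.smooth_e₁.differentiable (by simp) z)
  have w2 := hasWirtingerAt_of_differentiableAt (S.smooth_e₂.differentiable (by simp) z)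
  rw [S.dz_e₁] at w1
  rw [S.dz_e₂] at w2
  rw [(((hasWirtingerAt_of_differentiableAt ha).smul w1).add
    ((hasWirtingerAt_of_differentiableAt hb).smul w2)).dz_eq]
  simp

theorem dz_dz_h (S : IsIsotropicSurface ε h e₁ e₂ α β) (z : ℂ) :
    dz (dz (complexify h)) z = dz α z • e₁ z + dz β z • e₂ z := by
  have e : dz (complexify h) = fun w => α w • e₁ w + β w • e₂ w := funext S.dz_h
  rw [e, S.dz_combination (S.smooth_α.differentiable (by simp) z)
    (S.smooth_β.differentiable (by simp) z)]

theorem dz_eq_pd (S : IsIsotropicSurface ε h e₁ e₂ α β) (z : ℂ) : dz (complexify h) z =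
    (1 / 2 : ℂ) • ((fun i => (pd 0 h z i : ℂ)) - Complex.I • fun i => (pd 1 h z i : ℂ)) := by
  funext i
  rw [dz_complexify S.smooth]
  rfl

theorem dz_dz_eq_pd (S : IsIsotropicSurface ε h e₁ e₂ α β) (z : ℂ) : dz (dz (complexify h)) z =
    (1 / 4 : ℂ) • ((fun i => ((pd 0 (pd 0 h) z i - pd 1 (pd 1 h) z i : ℝ) : ℂ)) -
      (2 * Complex.I) • fun i => (pd 0 (pd 1 h) z i : ℂ)) := by
  funext i
  rw [dz_dz_complexify S.smooth]
  rfl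

/-- The real form of `⟨½ (q - i r), ¼ (a - 2 i b)⟩ = 0`. -/
theorem _root_.WillmorePair.real_of_dotProduct_eq_zero {q r a b : Fin 5 → ℝ} {s t : ℂ}
    (hs : s ≠ 0) (ht : t ≠ 0) {k l : ℝ}
    (h : (s • ((fun i => (q i : ℂ)) - ((k : ℂ) * Complex.I) • fun i => (r i : ℂ))) ⬝ᵥ
      (t • ((fun i => (a i : ℂ)) - ((l : ℂ) * Complex.I) • fun i => (b i : ℂ))) = 0) :
    q ⬝ᵥ a = k * l * (r ⬝ᵥ b) ∧ l * (q ⬝ᵥ b) + k * (r ⬝ᵥ a) = 0 := by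
  simp only [smul_dotProduct, dotProduct_smul, sub_dotProduct, dotProduct_sub, ofReal_dotProduct,
    smul_eq_mul] at h
  have h1 := (mul_eq_zero.1 h).resolve_left ht
  have h2 : ((q ⬝ᵥ a : ℝ) : ℂ) - k * Complex.I * (r ⬝ᵥ a : ℝ) -
      l * Complex.I * ((q ⬝ᵥ b : ℝ) - k * Complex.I * (r ⬝ᵥ b : ℝ)) = 0 :=
    (mul_eq_zero.1 (show s * _ = 0 by linear_combination h1)).resolve_left hs
  have hre := congrArg Complex.re h2
  have him := congrArg Complex.im h2
  simp only [Complex.sub_re, Complex.sub_im, Complex.mul_re, Complex.mul_im, Complex.ofReal_re,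
    Complex.ofReal_im, Complex.I_re, Complex.I_im, Complex.zero_re, Complex.zero_im] at hre him
  constructor <;> linarith

theorem dotProduct_pd (S : IsIsotropicSurface ε h e₁ e₂ α β) (z : ℂ) :
    (pd 0 h z).ofLp ⬝ᵥ (pd 0 h z).ofLp = (pd 1 h z).ofLp ⬝ᵥ (pd 1 h z).ofLp ∧
      (pd 0 h z).ofLp ⬝ᵥ (pd 1 h z).ofLp = 0 := by
  have h0 : dz (complexify h) z ⬝ᵥ dz (complexify h) z = 0 := by
    rw [S.dz_h, S.combination_dotProduct]
  rw [S.dz_eq_pd, show Complex.I = ((1 : ℝ) : ℂ) * Complex.I by simp] at h0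
  obtain ⟨a, b⟩ := real_of_dotProduct_eq_zero (by norm_num) (by norm_num) h0
  rw [dotProduct_comm (pd 1 h z).ofLp (pd 0 h z).ofLp] at b
  exact ⟨by linarith, by linarith⟩

theorem dz_ne_zero (S : IsIsotropicSurface ε h e₁ e₂ α β) (z : ℂ) : dz (complexify h) z ≠ 0 := by
  rw [S.dz_h]
  exact S.combination_ne_zero z (S.ne_zero z)

theorem dotProduct_pd_pos (S : IsIsotropicSurface ε h e₁ e₂ α β) (z : ℂ) :
    0 < (pd 0 h z).ofLp ⬝ᵥ (pd 0 h z).ofLp := by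
  have hnn : 0 ≤ (pd 0 h z).ofLp ⬝ᵥ (pd 0 h z).ofLp := by
    rw [← inner_eq_dotProduct]
    exact real_inner_self_nonneg
  refine lt_of_le_of_ne hnn fun h0 => S.dz_ne_zero z ?_
  have h1 : pd 0 h z = 0 := by
    rw [← inner_eq_dotProduct] at h0
    exact inner_self_eq_zero.1 h0.symm
  have h2 : pd 1 h z = 0 := by
    rw [(S.dotProduct_pd z).1, ← inner_eq_dotProduct] at h0
    exact inner_self_eq_zero.1 h0.symm
  funext i
  rw [dz_complexify S.smooth, h1, h2]
  simp

theorem gram_pos (S : IsIsotropicSurface ε h e₁ e₂ α β) (z : ℂ) : 0 < gram h z := by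
  have := S.dotProduct_pd_pos z
  rw [gram, ← (S.dotProduct_pd z).1, (S.dotProduct_pd z).2]
  nlinarith

theorem conformalAt (S : IsIsotropicSurface ε h e₁ e₂ α β) (z : ℂ) : ConformalAt h z := by
  rw [conformalAt_iff']
  refine ⟨_, S.dotProduct_pd_pos z, fun u v => ?_⟩
  have e : ∀ v : ℂ, fderiv ℝ h z v = v.re • pd 0 h z + v.im • pd 1 h z := fun v => by
    have hv : v = v.re • (1 : ℂ) + v.im • Complex.I := by simp [Complex.re_add_im]
    conv_lhs => rw [hv, map_add, map_smul, map_smul]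
    rfl
  obtain ⟨h1, h2⟩ := S.dotProduct_pd z
  have h3 : (pd 1 h z).ofLp ⬝ᵥ (pd 0 h z).ofLp = 0 := by rw [dotProduct_comm, h2]
  rw [e, e, inner_eq_dotProduct]
  simp only [WithLp.ofLp_add, WithLp.ofLp_smul, add_dotProduct, dotProduct_add, smul_dotProduct,
    dotProduct_smul, h2, h3, ← h1, smul_eq_mul, Complex.inner, Complex.mul_re, Complex.conj_re,
    Complex.conj_im]
  ring

/-- The determinant which gives the sign of the normal curvature: expressed in the basis
`e₁, e₂, ē₁, ē₂, h`, it is a nonnegative multiple of the determinant of that basis. -/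
theorem det5_second_derivatives (S : IsIsotropicSurface ε h e₁ e₂ α β) (z : ℂ) :
    0 ≤ ε * det5 ((pd 0 (pd 0 h) z).ofLp - (pd 1 (pd 1 h) z).ofLp) (pd 0 (pd 1 h) z).ofLp
      (h z).ofLp (pd 0 h z).ofLp (pd 1 h z).ofLp := by
  obtain ⟨d, hd, hdet⟩ := S.det z
  set a := dz α z with ha
  set b := dz β z with hb
  have hx : ∀ i, (pd 0 (pd 0 h) z i : ℂ) - pd 1 (pd 1 h) z i - 2 * Complex.I * pd 0 (pd 1 h) z i =
      4 * (a * e₁ z i + b * e₂ z i) := fun i => by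
    have h1 := dz_dz_complexify S.smooth z i
    have h2 := congrFun (S.dz_dz_h z) i
    simp only [Pi.add_apply, Pi.smul_apply, smul_eq_mul] at h2
    rw [h2] at h1
    push_cast at h1
    linear_combination -4 * h1
  have hp : ∀ i, (pd 0 h z i : ℂ) - Complex.I * pd 1 h z i =
      2 * (α z * e₁ z i + β z * e₂ z i) := fun i => by
    have h1 := dz_complexify S.smooth z i
    have h2 := congrFun (S.dz_h z) i
    simp only [Pi.add_apply, Pi.smul_apply, smul_eq_mul] at h2
    rw [h2] at h1
    linear_combination -2 * h1
  have hx' : ∀ i, (pd 0 (pd 0 h) z i : ℂ) - pd 1 (pd 1 h) z i + 2 * Complex.I * pd 0 (pd 1 h) z i =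
      4 * (star a * star (e₁ z i) + star b * star (e₂ z i)) := fun i => by
    have := congrArg (starRingEnd ℂ) (hx i)
    simp only [map_sub, map_mul, map_add, Complex.conj_ofReal, Complex.conj_I, map_ofNat] at this
    simp only [RCLike.star_def]
    linear_combination this
  have hp' : ∀ i, (pd 0 h z i : ℂ) + Complex.I * pd 1 h z i =
      2 * (star (α z) * star (e₁ z i) + star (β z) * star (e₂ z i)) := fun i => by
    have := congrArg (starRingEnd ℂ) (hp i)
    simp only [map_sub, map_mul, map_add, Complex.conj_ofReal, Complex.conj_I, map_ofNat] at this
    simp only [RCLike.star_def]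
    linear_combination this
  have hmat : Matrix.of ![(fun i => (((pd 0 (pd 0 h) z).ofLp - (pd 1 (pd 1 h) z).ofLp) i : ℂ)),
      (fun i => (pd 0 (pd 1 h) z i : ℂ)), complexify h z, (fun i => (pd 0 h z i : ℂ)),
      (fun i => (pd 1 h z i : ℂ))] =
      !![2 * a, 2 * b, 2 * star a, 2 * star b, 0;
        Complex.I * a, Complex.I * b, -Complex.I * star a, -Complex.I * star b, 0;
        0, 0, 0, 0, 1;
        α z, β z, star (α z), star (β z), 0;
        Complex.I * α z, Complex.I * β z, -Complex.I * star (α z), -Complex.I * star (β z), 0] *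
      Matrix.of ![e₁ z, e₂ z, star (e₁ z), star (e₂ z), complexify h z] := by
    ext i j
    have k1 := hx j
    have k2 := hx' j
    have k3 := hp j
    have k4 := hp' j
    simp only [RCLike.star_def] at k2 k4
    fin_cases i
    · simp [Matrix.mul_apply, Fin.sum_univ_succ]
      linear_combination (1 / 2) * k1 + (1 / 2) * k2
    · simp [Matrix.mul_apply, Fin.sum_univ_succ]
      linear_combination (Complex.I / 4) * k1 - (Complex.I / 4) * k2 +
        (pd 0 (pd 1 h) z j : ℂ) * Complex.I_sq
    · simp [Matrix.mul_apply, Fin.sum_univ_succ]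
    · simp [Matrix.mul_apply, Fin.sum_univ_succ]
      linear_combination (1 / 2) * k3 + (1 / 2) * k4
    · simp [Matrix.mul_apply, Fin.sum_univ_succ]
      linear_combination (Complex.I / 2) * k3 - (Complex.I / 2) * k4 +
        (pd 1 h z j : ℂ) * Complex.I_sq
  have hM : (!![2 * a, 2 * b, 2 * star a, 2 * star b, 0;
        Complex.I * a, Complex.I * b, -Complex.I * star a, -Complex.I * star b, 0;
        0, 0, 0, 0, 1;
        α z, β z, star (α z), star (β z), 0;
        Complex.I * α z, Complex.I * β z, -Complex.I * star (α z), -Complex.I * star (β z), 0] :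
        Matrix (Fin 5) (Fin 5) ℂ).det = ((8 * Complex.normSq (a * β z - b * α z) : ℝ) : ℂ) := by
    push_cast
    rw [Complex.normSq_eq_conj_mul_self]
    simp [Matrix.det_succ_row_zero, Fin.sum_univ_succ, Fin.succAbove]
    ring_nf
    rw [Complex.I_sq]
    ring
  have hreal : det5 ((pd 0 (pd 0 h) z).ofLp - (pd 1 (pd 1 h) z).ofLp) (pd 0 (pd 1 h) z).ofLp
      (h z).ofLp (pd 0 h z).ofLp (pd 1 h z).ofLp = 8 * Complex.normSq (a * β z - b * α z) * d := by
    have h1 := ofReal_det5 ((pd 0 (pd 0 h) z).ofLp - (pd 1 (pd 1 h) z).ofLp) (pd 0 (pd 1 h) z).ofLp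
      (h z).ofLp (pd 0 h z).ofLp (pd 1 h z).ofLp
    have h2 := congrArg Matrix.det hmat
    rw [Matrix.det_mul, hM] at h2
    rw [det5] at hdet
    rw [hdet] at h2
    rw [det5] at h1
    exact_mod_cast h1.trans h2
  rw [hreal]
  have := Complex.normSq_nonneg (a * β z - b * α z)
  have : 0 ≤ 8 * Complex.normSq (a * β z - b * α z) * (ε * d) := by positivity
  linarith

theorem willmoreDensity_eq (S : IsIsotropicSurface ε h e₁ e₂ α β) (hε : ε ^ 2 = 1) (z : ℂ) :
    willmoreDensity h z = ε * curvatureForm (normalRotation h) 1 Complex.I z := by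
  obtain ⟨hEG, hF⟩ := S.dotProduct_pd z
  refine willmoreDensity_eq_curvatureForm S.smooth S.norm (S.gram_pos z) hF hEG ?_ hε
    (S.det5_second_derivatives z)
  intro n m hf
  have hE := (S.dotProduct_pd_pos z).ne'
  set a : Fin 5 → ℝ := (pd 0 (pd 0 h) z).ofLp - (pd 1 (pd 1 h) z).ofLp with ha
  set b : Fin 5 → ℝ := (pd 0 (pd 1 h) z).ofLp with hb
  set p : Fin 5 → ℝ := (h z).ofLp with hp
  set q : Fin 5 → ℝ := (pd 0 h z).ofLp with hq
  set r : Fin 5 → ℝ := (pd 1 h z).ofLp with hr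
  -- the second derivative `h_zz = ¼ (a - 2 i b)` is isotropic and orthogonal to `h` and `h_z`
  have hxx : dz (dz (complexify h)) z ⬝ᵥ dz (dz (complexify h)) z = 0 := by
    rw [S.dz_dz_h, S.combination_dotProduct]
  have hpx : dz (complexify h) z ⬝ᵥ dz (dz (complexify h)) z = 0 := by
    rw [S.dz_dz_h, S.dz_h, S.combination_dotProduct]
  have hhx : complexify h z ⬝ᵥ dz (dz (complexify h)) z = 0 := by
    rw [dotProduct_comm, S.dz_dz_h, S.combination_dotProduct_self]
  have e2 : dz (dz (complexify h)) z = (1 / 4 : ℂ) • ((fun i => (a i : ℂ)) -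
      (((2 : ℝ) : ℂ) * Complex.I) • fun i => (b i : ℂ)) := by
    rw [S.dz_dz_eq_pd]
    simp [ha, hb]
  have e1 : dz (complexify h) z = (1 / 2 : ℂ) • ((fun i => (q i : ℂ)) -
      (((1 : ℝ) : ℂ) * Complex.I) • fun i => (r i : ℂ)) := by
    rw [S.dz_eq_pd]
    simp [hq, hr]
  have e0 : complexify h z = (1 : ℂ) • ((fun i => (p i : ℂ)) -
      (((0 : ℝ) : ℂ) * Complex.I) • fun i => (p i : ℂ)) := by
    funext i
    simp [hp, complexify]
  rw [e2] at hxx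
  rw [e1, e2] at hpx
  rw [e0, e2] at hhx
  obtain ⟨x1, x2⟩ := real_of_dotProduct_eq_zero (by norm_num) (by norm_num) hxx
  obtain ⟨p1, p2⟩ := real_of_dotProduct_eq_zero (by norm_num) (by norm_num) hpx
  obtain ⟨h1, h2⟩ := real_of_dotProduct_eq_zero (by norm_num) (by norm_num) hhx
  have hc : ∀ x y : Fin 5 → ℝ, x ⬝ᵥ y = (n ⬝ᵥ x) * (n ⬝ᵥ y) + (m ⬝ᵥ x) * (m ⬝ᵥ y) +
      (p ⬝ᵥ x) * (p ⬝ᵥ y) + (q ⬝ᵥ q)⁻¹ * ((q ⬝ᵥ x) * (q ⬝ᵥ y) + (r ⬝ᵥ x) * (r ⬝ᵥ y)) := by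
    intro x y
    have h := congrArg (fun v => x ⬝ᵥ v) (hf.complete y)
    simp only [dotProduct_add, dotProduct_smul, smul_eq_mul, hF, ← hEG] at h
    rw [h, dotProduct_comm x n, dotProduct_comm x m, dotProduct_comm x p, dotProduct_comm x q,
      dotProduct_comm x r]
    field_simp
    ring
  have caa := hc a a
  have cbb := hc b b
  have cab := hc a b
  have hba : b ⬝ᵥ a = a ⬝ᵥ b := dotProduct_comm _ _
  have h3 : p ⬝ᵥ b = 0 := by linarith
  have h4 : p ⬝ᵥ a = 0 := by linarith
  have r1 : (n ⬝ᵥ a) ^ 2 + (m ⬝ᵥ a) ^ 2 = 4 * ((n ⬝ᵥ b) ^ 2 + (m ⬝ᵥ b) ^ 2) := by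
    have p3 : r ⬝ᵥ a = -2 * (q ⬝ᵥ b) := by linarith
    have p4 : q ⬝ᵥ a = 2 * (r ⬝ᵥ b) := by linarith
    rw [h3] at cbb
    rw [h4, p3, p4] at caa
    linear_combination -caa + 4 * cbb + x1
  have r2 : (n ⬝ᵥ a) * (n ⬝ᵥ b) + (m ⬝ᵥ a) * (m ⬝ᵥ b) = 0 := by
    have p3 : r ⬝ᵥ a = -2 * (q ⬝ᵥ b) := by linarith
    have p4 : q ⬝ᵥ a = 2 * (r ⬝ᵥ b) := by linarith
    rw [h3, p3, p4] at cab
    linear_combination -cab + (1 / 4) * x2 - (1 / 2) * hba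
  rw [← dotProduct_sub, ← dotProduct_sub, ← ha]
  have r1' : ((n ⬝ᵥ a : ℝ) : ℂ) ^ 2 + ((m ⬝ᵥ a : ℝ) : ℂ) ^ 2 =
      4 * (((n ⬝ᵥ b : ℝ) : ℂ) ^ 2 + ((m ⬝ᵥ b : ℝ) : ℂ) ^ 2) := by exact_mod_cast r1
  have r2' : ((n ⬝ᵥ a : ℝ) : ℂ) * ((n ⬝ᵥ b : ℝ) : ℂ) + ((m ⬝ᵥ a : ℝ) : ℂ) * ((m ⬝ᵥ b : ℝ) : ℂ) = 0
      := by
    exact_mod_cast r2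
  linear_combination r1' - 4 * Complex.I * r2' +
    4 * (((n ⬝ᵥ b : ℝ) : ℂ) ^ 2 + ((m ⬝ᵥ b : ℝ) : ℂ) ^ 2) * Complex.I_sq

end IsIsotropicSurface

end

section

/-! ### The complex Minkowski product -/

section Mink

variable {n : ℕ} {R : Type*} [CommRing R] (x y w : Fin (n + 1) → R) (c : R)

theorem mink_comm : mink x y = mink y x := by
  simp only [mink, mul_comm]

theorem mink_add_left : mink (x + y) w = mink x w + mink y w := by
  simp only [mink, Pi.add_apply, add_mul, Finset.sum_add_distrib]
  ring

theorem mink_smul_left : mink (c • x) y = c * mink x y := by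
  simp only [mink, Pi.smul_apply, smul_eq_mul, mul_add, Finset.mul_sum, mul_assoc]
  ring

theorem mink_add_right : mink x (y + w) = mink x y + mink x w := by
  rw [mink_comm, mink_add_left, mink_comm y, mink_comm w]

theorem mink_smul_right : mink x (c • y) = c * mink x y := by
  rw [mink_comm, mink_smul_left, mink_comm]

theorem mink_sub_left : mink (x - y) w = mink x w - mink y w := by
  rw [sub_eq_add_neg, ← neg_one_smul R y, mink_add_left, mink_smul_left]
  ring

theorem mink_sub_right : mink x (y - w) = mink x y - mink x w := by
  rw [mink_comm, mink_sub_left, mink_comm y, mink_comm w]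

theorem mink_cons (a b : R) (u v : Fin n → R) :
    mink (Fin.cons a u : Fin (n + 1) → R) (Fin.cons b v) = -(a * b) + u ⬝ᵥ v := rfl

/-- The Minkowski product is nondegenerate. -/
theorem eq_zero_of_mink_eq_zero {x : Fin (n + 1) → R} (h : ∀ y, mink x y = 0) : x = 0 := by
  funext i
  induction i using Fin.cases with
  | zero => simpa [mink] using h (Pi.single 0 1)
  | succ i => simpa [mink, Pi.single_apply, Fin.succ_inj] using h (Pi.single i.succ 1)

/-- Orthogonality to a subspace can be tested on generators. -/
theorem forall_mem_span_mink_eq_zero_iff (s : Set (Fin (n + 1) → R)) :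
    (∀ v ∈ Submodule.span R s, mink x v = 0) ↔ ∀ v ∈ s, mink x v = 0 := by
  refine ⟨fun h v hv => h v (Submodule.subset_span hv), fun h v hv => ?_⟩
  induction hv using Submodule.span_induction with
  | mem v hv => exact h v hv
  | zero => simp [mink]
  | add u v _ _ hu hv => rw [mink_add_right, hu, hv, add_zero]
  | smul c v _ hv => rw [mink_smul_right, hv, mul_zero]

end Mink

theorem mink_star {n : ℕ} (x y : Fin (n + 1) → ℂ) : mink (star x) (star y) = star (mink x y) := by
  simp [mink]

/-- Six vectors `Y, Y₁, Y₂, Y₃, E, E'` of `ℂ⁶` with the products of the frame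
`Y, Y_z, Y_z̄, Y_zz̄, E, Ē` are not orthogonal to a nonzero vector. -/
theorem eq_zero_of_orthogonal_frame {Y Y₁ Y₂ Y₃ E E' x : Fin 6 → ℂ} {g p : ℂ} (hg : g ≠ 0)
    (h00 : mink Y Y = 0) (h01 : mink Y Y₁ = 0) (h02 : mink Y Y₂ = 0) (h03 : mink Y Y₃ = -g)
    (h11 : mink Y₁ Y₁ = 0) (h12 : mink Y₁ Y₂ = g) (h13 : mink Y₁ Y₃ = 0) (h22 : mink Y₂ Y₂ = 0)
    (h23 : mink Y₂ Y₃ = 0) (h33 : mink Y₃ Y₃ = p) (h0 : mink E Y = 0) (h1 : mink E Y₁ = 0)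
    (h2 : mink E Y₂ = 0) (h3 : mink E Y₃ = 0) (h0' : mink E' Y = 0) (h1' : mink E' Y₁ = 0)
    (h2' : mink E' Y₂ = 0) (h3' : mink E' Y₃ = 0) (hE : mink E E = 0) (hEE : mink E E' = 2)
    (hE' : mink E' E' = 0) (x0 : mink x Y = 0) (x1 : mink x Y₁ = 0) (x2 : mink x Y₂ = 0)
    (x3 : mink x Y₃ = 0) (xE : mink x E = 0) (xE' : mink x E' = 0) : x = 0 := by
  have hli : LinearIndependent ℂ ![Y, Y₁, Y₂, Y₃, E, E'] := by
    rw [Fintype.linearIndependent_iff]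
    intro c hc
    have key : ∀ v, c 0 * mink Y v + c 1 * mink Y₁ v + c 2 * mink Y₂ v + c 3 * mink Y₃ v +
        c 4 * mink E v + c 5 * mink E' v = 0 := fun v => by
      have := congrArg (fun u => mink u v) hc
      simp only [Fin.sum_univ_six, mink_add_left, mink_smul_left] at this
      simpa [mink] using this
    have k0 := key Y
    have k1 := key Y₁
    have k2 := key Y₂
    have k3 := key Y₃
    have k4 := key E
    have k5 := key E'
    simp only [h00, h01, h02, h03, h11, h12, h13, h22, h23, h33, h0, h1, h2, h3, h0', h1', h2', h3',
      hE, hEE, hE', mink_comm Y₁ Y, mink_comm Y₂ Y, mink_comm Y₃ Y, mink_comm Y₂ Y₁,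
      mink_comm Y₃ Y₁, mink_comm Y₃ Y₂, mink_comm Y E, mink_comm Y₁ E, mink_comm Y₂ E,
      mink_comm Y₃ E, mink_comm Y E', mink_comm Y₁ E', mink_comm Y₂ E', mink_comm Y₃ E',
      mink_comm E' E, mul_zero, add_zero, zero_add] at k0 k1 k2 k3 k4 k5
    have c3 : c 3 = 0 := by simpa [hg] using k0
    have c2 : c 2 = 0 := by simpa [hg] using k1
    have c1 : c 1 = 0 := by simpa [hg] using k2
    have c0 : c 0 = 0 := by simpa [hg, c3] using k3
    have c5 : c 5 = 0 := by simpa using k4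
    have c4 : c 4 = 0 := by simpa using k5
    intro i
    fin_cases i <;> assumption
  have hspan := hli.span_eq_top_of_card_eq_finrank' (by simp)
  refine eq_zero_of_mink_eq_zero fun v => ?_
  refine (forall_mem_span_mink_eq_zero_iff x (Set.range ![Y, Y₁, Y₂, Y₃, E, E'])).2 ?_ v
    (hspan ▸ Submodule.mem_top)
  rintro _ ⟨i, rfl⟩
  fin_cases i <;> assumption

theorem HasWirtingerAt.dotProduct {n : ℕ} {f g : ℂ → Fin n → ℂ} {a b a' b' : Fin n → ℂ} {z : ℂ}
    (hf : HasWirtingerAt f a b z) (hg : HasWirtingerAt g a' b' z) :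
    HasWirtingerAt (fun w => f w ⬝ᵥ g w) (a ⬝ᵥ g z + f z ⬝ᵥ a') (b ⬝ᵥ g z + f z ⬝ᵥ b') z := by
  have h := fun i => ((hasWirtingerAt_pi.1 hf) i).mul ((hasWirtingerAt_pi.1 hg) i)
  refine (HasFDerivAt.fun_sum fun i (_ : i ∈ Finset.univ) => h i).congr_fderiv
    (ContinuousLinearMap.ext fun v => ?_)
  simp only [sum_apply, wirtingerMap_apply, _root_.dotProduct, smul_eq_mul,
    Finset.mul_sum, ← Finset.sum_add_distrib]

theorem HasWirtingerAt.mink {n : ℕ} {f g : ℂ → Fin (n + 1) → ℂ} {a b a' b' : Fin (n + 1) → ℂ}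
    {z : ℂ} (hf : HasWirtingerAt f a b z) (hg : HasWirtingerAt g a' b' z) :
    HasWirtingerAt (fun w => mink (f w) (g w)) (WillmorePair.mink a (g z) +
      WillmorePair.mink (f z) a') (WillmorePair.mink b (g z) + WillmorePair.mink (f z) b') z := by
  have hf' := hasWirtingerAt_pi.1 hf
  have hg' := hasWirtingerAt_pi.1 hg
  have h := (((hf' 0).mul (hg' 0)).neg).add
    ((hasWirtingerAt_pi.2 fun i : Fin n => hf' i.succ).dotProduct
      (hasWirtingerAt_pi.2 fun i : Fin n => hg' i.succ))
  refine h.congr ?_ ?_ <;> simp only [WillmorePair.mink, _root_.dotProduct] <;> ring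

/-- A map `(a, f)` into `ℂⁿ⁺¹`. -/
theorem HasWirtingerAt.cons {n : ℕ} {c : ℂ → ℂ} {f : ℂ → Fin n → ℂ} {s t : ℂ} {a b : Fin n → ℂ}
    {z : ℂ} (hc : HasWirtingerAt c s t z) (hf : HasWirtingerAt f a b z) :
    HasWirtingerAt (fun w => (Fin.cons (c w) (f w) : Fin (n + 1) → ℂ)) (Fin.cons s a)
      (Fin.cons t b) z := by
  refine hasWirtingerAt_pi.2 fun i => ?_
  induction i using Fin.cases with
  | zero => exact hc
  | succ i => exact hasWirtingerAt_pi.1 hf i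

theorem complexLift_eq {n : ℕ} (h : ℂ → EuclideanSpace ℝ (Fin n)) :
    complexLift h = fun z => Fin.cons 1 (complexify h z) := by
  funext z i
  induction i using Fin.cases with
  | zero => simp [complexLift, coneLift]
  | succ i => simp [complexLift, coneLift, complexify]

theorem contDiff_cons {n : ℕ} {c : ℂ → ℂ} {f : ℂ → Fin n → ℂ} (hc : ContDiff ℝ ∞ c)
    (hf : ContDiff ℝ ∞ f) : ContDiff ℝ ∞ fun w => (Fin.cons (c w) (f w) : Fin (n + 1) → ℂ) := by
  refine contDiff_pi.2 fun i => ?_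
  induction i using Fin.cases with
  | zero => exact hc
  | succ i => exact contDiff_pi.1 hf i

theorem contDiff_complexLift {n : ℕ} {h : ℂ → EuclideanSpace ℝ (Fin n)} (hs : ContDiff ℝ ∞ h) :
    ContDiff ℝ ∞ (complexLift h) := by
  rw [complexLift_eq]
  exact contDiff_cons contDiff_const (contDiff_complexify hs)

theorem dz_complexLift {n : ℕ} {h : ℂ → EuclideanSpace ℝ (Fin n)} (hs : ContDiff ℝ ∞ h) (z : ℂ) :
    dz (complexLift h) z = Fin.cons 0 (dz (complexify h) z) := by
  rw [complexLift_eq]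
  exact ((hasWirtingerAt_const 1 z).cons (hasWirtingerAt_of_differentiableAt
    ((contDiff_complexify hs).differentiable (by simp) z))).dz_eq

theorem dzbar_complexLift {n : ℕ} {h : ℂ → EuclideanSpace ℝ (Fin n)} (hs : ContDiff ℝ ∞ h)
    (z : ℂ) : dzbar (complexLift h) z = Fin.cons 0 (dzbar (complexify h) z) := by
  rw [complexLift_eq]
  exact ((hasWirtingerAt_const 1 z).cons (hasWirtingerAt_of_differentiableAt
    ((contDiff_complexify hs).differentiable (by simp) z))).dzbar_eq

/-- The squared Hermitian norm of a complex vector. -/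
noncomputable def sqNorm {n : ℕ} (v : Fin n → ℂ) : ℝ := ∑ i, Complex.normSq (v i)

theorem dotProduct_star_self_eq_sqNorm {n : ℕ} (v : Fin n → ℂ) : v ⬝ᵥ star v = (sqNorm v : ℂ) := by
  simp [sqNorm, dotProduct, Complex.mul_conj]

theorem sqNorm_pos {n : ℕ} {v : Fin n → ℂ} (h : v ≠ 0) : 0 < sqNorm v := by
  obtain ⟨i, hi⟩ := Function.ne_iff.1 h
  exact Finset.sum_pos' (fun _ _ => Complex.normSq_nonneg _)
    ⟨i, Finset.mem_univ i, Complex.normSq_pos.2 hi⟩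

theorem contDiff_sqNorm {n : ℕ} {f : ℂ → Fin n → ℂ} (hf : ContDiff ℝ ∞ f) :
    ContDiff ℝ ∞ fun z => sqNorm (f z) := by
  refine ContDiff.sum fun i _ => ?_
  have h := contDiff_pi.1 hf i
  simp only [Complex.normSq_apply]
  exact ((Complex.reCLM.contDiff.comp h).mul (Complex.reCLM.contDiff.comp h)).add
    ((Complex.imCLM.contDiff.comp h).mul (Complex.imCLM.contDiff.comp h))

theorem contDiff_dotProduct {n : ℕ} {f g : ℂ → Fin n → ℂ} (hf : ContDiff ℝ ∞ f)
    (hg : ContDiff ℝ ∞ g) : ContDiff ℝ ∞ fun z => f z ⬝ᵥ g z :=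
  ContDiff.sum fun i _ => (contDiff_pi.1 hf i).mul (contDiff_pi.1 hg i)

theorem contDiff_star {n : ℕ} {f : ℂ → Fin n → ℂ} (hf : ContDiff ℝ ∞ f) :
    ContDiff ℝ ∞ fun z => star (f z) :=
  contDiff_pi.2 fun i => (Complex.conjCLE : ℂ →L[ℝ] ℂ).contDiff.comp (contDiff_pi.1 hf i)

theorem dzbar_dz_complexify {n : ℕ} {h : ℂ → EuclideanSpace ℝ (Fin n)} (hs : ContDiff ℝ ∞ h) (z : ℂ)
    (i : Fin n) : dzbar (dz (complexify h)) z i =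
      ((1 / 4 * (pd 0 (pd 0 h) z i + pd 1 (pd 1 h) z i) : ℝ) : ℂ) := by
  have e : dz (complexify h) = fun z i =>
      1 / 2 * (complexify (pd 0 h) z i - Complex.I * complexify (pd 1 h) z i) := by
    funext z i
    exact dz_complexify hs z i
  have h0 := hasWirtingerAt_pi.1 (hasWirtingerAt_complexify
    ((contDiff_pd hs 0).differentiable (by simp) z)) i
  have h1 := hasWirtingerAt_pi.1 (hasWirtingerAt_complexify
    ((contDiff_pd hs 1).differentiable (by simp) z)) i
  have h2 := (hasWirtingerAt_const (1 / 2 : ℂ) z).mul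
    (h0.sub ((hasWirtingerAt_const Complex.I z).mul h1))
  have hd : DifferentiableAt ℝ (dz (complexify h)) z :=
    (contDiff_dz (contDiff_complexify hs)).differentiable (by simp) z
  rw [dzbar_apply hd, e, h2.dzbar_eq, pd_comm hs z 1 0]
  push_cast
  linear_combination (-(1 / 4) * (pd 1 (pd 1 h) z i : ℂ)) * Complex.I_sq

end

section

namespace IsIsotropicSurface

variable {ε : ℝ} {h : ℂ → EuclideanSpace ℝ (Fin 5)} {e₁ e₂ : ℂ → Fin 5 → ℂ} {α β : ℂ → ℂ}

theorem contDiff_iterate_dz {f : ℂ → ℂ} (hf : ContDiff ℝ ∞ f) (j : ℕ) : ContDiff ℝ ∞ (dz^[j] f) :=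
    by
  induction j with
  | zero => exact hf
  | succ j ih =>
    rw [Function.iterate_succ_apply']
    exact contDiff_dz ih

/-- As `e₁` and `e₂` are antiholomorphic, all `z`-derivatives of the surface are sections of the
isotropic plane. -/
theorem iterate_dz_complexLift (S : IsIsotropicSurface ε h e₁ e₂ α β) (j : ℕ) :
    dz^[j + 1] (complexLift h) = fun z =>
      Fin.cons 0 (dz^[j] α z • e₁ z + dz^[j] β z • e₂ z) := by
  induction j with
  | zero =>
    funext z
    rw [zero_add, Function.iterate_one, dz_complexLift S.smooth, S.dz_h]
    rfl
  | succ j ih =>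
    funext z
    have ha := contDiff_iterate_dz S.smooth_α j
    have hb := contDiff_iterate_dz S.smooth_β j
    rw [Function.iterate_succ_apply', ih, Function.iterate_succ_apply',
        Function.iterate_succ_apply',
      ← S.dz_combination (ha.differentiable (by simp) z) (hb.differentiable (by simp) z)]
    exact ((hasWirtingerAt_const 0 z).cons (hasWirtingerAt_of_differentiableAt
      (((ha.smul S.smooth_e₁).add (hb.smul S.smooth_e₂)).differentiable (by simp) z))).dz_eq

/-- The conformal factor `⟨h_z, h_z̄⟩` is positive. -/
theorem sqNorm_dz_pos (S : IsIsotropicSurface ε h e₁ e₂ α β) (z : ℂ) :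
    0 < sqNorm (dz (complexify h) z) := sqNorm_pos (S.dz_ne_zero z)

/-- The products of `h_zz̄` with `h`, `h_z` and `h_z̄`. -/
theorem dotProduct_dzbar_dz (S : IsIsotropicSurface ε h e₁ e₂ α β) (z : ℂ) :
    complexify h z ⬝ᵥ dzbar (dz (complexify h)) z = -(sqNorm (dz (complexify h) z) : ℂ) ∧
      dz (complexify h) z ⬝ᵥ dzbar (dz (complexify h)) z = 0 ∧
      star (dz (complexify h) z) ⬝ᵥ dzbar (dz (complexify h)) z = 0 := by
  have hc := contDiff_complexify S.smooth
  have w := hasWirtingerAt_of_differentiableAt (hc.differentiable (by simp) z)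
  have w' := hasWirtingerAt_of_differentiableAt ((contDiff_dz hc).differentiable (by simp) z)
  have h1 : dz (complexify h) z ⬝ᵥ dzbar (dz (complexify h)) z = 0 := by
    have e : (fun w => dz (complexify h) w ⬝ᵥ dz (complexify h) w) = fun _ => 0 := by
      funext w
      rw [S.dz_h, S.combination_dotProduct]
    have k := (w'.dotProduct w').dzbar_eq
    rw [e, (hasWirtingerAt_const 0 z).dzbar_eq, dotProduct_comm (dzbar _ _)] at k
    linear_combination -(1 / 2 : ℂ) * k
  refine ⟨?_, h1, ?_⟩
  · have e : (fun w => complexify h w ⬝ᵥ dz (complexify h) w) = fun _ => 0 := by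
      funext w
      rw [dotProduct_comm, S.dz_h, S.combination_dotProduct_self]
    have k := (w.dotProduct w').dzbar_eq
    rw [e, (hasWirtingerAt_const 0 z).dzbar_eq, dzbar_complexify S.smooth, dotProduct_comm (star _),
      dotProduct_star_self_eq_sqNorm] at k
    linear_combination -k
  · have hr : star (dzbar (dz (complexify h)) z) = dzbar (dz (complexify h)) z := by
      funext i
      rw [Pi.star_apply, dzbar_dz_complexify S.smooth, RCLike.star_def, Complex.conj_ofReal]
    have k := congrArg star h1
    rw [← hr]
    simpa [dotProduct, mul_comm] using k

/-- The section `e = A e₁ - B e₂` of the isotropic plane which is orthogonal to `h_z̄`, where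
`A = ⟨e₂, h_z̄⟩` and `B = ⟨e₁, h_z̄⟩`. -/
noncomputable def normalPart (h : ℂ → EuclideanSpace ℝ (Fin 5)) (e₁ e₂ : ℂ → Fin 5 → ℂ) (z : ℂ) :
    Fin 5 → ℂ :=
  (e₂ z ⬝ᵥ star (dz (complexify h) z)) • e₁ z - (e₁ z ⬝ᵥ star (dz (complexify h) z)) • e₂ z

theorem normalPart_eq (z : ℂ) : normalPart h e₁ e₂ z =
    (e₂ z ⬝ᵥ star (dz (complexify h) z)) • e₁ z +
      (-(e₁ z ⬝ᵥ star (dz (complexify h) z))) • e₂ z := by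
  rw [normalPart, neg_smul, sub_eq_add_neg]

theorem contDiff_normalPart (S : IsIsotropicSurface ε h e₁ e₂ α β) :
    ContDiff ℝ ∞ (normalPart h e₁ e₂) := by
  have hz := contDiff_star (contDiff_dz (contDiff_complexify S.smooth))
  exact ((contDiff_dotProduct S.smooth_e₂ hz).smul S.smooth_e₁).sub
    ((contDiff_dotProduct S.smooth_e₁ hz).smul S.smooth_e₂)

theorem sqNorm_dz_eq (S : IsIsotropicSurface ε h e₁ e₂ α β) (z : ℂ) :
    (sqNorm (dz (complexify h) z) : ℂ) = α z * (e₁ z ⬝ᵥ star (dz (complexify h) z)) +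
      β z * (e₂ z ⬝ᵥ star (dz (complexify h) z)) := by
  rw [← dotProduct_star_self_eq_sqNorm]
  nth_rewrite 1 [S.dz_h]
  simp [add_dotProduct]

theorem normalPart_ne_zero (S : IsIsotropicSurface ε h e₁ e₂ α β) (z : ℂ) :
    normalPart h e₁ e₂ z ≠ 0 := by
  rw [normalPart_eq]
  refine S.combination_ne_zero z ?_
  by_contra! hc
  have := S.sqNorm_dz_eq z
  rw [hc.1, neg_eq_zero.1 hc.2, mul_zero, mul_zero, add_zero] at this
  exact (S.sqNorm_dz_pos z).ne' (by exact_mod_cast this)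

theorem normalPart_dotProduct_star_dz (z : ℂ) :
    normalPart h e₁ e₂ z ⬝ᵥ star (dz (complexify h) z) = 0 := by
  simp only [normalPart, sub_dotProduct, smul_dotProduct, smul_eq_mul]
  ring

/-- The coefficient `τ` for which `(0, e) + τ (1, h)` is orthogonal to `(1, h)_zz̄`. -/
noncomputable def normalShift (h : ℂ → EuclideanSpace ℝ (Fin 5)) (e₁ e₂ : ℂ → Fin 5 → ℂ) (z : ℂ) :
    ℂ :=
  (normalPart h e₁ e₂ z ⬝ᵥ dzbar (dz (complexify h)) z) * ((sqNorm (dz (complexify h) z))⁻¹ : ℝ)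

/-- The isotropic section `E₁` of the bundle `V`, proportional to `Y_z`. -/
noncomputable def tangentFrame (h : ℂ → EuclideanSpace ℝ (Fin 5)) (z : ℂ) : Fin 6 → ℂ :=
  ((√2 * (√(sqNorm (dz (complexify h) z)))⁻¹ : ℝ) : ℂ) • Fin.cons 0 (dz (complexify h) z)

/-- The isotropic section `E₂` of the conformal normal bundle. -/
noncomputable def normalFrame (h : ℂ → EuclideanSpace ℝ (Fin 5)) (e₁ e₂ : ℂ → Fin 5 → ℂ) (z : ℂ) :
    Fin 6 → ℂ :=
  ((√2 * (√(sqNorm (normalPart h e₁ e₂ z)))⁻¹ : ℝ) : ℂ) •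
    Fin.cons (normalShift h e₁ e₂ z)
      (normalPart h e₁ e₂ z + normalShift h e₁ e₂ z • complexify h z)

theorem contDiff_unitFactor {f : ℂ → ℝ} (hf : ContDiff ℝ ∞ f) (h0 : ∀ z, 0 < f z) :
    ContDiff ℝ ∞ fun z => ((√2 * (√(f z))⁻¹ : ℝ) : ℂ) :=
  Complex.ofRealCLM.contDiff.comp (contDiff_const.mul
    ((hf.sqrt fun z => (h0 z).ne').inv fun z => (Real.sqrt_pos.2 (h0 z)).ne'))

theorem contDiff_tangentFrame (S : IsIsotropicSurface ε h e₁ e₂ α β) :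
    ContDiff ℝ ∞ (tangentFrame h) :=
  (contDiff_unitFactor (contDiff_sqNorm (contDiff_dz (contDiff_complexify S.smooth)))
    S.sqNorm_dz_pos).smul (contDiff_cons contDiff_const (contDiff_dz (contDiff_complexify
        S.smooth)))

theorem contDiff_normalShift (S : IsIsotropicSurface ε h e₁ e₂ α β) :
    ContDiff ℝ ∞ (normalShift h e₁ e₂) := by
  have hz := contDiff_dz (contDiff_complexify S.smooth)
  exact (contDiff_dotProduct S.contDiff_normalPart (contDiff_dzbar hz)).mul
    (Complex.ofRealCLM.contDiff.comp ((contDiff_sqNorm hz).inv fun z => (S.sqNorm_dz_pos z).ne'))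

theorem contDiff_normalFrame (S : IsIsotropicSurface ε h e₁ e₂ α β) :
    ContDiff ℝ ∞ (normalFrame h e₁ e₂) :=
  (contDiff_unitFactor (contDiff_sqNorm S.contDiff_normalPart)
    fun z => sqNorm_pos (S.normalPart_ne_zero z)).smul
    (contDiff_cons S.contDiff_normalShift
      (S.contDiff_normalPart.add (S.contDiff_normalShift.smul (contDiff_complexify S.smooth))))

theorem unitFactor_sq {r : ℝ} (hr : 0 < r) :
    ((√2 * (√r)⁻¹ : ℝ) : ℂ) * ((√2 * (√r)⁻¹ : ℝ) : ℂ) * r = 2 := by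
  have h2 : √2 * √2 = 2 := Real.mul_self_sqrt (by norm_num)
  have h3 : √r * √r = r := Real.mul_self_sqrt hr.le
  have h4 : √r ≠ 0 := (Real.sqrt_pos.2 hr).ne'
  rw [← Complex.ofReal_mul, ← Complex.ofReal_mul]
  have : √2 * (√r)⁻¹ * (√2 * (√r)⁻¹) * r = 2 := by
    nth_rewrite 3 [← h3]
    field_simp
    nlinarith
  rw [this]
  simp

theorem unitFactor_ne_zero {r : ℝ} (hr : 0 < r) : ((√2 * (√r)⁻¹ : ℝ) : ℂ) ≠ 0 := by
  have h4 : 0 < √r := Real.sqrt_pos.2 hr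
  have : 0 < √2 * (√r)⁻¹ := by positivity
  exact_mod_cast this.ne'

theorem star_cons (a : ℂ) (u : Fin 5 → ℂ) :
    star (Fin.cons a u : Fin 6 → ℂ) = Fin.cons (star a) (star u) := by
  funext i
  induction i using Fin.cases <;> rfl

/-- All products of the frame `Y, Y_z, Y_z̄, Y_zz̄, E₂, Ē₂` of `ℂ⁶`. -/
structure FrameProducts (h : ℂ → EuclideanSpace ℝ (Fin 5)) (E : Fin 6 → ℂ) (z : ℂ) : Prop where
  h00 : mink (complexLift h z) (complexLift h z) = 0
  h01 : mink (complexLift h z) (dz (complexLift h) z) = 0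
  h02 : mink (complexLift h z) (dzbar (complexLift h) z) = 0
  h03 : mink (complexLift h z) (dzbar (dz (complexLift h)) z) = -(sqNorm (dz (complexify h) z) : ℂ)
  h11 : mink (dz (complexLift h) z) (dz (complexLift h) z) = 0
  h12 : mink (dz (complexLift h) z) (dzbar (complexLift h) z) = (sqNorm (dz (complexify h) z) : ℂ)
  h13 : mink (dz (complexLift h) z) (dzbar (dz (complexLift h)) z) = 0
  h22 : mink (dzbar (complexLift h) z) (dzbar (complexLift h) z) = 0
  h23 : mink (dzbar (complexLift h) z) (dzbar (dz (complexLift h)) z) = 0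
  h0 : mink E (complexLift h z) = 0
  h1 : mink E (dz (complexLift h) z) = 0
  h2 : mink E (dzbar (complexLift h) z) = 0
  h3 : mink E (dzbar (dz (complexLift h)) z) = 0
  hE : mink E E = 0
  hEE : mink E (star E) = 2
  star₀ : star (complexLift h z) = complexLift h z
  star₁ : star (dz (complexLift h) z) = dzbar (complexLift h) z
  star₃ : star (dzbar (dz (complexLift h)) z) = dzbar (dz (complexLift h)) z

theorem dzbar_dz_complexLift (S : IsIsotropicSurface ε h e₁ e₂ α β) (z : ℂ) :
    dzbar (dz (complexLift h)) z = Fin.cons 0 (dzbar (dz (complexify h)) z) := by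
  have e : dz (complexLift h) = fun w => Fin.cons 0 (dz (complexify h) w) :=
    funext (dz_complexLift S.smooth)
  rw [e]
  exact ((hasWirtingerAt_const 0 z).cons (hasWirtingerAt_of_differentiableAt
    ((contDiff_dz (contDiff_complexify S.smooth)).differentiable (by simp) z))).dzbar_eq

theorem star_complexify (z : ℂ) : star (complexify h z) = complexify h z := by
  funext i
  simp [complexify]

theorem frameProducts (S : IsIsotropicSurface ε h e₁ e₂ α β) (z : ℂ) :
    FrameProducts h (normalFrame h e₁ e₂ z) z := by
  obtain ⟨k0, k1, k2⟩ := S.dotProduct_dzbar_dz z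
  have hh : complexify h z ⬝ᵥ complexify h z = 1 := by
    have h1 := ofReal_dotProduct (h z).ofLp (h z).ofLp
    rw [← inner_eq_dotProduct, real_inner_self_eq_norm_sq, S.norm] at h1
    exact h1.trans (by norm_num)
  have hzh : dz (complexify h) z ⬝ᵥ complexify h z = 0 := by
    rw [S.dz_h, S.combination_dotProduct_self]
  have hzz : dz (complexify h) z ⬝ᵥ dz (complexify h) z = 0 := by
    rw [S.dz_h, S.combination_dotProduct]
  have eh : normalPart h e₁ e₂ z ⬝ᵥ complexify h z = 0 := by
    rw [normalPart_eq, S.combination_dotProduct_self]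
  have ez : normalPart h e₁ e₂ z ⬝ᵥ dz (complexify h) z = 0 := by
    rw [normalPart_eq, S.dz_h, S.combination_dotProduct]
  have ee : normalPart h e₁ e₂ z ⬝ᵥ normalPart h e₁ e₂ z = 0 := by
    rw [normalPart_eq, S.combination_dotProduct]
  have ez' : normalPart h e₁ e₂ z ⬝ᵥ star (dz (complexify h) z) = 0 :=
    normalPart_dotProduct_star_dz z
  have sdot : ∀ u v : Fin 5 → ℂ, star u ⬝ᵥ star v = star (u ⬝ᵥ v) := fun u v => by
    simp [dotProduct]
  have hzh' : star (dz (complexify h) z) ⬝ᵥ complexify h z = 0 := by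
    rw [← star_complexify (h := h), sdot, hzh, star_zero]
  have hzz' : star (dz (complexify h) z) ⬝ᵥ star (dz (complexify h) z) = 0 := by
    rw [sdot, hzz, star_zero]
  have eh' : complexify h z ⬝ᵥ star (normalPart h e₁ e₂ z) = 0 := by
    rw [← star_complexify (h := h), sdot, dotProduct_comm, eh, star_zero]
  have g0 : (sqNorm (dz (complexify h) z) : ℂ) ≠ 0 := by exact_mod_cast (S.sqNorm_dz_pos z).ne'
  have hY : complexLift h z = Fin.cons 1 (complexify h z) := congrFun (complexLift_eq h) z
  have hYz := dz_complexLift S.smooth z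
  have hYb : dzbar (complexLift h) z = Fin.cons 0 (star (dz (complexify h) z)) := by
    rw [dzbar_complexLift S.smooth, dzbar_complexify S.smooth]
  have hYzb := S.dzbar_dz_complexLift z
  constructor
  · rw [hY, mink_cons, hh]; ring
  · rw [hY, hYz, mink_cons, dotProduct_comm, hzh]; ring
  · rw [hY, hYb, mink_cons, dotProduct_comm, hzh']; ring
  · rw [hY, hYzb, mink_cons, k0]; ring
  · rw [hYz, mink_cons, hzz]; ring
  · rw [hYz, hYb, mink_cons, dotProduct_star_self_eq_sqNorm]; ring
  · rw [hYz, hYzb, mink_cons, k1]; ring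
  · rw [hYb, mink_cons, hzz']; ring
  · rw [hYb, hYzb, mink_cons, k2]; ring
  · rw [hY, normalFrame, mink_smul_left, mink_cons, add_dotProduct, eh, smul_dotProduct, hh,
      smul_eq_mul]
    ring
  · rw [hYz, normalFrame, mink_smul_left, mink_cons, add_dotProduct, ez, smul_dotProduct,
      dotProduct_comm, hzh, smul_zero]
    ring
  · rw [hYb, normalFrame, mink_smul_left, mink_cons, add_dotProduct, ez', smul_dotProduct,
      dotProduct_comm, hzh', smul_zero]
    ring
  · rw [hYzb, normalFrame, mink_smul_left, mink_cons, add_dotProduct, smul_dotProduct, k0,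
      normalShift, smul_eq_mul, Complex.ofReal_inv]
    field_simp
    ring
  · rw [normalFrame, mink_smul_left, mink_smul_right, mink_cons, add_dotProduct, dotProduct_add,
      dotProduct_add, smul_dotProduct, smul_dotProduct, dotProduct_smul, dotProduct_smul, ee, eh,
      dotProduct_comm (complexify h z) (normalPart h e₁ e₂ z), eh, hh]
    simp only [smul_eq_mul]
    ring
  · have hs : star (normalFrame h e₁ e₂ z) = ((√2 * (√(sqNorm (normalPart h e₁ e₂ z)))⁻¹ : ℝ) : ℂ) •
        Fin.cons (star (normalShift h e₁ e₂ z)) (star (normalPart h e₁ e₂ z) +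
          star (normalShift h e₁ e₂ z) • complexify h z) := by
      rw [normalFrame, star_smul, star_cons, star_add, star_smul, star_complexify, RCLike.star_def,
        Complex.conj_ofReal]
    rw [hs, normalFrame, mink_smul_left, mink_smul_right, mink_cons, add_dotProduct, dotProduct_add,
      dotProduct_add, smul_dotProduct, smul_dotProduct, dotProduct_smul, dotProduct_smul, eh, eh',
      hh, dotProduct_star_self_eq_sqNorm]
    have := unitFactor_sq (sqNorm_pos (S.normalPart_ne_zero z))
    simp only [smul_eq_mul]
    linear_combination this
  · rw [hY, star_cons, star_one, star_complexify]
  · rw [hYz, hYb, star_cons, star_zero]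
  · rw [hYzb, star_cons, star_zero]
    congr 1
    funext i
    rw [Pi.star_apply, dzbar_dz_complexify S.smooth, RCLike.star_def, Complex.conj_ofReal]

namespace FrameProducts

variable {E : Fin 6 → ℂ} {z : ℂ}

theorem star_h0 (P : FrameProducts h E z) : mink (star E) (complexLift h z) = 0 := by
  rw [← P.star₀, mink_star, P.h0, star_zero]

theorem star_h1 (P : FrameProducts h E z) : mink (star E) (dzbar (complexLift h) z) = 0 := by
  rw [← P.star₁, mink_star, P.h1, star_zero]

theorem star_h2 (P : FrameProducts h E z) : mink (star E) (dz (complexLift h) z) = 0 := by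
  rw [← star_star (dz _ _), P.star₁, mink_star, P.h2, star_zero]

theorem star_h3 (P : FrameProducts h E z) : mink (star E) (dzbar (dz (complexLift h)) z) = 0 := by
  rw [← P.star₃, mink_star, P.h3, star_zero]

theorem star_hE (P : FrameProducts h E z) : mink (star E) (star E) = 0 := by
  rw [mink_star, P.hE, star_zero]

theorem eq_zero (P : FrameProducts h E z) (hg : (sqNorm (dz (complexify h) z) : ℂ) ≠ 0)
    {x : Fin 6 → ℂ} (x0 : mink x (complexLift h z) = 0) (x1 : mink x (dz (complexLift h) z) = 0)
    (x2 : mink x (dzbar (complexLift h) z) = 0) (x3 : mink x (dzbar (dz (complexLift h)) z) = 0)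
    (xE : mink x E = 0) (xE' : mink x (star E) = 0) : x = 0 :=
  eq_zero_of_orthogonal_frame hg P.h00 P.h01 P.h02 P.h03 P.h11 P.h12 P.h13 P.h22 P.h23 rfl P.h0
    P.h1 P.h2 P.h3 P.star_h0 P.star_h2 P.star_h1 P.star_h3 P.hE P.hEE P.star_hE x0 x1 x2 x3 xE xE'

theorem mink_bundleV (P : FrameProducts h E z) :
    (∀ v ∈ bundleV (complexLift h) z, mink E v = 0) ∧
      ∀ v ∈ bundleV (complexLift h) z, mink (star E) v = 0 := by
  constructor <;> refine (forall_mem_span_mink_eq_zero_iff _ _).2 ?_ <;>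
    simp only [Set.mem_insert_iff, Set.mem_singleton_iff, forall_eq_or_imp, forall_eq]
  · exact ⟨P.h0, P.h1, P.h2, P.h3⟩
  · exact ⟨P.star_h0, P.star_h2, P.star_h1, P.star_h3⟩

/-- A vector orthogonal to `V` is a combination of `E` and `Ē`. -/
theorem eq_of_orthogonal_bundleV (P : FrameProducts h E z)
    (hg : (sqNorm (dz (complexify h) z) : ℂ) ≠ 0) {x : Fin 6 → ℂ}
    (hx : ∀ v ∈ bundleV (complexLift h) z, mink x v = 0) :
    x = (1 / 2 * mink x (star E)) • E + (1 / 2 * mink x E) • star E := by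
  have hV : ∀ v, v ∈ ({complexLift h z, dz (complexLift h) z, dzbar (complexLift h) z,
      dzbar (dz (complexLift h)) z} : Set (Fin 6 → ℂ)) → mink x v = 0 :=
    fun v hv => hx v (Submodule.subset_span hv)
  rw [← sub_eq_zero]
  refine P.eq_zero hg ?_ ?_ ?_ ?_ ?_ ?_ <;>
    simp only [mink_sub_left, mink_add_left, mink_smul_left, P.h0, P.h1, P.h2, P.h3, P.star_h0,
      P.star_h1, P.star_h2, P.star_h3, P.hE, P.star_hE, P.hEE, mink_comm (star E) E]
  · rw [hV _ (by simp)]; ring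
  · rw [hV _ (by simp)]; ring
  · rw [hV _ (by simp)]; ring
  · rw [hV _ (by simp)]; ring
  · ring
  · ring

/-- A vector orthogonal to `E` is a combination of `E` and a vector of `V`. -/
theorem mem_of_mink_eq_zero (P : FrameProducts h E z)
    (hg : (sqNorm (dz (complexify h) z) : ℂ) ≠ 0) {w : Fin 6 → ℂ} (hw : mink w E = 0) :
    ∃ c : ℂ, ∃ v ∈ bundleV (complexLift h) z, w = c • E + v := by
  set g : ℂ := (sqNorm (dz (complexify h) z) : ℂ) with hgdef
  set p := mink (dzbar (dz (complexLift h)) z) (dzbar (dz (complexLift h)) z) with hp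
  have hm : ∀ v, v ∈ ({complexLift h z, dz (complexLift h) z, dzbar (complexLift h) z,
      dzbar (dz (complexLift h)) z} : Set (Fin 6 → ℂ)) → v ∈ bundleV (complexLift h) z :=
    fun v hv => Submodule.subset_span hv
  set d := -(mink w (complexLift h z)) / g with hd
  set v : Fin 6 → ℂ := ((d * p - mink w (dzbar (dz (complexLift h)) z)) / g) • complexLift h z +
    (mink w (dzbar (complexLift h) z) / g) • dz (complexLift h) z +
    (mink w (dz (complexLift h) z) / g) • dzbar (complexLift h) z +
    d • dzbar (dz (complexLift h)) z with hv
  refine ⟨1 / 2 * mink w (star E), v, ?_, ?_⟩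
  · exact Submodule.add_mem _ (Submodule.add_mem _ (Submodule.add_mem _
      (Submodule.smul_mem _ _ (hm _ (by simp))) (Submodule.smul_mem _ _ (hm _ (by simp))))
      (Submodule.smul_mem _ _ (hm _ (by simp)))) (Submodule.smul_mem _ _ (hm _ (by simp)))
  · rw [← sub_eq_zero]
    have c0 := mink_comm (complexLift h z)
    have c1 := mink_comm (dz (complexLift h) z)
    have c2 := mink_comm (dzbar (complexLift h) z)
    have c3 := mink_comm (dzbar (dz (complexLift h)) z)
    refine P.eq_zero hg ?_ ?_ ?_ ?_ ?_ ?_ <;>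
      simp only [hv, mink_sub_left, mink_add_left, mink_smul_left, P.h0, P.h1, P.h2, P.h3,
        P.star_h0, P.star_h1, P.star_h2, P.star_h3, P.hE, P.hEE, P.h00, P.h01, P.h02, P.h03,
        P.h11, P.h12, P.h13, P.h22, P.h23, c0 E, c1 E, c2 E, c3 E, c0 (star E), c1 (star E),
        c2 (star E), c3 (star E), c1 (complexLift h z), c2 (complexLift h z), c3 (complexLift h z),
        c2 (dz (complexLift h) z), c3 (dz (complexLift h) z), c3 (dzbar (complexLift h) z), hw,
        ← hp, ← hgdef, hd] <;> field_simp <;> ring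

end FrameProducts

/-- The isotropic plane is spanned by `h_z` and the normal part. -/
theorem combination_eq (S : IsIsotropicSurface ε h e₁ e₂ α β) (z a b : ℂ) :
    ∃ c d : ℂ, a • e₁ z + b • e₂ z = c • dz (complexify h) z + d • normalPart h e₁ e₂ z := by
  have g0 : (sqNorm (dz (complexify h) z) : ℂ) ≠ 0 := by exact_mod_cast (S.sqNorm_dz_pos z).ne'
  have hg := S.sqNorm_dz_eq z
  rw [normalPart]
  set A := e₂ z ⬝ᵥ star (dz (complexify h) z)
  set B := e₁ z ⬝ᵥ star (dz (complexify h) z)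
  set g : ℂ := (sqNorm (dz (complexify h) z) : ℂ)
  refine ⟨(a * B + b * A) / g, (a * β z - b * α z) / g, ?_⟩
  rw [S.dz_h]
  funext i
  simp only [Pi.add_apply, Pi.sub_apply, Pi.smul_apply, smul_eq_mul]
  field_simp
  rw [hg]
  ring

/-- The frame consists of the normalized `Y_z` and of the normalized section of the isotropic plane
bundle orthogonal to `Y_z̄`, shifted along `Y` into the conformal normal bundle. -/
theorem isHTotallyIsotropicInChart (S : IsIsotropicSurface ε h e₁ e₂ α β) :
    IsHTotallyIsotropicInChart 2 h := by
  have hYd : Differentiable ℝ (dz (complexLift h)) :=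
    (contDiff_dz (contDiff_complexLift S.smooth)).differentiable (by simp)
  refine ⟨fun z j l hj hl => ?_, fun z₀ => ⟨Set.univ, isOpen_univ, Set.mem_univ _,
    ![tangentFrame h, normalFrame h e₁ e₂], ?_, fun z _ => ?_⟩⟩
  · obtain ⟨j, rfl⟩ := Nat.exists_eq_succ_of_ne_zero (by omega : j ≠ 0)
    obtain ⟨l, rfl⟩ := Nat.exists_eq_succ_of_ne_zero (by omega : l ≠ 0)
    rw [Nat.succ_eq_add_one, Nat.succ_eq_add_one, S.iterate_dz_complexLift,
      S.iterate_dz_complexLift, mink_cons, S.combination_dotProduct]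
    ring
  · intro j
    fin_cases j
    · exact S.contDiff_tangentFrame.contDiffOn
    · exact S.contDiff_normalFrame.contDiffOn
  have P := S.frameProducts z
  have g0 : (sqNorm (dz (complexify h) z) : ℂ) ≠ 0 := by exact_mod_cast (S.sqNorm_dz_pos z).ne'
  set E := normalFrame h e₁ e₂ z with hE
  have hT : tangentFrame h z = ((√2 * (√(sqNorm (dz (complexify h) z)))⁻¹ : ℝ) : ℂ) •
      dz (complexLift h) z := by
    rw [tangentFrame, dz_complexLift S.smooth]
  have hT' : star (tangentFrame h z) = ((√2 * (√(sqNorm (dz (complexify h) z)))⁻¹ : ℝ) : ℂ) •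
      dzbar (complexLift h) z := by
    rw [hT, star_smul, P.star₁, RCLike.star_def, Complex.conj_ofReal]
  have hc0 := unitFactor_ne_zero (S.sqNorm_dz_pos z)
  have hc2 := unitFactor_sq (S.sqNorm_dz_pos z)
  set c : ℂ := ((√2 * (√(sqNorm (dz (complexify h) z)))⁻¹ : ℝ) : ℂ) with hc
  have hd0 := unitFactor_ne_zero (sqNorm_pos (S.normalPart_ne_zero z))
  refine ⟨?_, ?_, ?_, ?_, ?_, ?_⟩
  · have h01 : mink (tangentFrame h z) E = 0 := by
      rw [hT, mink_smul_left, mink_comm, P.h1, mul_zero]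
    intro j l
    fin_cases j <;> fin_cases l
    · change mink (tangentFrame h z) (tangentFrame h z) = 0
      rw [hT, mink_smul_left, mink_smul_right, P.h11]
      ring
    · exact h01
    · exact (mink_comm _ _).trans h01
    · exact P.hE
  · intro j l
    fin_cases j <;> fin_cases l
    · change mink (tangentFrame h z) (star (tangentFrame h z)) = 2
      rw [hT', hT, mink_smul_left, mink_smul_right, P.h12]
      linear_combination hc2
    · change mink (tangentFrame h z) (star E) = 0
      rw [hT, mink_smul_left, mink_comm, P.star_h2, mul_zero]
    · change mink E (star (tangentFrame h z)) = 0
      rw [hT', mink_smul_right, P.h2, mul_zero]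
    · exact P.hEE
  · have m0 : ∀ j : Fin 2, complexLift h z ∈ Submodule.span ℂ ({complexLift h z} ∪
        {e | ∃ l ≤ j, e = ![tangentFrame h, normalFrame h e₁ e₂] l z}) :=
      fun j => Submodule.subset_span (Or.inl rfl)
    have m1 : ∀ j : Fin 2, dz (complexLift h) z ∈ Submodule.span ℂ ({complexLift h z} ∪
        {e | ∃ l ≤ j, e = ![tangentFrame h, normalFrame h e₁ e₂] l z}) := fun j => by
      have : dz (complexLift h) z = c⁻¹ • tangentFrame h z := by
        rw [hT, smul_smul, inv_mul_cancel₀ hc0, one_smul]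
      rw [this]
      exact Submodule.smul_mem _ _ (Submodule.subset_span (Or.inr ⟨0, Fin.zero_le j, rfl⟩))
    intro j
    fin_cases j
    · exact m1 0
    · change dz^[1 + 1] (complexLift h) z ∈ _
      rw [S.iterate_dz_complexLift]
      obtain ⟨a, b, hab⟩ := S.combination_eq z (dz^[1] α z) (dz^[1] β z)
      set d : ℂ := ((√2 * (√(sqNorm (normalPart h e₁ e₂ z)))⁻¹ : ℝ) : ℂ) with hd
      have e : (Fin.cons 0 (dz^[1] α z • e₁ z + dz^[1] β z • e₂ z) : Fin 6 → ℂ) =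
          a • dz (complexLift h) z + b • (d⁻¹ • E - normalShift h e₁ e₂ z • complexLift h z) := by
        rw [hab, hE, normalFrame, ← hd, smul_smul, inv_mul_cancel₀ hd0, one_smul,
          dz_complexLift S.smooth, complexLift_eq]
        funext i
        induction i using Fin.cases with
        | zero => simp
        | succ i => simp
      simp only [e]
      exact Submodule.add_mem _ (Submodule.smul_mem _ _ (m1 1)) (Submodule.smul_mem _ _
        (Submodule.sub_mem _ (Submodule.smul_mem _ _ (Submodule.subset_span
          (Or.inr ⟨1, le_rfl, rfl⟩))) (Submodule.smul_mem _ _ (m0 1))))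
  · let _ : Unique {j : Fin 2 // 0 < (j : ℕ)} :=
      ⟨⟨⟨1, by norm_num⟩⟩, fun ⟨j, hj⟩ => Subtype.ext (by
        fin_cases j
        · exact absurd hj (lt_irrefl _)
        · rfl)⟩
    rw [Fintype.linearIndependent_iff]
    intro a ha
    rw [Fintype.sum_sum_type, Fintype.sum_unique, Fintype.sum_unique] at ha
    change a (Sum.inl default) • E + a (Sum.inr default) • star E = 0 at ha
    have k1 := congrArg (fun v => mink v E) ha
    have k2 := congrArg (fun v => mink v (star E)) ha
    have z1 : ∀ v : Fin 6 → ℂ, mink 0 v = 0 := fun v => by simp [mink]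
    simp only [mink_add_left, mink_smul_left, P.hE, P.hEE, P.star_hE, mink_comm (star E) E,
      z1] at k1 k2
    rintro (j | j)
    · rw [Unique.eq_default j]
      simpa using k2
    · rw [Unique.eq_default j]
      simpa using k1
  · intro x
    constructor
    · intro hx v hv
      rw [mink_comm]
      refine (forall_mem_span_mink_eq_zero_iff v _).2 ?_ x hx
      rintro e ⟨j, hj, he⟩
      fin_cases j
      · exact absurd hj (lt_irrefl _)
      · rcases he with rfl | rfl
        · exact (mink_comm _ _).trans (P.mink_bundleV.1 v hv)
        · exact (mink_comm _ _).trans (P.mink_bundleV.2 v hv)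
    · intro hx
      rw [P.eq_of_orthogonal_bundleV g0 hx]
      exact Submodule.add_mem _
        (Submodule.smul_mem _ _ (Submodule.subset_span ⟨1, by norm_num, Or.inl rfl⟩))
        (Submodule.smul_mem _ _ (Submodule.subset_span ⟨1, by norm_num, Or.inr rfl⟩))
  · intro j hj
    fin_cases j
    · exact absurd hj (lt_irrefl _)
    change dzbar (normalFrame h e₁ e₂) z ∈ _
    have hw : mink (dzbar (normalFrame h e₁ e₂) z) E = 0 := by
      have w := hasWirtingerAt_of_differentiableAt
        (S.contDiff_normalFrame.differentiable (by simp) z)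
      have e : (fun w => mink (normalFrame h e₁ e₂ w) (normalFrame h e₁ e₂ w)) = fun _ => 0 :=
        funext fun w => (S.frameProducts w).hE
      have k := (w.mink w).dzbar_eq
      rw [e, (hasWirtingerAt_const 0 z).dzbar_eq, mink_comm (normalFrame h e₁ e₂ z), ← hE] at k
      linear_combination -(1 / 2 : ℂ) * k
    obtain ⟨a, v, hv, hav⟩ := P.mem_of_mink_eq_zero g0 hw
    rw [hav]
    exact Submodule.add_mem_sup
      (Submodule.smul_mem _ _ (Submodule.subset_span ⟨1, by norm_num, rfl⟩)) hv

end IsIsotropicSurface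

end

section

/-! ### Symmetries of isotropic surfaces, and the basic example -/

theorem complexify_toLp_mulVec (R : Matrix (Fin 5) (Fin 5) ℝ) (h : ℂ → EuclideanSpace ℝ (Fin 5))
    (z : ℂ) : complexify (fun w => WithLp.toLp 2 (R *ᵥ (h w).ofLp)) z =
      R.map Complex.ofReal *ᵥ complexify h z := by
  funext i
  simp [complexify, Matrix.mulVec, dotProduct]

theorem star_map_mulVec (R : Matrix (Fin 5) (Fin 5) ℝ) (v : Fin 5 → ℂ) :
    star (R.map Complex.ofReal *ᵥ v) = R.map Complex.ofReal *ᵥ star v := by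
  funext i
  simp [Matrix.mulVec, dotProduct]

theorem mulVec_dotProduct_mulVec {K : Type*} [CommRing K] {R : Matrix (Fin 5) (Fin 5) K}
    (hR : Rᵀ * R = 1) (u v : Fin 5 → K) : (R *ᵥ u) ⬝ᵥ (R *ᵥ v) = u ⬝ᵥ v := by
  rw [Matrix.dotProduct_mulVec, Matrix.vecMul_mulVec, hR, Matrix.vecMul_one]

theorem det5_mulVec {K : Type*} [CommRing K] (R : Matrix (Fin 5) (Fin 5) K)
    (v₁ v₂ v₃ v₄ v₅ : Fin 5 → K) : det5 (R *ᵥ v₁) (R *ᵥ v₂) (R *ᵥ v₃) (R *ᵥ v₄) (R *ᵥ v₅) =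
      R.det * det5 v₁ v₂ v₃ v₄ v₅ := by
  rw [det5, det5, mul_comm, ← Matrix.det_transpose R, ← Matrix.det_mul]
  congr 1
  ext i j
  fin_cases i <;> simp [Matrix.mul_apply, Matrix.mulVec, dotProduct, mul_comm]

theorem HasWirtingerAt.mulVec {n : ℕ} {f : ℂ → Fin n → ℂ} {a b : Fin n → ℂ} {z : ℂ}
    (hf : HasWirtingerAt f a b z) (M : Matrix (Fin n) (Fin n) ℂ) :
    HasWirtingerAt (fun w => M *ᵥ f w) (M *ᵥ a) (M *ᵥ b) z :=
  hasWirtingerAt_pi.2 fun i => ((hasWirtingerAt_const (M i) z).dotProduct hf).congr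
    (by rw [zero_dotProduct, zero_add]; rfl) (by rw [zero_dotProduct, zero_add]; rfl)

theorem contDiff_mulVec {n : ℕ} {f : ℂ → Fin n → ℂ} (hf : ContDiff ℝ ∞ f)
    (M : Matrix (Fin n) (Fin n) ℂ) : ContDiff ℝ ∞ fun w => M *ᵥ f w :=
  contDiff_pi.2 fun i => contDiff_dotProduct (contDiff_const (c := M i)) hf

namespace IsIsotropicSurface

variable {ε : ℝ} {h : ℂ → EuclideanSpace ℝ (Fin 5)} {e₁ e₂ : ℂ → Fin 5 → ℂ} {α β : ℂ → ℂ}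

theorem comp_mul_left (S : IsIsotropicSurface ε h e₁ e₂ α β) {c : ℂ} (hc : c ≠ 0) :
    IsIsotropicSurface ε (fun z => h (c * z)) (fun z => e₁ (c * z)) (fun z => e₂ (c * z))
      (fun z => c * α (c * z)) (fun z => c * β (c * z)) where
  smooth := S.smooth.comp (contDiff_const.mul contDiff_id)
  norm z := S.norm _
  smooth_e₁ := S.smooth_e₁.comp (contDiff_const.mul contDiff_id)
  smooth_e₂ := S.smooth_e₂.comp (contDiff_const.mul contDiff_id)
  smooth_α := contDiff_const.mul (S.smooth_α.comp (contDiff_const.mul contDiff_id))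
  smooth_β := contDiff_const.mul (S.smooth_β.comp (contDiff_const.mul contDiff_id))
  dz_e₁ z := by
    rw [((hasWirtingerAt_of_differentiableAt
      (S.smooth_e₁.differentiable (by simp) (c * z))).comp_mul_left).dz_eq, S.dz_e₁, smul_zero]
  dz_e₂ z := by
    rw [((hasWirtingerAt_of_differentiableAt
      (S.smooth_e₂.differentiable (by simp) (c * z))).comp_mul_left).dz_eq, S.dz_e₂, smul_zero]
  iso₁₁ z := S.iso₁₁ _
  iso₁₂ z := S.iso₁₂ _
  iso₂₂ z := S.iso₂₂ _
  perp₁ z := S.perp₁ _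
  perp₂ z := S.perp₂ _
  dz_h z := by
    have e : complexify (fun z => h (c * z)) = fun z => complexify h (c * z) := rfl
    rw [e, ((hasWirtingerAt_of_differentiableAt
      ((contDiff_complexify S.smooth).differentiable (by simp) (c * z))).comp_mul_left).dz_eq,
      S.dz_h, smul_add, smul_smul, smul_smul]
  ne_zero z := (S.ne_zero (c * z)).imp (mul_ne_zero hc) (mul_ne_zero hc)
  det z := S.det _

theorem mulVec (S : IsIsotropicSurface ε h e₁ e₂ α β) {R : Matrix (Fin 5) (Fin 5) ℝ}
    (hR : Rᵀ * R = 1) :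
    IsIsotropicSurface (ε * R.det) (fun z => WithLp.toLp 2 (R *ᵥ (h z).ofLp))
      (fun z => R.map Complex.ofReal *ᵥ e₁ z) (fun z => R.map Complex.ofReal *ᵥ e₂ z) α β := by
  have hRC : (R.map Complex.ofReal)ᵀ * R.map Complex.ofReal = 1 := by
    have := congrArg (fun M => M.map Complex.ofRealHom) hR
    rw [Matrix.map_mul, Matrix.map_one _ (map_zero _) (map_one _), Matrix.transpose_map] at this
    exact this
  have hdet : R.det * R.det = 1 := by
    have := congrArg Matrix.det hR
    rwa [Matrix.det_mul, Matrix.det_transpose, Matrix.det_one] at this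
  have hc : complexify (fun w => WithLp.toLp 2 (R *ᵥ (h w).ofLp)) =
      fun z => R.map Complex.ofReal *ᵥ complexify h z := funext (complexify_toLp_mulVec R h)
  refine
    { smooth := ?_
      norm := fun z => ?_
      smooth_e₁ := contDiff_mulVec S.smooth_e₁ _
      smooth_e₂ := contDiff_mulVec S.smooth_e₂ _
      smooth_α := S.smooth_α
      smooth_β := S.smooth_β
      dz_e₁ := fun z => ?_
      dz_e₂ := fun z => ?_
      iso₁₁ := fun z => by rw [mulVec_dotProduct_mulVec hRC, S.iso₁₁]
      iso₁₂ := fun z => by rw [mulVec_dotProduct_mulVec hRC, S.iso₁₂]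
      iso₂₂ := fun z => by rw [mulVec_dotProduct_mulVec hRC, S.iso₂₂]
      perp₁ := fun z => by rw [hc, mulVec_dotProduct_mulVec hRC, S.perp₁]
      perp₂ := fun z => by rw [hc, mulVec_dotProduct_mulVec hRC, S.perp₂]
      dz_h := fun z => ?_
      ne_zero := S.ne_zero
      det := fun z => ?_ }
  · refine (contDiff_piLp 2).2 fun i => ?_
    exact ContDiff.sum (s := Finset.univ) (f := fun j z => R i j * h z j)
      fun j _ => contDiff_const.mul ((contDiff_piLp 2).1 S.smooth j)
  · have h1 : ‖WithLp.toLp 2 (R *ᵥ (h z).ofLp)‖ ^ 2 = 1 := by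
      rw [← real_inner_self_eq_norm_sq, inner_eq_dotProduct, mulVec_dotProduct_mulVec hR,
        ← inner_eq_dotProduct, real_inner_self_eq_norm_sq, S.norm, one_pow]
    exact (pow_eq_one_iff_of_nonneg (norm_nonneg _) two_ne_zero).1 h1
  · rw [((hasWirtingerAt_of_differentiableAt
      (S.smooth_e₁.differentiable (by simp) z)).mulVec _).dz_eq, S.dz_e₁, Matrix.mulVec_zero]
  · rw [((hasWirtingerAt_of_differentiableAt
      (S.smooth_e₂.differentiable (by simp) z)).mulVec _).dz_eq, S.dz_e₂, Matrix.mulVec_zero]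
  · rw [hc, ((hasWirtingerAt_of_differentiableAt
      ((contDiff_complexify S.smooth).differentiable (by simp) z)).mulVec _).dz_eq, S.dz_h,
      Matrix.mulVec_add, Matrix.mulVec_smul, Matrix.mulVec_smul]
  · obtain ⟨d, hd, hdd⟩ := S.det z
    refine ⟨R.det * d, ?_, ?_⟩
    · calc 0 < ε * d := hd
        _ = ε * R.det * (R.det * d) := by linear_combination (-(ε * d)) * hdet
    · rw [star_map_mulVec, star_map_mulVec, hc, det5_mulVec, hdd]
      have : (R.map Complex.ofReal).det = (R.det : ℂ) := (RingHom.map_det Complex.ofRealHom R).symm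
      rw [this, Complex.ofReal_mul]

end IsIsotropicSurface

/-- The surface `(-(1-q)², -2 Im ζ, -2 Re ζ, 2q Im ζ, 2q Re ζ) / (1+q)²`, `q = |ζ|² / 2`, in the
unit sphere of `ℝ⁵`. -/
noncomputable def modelSurface (ζ : ℂ) : EuclideanSpace ℝ (Fin 5) :=
  WithLp.toLp 2 (((1 + Complex.normSq ζ / 2) ^ 2)⁻¹ •
    ![-(1 - Complex.normSq ζ / 2) ^ 2, -(2 * ζ.im), -(2 * ζ.re), Complex.normSq ζ * ζ.im,
      Complex.normSq ζ * ζ.re])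

/-- The first section of the isotropic plane of `modelSurface`. -/
noncomputable def modelFrame₁ (ζ : ℂ) : Fin 5 → ℂ :=
  ![-2 * star ζ, -(Complex.I * (1 + star ζ * star ζ)), 1 - star ζ * star ζ,
    -(Complex.I * (star ζ * star ζ) / 2), -(star ζ * star ζ / 2)]

/-- The second section of the isotropic plane of `modelSurface`. -/
noncomputable def modelFrame₂ (ζ : ℂ) : Fin 5 → ℂ :=
  ![0, Complex.I * (star ζ * star ζ), star ζ * star ζ, -2 * Complex.I, 2]

theorem im_eq_star (ζ : ℂ) : (ζ.im : ℂ) = -Complex.I / 2 * (ζ - star ζ) := by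
  apply Complex.ext
  · simp
    ring
  · simp

theorem re_eq_star (ζ : ℂ) : (ζ.re : ℂ) = (ζ + star ζ) / 2 := by
  apply Complex.ext <;> simp

theorem normSq_eq_star (ζ : ℂ) : (Complex.normSq ζ : ℂ) = ζ * star ζ := by
  rw [RCLike.star_def, Complex.mul_conj]

theorem one_add_ne_zero (ζ : ℂ) : 1 + ζ * star ζ / 2 ≠ 0 := by
  rw [← normSq_eq_star]
  have := Complex.normSq_nonneg ζ
  have : 1 + Complex.normSq ζ / 2 ≠ 0 := by positivity
  exact_mod_cast this

theorem complexify_modelSurface (ζ : ℂ) : complexify modelSurface ζ =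
    ((1 + ζ * star ζ / 2)⁻¹ * (1 + ζ * star ζ / 2)⁻¹) •
      ![-((1 - ζ * star ζ / 2) * (1 - ζ * star ζ / 2)), Complex.I * (ζ - star ζ), -(ζ + star ζ),
        -(Complex.I * (ζ * star ζ / 2) * (ζ - star ζ)), ζ * star ζ / 2 * (ζ + star ζ)] := by
  have h0 := one_add_ne_zero ζ
  funext i
  fin_cases i <;> simp only [complexify, modelSurface, Pi.smul_apply, smul_eq_mul,
    Complex.ofReal_mul, Complex.ofReal_inv, Complex.ofReal_add,
    Complex.ofReal_div, Complex.ofReal_one, Complex.ofReal_ofNat, normSq_eq_star, sq,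
    Fin.zero_eta, Fin.mk_one, Fin.reduceFinMk, Matrix.cons_val, Complex.ofReal_neg,
    Complex.ofReal_sub, im_eq_star, re_eq_star, mul_inv] <;> ring

theorem hasWirtingerAt_star (z : ℂ) : HasWirtingerAt (fun w => star w) 0 1 z :=
  hasWirtingerAt_conj z

theorem HasWirtingerAt.vecCons {n : ℕ} {c : ℂ → ℂ} {f : ℂ → Fin n → ℂ} {s t : ℂ} {a b : Fin n → ℂ}
    {z : ℂ} (hc : HasWirtingerAt c s t z) (hf : HasWirtingerAt f a b z) :
    HasWirtingerAt (fun w => Matrix.vecCons (c w) (f w)) (Matrix.vecCons s a)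
      (Matrix.vecCons t b) z := hc.cons hf

theorem hasWirtingerAt_vecEmpty (z : ℂ) :
    HasWirtingerAt (fun _ => (![] : Fin 0 → ℂ)) ![] ![] z :=
  hasWirtingerAt_pi.2 fun i => i.elim0

theorem dz_complexify_modelSurface (ζ : ℂ) : dz (complexify modelSurface) ζ =
    ((ζ * star ζ / 2 - 1) * (1 + ζ * star ζ / 2)⁻¹ ^ 3) • modelFrame₁ ζ +
      (ζ * star ζ / 2 * (1 + ζ * star ζ / 2)⁻¹ ^ 3) • modelFrame₂ ζ := by
  have h0 := one_add_ne_zero ζ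
  have hid := hasWirtingerAt_id ζ
  have hst := hasWirtingerAt_star ζ
  have hI := hasWirtingerAt_const Complex.I ζ
  have h1 := hasWirtingerAt_const (1 : ℂ) ζ
  have hq : HasWirtingerAt (fun w => w * star w / 2) (star ζ / 2) (ζ / 2) ζ :=
    ((hid.mul hst).mul (hasWirtingerAt_const (2⁻¹ : ℂ) ζ)).congr (by ring) (by ring)
  have hd := (h1.add hq).inv h0
  have hs := hd.mul hd
  have hv := (((h1.sub hq).mul (h1.sub hq)).neg).vecCons ((hI.mul (hid.sub hst)).vecCons
    ((hid.add hst).neg.vecCons (((hI.mul hq).mul (hid.sub hst)).neg.vecCons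
      ((hq.mul (hid.add hst)).vecCons (hasWirtingerAt_vecEmpty ζ)))))
  have e : complexify modelSurface = _ := funext complexify_modelSurface
  rw [e]
  refine (hs.smul hv).dz_eq.trans ?_
  funext i
  fin_cases i <;> simp [modelFrame₁, modelFrame₂, -RCLike.star_def] <;>
    generalize star ζ = b at h0 ⊢ <;> field_simp <;> ring

theorem star_modelFrame₁ (z : ℂ) : star (modelFrame₁ z) = ![-2 * z, Complex.I * (1 + z * z),
    1 - z * z, Complex.I * (z * z) / 2, -(z * z / 2)] := by
  funext i
  fin_cases i <;> simp [modelFrame₁, neg_div]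

theorem star_modelFrame₂ (z : ℂ) :
    star (modelFrame₂ z) = ![0, -(Complex.I * (z * z)), z * z, 2 * Complex.I, 2] := by
  funext i
  fin_cases i <;> simp [modelFrame₂]

theorem isIsotropicSurface_modelSurface :
    ∃ α β : ℂ → ℂ, IsIsotropicSurface (-1) modelSurface modelFrame₁ modelFrame₂ α β := by
  have hn : ContDiff ℝ ∞ fun ζ : ℂ => Complex.normSq ζ := by
    simp only [Complex.normSq_apply]
    exact ((Complex.reCLM.contDiff).mul Complex.reCLM.contDiff).add
      ((Complex.imCLM.contDiff).mul Complex.imCLM.contDiff)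
  have hq : ContDiff ℝ ∞ fun ζ : ℂ => Complex.normSq ζ / 2 := hn.div_const 2
  have hq0 : ∀ ζ : ℂ, 0 ≤ Complex.normSq ζ / 2 := fun ζ => by
    have := Complex.normSq_nonneg ζ
    positivity
  have hst : ContDiff ℝ ∞ fun ζ : ℂ => star ζ := (Complex.conjCLE : ℂ →L[ℝ] ℂ).contDiff
  have hqC : ContDiff ℝ ∞ fun ζ : ℂ => ζ * star ζ / 2 := (contDiff_id.mul hst).div_const 2
  have hinv : ContDiff ℝ ∞ fun ζ : ℂ => (1 + ζ * star ζ / 2)⁻¹ ^ 3 :=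
    ((contDiff_const.add hqC).inv one_add_ne_zero).pow 3
  have hst' : ∀ z : ℂ, HasWirtingerAt (fun w => star w) 0 1 z := hasWirtingerAt_star
  refine ⟨fun ζ => (ζ * star ζ / 2 - 1) * (1 + ζ * star ζ / 2)⁻¹ ^ 3,
    fun ζ => ζ * star ζ / 2 * (1 + ζ * star ζ / 2)⁻¹ ^ 3, ?_⟩
  refine
    { smooth := ?_
      norm := fun z => ?_
      smooth_e₁ := ?_
      smooth_e₂ := ?_
      smooth_α := (hqC.sub contDiff_const).mul hinv
      smooth_β := hqC.mul hinv
      dz_e₁ := fun z => ?_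
      dz_e₂ := fun z => ?_
      iso₁₁ := fun z => ?_
      iso₁₂ := fun z => ?_
      iso₂₂ := fun z => ?_
      perp₁ := fun z => ?_
      perp₂ := fun z => ?_
      dz_h := dz_complexify_modelSurface
      ne_zero := fun z => ?_
      det := fun z => ?_ }
  · refine (contDiff_piLp 2).2 fun i => ?_
    have hs : ContDiff ℝ ∞ fun ζ : ℂ => ((1 + Complex.normSq ζ / 2) ^ 2)⁻¹ :=
      ((contDiff_const.add hq).pow 2).inv fun ζ => by have := hq0 ζ; positivity
    have hre : ContDiff ℝ ∞ fun ζ : ℂ => ζ.re := Complex.reCLM.contDiff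
    have him : ContDiff ℝ ∞ fun ζ : ℂ => ζ.im := Complex.imCLM.contDiff
    fin_cases i
    · exact hs.mul ((contDiff_const.sub hq).pow 2).neg
    · exact hs.mul (contDiff_const.mul him).neg
    · exact hs.mul (contDiff_const.mul hre).neg
    · exact hs.mul (hn.mul him)
    · exact hs.mul (hn.mul hre)
  · have h1 : ‖modelSurface z‖ ^ 2 = 1 := by
      have := hq0 z
      rw [EuclideanSpace.real_norm_sq_eq, modelSurface]
      simp only [Fin.sum_univ_succ, Pi.smul_apply, smul_eq_mul, Fin.isValue,
        Matrix.cons_val_zero, Matrix.cons_val_succ, Finset.univ_unique,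
        Finset.sum_singleton, Fin.default_eq_zero, Matrix.cons_val_fin_one]
      rw [Complex.normSq_apply] at *
      field_simp
      ring
    exact (pow_eq_one_iff_of_nonneg (norm_nonneg _) two_ne_zero).1 h1
  · refine contDiff_pi.2 fun i => ?_
    fin_cases i
    · exact contDiff_const.mul hst
    · exact (contDiff_const.mul (contDiff_const.add (hst.mul hst))).neg
    · exact contDiff_const.sub (hst.mul hst)
    · exact ((contDiff_const.mul (hst.mul hst)).div_const 2).neg
    · exact ((hst.mul hst).div_const 2).neg
  · refine contDiff_pi.2 fun i => ?_
    fin_cases i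
    · exact contDiff_const
    · exact contDiff_const.mul (hst.mul hst)
    · exact hst.mul hst
    · exact contDiff_const
    · exact contDiff_const
  · have hs := (hst' z).mul (hst' z)
    have c := fun x => hasWirtingerAt_const (x : ℂ) z
    refine (((c (-2)).mul (hst' z)).vecCons (((c Complex.I).mul ((c 1).add hs)).neg.vecCons
      (((c 1).sub hs).vecCons ((((c Complex.I).mul hs).mul (c 2⁻¹)).neg.vecCons
        ((hs.mul (c 2⁻¹)).neg.vecCons (hasWirtingerAt_vecEmpty z)))))).dz_eq.trans ?_
    funext i
    fin_cases i <;> simp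
  · have hs := (hst' z).mul (hst' z)
    have c := fun x => hasWirtingerAt_const (x : ℂ) z
    refine ((c 0).vecCons (((c Complex.I).mul hs).vecCons (hs.vecCons
      ((c (-2 * Complex.I)).vecCons ((c 2).vecCons (hasWirtingerAt_vecEmpty z)))))).dz_eq.trans ?_
    funext i
    fin_cases i <;> simp
  · generalize hb : star z = b
    simp [modelFrame₁, dotProduct, Fin.sum_univ_succ, hb, -RCLike.star_def]
    linear_combination ((1 + b * b) ^ 2 + b ^ 4 / 4) * Complex.I_sq
  · generalize hb : star z = b
    simp [modelFrame₁, modelFrame₂, dotProduct, Fin.sum_univ_succ, hb, -RCLike.star_def]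
    linear_combination (-((1 + b * b) * (b * b)) + b ^ 2) * Complex.I_sq
  · generalize hb : star z = b
    simp [modelFrame₂, dotProduct, Fin.sum_univ_succ, hb, -RCLike.star_def]
    linear_combination (b ^ 4 + 4) * Complex.I_sq
  · rw [complexify_modelSurface, dotProduct_smul]
    refine smul_eq_zero_of_right _ ?_
    generalize hb : star z = b
    simp [modelFrame₁, dotProduct, Fin.sum_univ_succ, hb, -RCLike.star_def]
    ring_nf
    rw [Complex.I_sq]
    ring
  · rw [complexify_modelSurface, dotProduct_smul]
    refine smul_eq_zero_of_right _ ?_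
    generalize hb : star z = b
    simp [modelFrame₂, dotProduct, Fin.sum_univ_succ, hb, -RCLike.star_def]
    ring_nf
    rw [Complex.I_sq]
    ring
  · have h0 := pow_ne_zero 3 (inv_ne_zero (one_add_ne_zero z))
    by_cases hz : z * star z / 2 = 0
    · left
      rw [hz] at h0 ⊢
      exact mul_ne_zero (by norm_num) h0
    · exact Or.inr (mul_ne_zero hz h0)
  · refine ⟨-16 * (1 + Complex.normSq z / 2) ^ 4, ?_, ?_⟩
    · have := hq0 z
      have : 0 < (1 + Complex.normSq z / 2) ^ 4 := by positivity
      linarith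
    · have h0 := one_add_ne_zero z
      push_cast
      rw [normSq_eq_star, complexify_modelSurface, det5]
      rw [star_modelFrame₁, star_modelFrame₂, modelFrame₁, modelFrame₂]
      have ht : (1 + z * star z / 2)⁻¹ * (1 + z * star z / 2) = 1 := inv_mul_cancel₀ h0
      generalize (1 + z * star z / 2)⁻¹ = t at ht ⊢
      generalize star z = b at ht ⊢
      simp [Matrix.det_succ_row_zero, Fin.sum_univ_succ, Fin.succAbove]
      ring_nf
      simp only [Complex.I_sq]
      linear_combination (-16 * (1 + z * b / 2) ^ 4) * (t * (1 + z * b / 2) + 1) * ht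

end

/-! ### The pair of surfaces on the Riemann sphere -/

theorem isConformalImmersion_of_isIsotropicSurface {y : OnePoint ℂ → EuclideanSpace ℝ (Fin 5)}
    {ε : ℝ} (h : ∀ a, ∃ e₁ e₂ α β, IsIsotropicSurface ε (fun z => y (sphereChart a z)) e₁ e₂ α β) :
    IsConformalImmersion y := by
  choose e₁ e₂ α β S using h
  refine ⟨fun p => ?_, fun a => (S a).smooth, fun a z => (S a).conformalAt z⟩
  induction p using OnePoint.rec with
  | infty => simpa [sphereChart] using (S 1).norm 0
  | coe z => simpa [sphereChart] using (S 0).norm z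

/-- A surface which is totally isotropic in both charts, with the same orientation `ε`, is a
Willmore immersion. -/
theorem isWillmoreImmersion_of_isIsotropicSurface {y : OnePoint ℂ → EuclideanSpace ℝ (Fin 5)}
    {ε : ℝ} (hε : ε ^ 2 = 1)
    (h : ∀ a, ∃ e₁ e₂ α β, IsIsotropicSurface ε (fun z => y (sphereChart a z)) e₁ e₂ α β) :
    IsWillmoreImmersion y := by
  refine isWillmoreImmersion_of_density_eq (isConformalImmersion_of_isIsotropicSurface h) hε
    fun a z => ?_
  obtain ⟨e₁, e₂, α, β, S⟩ := h a
  exact S.willmoreDensity_eq hε z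

theorem isHTotallyIsotropic_of_isIsotropicSurface {y : OnePoint ℂ → EuclideanSpace ℝ (Fin 5)}
    {ε : ℝ} (h : ∀ a, ∃ e₁ e₂ α β, IsIsotropicSurface ε (fun z => y (sphereChart a z)) e₁ e₂ α β) :
    IsHTotallyIsotropic 2 y := by
  refine ⟨isConformalImmersion_of_isIsotropicSurface h, fun a => ?_⟩
  obtain ⟨e₁, e₂, α, β, S⟩ := h a
  exact S.isHTotallyIsotropicInChart

/-- The surface `[Y]`, extended to the Riemann sphere. -/
noncomputable def exampleSurface (l : ℂ) (p : OnePoint ℂ) : EuclideanSpace ℝ (Fin 5) :=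
  p.elim (WithLp.toLp 2 ![-1, 0, 0, 0, 0]) fun z => modelSurface (l⁻¹ * z)

/-- The isometry which relates the two charts of `exampleSurface`. -/
def chartIsometry : Matrix (Fin 5) (Fin 5) ℝ :=
  !![1, 0, 0, 0, 0; 0, 0, 0, 1, 0; 0, 0, 0, 0, -1; 0, 1, 0, 0, 0; 0, 0, -1, 0, 0]

/-- The orientation reversing isometry which maps `[Y]` to `[Ŷ]`. -/
def dualIsometry : Matrix (Fin 5) (Fin 5) ℝ :=
  !![-1, 0, 0, 0, 0; 0, 0, 0, -1, 0; 0, 0, 0, 0, -1; 0, -1, 0, 0, 0; 0, 0, -1, 0, 0]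

/-- The surface `[Ŷ]`, extended to the Riemann sphere. -/
noncomputable def exampleDual (l : ℂ) (p : OnePoint ℂ) : EuclideanSpace ℝ (Fin 5) :=
  WithLp.toLp 2 (dualIsometry *ᵥ (exampleSurface l p).ofLp)

theorem chartIsometry_orthogonal : chartIsometryᵀ * chartIsometry = 1 := by
  ext i j
  fin_cases i <;> fin_cases j <;> simp [chartIsometry, Matrix.mul_apply, Fin.sum_univ_succ]

theorem dualIsometry_orthogonal : dualIsometryᵀ * dualIsometry = 1 := by
  ext i j
  fin_cases i <;> fin_cases j <;> simp [dualIsometry, Matrix.mul_apply, Fin.sum_univ_succ]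

theorem det_chartIsometry : chartIsometry.det = 1 := by
  simp [chartIsometry, Matrix.det_succ_row_zero, Fin.sum_univ_succ, Fin.succAbove]

theorem det_dualIsometry : dualIsometry.det = -1 := by
  simp [dualIsometry, Matrix.det_succ_row_zero, Fin.sum_univ_succ, Fin.succAbove]

/-- In the chart `w = 1 / z` the surface is again the model surface, up to an isometry and a
dilation: with `q = |w⁻¹|² / 2`, the argument `2 l w` has `q' = 2 |w|² = 1 / q`. -/
theorem exampleSurface_chart_one {l : ℂ} (hl : ‖l‖ = 1) (w : ℂ) :
    exampleSurface l (sphereChart 1 w) =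
      WithLp.toLp 2 (chartIsometry *ᵥ (modelSurface (2 * l * w)).ofLp) := by
  by_cases hw : w = 0
  · subst hw
    ext i
    fin_cases i <;> simp [exampleSurface, sphereChart, chartIsometry, modelSurface, Matrix.mulVec,
      dotProduct, Fin.sum_univ_succ]
  have hn : Complex.normSq w ≠ 0 := (Complex.normSq_pos.2 hw).ne'
  have hl1 : Complex.normSq l = 1 := by rw [Complex.normSq_eq_norm_sq, hl, one_pow]
  have e : (l⁻¹ * w⁻¹ : ℂ) = (starRingEnd ℂ) (l * w) * ((Complex.normSq w)⁻¹ : ℝ) := by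
    rw [← mul_inv, Complex.inv_def, Complex.normSq_mul, hl1, one_mul]
  have h1 : exampleSurface l (sphereChart 1 w) = modelSurface (l⁻¹ * w⁻¹) := by
    simp [exampleSurface, sphereChart, hw]
  have n1 : Complex.normSq (2 * l * w) = 4 * Complex.normSq w := by
    rw [Complex.normSq_mul, Complex.normSq_mul, hl1]
    norm_num [Complex.normSq_apply]
  have n2 : Complex.normSq ((starRingEnd ℂ) (l * w) * ((Complex.normSq w)⁻¹ : ℝ)) =
      (Complex.normSq w)⁻¹ := by
    rw [Complex.normSq_mul, Complex.normSq_conj, Complex.normSq_mul, hl1, Complex.normSq_ofReal]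
    field_simp
  have r1 : (2 * l * w).re = 2 * (l * w).re := by simp [mul_assoc]
  have i1 : (2 * l * w).im = 2 * (l * w).im := by simp [mul_assoc]
  have r2 : ((starRingEnd ℂ) (l * w) * ((Complex.normSq w)⁻¹ : ℝ)).re =
      (l * w).re * (Complex.normSq w)⁻¹ := by
    rw [Complex.re_mul_ofReal, Complex.conj_re]
  have i2 : ((starRingEnd ℂ) (l * w) * ((Complex.normSq w)⁻¹ : ℝ)).im =
      -(l * w).im * (Complex.normSq w)⁻¹ := by
    rw [Complex.im_mul_ofReal, Complex.conj_im]
  rw [h1, e]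
  ext i
  have hpos := Complex.normSq_pos.2 hw
  simp only [modelSurface, n1, n2, r1, r2, i1, i2]
  generalize Complex.normSq w = n at *
  generalize (l * w).re = a
  generalize (l * w).im = b
  fin_cases i <;> simp [chartIsometry, Matrix.mulVec, dotProduct, Fin.sum_univ_succ] <;>
    field_simp <;> ring

theorem exampleSurface_isotropic {l : ℂ} (hl : ‖l‖ = 1) (a : Fin 2) : ∃ e₁ e₂ α β,
    IsIsotropicSurface (-1) (fun z => exampleSurface l (sphereChart a z)) e₁ e₂ α β := by
  have hl0 : l ≠ 0 := fun h => by simp [h] at hl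
  obtain ⟨α, β, S⟩ := isIsotropicSurface_modelSurface
  fin_cases a
  · exact ⟨_, _, _, _, S.comp_mul_left (inv_ne_zero hl0)⟩
  · have S' := (S.comp_mul_left (mul_ne_zero two_ne_zero hl0)).mulVec chartIsometry_orthogonal
    rw [det_chartIsometry, mul_one] at S'
    have e : (fun z => exampleSurface l (sphereChart 1 z)) = fun z =>
        WithLp.toLp 2 (chartIsometry *ᵥ (modelSurface (2 * l * z)).ofLp) :=
      funext (exampleSurface_chart_one hl)
    rw [← e] at S'
    exact ⟨_, _, _, _, S'⟩

theorem exampleDual_isotropic {l : ℂ} (hl : ‖l‖ = 1) (a : Fin 2) : ∃ e₁ e₂ α β,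
    IsIsotropicSurface 1 (fun z => exampleDual l (sphereChart a z)) e₁ e₂ α β := by
  obtain ⟨e₁, e₂, α, β, S⟩ := exampleSurface_isotropic hl a
  have S' := S.mulVec dualIsometry_orthogonal
  rw [det_dualIsometry, neg_one_mul, neg_neg] at S'
  exact ⟨_, _, _, _, S'⟩

theorem coneLift_eq (y : EuclideanSpace ℝ (Fin 5)) : coneLift y = ![1, y 0, y 1, y 2, y 3, y 4] :=
    by
  funext i
  fin_cases i <;> rfl

/-- An isometry of `ℝ⁵` acts on the light cone by an element of `O(1,5)`. -/
theorem conformallyEquivalentOn_exampleDual (l : ℂ) :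
    ConformallyEquivalentOn Set.univ (fun p => coneLift (exampleSurface l p))
      (fun p => coneLift (exampleDual l p)) := by
  refine ⟨!![1, 0, 0, 0, 0, 0; 0, -1, 0, 0, 0, 0; 0, 0, 0, 0, -1, 0; 0, 0, 0, 0, 0, -1;
    0, 0, -1, 0, 0, 0; 0, 0, 0, -1, 0, 0], ?_, fun p _ => ⟨1, one_ne_zero, ?_⟩⟩
  · ext i j
    fin_cases i <;> fin_cases j <;>
      simp [metricMatrix, Matrix.mul_apply, Fin.sum_univ_succ, Matrix.diagonal_apply]
  · rw [one_smul]
    funext i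
    fin_cases i <;> simp [coneLift_eq, exampleDual, dualIsometry, Matrix.mulVec, dotProduct,
      Fin.sum_univ_succ]

section

/-! ### The light cone vectors and the metric -/

/-- The light cone vector `2ς Y / √2`, as a function of `ζ = λ⁻¹ z`. -/
noncomputable def modelLift (ζ : ℂ) : Fin 6 → ℝ :=
  ![(1 + Complex.normSq ζ / 2) ^ 2, -(1 - Complex.normSq ζ / 2) ^ 2, -(2 * ζ.im), -(2 * ζ.re),
    Complex.normSq ζ * ζ.im, Complex.normSq ζ * ζ.re]

/-- The light cone vector `2ς Ŷ / √2`, as a function of `ζ = λ⁻¹ z`. -/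
noncomputable def modelDualLift (ζ : ℂ) : Fin 6 → ℝ :=
  ![(1 + Complex.normSq ζ / 2) ^ 2, (1 - Complex.normSq ζ / 2) ^ 2, -(Complex.normSq ζ * ζ.im),
    -(Complex.normSq ζ * ζ.re), 2 * ζ.im, 2 * ζ.re]

section UnitParameter

variable {l : ℂ} (hl : ‖l‖ = 1) (z : ℂ)

theorem normSq_inv_mul (hl : ‖l‖ = 1) (z : ℂ) : Complex.normSq (l⁻¹ * z) = ‖z‖ ^ 2 := by
  rw [Complex.normSq_mul, Complex.normSq_inv, Complex.normSq_eq_norm_sq, Complex.normSq_eq_norm_sq,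
    hl]
  norm_num

theorem star_inv_mul (hl : ‖l‖ = 1) (z : ℂ) : star (l⁻¹ * z) = l * star z := by
  rw [star_mul', RCLike.star_def, map_inv₀, ← Complex.inv_eq_conj hl, inv_inv]

theorem exampleY_eq (hl : ‖l‖ = 1) (z : ℂ) :
    exampleY l z = (√2 / (2 * (1 - ‖z‖ ^ 4 / 4))) • modelLift (l⁻¹ * z) := by
  funext i
  refine Complex.ofReal_injective ?_
  rw [exampleYC_real hl, exampleYC, ← star_inv_mul hl z, neg_mul]
  have h1 := im_eq_star (l⁻¹ * z)
  have h2 := re_eq_star (l⁻¹ * z)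
  rw [modelLift, normSq_inv_mul hl]
  generalize star (l⁻¹ * z) = b at *
  generalize l⁻¹ * z = ζ at *
  simp only [Pi.smul_apply, smul_eq_mul, Complex.ofReal_mul]
  congr 1
  fin_cases i <;> simp [h1, h2] <;> ring

theorem exampleYh_eq (hl : ‖l‖ = 1) (z : ℂ) :
    exampleYh l z = (√2 / (2 * (1 - ‖z‖ ^ 4 / 4))) • modelDualLift (l⁻¹ * z) := by
  funext i
  refine Complex.ofReal_injective ?_
  rw [exampleYhC_real hl, exampleYhC, ← star_inv_mul hl z]
  have h1 := im_eq_star (l⁻¹ * z)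
  have h2 := re_eq_star (l⁻¹ * z)
  rw [modelDualLift, normSq_inv_mul hl]
  generalize star (l⁻¹ * z) = b at *
  generalize l⁻¹ * z = ζ at *
  simp only [Pi.smul_apply, smul_eq_mul, Complex.ofReal_mul]
  congr 1
  fin_cases i <;> simp [h1, h2] <;> ring

theorem toSphere_smul {n : ℕ} {c : ℝ} (hc : c ≠ 0) (Y : Fin (n + 1) → ℝ) :
    toSphere (c • Y) = toSphere Y := by
  ext i
  simp [toSphere, mul_div_mul_left _ _ hc]

theorem toSphere_modelLift (ζ : ℂ) : toSphere (modelLift ζ) = modelSurface ζ := by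
  ext i
  fin_cases i <;> simp [toSphere, modelLift, modelSurface, div_eq_inv_mul]

theorem toSphere_modelDualLift (ζ : ℂ) :
    toSphere (modelDualLift ζ) = WithLp.toLp 2 (dualIsometry *ᵥ (modelSurface ζ).ofLp) := by
  ext i
  fin_cases i <;> simp [toSphere, modelDualLift, modelSurface, div_eq_inv_mul, dualIsometry,
    Matrix.mulVec, dotProduct, Fin.sum_univ_succ]

theorem sqrt_two_div_ne_zero {z : ℂ} (hz : z ∈ exampleU) :
    √2 / (2 * (1 - ‖z‖ ^ 4 / 4)) ≠ 0 :=
  div_ne_zero (by norm_num) (mul_ne_zero two_ne_zero hz)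

theorem exampleSurface_eq_toSphere (hl : ‖l‖ = 1) {z : ℂ} (hz : z ∈ exampleU) :
    exampleSurface l z = toSphere (exampleY l z) := by
  rw [exampleY_eq hl, toSphere_smul (sqrt_two_div_ne_zero hz), toSphere_modelLift]
  rfl

theorem exampleDual_eq_toSphere (hl : ‖l‖ = 1) {z : ℂ} (hz : z ∈ exampleU) :
    exampleDual l z = toSphere (exampleYh l z) := by
  rw [exampleYh_eq hl, toSphere_smul (sqrt_two_div_ne_zero hz), toSphere_modelDualLift]
  rfl

theorem sqNorm_dz_modelSurface (ζ : ℂ) : dz (complexify modelSurface) ζ ⬝ᵥ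
    star (dz (complexify modelSurface) ζ) =
      (2 + 2 * (ζ * star ζ / 2) ^ 2) * ((1 + ζ * star ζ / 2) ^ 4)⁻¹ := by
  have h0 := one_add_ne_zero ζ
  have s : star (ζ * star ζ / 2) = ζ * star ζ / 2 := by
    simp only [star_div₀, star_mul', star_star, star_ofNat]
    ring
  rw [dz_complexify_modelSurface, star_add, star_smul, star_smul, star_modelFrame₁,
    star_modelFrame₂, modelFrame₁, modelFrame₂]
  simp only [star_mul' _ (_ ^ 3 : ℂ), star_sub, star_one, star_pow, star_inv₀, star_add, s]
  have ht : (1 + ζ * star ζ / 2)⁻¹ * (1 + ζ * star ζ / 2) = 1 := inv_mul_cancel₀ h0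
  rw [← inv_pow]
  generalize (1 + ζ * star ζ / 2)⁻¹ = t at ht ⊢
  generalize star ζ = b at ht ⊢
  simp [dotProduct, Fin.sum_univ_succ]
  ring_nf
  simp only [Complex.I_sq]
  linear_combination (2 + 2 * (ζ * b / 2) ^ 2) * t ^ 4 * (t * (1 + ζ * b / 2) + 1) * ht

theorem metric_exampleSurface (hl : ‖l‖ = 1) (z : ℂ) :
    mink (dz (complexLift fun w : ℂ => exampleSurface l w) z)
      (dzbar (complexLift fun w : ℂ => exampleSurface l w) z) =
      (((2 + ‖z‖ ^ 4 / 2) / (1 + ‖z‖ ^ 2 / 2) ^ 4 : ℝ) : ℂ) := by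
  obtain ⟨α, β, S⟩ := isIsotropicSurface_modelSurface
  have hl0 : l ≠ 0 := fun h => by simp [h] at hl
  have S' := S.comp_mul_left (inv_ne_zero hl0)
  change mink (dz (complexLift fun w : ℂ => modelSurface (l⁻¹ * w)) z)
      (dzbar (complexLift fun w : ℂ => modelSurface (l⁻¹ * w)) z) = _
  have e : dz (complexify fun w : ℂ => modelSurface (l⁻¹ * w)) z =
      l⁻¹ • dz (complexify modelSurface) (l⁻¹ * z) :=
    ((hasWirtingerAt_of_differentiableAt ((contDiff_complexify S.smooth).differentiable
      (by simp) (l⁻¹ * z))).comp_mul_left).dz_eq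
  have hll : l⁻¹ * star l⁻¹ = 1 := by
    rw [RCLike.star_def, Complex.mul_conj, Complex.normSq_eq_norm_sq, norm_inv, hl]
    norm_num
  rw [dz_complexLift S'.smooth, dzbar_complexLift S'.smooth, dzbar_complexify S'.smooth, mink_cons,
    e, star_smul, smul_dotProduct, dotProduct_smul, sqNorm_dz_modelSurface, ← normSq_eq_star,
    normSq_inv_mul hl, smul_eq_mul, smul_eq_mul, ← mul_assoc, hll]
  push_cast
  ring

/-- On the curve `ς = 0` both surfaces lie in the fixed set of the isometry between them. -/
theorem exampleSurface_eq_exampleDual (hl : ‖l‖ = 1) {z : ℂ} (hz : 1 - ‖z‖ ^ 4 / 4 = 0) :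
    exampleSurface l z = exampleDual l z := by
  have hq : ‖z‖ ^ 2 = 2 := by nlinarith [sq_nonneg ‖z‖]
  change modelSurface (l⁻¹ * z) = WithLp.toLp 2 (dualIsometry *ᵥ (modelSurface (l⁻¹ * z)).ofLp)
  ext i
  fin_cases i <;> simp [modelSurface, normSq_inv_mul hl, hq, dualIsometry, Matrix.mulVec,
    dotProduct, Fin.sum_univ_succ]

end UnitParameter

/-! ### The minimal surface -/

/-- The real part of an isotropic holomorphic curve is a minimal surface. -/
theorem isMinimalSurfaceOn_re {n : ℕ} {S : Set ℂ} (hS : IsOpen S) {φ φ' φ'' : ℂ → Fin n → ℂ}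
    (h1 : ∀ z ∈ S, ∀ i, HasDerivAt (fun w => φ w i) (φ' z i) z)
    (h2 : ∀ z ∈ S, ∀ i, HasDerivAt (fun w => φ' w i) (φ'' z i) z)
    (iso : ∀ z ∈ S, φ' z ⬝ᵥ φ' z = 0) (ne : ∀ z ∈ S, φ' z ≠ 0) :
    IsMinimalSurfaceOn S fun z => (WithLp.toLp 2 fun i => (φ z i).re : EuclideanSpace ℝ (Fin n)) :=
        by
  -- the derivative of the real part of a holomorphic curve
  have key : ∀ {ψ : ℂ → Fin n → ℂ} {ψ' : Fin n → ℂ} {z : ℂ},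
      (∀ i, HasDerivAt (fun w => ψ w i) (ψ' i) z) → ∀ v : ℂ,
      fderiv ℝ (fun w => (WithLp.toLp 2 fun i => (ψ w i).re : EuclideanSpace ℝ (Fin n))) z v =
        WithLp.toLp 2 fun i => (v * ψ' i).re := by
    intro ψ ψ' z hψ v
    have hd : ∀ i, HasFDerivAt (fun w => (ψ w i).re) (Complex.reCLM.comp
        ((ContinuousLinearMap.toSpanSingleton ℂ (ψ' i)).restrictScalars ℝ)) z := fun i =>
      Complex.reCLM.hasFDerivAt.comp z ((hψ i).hasFDerivAt.restrictScalars ℝ)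
    have hp : HasFDerivAt (fun w i => (ψ w i).re) (ContinuousLinearMap.pi fun i =>
        Complex.reCLM.comp
        ((ContinuousLinearMap.toSpanSingleton ℂ (ψ' i)).restrictScalars ℝ)) z := hasFDerivAt_pi.2 hd
    have hl := (PiLp.hasFDerivAt_toLp (𝕜 := ℝ) (E := fun _ : Fin n => ℝ) 2
      fun i => (ψ z i).re).comp z hp
    rw [show (fun w => (WithLp.toLp 2 fun i => (ψ w i).re : EuclideanSpace ℝ (Fin n))) =
      WithLp.toLp 2 ∘ fun w i => (ψ w i).re from rfl, hl.fderiv]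
    ext i
    simp
  set x : ℂ → EuclideanSpace ℝ (Fin n) := fun z => WithLp.toLp 2 fun i => (φ z i).re with hx
  have hpd : ∀ z ∈ S, ∀ i, pd i x z = WithLp.toLp 2 fun k => (![1, Complex.I] i * φ' z k).re :=
    fun z hz i => key (h1 z hz) _
  have hpd2 : ∀ z ∈ S, ∀ i j, pd i (pd j x) z =
      WithLp.toLp 2 fun k => (![1, Complex.I] i * (![1, Complex.I] j * φ'' z k)).re := by
    intro z hz i j
    have e : pd j x =ᶠ[𝓝 z] fun w => WithLp.toLp 2 fun k => (![1, Complex.I] j * φ' w k).re :=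
      Filter.eventuallyEq_of_mem (hS.mem_nhds hz) fun w hw => hpd w hw j
    rw [pd, e.fderiv_eq]
    exact key (ψ := fun w k => ![1, Complex.I] j * φ' w k) (fun k => (h2 z hz k).const_mul _) _
  have hinner : ∀ z ∈ S, ∀ u v : ℂ,
      inner ℝ (WithLp.toLp 2 fun k => (u * φ' z k).re : EuclideanSpace ℝ (Fin n))
        (WithLp.toLp 2 fun k => (v * φ' z k).re) = sqNorm (φ' z) / 2 * inner ℝ u v := by
    intro z hz u v
    have k1 : ∀ k, (u * φ' z k).re * (v * φ' z k).re =
        1 / 2 * ((u * v * (φ' z k * φ' z k)).re +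
          Complex.normSq (φ' z k) * ((starRingEnd ℂ) u * v).re) := fun k => by
      simp only [Complex.mul_re, Complex.mul_im, Complex.normSq_apply, Complex.conj_re,
        Complex.conj_im]
      ring
    have k2 : ∑ k, (u * v * (φ' z k * φ' z k)).re = 0 := by
      rw [← Complex.re_sum, ← Finset.mul_sum]
      have := iso z hz
      rw [dotProduct] at this
      rw [this, mul_zero, Complex.zero_re]
    rw [inner_eq_dotProduct, dotProduct]
    simp only [k1]
    rw [← Finset.mul_sum, Finset.sum_add_distrib, k2, ← Finset.sum_mul, Complex.inner, sqNorm,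
      mul_comm ((starRingEnd ℂ) u)]
    ring
  refine ⟨?_, fun z hz => ?_, fun z hz => ?_⟩
  · refine (contDiffOn_piLp 2).2 fun i => ?_
    have hd : DifferentiableOn ℂ (fun w => φ w i) S :=
      fun z hz => (h1 z hz i).differentiableAt.differentiableWithinAt
    exact Complex.reCLM.contDiff.comp_contDiffOn ((hd.contDiffOn hS).restrict_scalars ℝ)
  · rw [conformalAt_iff']
    refine ⟨sqNorm (φ' z) / 2, half_pos (sqNorm_pos (ne z hz)), fun u v => ?_⟩
    rw [key (h1 z hz), key (h1 z hz), hinner z hz]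
  · have hN := sqNorm_pos (ne z hz)
    have hg : firstForm x z = (sqNorm (φ' z) / 2) • (1 : Matrix (Fin 2) (Fin 2) ℝ) := by
      ext i j
      rw [firstForm, Matrix.of_apply, hpd z hz, hpd z hz, hinner z hz]
      fin_cases i <;> fin_cases j <;> simp [Complex.inner]
    have hgi : (firstForm x z)⁻¹ = (sqNorm (φ' z) / 2)⁻¹ • (1 : Matrix (Fin 2) (Fin 2) ℝ) := by
      refine Matrix.inv_eq_right_inv ?_
      rw [hg, smul_mul_smul_comm, mul_inv_cancel₀ (half_pos hN).ne', one_mul, one_smul]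
    -- the coordinate functions are harmonic
    have hlap : pd 1 (pd 1 x) z = -pd 0 (pd 0 x) z := by
      rw [hpd2 z hz, hpd2 z hz]
      ext k
      simp
    rw [meanCurvature, hgi]
    simp only [Fin.sum_univ_two, Matrix.smul_apply, Matrix.one_apply_eq, ne_eq, zero_ne_one,
      not_false_eq_true, Matrix.one_apply_ne, one_ne_zero, smul_eq_mul, mul_one, mul_zero,
          zero_smul,
      add_zero, zero_add, flatSecondForm, hgi, hlap, inner_neg_left, mul_neg, neg_smul, zero_mul]
    module

theorem isMinimalSurfaceOn_exampleX {l : ℂ} (hl : ‖l‖ = 1) :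
    IsMinimalSurfaceOn {z | z ≠ 0} (exampleX l) := by
  have hl0 : l ≠ 0 := fun h => by simp [h] at hl
  -- `x` is the real part of `φ = (-4iλ/z, -4λ/z, -2iλ⁻¹z, 2λ⁻¹z)`
  have e : exampleX l = fun z => WithLp.toLp 2 fun i =>
      ((![-4 * Complex.I * l * z⁻¹, -4 * l * z⁻¹, -2 * Complex.I * l⁻¹ * z, 2 * l⁻¹ * z] :
        Fin 4 → ℂ) i).re := by
    funext z
    ext i
    have hb : ∀ w : ℂ, (w.re : ℂ) = (w + star w) / 2 := re_eq_star
    refine Complex.ofReal_injective ?_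
    rw [exampleXC_real hl, exampleXC, hb]
    have s1 : star l = l⁻¹ := (Complex.inv_eq_conj hl).symm
    have hI : star Complex.I = -Complex.I := Complex.conj_I
    fin_cases i <;> simp only [Fin.zero_eta, Fin.mk_one, Fin.reduceFinMk, Matrix.cons_val,
      star_mul', star_neg, star_inv₀, s1, star_ofNat, hI, inv_inv] <;> ring
  rw [e]
  refine isMinimalSurfaceOn_re isOpen_ne
    (φ' := fun z => ![-4 * Complex.I * l * (-(z ^ 2)⁻¹), -4 * l * (-(z ^ 2)⁻¹),
      -2 * Complex.I * l⁻¹, 2 * l⁻¹])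
    (φ'' := fun z => ![-4 * Complex.I * l * (2 * (z ^ 3)⁻¹), -4 * l * (2 * (z ^ 3)⁻¹), 0, 0])
    (fun z hz i => ?_) (fun z hz i => ?_) (fun z hz => ?_) (fun z hz h => ?_)
  · fin_cases i
    · exact (hasDerivAt_inv hz).const_mul _
    · exact (hasDerivAt_inv hz).const_mul _
    · exact ((hasDerivAt_id z).const_mul (-2 * Complex.I * l⁻¹)).congr_deriv (mul_one _)
    · exact ((hasDerivAt_id z).const_mul (2 * l⁻¹)).congr_deriv (mul_one _)
  · have hd : HasDerivAt (fun w : ℂ => -(w ^ 2)⁻¹) (2 * (z ^ 3)⁻¹) z := by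
      have h0 : z ≠ 0 := hz
      refine ((hasDerivAt_pow 2 z).inv (pow_ne_zero 2 h0)).neg.congr_deriv ?_
      field_simp
      norm_num [mul_comm]
    fin_cases i
    · exact hd.const_mul _
    · exact hd.const_mul _
    · exact hasDerivAt_const z _
    · exact hasDerivAt_const z _
  · simp only [dotProduct, Fin.sum_univ_four, Matrix.cons_val]
    linear_combination ((4 * l * (-(z ^ 2)⁻¹)) ^ 2 + (2 * l⁻¹) ^ 2) * Complex.I_sq
  · have := congrFun h 3
    simp [hl0] at this

theorem exampleX_eq {l : ℂ} (hl : ‖l‖ = 1) {z : ℂ} (hz : z ≠ 0) :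
    exampleX l z = WithLp.toLp 2 ![-(4 * (l⁻¹ * z).im / Complex.normSq (l⁻¹ * z)),
      -(4 * (l⁻¹ * z).re / Complex.normSq (l⁻¹ * z)), 2 * (l⁻¹ * z).im, 2 * (l⁻¹ * z).re] := by
  have hl0 : l ≠ 0 := fun h => by simp [h] at hl
  ext i
  refine Complex.ofReal_injective ?_
  rw [exampleXC_real hl, exampleXC]
  have h1 := im_eq_star (l⁻¹ * z)
  have h2 := re_eq_star (l⁻¹ * z)
  have h3 := normSq_eq_star (l⁻¹ * z)
  rw [star_inv_mul hl] at h1 h2 h3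
  have hs : star z ≠ 0 := star_ne_zero.2 hz
  generalize star z = b at *
  fin_cases i <;> simp only [Fin.zero_eta, Fin.mk_one, Fin.reduceFinMk, Matrix.cons_val,
    Complex.ofReal_neg, Complex.ofReal_mul, Complex.ofReal_div, Complex.ofReal_ofNat, h1, h2, h3]
        <;>
    field_simp <;> ring

theorem conformallyEquivalentOn_exampleX {l : ℂ} (hl : ‖l‖ = 1) :
    ConformallyEquivalentOn {z : ℂ | z ≠ 0} (fun z => coneLift (exampleSurface l z))
      (fun z => stereoLift (exampleX l z)) := by
  have hl0 : l ≠ 0 := fun h => by simp [h] at hl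
  -- a Lorentz boost in the first two coordinates
  refine ⟨!![17 / 8, -15 / 8, 0, 0, 0, 0; -15 / 8, 17 / 8, 0, 0, 0, 0; 0, 0, 1, 0, 0, 0;
    0, 0, 0, 1, 0, 0; 0, 0, 0, 0, 1, 0; 0, 0, 0, 0, 0, 1], ?_, fun z hz => ?_⟩
  · ext i j
    fin_cases i <;> fin_cases j <;>
      simp [metricMatrix, Matrix.mul_apply, Fin.sum_univ_succ, Matrix.diagonal_apply] <;> norm_num
  · have hz0 : z ≠ 0 := hz
    have hn : 0 < Complex.normSq (l⁻¹ * z) :=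
      Complex.normSq_pos.2 (mul_ne_zero (inv_ne_zero hl0) hz0)
    refine ⟨Complex.normSq (l⁻¹ * z) / 2 * ((1 + Complex.normSq (l⁻¹ * z) / 2) ^ 2)⁻¹,
      by positivity, ?_⟩
    change _ *ᵥ coneLift (modelSurface (l⁻¹ * z)) = _ • stereoLift (exampleX l z)
    rw [exampleX_eq hl hz0, coneLift_eq, stereoLift, EuclideanSpace.real_norm_sq_eq, modelSurface]
    have h := Complex.normSq_apply (l⁻¹ * z)
    generalize Complex.normSq (l⁻¹ * z) = n at *
    generalize (l⁻¹ * z).re = a at *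
    generalize (l⁻¹ * z).im = b at *
    have hb : b ^ 2 = n - a ^ 2 := by rw [h]; ring
    funext i
    fin_cases i <;> simp [Matrix.mulVec, dotProduct, Fin.sum_univ_succ] <;> field_simp <;>
      ring_nf <;> simp only [hb] <;> ring

end

/-! ### The canonical lift of the model surface and its invariants -/

/-- The polynomial light cone vector of the model surface, with `b` in place of `ζ̄`. -/
noncomputable def polyLift (z b : ℂ) : Fin 6 → ℂ :=
  ![(1 + z * b / 2) ^ 2, -(1 - z * b / 2) ^ 2, Complex.I * (z - b), -(z + b),
    -(Complex.I * (z * b / 2) * (z - b)), z * b / 2 * (z + b)]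

/-- The polynomial light cone vector of the dual of the model surface. -/
noncomputable def polyDualLift (z b : ℂ) : Fin 6 → ℂ :=
  ![(1 + z * b / 2) ^ 2, (1 - z * b / 2) ^ 2, Complex.I * (z * b / 2) * (z - b),
    -(z * b / 2 * (z + b)), -(Complex.I * (z - b)), z + b]

/-- `∂_z` of `polyLift`. -/
noncomputable def polyLiftZ (z b : ℂ) : Fin 6 → ℂ :=
  ![b * (1 + z * b / 2), b * (1 - z * b / 2), Complex.I, -1, -(Complex.I * (z * b - b ^ 2 / 2)),
    z * b + b ^ 2 / 2]

/-- `∂_z̄` of `polyLift`. -/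
noncomputable def polyLiftB (z b : ℂ) : Fin 6 → ℂ :=
  ![z * (1 + z * b / 2), z * (1 - z * b / 2), -Complex.I, -1, -(Complex.I * (z ^ 2 / 2 - z * b)),
    z * b + z ^ 2 / 2]

/-- `∂_z ∂_z` of `polyLift`. -/
noncomputable def polyLiftZZ (_z b : ℂ) : Fin 6 → ℂ :=
  ![b ^ 2 / 2, -(b ^ 2 / 2), 0, 0, -(Complex.I * b), b]

/-- `∂_z ∂_z̄` of `polyLift`. -/
noncomputable def polyLiftZB (z b : ℂ) : Fin 6 → ℂ :=
  ![1 + z * b, 1 - z * b, 0, 0, -(Complex.I * (z - b)), z + b]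

/-- The isotropic section of the conformal normal bundle, an antiholomorphic polynomial. -/
noncomputable def polyNormal (b : ℂ) : Fin 6 → ℂ :=
  ![2 * b, -(2 * b), -(Complex.I * b ^ 2), -b ^ 2, -(2 * Complex.I), 2]

/-- `∂_z̄` of `polyNormal`. -/
noncomputable def polyNormalB (b : ℂ) : Fin 6 → ℂ :=
  ![2, -2, -(2 * Complex.I * b), -(2 * b), 0, 0]

theorem hasWirtingerAt_polyLift (z : ℂ) : HasWirtingerAt (fun w => polyLift w (star w))
    (polyLiftZ z (star z)) (polyLiftB z (star z)) z := by
  have hid := hasWirtingerAt_id z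
  have hst := hasWirtingerAt_star z
  have hI := hasWirtingerAt_const Complex.I z
  have h1 := hasWirtingerAt_const (1 : ℂ) z
  have hq : HasWirtingerAt (fun w => w * star w / 2) (star z / 2) (z / 2) z :=
    ((hid.mul hst).mul (hasWirtingerAt_const (2⁻¹ : ℂ) z)).congr (by ring) (by ring)
  have hsq : ∀ {f : ℂ → ℂ} {a b : ℂ}, HasWirtingerAt f a b z →
      HasWirtingerAt (fun w => f w ^ 2) (2 * f z * a) (2 * f z * b) z := fun {f} {a} {b} h => by
    have := (h.mul h).congr (a₁ := 2 * f z * a) (b₁ := 2 * f z * b) (by ring) (by ring)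
    simpa only [sq] using this
  refine ((hsq (h1.add hq)).vecCons ((hsq (h1.sub hq)).neg.vecCons ((hI.mul (hid.sub hst)).vecCons
    ((hid.add hst).neg.vecCons (((hI.mul hq).mul (hid.sub hst)).neg.vecCons
      ((hq.mul (hid.add hst)).vecCons (hasWirtingerAt_vecEmpty z))))))).congr ?_ ?_
  · rw [polyLiftZ]
    generalize star z = b
    funext i
    fin_cases i <;> simp <;> ring
  · rw [polyLiftB]
    generalize star z = b
    funext i
    fin_cases i <;> simp <;> ring

theorem hasWirtingerAt_polyLiftZ (z : ℂ) : HasWirtingerAt (fun w => polyLiftZ w (star w))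
    (polyLiftZZ z (star z)) (polyLiftZB z (star z)) z := by
  have hid := hasWirtingerAt_id z
  have hst := hasWirtingerAt_star z
  have c := fun x => hasWirtingerAt_const (x : ℂ) z
  have hq : HasWirtingerAt (fun w => w * star w / 2) (star z / 2) (z / 2) z :=
    ((hid.mul hst).mul (c 2⁻¹)).congr (by ring) (by ring)
  have hp : HasWirtingerAt (fun w => w * star w) (star z) z z :=
    (hid.mul hst).congr (by ring) (by ring)
  have hs : HasWirtingerAt (fun w => star w ^ 2 / 2) 0 (star z) z := by
    have := ((hst.mul hst).mul (c 2⁻¹)).congr (a₁ := 0) (b₁ := star z) (by ring) (by ring)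
    simpa only [sq, div_eq_mul_inv] using this
  refine ((hst.mul ((c 1).add hq)).vecCons ((hst.mul ((c 1).sub hq)).vecCons
    ((c Complex.I).vecCons ((c (-1)).vecCons (((c Complex.I).mul (hp.sub hs)).neg.vecCons
      ((hp.add hs).vecCons (hasWirtingerAt_vecEmpty z))))))).congr ?_ ?_
  · rw [polyLiftZZ]
    generalize star z = b
    funext i
    fin_cases i <;> simp <;> ring
  · rw [polyLiftZB]
    generalize star z = b
    funext i
    fin_cases i <;> simp <;> ring

theorem hasWirtingerAt_polyNormal (z : ℂ) : HasWirtingerAt (fun w => polyNormal (star w))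
    0 (polyNormalB (star z)) z := by
  have hst := hasWirtingerAt_star z
  have c := fun x => hasWirtingerAt_const (x : ℂ) z
  have hs : HasWirtingerAt (fun w => star w ^ 2) 0 (2 * star z) z := by
    have := (hst.mul hst).congr (a₁ := 0) (b₁ := 2 * star z) (by ring) (by ring)
    simpa only [sq] using this
  refine (((c 2).mul hst).vecCons (((c 2).mul hst).neg.vecCons
    (((c Complex.I).mul hs).neg.vecCons (hs.neg.vecCons ((c (-(2 * Complex.I))).vecCons
      ((c 2).vecCons (hasWirtingerAt_vecEmpty z))))))).congr ?_ ?_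
  · funext i
    fin_cases i <;> simp
  · rw [polyNormalB]
    generalize star z = b
    funext i
    fin_cases i <;> simp
    ring

/-- The scale `(4 + |ζ|⁴)^{-1/2}` of the canonical lift. -/
noncomputable def liftScale (z : ℂ) : ℂ := (((√(4 + Complex.normSq z ^ 2))⁻¹ : ℝ) : ℂ)

theorem liftScale_sq (z : ℂ) : liftScale z ^ 2 * (4 + z ^ 2 * star z ^ 2) = 1 := by
  have h0 : 0 < 4 + Complex.normSq z ^ 2 := by positivity
  have h1 : ((√(4 + Complex.normSq z ^ 2))⁻¹) ^ 2 * (4 + Complex.normSq z ^ 2) = 1 := by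
    rw [inv_pow, Real.sq_sqrt h0.le, inv_mul_cancel₀ h0.ne']
  have h2 : (4 + z ^ 2 * star z ^ 2 : ℂ) = ((4 + Complex.normSq z ^ 2 : ℝ) : ℂ) := by
    push_cast
    rw [normSq_eq_star]
    ring
  rw [h2, liftScale]
  exact_mod_cast h1

theorem hasWirtingerAt_liftScale (z : ℂ) : HasWirtingerAt liftScale
    (-(z * star z ^ 2 * liftScale z ^ 3)) (-(z ^ 2 * star z * liftScale z ^ 3)) z := by
  have hd : DifferentiableAt ℝ liftScale z := by
    have hn : Differentiable ℝ fun ζ : ℂ => Complex.normSq ζ := by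
      simp only [Complex.normSq_apply]
      exact ((Complex.reCLM.differentiable).mul Complex.reCLM.differentiable).add
        ((Complex.imCLM.differentiable).mul Complex.imCLM.differentiable)
    have h0 : 0 < 4 + Complex.normSq z ^ 2 := by positivity
    refine Complex.ofRealCLM.differentiableAt.comp z (DifferentiableAt.inv ?_
      (Real.sqrt_pos.2 h0).ne')
    exact (((hn z).pow 2).const_add 4).sqrt h0.ne'
  have hw := hasWirtingerAt_of_differentiableAt hd
  have hid := hasWirtingerAt_id z
  have hst := hasWirtingerAt_star z
  have hp := (hid.mul hst)
  have hz : (liftScale z) ≠ 0 := fun h => by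
    have := liftScale_sq z
    rw [h] at this
    norm_num at this
  have e := (hw.mul hw).mul ((hasWirtingerAt_const 4 z).add (hp.mul hp))
  have e' : (fun w => liftScale w * liftScale w * (4 + w * star w * (w * star w))) = fun _ => 1 :=
      by
    funext w
    rw [← liftScale_sq w]
    ring
  rw [e'] at e
  have k1 := e.dz_eq
  have k2 := e.dzbar_eq
  rw [(hasWirtingerAt_const 1 z).dz_eq] at k1
  rw [(hasWirtingerAt_const 1 z).dzbar_eq] at k2
  have hs := liftScale_sq z
  refine hw.congr ?_ ?_
  · refine mul_left_cancel₀ hz ?_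
    generalize star z = b at *
    linear_combination (-(1 / 2) * liftScale z ^ 2) * k1 +
      (-(liftScale z * dz liftScale z)) * hs
  · refine mul_left_cancel₀ hz ?_
    generalize star z = b at *
    linear_combination (-(1 / 2) * liftScale z ^ 2) * k2 +
      (-(liftScale z * dzbar liftScale z)) * hs

/-- The canonical lift of the model surface. -/
noncomputable def liftG (z : ℂ) : Fin 6 → ℂ := liftScale z • polyLift z (star z)

/-- `∂_z` of the canonical lift. -/
noncomputable def liftGZ (z : ℂ) : Fin 6 → ℂ :=
  (-(z * star z ^ 2 * liftScale z ^ 3)) • polyLift z (star z) +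
    liftScale z • polyLiftZ z (star z)

/-- `∂_z̄` of the canonical lift. -/
noncomputable def liftGB (z : ℂ) : Fin 6 → ℂ :=
  (-(z ^ 2 * star z * liftScale z ^ 3)) • polyLift z (star z) +
    liftScale z • polyLiftB z (star z)

/-- `∂_z ∂_z̄` of the canonical lift. -/
noncomputable def liftGZB (z : ℂ) : Fin 6 → ℂ :=
  (-(2 * z * star z * liftScale z ^ 3) + 3 * z ^ 3 * star z ^ 3 * liftScale z ^ 5) •
      polyLift z (star z) +
    (-(z * star z ^ 2 * liftScale z ^ 3)) • polyLiftB z (star z) +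
    (-(z ^ 2 * star z * liftScale z ^ 3)) • polyLiftZ z (star z) +
    liftScale z • polyLiftZB z (star z)

/-- The section `N` of the model surface. -/
noncomputable def liftN (z : ℂ) : Fin 6 → ℂ :=
  (2 : ℂ) • liftGZB z + (16 * z * star z * liftScale z ^ 4) • liftG z

/-- The coefficient of the conformal Hopf differential `κ` with respect to `polyNormal`. -/
noncomputable def hopfCoeff (z : ℂ) : ℂ := 2 * star z * liftScale z ^ 3

/-- `∂_z ∂_z` of the canonical lift, expressed through `κ` and the Schwarzian `24 z̄² / (4 + r⁴)²`.
-/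
noncomputable def liftGZZ (z : ℂ) : Fin 6 → ℂ :=
  hopfCoeff z • polyNormal (star z) - (12 * star z ^ 2 * liftScale z ^ 4) • liftG z

theorem hasWirtingerAt_liftG (z : ℂ) : HasWirtingerAt liftG (liftGZ z) (liftGB z) z :=
  (hasWirtingerAt_liftScale z).smul (hasWirtingerAt_polyLift z)

theorem liftScale_ne_zero (z : ℂ) : liftScale z ≠ 0 := fun h => by
  have := liftScale_sq z
  rw [h] at this
  norm_num at this

theorem four_add_ne_zero (z : ℂ) : 4 + z ^ 2 * star z ^ 2 ≠ 0 := fun h => by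
  have := liftScale_sq z
  rw [h] at this
  norm_num at this

theorem hasWirtingerAt_liftScale_pow_three (z : ℂ) : HasWirtingerAt (fun w => liftScale w ^ 3)
    (-(3 * z * star z ^ 2 * liftScale z ^ 5)) (-(3 * z ^ 2 * star z * liftScale z ^ 5)) z := by
  have hw := hasWirtingerAt_liftScale z
  have e : (fun w => liftScale w ^ 3) = fun w => liftScale w * liftScale w * liftScale w := by
    funext w
    ring
  rw [e]
  exact ((hw.mul hw).mul hw).congr (by ring) (by ring)

theorem hasWirtingerAt_liftGZ (z : ℂ) : HasWirtingerAt liftGZ (liftGZZ z) (liftGZB z) z := by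
  have hst := hasWirtingerAt_star z
  have hc : HasWirtingerAt (fun w => -(w * star w ^ 2 * liftScale w ^ 3))
      (-(star z ^ 2 * liftScale z ^ 3) + 3 * z ^ 2 * star z ^ 4 * liftScale z ^ 5)
      (-(2 * z * star z * liftScale z ^ 3) + 3 * z ^ 3 * star z ^ 3 * liftScale z ^ 5) z := by
    have e : (fun w => -(w * star w ^ 2 * liftScale w ^ 3)) =
        fun w => -(w * (star w * star w) * liftScale w ^ 3) := by
      funext w
      ring
    rw [e]
    exact ((((hasWirtingerAt_id z).mul (hst.mul hst)).mul
      (hasWirtingerAt_liftScale_pow_three z)).neg).congr (by ring) (by ring)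
  refine ((hc.smul (hasWirtingerAt_polyLift z)).add
    ((hasWirtingerAt_liftScale z).smul (hasWirtingerAt_polyLiftZ z))).congr ?_ ?_
  · have hs := liftScale_sq z
    have ha := four_add_ne_zero z
    rw [liftGZZ, hopfCoeff, liftG, polyLift, polyLiftZ, polyLiftZZ, polyNormal]
    generalize star z = b at *
    generalize liftScale z = t at *
    obtain ⟨a, hab⟩ : ∃ a, a = 4 + z ^ 2 * b ^ 2 := ⟨_, rfl⟩
    rw [← hab] at hs ha
    have h2 : t ^ 2 = a⁻¹ := eq_inv_of_mul_eq_one_left hs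
    have h3 : t ^ 3 = t * a⁻¹ := by rw [← h2]; ring
    have h4 : t ^ 4 = a⁻¹ ^ 2 := by rw [← h2]; ring
    have h5 : t ^ 5 = t * a⁻¹ ^ 2 := by rw [← h2]; ring
    rw [h3, h4, h5]
    funext i
    fin_cases i <;> simp <;> field_simp <;> rw [hab] <;> ring
  · rw [liftGZB]
    module

/-- All products needed for the canonical lift: `⟨Y, Y⟩`, `⟨Y, Y_z⟩`, `⟨Y_z, Y_z⟩`, `⟨Y, Y_zz̄⟩` and
`⟨Y_zz̄, Y_zz̄⟩`. -/
theorem mink_liftG (z : ℂ) : mink (liftG z) (liftG z) = 0 ∧ mink (liftG z) (liftGZ z) = 0 ∧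
    mink (liftGZ z) (liftGZ z) = 0 ∧ mink (liftG z) (liftGZB z) = -(1 / 2) ∧
    mink (liftGZB z) (liftGZB z) = 8 * z * star z * liftScale z ^ 4 := by
  have hs := liftScale_sq z
  have ha := four_add_ne_zero z
  simp only [liftG, liftGZ, liftGZB, mink_add_left, mink_add_right, mink_smul_left, mink_smul_right]
  generalize star z = b at *
  generalize liftScale z = t at *
  obtain ⟨a, hab⟩ : ∃ a, a = 4 + z ^ 2 * b ^ 2 := ⟨_, rfl⟩
  rw [← hab] at hs ha
  have h2 : t ^ 2 = a⁻¹ := eq_inv_of_mul_eq_one_left hs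
  have h3 : t ^ 3 = t * a⁻¹ := by rw [← h2]; ring
  have h4 : t ^ 4 = a⁻¹ ^ 2 := by rw [← h2]; ring
  have h5 : t ^ 5 = t * a⁻¹ ^ 2 := by rw [← h2]; ring
  rw [h3, h4, h5]
  -- the Gram matrix of the polynomial vectors
  have g00 : mink (polyLift z b) (polyLift z b) = 0 := by
    simp [mink, polyLift, Fin.sum_univ_succ]
    ring_nf
    simp only [Complex.I_sq]
    ring
  have g01 : mink (polyLift z b) (polyLiftZ z b) = 0 := by
    simp [mink, polyLift, polyLiftZ, Fin.sum_univ_succ]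
    ring_nf
    simp only [Complex.I_sq]
    ring
  have g11 : mink (polyLiftZ z b) (polyLiftZ z b) = 0 := by
    simp [mink, polyLiftZ, Fin.sum_univ_succ]
    ring_nf
    simp only [Complex.I_sq]
    ring
  have g02 : mink (polyLift z b) (polyLiftB z b) = 0 := by
    simp [mink, polyLift, polyLiftB, Fin.sum_univ_succ]
    ring_nf
    simp only [Complex.I_sq]
    ring
  have g22 : mink (polyLiftB z b) (polyLiftB z b) = 0 := by
    simp [mink, polyLiftB, Fin.sum_univ_succ]
    ring_nf
    simp only [Complex.I_sq]
    ring
  have g12 : mink (polyLiftZ z b) (polyLiftB z b) = a / 2 := by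
    rw [hab]
    simp [mink, polyLiftZ, polyLiftB, Fin.sum_univ_succ]
    ring_nf
    simp only [Complex.I_sq]
    ring
  have g03 : mink (polyLift z b) (polyLiftZB z b) = -(a / 2) := by
    rw [hab]
    simp [mink, polyLift, polyLiftZB, Fin.sum_univ_succ]
    ring_nf
    simp only [Complex.I_sq]
    ring
  have g13 : mink (polyLiftZ z b) (polyLiftZB z b) = 0 := by
    simp [mink, polyLiftZ, polyLiftZB, Fin.sum_univ_succ]
    ring_nf
    simp only [Complex.I_sq]
    ring
  have g23 : mink (polyLiftB z b) (polyLiftZB z b) = 0 := by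
    simp [mink, polyLiftB, polyLiftZB, Fin.sum_univ_succ]
    ring_nf
    simp only [Complex.I_sq]
    ring
  have g33 : mink (polyLiftZB z b) (polyLiftZB z b) = 0 := by
    simp [mink, polyLiftZB, Fin.sum_univ_succ]
    ring_nf
    simp only [Complex.I_sq]
    ring
  have ht : t * t = a⁻¹ := by rw [← h2]; ring
  have hta : t * t * a = 1 := by rw [ht, inv_mul_cancel₀ ha]
  simp only [g00, g01, g11, g02, g22, g12, g03, g13, g23, g33, mink_comm (polyLiftZ z b) (polyLift z
      b),
    mink_comm (polyLiftB z b) (polyLift z b), mink_comm (polyLiftB z b) (polyLiftZ z b),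
    mink_comm (polyLiftZB z b)]
  refine ⟨by ring, by ring, by ring, ?_, ?_⟩
  · linear_combination (-(1 / 2)) * hta
  · have hu : a⁻¹ * a = 1 := inv_mul_cancel₀ ha
    linear_combination (2 * z * b * a⁻¹ - 2 * z ^ 3 * b ^ 3 * a⁻¹ ^ 2) * hta -
      2 * z * b * a⁻¹ * hu + 2 * z * b * a⁻¹ ^ 2 * hab

theorem mink_polyNormal (z : ℂ) : mink (polyNormal (star z)) (polyNormal (star z)) = 0 ∧
    mink (polyNormal (star z)) (polyNormalB (star z)) = 0 ∧
    mink (polyNormalB (star z)) (polyNormalB (star z)) = 0 ∧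
    mink (polyNormal (star z)) (liftG z) = 0 ∧ mink (polyNormal (star z)) (liftGZ z) = 0 ∧
    mink (polyNormal (star z)) (liftGB z) = 0 ∧ mink (polyNormal (star z)) (liftN z) = 0 ∧
    mink (polyNormalB (star z)) (liftG z) = 0 ∧ mink (polyNormalB (star z)) (liftGZ z) = 0 := by
  have hn : mink (polyNormal (star z)) (polyNormal (star z)) = 0 ∧
      mink (polyNormal (star z)) (polyNormalB (star z)) = 0 ∧
      mink (polyNormalB (star z)) (polyNormalB (star z)) = 0 ∧
      mink (polyNormal (star z)) (polyLift z (star z)) = 0 ∧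
      mink (polyNormal (star z)) (polyLiftZ z (star z)) = 0 ∧
      mink (polyNormal (star z)) (polyLiftB z (star z)) = 0 ∧
      mink (polyNormal (star z)) (polyLiftZB z (star z)) = 0 ∧
      mink (polyNormalB (star z)) (polyLift z (star z)) = 0 ∧
      mink (polyNormalB (star z)) (polyLiftZ z (star z)) = 0 := by
    generalize star z = b
    refine ⟨?_, ?_, ?_, ?_, ?_, ?_, ?_, ?_, ?_⟩ <;>
      simp [mink, polyLift, polyLiftZ, polyLiftB, polyLiftZB, polyNormal, polyNormalB,
        Fin.sum_univ_succ] <;> ring_nf <;> simp only [Complex.I_sq] <;> ring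
  obtain ⟨n1, n2, n3, n4, n5, n6, n7, n8, n9⟩ := hn
  refine ⟨n1, n2, n3, ?_, ?_, ?_, ?_, ?_, ?_⟩ <;>
    simp only [liftN, liftG, liftGZ, liftGB, liftGZB, mink_add_right, mink_smul_right, n4, n5, n6,
        n7,
      n8, n9] <;> ring

section

/-! ### The adjoint transform -/

/-- The function `μ` of the model surface, `2 ζ ζ̄² (12 + r⁴) / (16 - r⁸)`. -/
noncomputable def modelMu (z : ℂ) : ℂ :=
  (24 * z + 2 * (z * z * z) * (star z * star z)) * (star z * star z) *
    (16 - z * z * (z * z) * (star z * star z * (star z * star z)))⁻¹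

theorem hasWirtingerAt_modelMu {z : ℂ} (hz : 4 - z ^ 2 * star z ^ 2 ≠ 0) : ∃ c, HasWirtingerAt
    modelMu
    (modelMu z ^ 2 / 2 + 24 * star z ^ 2 * liftScale z ^ 4) c z := by
  have hid := hasWirtingerAt_id z
  have hst := hasWirtingerAt_star z
  have c := fun x => hasWirtingerAt_const (x : ℂ) z
  have ha := four_add_ne_zero z
  have hg0 : 16 - z * z * (z * z) * (star z * star z * (star z * star z)) ≠ 0 := by
    have := mul_ne_zero ha hz
    convert this using 1
    ring
  have hm := (((((c 24).mul hid).add (((c 2).mul ((hid.mul hid).mul hid)).mul (hst.mul hst))).mul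
    (hst.mul hst)).mul (((c 16).sub (((hid.mul hid).mul (hid.mul hid)).mul
      ((hst.mul hst).mul (hst.mul hst)))).inv hg0))
  refine ⟨_, hm.congr ?_ rfl⟩
  have h4 : liftScale z ^ 4 = (4 + z ^ 2 * star z ^ 2)⁻¹ ^ 2 := by
    rw [← eq_inv_of_mul_eq_one_left (liftScale_sq z)]
    ring
  rw [h4, modelMu]
  generalize star z = b at *
  have hg : 16 - z * z * (z * z) * (b * b * (b * b)) = (4 + z ^ 2 * b ^ 2) * (4 - z ^ 2 * b ^ 2) :=
      by
    ring
  rw [hg] at hg0 ⊢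
  obtain ⟨a, hab⟩ : ∃ a, a = 4 + z ^ 2 * b ^ 2 := ⟨_, rfl⟩
  obtain ⟨d, hd⟩ : ∃ d, d = 4 - z ^ 2 * b ^ 2 := ⟨_, rfl⟩
  rw [← hab] at ha hg0
  rw [← hd] at hz hg0
  rw [← hab, ← hd]
  field_simp
  rw [hab, hd]
  ring

theorem star_modelMu (z : ℂ) : star (modelMu z) =
    (24 * star z + 2 * (star z * star z * star z) * (z * z)) * (z * z) *
      (16 - z * z * (z * z) * (star z * star z * (star z * star z)))⁻¹ := by
  simp only [modelMu, star_mul', star_inv₀, star_add, star_sub, star_star, star_ofNat]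
  rw [mul_comm (star z * star z * (star z * star z))]

/-- The dual light cone vector in terms of the moving frame of the model surface. -/
theorem liftN_add (z : ℂ) (hz : 4 - z ^ 2 * star z ^ 2 ≠ 0) :
    liftN z + star (modelMu z) • liftGZ z + modelMu z • liftGB z +
      (modelMu z * star (modelMu z) / 2) • liftG z =
    (8 * (liftScale z)⁻¹ * ((4 - z ^ 2 * star z ^ 2)⁻¹) ^ 2) • polyDualLift z (star z) := by
  have hs := liftScale_sq z
  have ha := four_add_ne_zero z
  have ht := liftScale_ne_zero z
  rw [star_modelMu, modelMu, liftN, liftGZB, liftGZ, liftGB, liftG, polyLift, polyLiftZ, polyLiftB,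
    polyLiftZB, polyDualLift]
  generalize star z = b at *
  generalize liftScale z = t at *
  have hg : 16 - z * z * (z * z) * (b * b * (b * b)) = (4 + z ^ 2 * b ^ 2) * (4 - z ^ 2 * b ^ 2) :=
      by
    ring
  rw [hg]
  obtain ⟨a, hab⟩ : ∃ a, a = 4 + z ^ 2 * b ^ 2 := ⟨_, rfl⟩
  obtain ⟨d, hd⟩ : ∃ d, d = 4 - z ^ 2 * b ^ 2 := ⟨_, rfl⟩
  rw [← hab] at hs ha
  rw [← hd] at hz
  rw [← hab, ← hd]
  have h2 : t ^ 2 = a⁻¹ := eq_inv_of_mul_eq_one_left hs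
  have h3 : t ^ 3 = t * a⁻¹ := by rw [← h2]; ring
  have h4 : t ^ 4 = a⁻¹ ^ 2 := by rw [← h2]; ring
  have h5 : t ^ 5 = t * a⁻¹ ^ 2 := by rw [← h2]; ring
  have h1 : t⁻¹ = t * a := by
    refine inv_eq_of_mul_eq_one_left ?_
    rw [← hs]
    ring
  rw [h1, h3, h4, h5]
  funext i
  fin_cases i <;> simp <;> field_simp <;> rw [hab, hd] <;> ring

section Pullback

variable {l : ℂ}

theorem exampleU_iff (hl : ‖l‖ = 1) (z : ℂ) :
    z ∈ exampleU ↔ 4 - (l⁻¹ * z) ^ 2 * star (l⁻¹ * z) ^ 2 ≠ 0 := by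
  have h1 : (4 - (l⁻¹ * z) ^ 2 * star (l⁻¹ * z) ^ 2 : ℂ) = ((4 * (1 - ‖z‖ ^ 4 / 4) : ℝ) : ℂ) := by
    rw [← mul_pow, ← normSq_eq_star, normSq_inv_mul hl]
    push_cast
    ring
  rw [h1, Complex.ofReal_ne_zero]
  simp [exampleU]

theorem complexLift_modelSurface (z : ℂ) :
    complexLift modelSurface z = ((1 + z * star z / 2) ^ 2)⁻¹ • polyLift z (star z) := by
  have h0 := one_add_ne_zero z
  rw [complexLift_eq]
  change (Fin.cons 1 (complexify modelSurface z) : Fin 6 → ℂ) = _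
  rw [complexify_modelSurface, polyLift, sq, mul_inv]
  funext i
  refine Fin.cases ?_ (fun i => ?_) i
  · rw [Fin.cons_zero, Pi.smul_apply, smul_eq_mul, Matrix.cons_val_zero, mul_mul_mul_comm,
      inv_mul_cancel₀ h0, one_mul]
  · rw [Fin.cons_succ, Pi.smul_apply, Pi.smul_apply, Matrix.cons_val_succ]
    congr 1
    fin_cases i <;> simp [sq]

theorem canonicalLift_exampleSurface (hl : ‖l‖ = 1) :
    canonicalLift (fun z : ℂ => exampleSurface l z) = fun z => liftG (l⁻¹ * z) := by
  funext z
  rw [canonicalLift, metric_exampleSurface hl, Complex.ofReal_re]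
  change _ • complexLift modelSurface (l⁻¹ * z) = _
  have h0 : 0 < 1 + ‖z‖ ^ 2 / 2 := by positivity
  have e : 2 * ((2 + ‖z‖ ^ 4 / 2) / (1 + ‖z‖ ^ 2 / 2) ^ 4) =
      (4 + (‖z‖ ^ 2) ^ 2) / ((1 + ‖z‖ ^ 2 / 2) ^ 2) ^ 2 := by
    field_simp
    ring
  rw [complexLift_modelSurface, smul_smul, liftG, liftScale, normSq_inv_mul hl, e, Real.sqrt_div'
    _ (by positivity), Real.sqrt_sq (by positivity), ← normSq_eq_star, normSq_inv_mul hl]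
  congr 1
  rw [inv_div, div_eq_mul_inv]
  have h1 : (1 + (‖z‖ : ℂ) ^ 2 / 2) ≠ 0 := by exact_mod_cast h0.ne'
  have h2 : (((1 + ‖z‖ ^ 2 / 2) ^ 2 : ℝ) : ℂ) = (1 + (‖z‖ : ℂ) ^ 2 / 2) ^ 2 := by push_cast; rfl
  rw [mul_comm, Complex.ofReal_mul, h2, Complex.ofReal_pow, ← mul_assoc,
    inv_mul_cancel₀ (pow_ne_zero 2 h1), one_mul]

theorem conj_inv_mul (hl : ‖l‖ = 1) : (starRingEnd ℂ) l⁻¹ * l⁻¹ = 1 := by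
  rw [← Complex.normSq_eq_conj_mul_self, Complex.normSq_eq_norm_sq, norm_inv, hl]
  norm_num

theorem dz_canonicalLift (hl : ‖l‖ = 1) : dz (canonicalLift fun z : ℂ => exampleSurface l z) =
    fun z => l⁻¹ • liftGZ (l⁻¹ * z) := by
  rw [canonicalLift_exampleSurface hl]
  exact funext fun z => ((hasWirtingerAt_liftG (l⁻¹ * z)).comp_mul_left).dz_eq

theorem dzbar_canonicalLift (hl : ‖l‖ = 1) : dzbar (canonicalLift fun z : ℂ => exampleSurface l z) =
    fun z => (starRingEnd ℂ) l⁻¹ • liftGB (l⁻¹ * z) := by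
  rw [canonicalLift_exampleSurface hl]
  exact funext fun z => ((hasWirtingerAt_liftG (l⁻¹ * z)).comp_mul_left).dzbar_eq

theorem hasWirtingerAt_dz_canonicalLift (hl : ‖l‖ = 1) (z : ℂ) :
    HasWirtingerAt (dz (canonicalLift fun z : ℂ => exampleSurface l z))
      ((l⁻¹ ^ 2) • liftGZZ (l⁻¹ * z)) (liftGZB (l⁻¹ * z)) z := by
  rw [dz_canonicalLift hl]
  refine ((hasWirtingerAt_const l⁻¹ z).smul ((hasWirtingerAt_liftGZ (l⁻¹ * z)).comp_mul_left)).congr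
    ?_ ?_
  · rw [zero_smul, zero_add, smul_smul, sq]
  · rw [zero_smul, zero_add, smul_smul, mul_comm, conj_inv_mul hl, one_smul]

theorem sectionN_canonicalLift (hl : ‖l‖ = 1) (z : ℂ) :
    sectionN (canonicalLift fun z : ℂ => exampleSurface l z) z = liftN (l⁻¹ * z) := by
  rw [sectionN, (hasWirtingerAt_dz_canonicalLift hl z).dzbar_eq, (mink_liftG _).2.2.2.2,
    canonicalLift_exampleSurface hl, liftN]
  congr 2
  ring

theorem mink_liftG_liftN (z : ℂ) : mink (liftG z) (liftN z) = -1 := by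
  obtain ⟨h00, -, -, h03, -⟩ := mink_liftG z
  rw [liftN, mink_add_right, mink_smul_right, mink_smul_right, h03, h00]
  ring

theorem schwarzian_canonicalLift (hl : ‖l‖ = 1) (z : ℂ) :
    schwarzian (canonicalLift fun z : ℂ => exampleSurface l z) z =
      l⁻¹ ^ 2 * (24 * star (l⁻¹ * z) ^ 2 * liftScale (l⁻¹ * z) ^ 4) := by
  obtain ⟨-, -, -, -, -, -, hEN, -, -⟩ := mink_polyNormal (l⁻¹ * z)
  rw [schwarzian, (hasWirtingerAt_dz_canonicalLift hl z).dz_eq, sectionN_canonicalLift hl, liftGZZ,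
    mink_smul_left, mink_sub_left, mink_smul_left, mink_smul_left, hEN, mink_liftG_liftN]
  ring

theorem hopf_canonicalLift (hl : ‖l‖ = 1) :
    hopf (canonicalLift fun z : ℂ => exampleSurface l z) = fun z =>
      l⁻¹ ^ 2 • (hopfCoeff (l⁻¹ * z) • polyNormal (star (l⁻¹ * z))) := by
  funext z
  rw [hopf, (hasWirtingerAt_dz_canonicalLift hl z).dz_eq, schwarzian_canonicalLift hl, liftGZZ,
    canonicalLift_exampleSurface hl]
  module

/-- The vector `D_z̄ κ + (μ̄ / 2) κ` lies in the totally isotropic subspace spanned by `Y`, `Y_z`,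
the antiholomorphic normal section and its derivative. -/
theorem mink_dzbarHopf (hl : ‖l‖ = 1) (z m : ℂ) :
    mink (dzbarHopf (canonicalLift fun z : ℂ => exampleSurface l z) z +
        m • hopf (canonicalLift fun z : ℂ => exampleSurface l z) z)
      (dzbarHopf (canonicalLift fun z : ℂ => exampleSurface l z) z +
        m • hopf (canonicalLift fun z : ℂ => exampleSurface l z) z) = 0 := by
  obtain ⟨n1, n2, n3, n4, n5, n6, n7, n8, n9⟩ := mink_polyNormal (l⁻¹ * z)
  obtain ⟨h00, h01, h11, -, -⟩ := mink_liftG (l⁻¹ * z)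
  obtain ⟨a, c, hc⟩ : ∃ a c, HasWirtingerAt hopfCoeff a c (l⁻¹ * z) :=
    ⟨_, _, ((hasWirtingerAt_const 2 _).mul (hasWirtingerAt_star _)).mul
      (hasWirtingerAt_liftScale_pow_three _)⟩
  have hw := ((hasWirtingerAt_const (l⁻¹ ^ 2) z).smul
    ((hc.smul (hasWirtingerAt_polyNormal (l⁻¹ * z))).comp_mul_left)).dzbar_eq
  rw [dzbarHopf, normalProj, hopf_canonicalLift hl, hw, sectionN_canonicalLift hl,
    dz_canonicalLift hl, dzbar_canonicalLift hl, canonicalLift_exampleSurface hl]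
  simp only [mink_add_left, mink_add_right, mink_sub_left, mink_sub_right, mink_smul_left,
    mink_smul_right, n1, n2, n3, n4, n5, n6, n7, n8, n9, h00, h01, h11, zero_smul, zero_add,
    mink_comm (liftG _) (polyNormal _), mink_comm (liftG _) (polyNormalB _),
    mink_comm (liftGZ _) (polyNormal _), mink_comm (liftGZ _) (polyNormalB _),
    mink_comm (polyNormalB _) (polyNormal _), mink_comm (liftGZ _) (liftG _), mul_zero, add_zero,
    sub_zero]

theorem complexify_modelDualLift (z : ℂ) :
    (fun i => (modelDualLift z i : ℂ)) = polyDualLift z (star z) := by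
  have h1 := im_eq_star z
  have h2 := re_eq_star z
  have h3 := normSq_eq_star z
  rw [modelDualLift, polyDualLift]
  generalize star z = b at *
  funext i
  fin_cases i <;> simp [h1, h2, h3] <;> ring

theorem isAdjointTransformOn_example (hl : ‖l‖ = 1) :
    IsAdjointTransformOn exampleU (fun z => exampleSurface l z) (exampleYh l) := by
  have hU : ∀ {z : ℂ}, z ∈ exampleU → 4 - (l⁻¹ * z) ^ 2 * star (l⁻¹ * z) ^ 2 ≠ 0 :=
    fun {z} hz => (exampleU_iff hl z).1 hz
  refine ⟨fun z => l⁻¹ * modelMu (l⁻¹ * z), ?_, fun z hz => ⟨?_, ?_, mink_dzbarHopf hl z _⟩⟩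
  · have hk : ContDiff ℝ ∞ fun z : ℂ => l⁻¹ * z := contDiff_const.mul contDiff_id
    have hs : ContDiff ℝ ∞ fun z : ℂ => star (l⁻¹ * z) :=
      (Complex.conjCLE : ℂ →L[ℝ] ℂ).contDiff.comp hk
    have hg : ContDiff ℝ ∞ fun z : ℂ => 16 - l⁻¹ * z * (l⁻¹ * z) * (l⁻¹ * z * (l⁻¹ * z)) *
        (star (l⁻¹ * z) * star (l⁻¹ * z) * (star (l⁻¹ * z) * star (l⁻¹ * z))) :=
      contDiff_const.sub (((hk.mul hk).mul (hk.mul hk)).mul ((hs.mul hs).mul (hs.mul hs)))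
    have hf : ContDiff ℝ ∞ fun z : ℂ => (24 * (l⁻¹ * z) + 2 * (l⁻¹ * z * (l⁻¹ * z) * (l⁻¹ * z)) *
        (star (l⁻¹ * z) * star (l⁻¹ * z))) * (star (l⁻¹ * z) * star (l⁻¹ * z)) :=
      ((contDiff_const.mul hk).add ((contDiff_const.mul ((hk.mul hk).mul hk)).mul (hs.mul hs))).mul
        (hs.mul hs)
    refine contDiffOn_const.mul (hf.contDiffOn.mul (hg.contDiffOn.inv fun z hz => ?_))
    have := mul_ne_zero (four_add_ne_zero (l⁻¹ * z)) (hU hz)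
    convert this using 1
    ring
  · have hs : √(4 + Complex.normSq (l⁻¹ * z) ^ 2) ≠ 0 :=
      (Real.sqrt_pos.2 (by positivity)).ne'
    have hz' : 1 - ‖z‖ ^ 4 / 4 ≠ 0 := hz
    refine ⟨√(4 + Complex.normSq (l⁻¹ * z) ^ 2) / (√2 * (1 - ‖z‖ ^ 4 / 4)),
      div_ne_zero hs (mul_ne_zero (by norm_num) hz'), ?_⟩
    have hm : star (l⁻¹ * modelMu (l⁻¹ * z)) * l⁻¹ = star (modelMu (l⁻¹ * z)) := by
      rw [star_mul', mul_right_comm, RCLike.star_def, conj_inv_mul hl, one_mul]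
    have hm' : l⁻¹ * modelMu (l⁻¹ * z) * (starRingEnd ℂ) l⁻¹ = modelMu (l⁻¹ * z) := by
      rw [mul_right_comm, mul_comm l⁻¹, conj_inv_mul hl, one_mul]
    have hm2 : l⁻¹ * modelMu (l⁻¹ * z) * star (l⁻¹ * modelMu (l⁻¹ * z)) =
        modelMu (l⁻¹ * z) * star (modelMu (l⁻¹ * z)) := by
      rw [star_mul', mul_mul_mul_comm, RCLike.star_def, mul_comm l⁻¹, conj_inv_mul hl, one_mul]
    rw [sectionN_canonicalLift hl, dz_canonicalLift hl, dzbar_canonicalLift hl,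
      canonicalLift_exampleSurface hl, smul_smul, smul_smul, hm, hm', hm2, liftN_add _ (hU hz),
      ← complexify_modelDualLift]
    funext i
    have h4 : (4 - (l⁻¹ * z) ^ 2 * star (l⁻¹ * z) ^ 2 : ℂ) = ((4 * (1 - ‖z‖ ^ 4 / 4) : ℝ) : ℂ) := by
      rw [← mul_pow, ← normSq_eq_star, normSq_inv_mul hl]
      push_cast
      ring
    have h5 : √2 * √2 = 2 := Real.mul_self_sqrt (by norm_num)
    rw [exampleYh_eq hl, h4, liftScale, Pi.smul_apply, Pi.smul_apply, smul_eq_mul, smul_eq_mul]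
    norm_cast
    have h2 : √2 ≠ 0 := by norm_num
    rw [inv_inv]
    field_simp
    ring
  · obtain ⟨c, hc⟩ := hasWirtingerAt_modelMu (hU hz)
    have hd := ((hasWirtingerAt_const l⁻¹ z).mul hc.comp_mul_left).dz_eq
    rw [hd, schwarzian_canonicalLift hl]
    simp only [smul_eq_mul]
    ring

end Pullback

end

section

/-! ### The Iwasawa splitting -/

section Split

variable (K : Type*) [Field K]

/-- The basis `ε₀, -ε₂ + ε₄, -ε₃ + ε₅, ε₁, ε₂ + ε₄, ε₃ + ε₅` of `K⁶`, in columns. The potential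
preserves both the span of the first three and the span of the last three vectors. -/
def splitBasis : Matrix (Fin 6) (Fin 3 ⊕ Fin 3) K :=
  Matrix.fromCols !![1, 0, 0; 0, 0, 0; 0, -1, 0; 0, 0, -1; 0, 1, 0; 0, 0, 1]
    !![0, 0, 0; 1, 0, 0; 0, 1, 0; 0, 0, 1; 0, 1, 0; 0, 0, 1]

/-- The inverse of `splitBasis`. -/
def splitBasisInv : Matrix (Fin 3 ⊕ Fin 3) (Fin 6) K :=
  Matrix.fromRows !![1, 0, 0, 0, 0, 0; 0, 0, -(1 / 2), 0, 1 / 2, 0; 0, 0, 0, -(1 / 2), 0, 1 / 2]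
    !![0, 1, 0, 0, 0, 0; 0, 0, 1 / 2, 0, 1 / 2, 0; 0, 0, 0, 1 / 2, 0, 1 / 2]

/-- The endomorphism of `K⁶` which is given by `M` and `N` on the two invariant subspaces. -/
def splitSum (M N : Matrix (Fin 3) (Fin 3) K) : Matrix (Fin 6) (Fin 6) K :=
  splitBasis K * Matrix.fromBlocks M 0 0 N * splitBasisInv K

theorem splitSum_eq (M N : Matrix (Fin 3) (Fin 3) K) : splitSum K M N =
    !![M 0 0, 0, -(M 0 1 / 2), -(M 0 2 / 2), M 0 1 / 2, M 0 2 / 2;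
      0, N 0 0, N 0 1 / 2, N 0 2 / 2, N 0 1 / 2, N 0 2 / 2;
      -M 1 0, N 1 0, (N 1 1 + M 1 1) / 2, (N 1 2 + M 1 2) / 2, (N 1 1 - M 1 1) / 2,
        (N 1 2 - M 1 2) / 2;
      -M 2 0, N 2 0, (N 2 1 + M 2 1) / 2, (N 2 2 + M 2 2) / 2, (N 2 1 - M 2 1) / 2,
        (N 2 2 - M 2 2) / 2;
      M 1 0, N 1 0, (N 1 1 - M 1 1) / 2, (N 1 2 - M 1 2) / 2, (N 1 1 + M 1 1) / 2,
        (N 1 2 + M 1 2) / 2;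
      M 2 0, N 2 0, (N 2 1 - M 2 1) / 2, (N 2 2 - M 2 2) / 2, (N 2 1 + M 2 1) / 2,
        (N 2 2 + M 2 2) / 2] := by
  ext i j
  fin_cases i <;> fin_cases j <;>
    simp [splitSum, splitBasis, splitBasisInv, Matrix.mul_apply, Fin.sum_univ_succ] <;> ring

variable {K}

/-- The Gram matrix `diag(σ, 2, 2)` of the basis of one of the invariant subspaces (`σ = -1` for the
first, `σ = 1` for the second one). -/
def splitMetric (σ : K) : Matrix (Fin 3) (Fin 3) K := Matrix.diagonal ![σ, 2, 2]

theorem splitBasis_metric : (splitBasis K)ᵀ * metricMatrix K * splitBasis K =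
    Matrix.fromBlocks (splitMetric (-1)) 0 0 (splitMetric 1) := by
  ext i j
  rcases i with i | i <;> rcases j with j | j <;> fin_cases i <;> fin_cases j <;>
    simp [splitBasis, metricMatrix, splitMetric, Matrix.mul_apply, Fin.sum_univ_succ,
      Matrix.diagonal_apply] <;> norm_num

variable [NeZero (2 : K)]

theorem splitBasis_mul_inv : splitBasis K * splitBasisInv K = 1 := by
  have h2 : (2 : K) ≠ 0 := NeZero.ne 2
  ext i j
  fin_cases i <;> fin_cases j <;>
    simp [splitBasis, splitBasisInv, Matrix.mul_apply, Fin.sum_univ_succ] <;> field_simp <;>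
        norm_num

theorem splitBasisInv_mul : splitBasisInv K * splitBasis K = 1 := by
  have h2 : (2 : K) ≠ 0 := NeZero.ne 2
  ext i j
  rcases i with i | i <;> rcases j with j | j <;> fin_cases i <;> fin_cases j <;>
    simp [splitBasis, splitBasisInv, Matrix.mul_apply, Fin.sum_univ_succ] <;> field_simp <;>
        norm_num

theorem splitSum_mul (M N M' N' : Matrix (Fin 3) (Fin 3) K) :
    splitSum K M N * splitSum K M' N' = splitSum K (M * M') (N * N') := by
  have h : Matrix.fromBlocks (M * M') 0 0 (N * N') =
      Matrix.fromBlocks M 0 0 N * Matrix.fromBlocks M' 0 0 N' := by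
    simp [Matrix.fromBlocks_multiply]
  rw [splitSum, splitSum, splitSum, h]
  simp only [Matrix.mul_assoc]
  rw [← Matrix.mul_assoc (splitBasisInv K) (splitBasis K), splitBasisInv_mul, Matrix.one_mul]

theorem splitSum_one : splitSum K 1 1 = 1 := by
  rw [splitSum, Matrix.fromBlocks_one, Matrix.mul_one, splitBasis_mul_inv]

theorem det_splitSum (M N : Matrix (Fin 3) (Fin 3) K) : (splitSum K M N).det = M.det * N.det := by
  rw [splitSum, Matrix.det_conj_of_mul_eq_one splitBasis_mul_inv splitBasisInv_mul,
    Matrix.det_fromBlocks_zero₂₁]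

/-- Isometries of the two invariant subspaces define an isometry. -/
theorem splitSum_isometry {M N : Matrix (Fin 3) (Fin 3) K}
    (hM : Mᵀ * splitMetric (-1) * M = splitMetric (-1)) (hN : Nᵀ * splitMetric 1 * N = splitMetric
        1) :
    (splitSum K M N)ᵀ * metricMatrix K * splitSum K M N = metricMatrix K := by
  have h : (Matrix.fromBlocks M 0 0 N)ᵀ * Matrix.fromBlocks (splitMetric (-1)) 0 0 (splitMetric 1) *
      Matrix.fromBlocks M 0 0 N = Matrix.fromBlocks (splitMetric (-1)) 0 0 (splitMetric 1) := by
    simp [Matrix.fromBlocks_transpose, Matrix.fromBlocks_multiply, hM, hN]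
  have e : ∀ A : Matrix (Fin 3 ⊕ Fin 3) (Fin 3 ⊕ Fin 3) K,
      (splitBasis K * A * splitBasisInv K)ᵀ * metricMatrix K * (splitBasis K * A * splitBasisInv K)
          =
      (splitBasisInv K)ᵀ * (Aᵀ * ((splitBasis K)ᵀ * metricMatrix K * splitBasis K) * A) *
        splitBasisInv K := fun A => by
    simp only [Matrix.transpose_mul, Matrix.mul_assoc]
  have e1 := e 1
  rw [splitSum, e, splitBasis_metric, h, ← splitBasis_metric]
  rw [Matrix.mul_one, splitBasis_mul_inv, Matrix.transpose_one, Matrix.transpose_one,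
      Matrix.one_mul,
    Matrix.mul_one, Matrix.one_mul, Matrix.mul_one] at e1
  exact e1.symm

end Split

end

/-- The solution of `G' = G A` on one of the invariant subspaces, `A = blockPotential σ`. -/
noncomputable def blockSolution (σ ζ : ℂ) : Matrix (Fin 3) (Fin 3) ℂ :=
  !![1, σ * Complex.I * ζ, -(σ * ζ);
    -(Complex.I * ζ / 2), 1 + σ * ζ ^ 2 / 4, σ * Complex.I * ζ ^ 2 / 4;
    ζ / 2, σ * Complex.I * ζ ^ 2 / 4, 1 - σ * ζ ^ 2 / 4]

/-- The potential on one of the invariant subspaces. -/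
noncomputable def blockPotential (σ : ℂ) : Matrix (Fin 3) (Fin 3) ℂ :=
  !![0, σ * Complex.I, -σ; -(Complex.I / 2), 0, 0; 1 / 2, 0, 0]

/-- The real factor of the Iwasawa splitting on one of the invariant subspaces: for `σ = -1` a
boost, for `σ = 1` a rotation, in the plane of the first basis vector and its image. -/
noncomputable def blockReal (σ : ℝ) (ζ : ℂ) : Matrix (Fin 3) (Fin 3) ℝ :=
  (1 + σ * (Complex.normSq ζ / 2))⁻¹ •
    !![1 - σ * (Complex.normSq ζ / 2), -(2 * σ * ζ.im), -(2 * σ * ζ.re);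
      ζ.im, 1 + σ * (Complex.normSq ζ / 2) - σ * ζ.im ^ 2, -(σ * ζ.re * ζ.im);
      ζ.re, -(σ * ζ.re * ζ.im), 1 + σ * (Complex.normSq ζ / 2) - σ * ζ.re ^ 2]

/-- The holomorphic factor of the Iwasawa splitting on one of the invariant subspaces, as a
polynomial in `b = λ z̄` with `d = 1 + σ r² / 2` fixed. -/
noncomputable def blockPlus (σ d b : ℂ) : Matrix (Fin 3) (Fin 3) ℂ :=
  !![1, σ * Complex.I * b * d⁻¹, σ * b * d⁻¹;
    -(Complex.I * b / 2), (d⁻¹ + σ * b ^ 2 / 2 * d⁻¹ + d) / 2,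
      -(Complex.I * (d⁻¹ + σ * b ^ 2 / 2 * d⁻¹ - d) / 2);
    -(b / 2), Complex.I * (d⁻¹ - σ * b ^ 2 / 2 * d⁻¹ - d) / 2,
      (d⁻¹ - σ * b ^ 2 / 2 * d⁻¹ + d) / 2]

/-- The reflection `diag(s, 1, 1)`. -/
def blockSign {K : Type*} [Field K] (s : K) : Matrix (Fin 3) (Fin 3) K := Matrix.diagonal ![s, 1, 1]

theorem blockSolution_eq (σ ζ : ℂ) : blockSolution σ ζ =
    1 + ζ • blockPotential σ + (ζ ^ 2 / 2) • (blockPotential σ * blockPotential σ) := by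
  ext i j
  fin_cases i <;> fin_cases j <;>
    simp [blockSolution, blockPotential, -mul_eq_zero]
  all_goals ring_nf
  all_goals try simp only [Complex.I_sq]
  all_goals try ring

theorem blockPotential_cube (σ : ℂ) :
    blockPotential σ * blockPotential σ * blockPotential σ = 0 := by
  ext i j
  fin_cases i <;> fin_cases j <;>
    simp [blockPotential, Matrix.mul_apply, Fin.sum_univ_succ, -mul_eq_zero]
  all_goals ring_nf
  all_goals try simp only [Complex.I_sq, show Complex.I ^ 3 = -Complex.I by
    rw [pow_succ, Complex.I_sq, neg_one_mul]]
  all_goals try ring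

theorem blockReal_isometry {σ : ℝ} (hσ : σ ^ 2 = 1) {ζ : ℂ}
    (h0 : 1 + σ * (Complex.normSq ζ / 2) ≠ 0) :
    (blockReal σ ζ)ᵀ * splitMetric σ * blockReal σ ζ = splitMetric σ := by
  obtain ⟨d, hd⟩ : ∃ d, d = 1 + σ * (Complex.normSq ζ / 2) := ⟨_, rfl⟩
  rw [← hd] at h0
  rw [blockReal, ← hd, Complex.normSq_apply]
  rw [Complex.normSq_apply] at hd
  generalize ζ.re = u at *
  generalize ζ.im = v at *
  rw [Matrix.transpose_smul, Matrix.smul_mul, Matrix.smul_mul, Matrix.mul_smul, smul_smul,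
    ← mul_inv, inv_smul_eq_iff₀ (by simpa using h0)]
  rcases eq_or_eq_neg_of_sq_eq_sq _ _ (hσ.trans (one_pow 2).symm) with rfl | rfl <;> ext i j <;>
    fin_cases i <;> fin_cases j <;>
    simp [splitMetric, Matrix.mul_apply, Fin.sum_univ_succ, Matrix.diagonal_apply, hd] <;>
    ring

theorem det_blockReal {σ : ℝ} (hσ : σ ^ 2 = 1) {ζ : ℂ}
    (h0 : 1 + σ * (Complex.normSq ζ / 2) ≠ 0) : (blockReal σ ζ).det = 1 := by
  obtain ⟨d, hd⟩ : ∃ d, d = 1 + σ * (Complex.normSq ζ / 2) := ⟨_, rfl⟩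
  rw [← hd] at h0
  rw [blockReal, ← hd, Complex.normSq_apply]
  rw [Complex.normSq_apply] at hd
  generalize ζ.re = u at *
  generalize ζ.im = v at *
  rw [Matrix.det_smul, Fintype.card_fin, inv_pow, inv_mul_eq_one₀ (pow_ne_zero _ h0),
    Matrix.det_fin_three]
  rcases eq_or_eq_neg_of_sq_eq_sq _ _ (hσ.trans (one_pow 2).symm) with rfl | rfl <;> simp [hd] <;>
      ring

theorem blockPlus_isometry {σ d : ℂ} (hσ : σ ^ 2 = 1) (h0 : d ≠ 0) (b : ℂ) :
    (blockPlus σ d b)ᵀ * splitMetric σ * blockPlus σ d b = splitMetric σ := by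
  rcases eq_or_eq_neg_of_sq_eq_sq _ _ (hσ.trans (one_pow 2).symm) with rfl | rfl <;> ext i j <;>
    fin_cases i <;> fin_cases j <;>
    simp [blockPlus, splitMetric, Matrix.mul_apply, Fin.sum_univ_succ, Matrix.diagonal_apply]
  all_goals field_simp
  all_goals ring_nf
  all_goals try simp only [Complex.I_sq]
  all_goals try ring

theorem det_blockPlus {σ d : ℂ} (h0 : d ≠ 0) (b : ℂ) : (blockPlus σ d b).det = 1 := by
  rw [Matrix.det_fin_three]
  simp [blockPlus]
  field_simp
  ring_nf
  simp only [Complex.I_sq]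
  ring

/-- The splitting of `blockSolution` into a real and a holomorphic factor. -/
theorem blockSolution_factor {σ : ℝ} (hσ : σ ^ 2 = 1) {ζ : ℂ}
    (h0 : 1 + σ * (Complex.normSq ζ / 2) ≠ 0) :
    blockSolution σ ζ = (blockReal σ ζ).map Complex.ofReal *
      blockPlus σ (1 + σ * (Complex.normSq ζ / 2) : ℝ) (star ζ) := by
  obtain ⟨d, hd⟩ : ∃ d, d = 1 + σ * (Complex.normSq ζ / 2) := ⟨_, rfl⟩
  rw [← hd] at h0
  rw [blockReal, ← hd]
  have h1 : (d : ℂ) ≠ 0 := by exact_mod_cast h0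
  have hdc : (d : ℂ) = 1 + σ * (ζ * star ζ / 2) := by
    rw [hd]; push_cast; rw [normSq_eq_star]
  have hm : ((d⁻¹ • !![1 - σ * (Complex.normSq ζ / 2), -(2 * σ * ζ.im), -(2 * σ * ζ.re);
      ζ.im, d - σ * ζ.im ^ 2, -(σ * ζ.re * ζ.im);
      ζ.re, -(σ * ζ.re * ζ.im), d - σ * ζ.re ^ 2] : Matrix (Fin 3) (Fin 3) ℝ)).map
        Complex.ofReal = (d : ℂ)⁻¹ • !![1 - σ * (Complex.normSq ζ / 2 : ℂ), -(2 * σ * ζ.im),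
          -(2 * σ * ζ.re);
      ζ.im, d - σ * ζ.im ^ 2, -(σ * ζ.re * ζ.im);
      ζ.re, -(σ * ζ.re * ζ.im), d - σ * ζ.re ^ 2] := by
    ext i j
    fin_cases i <;> fin_cases j <;> simp
  rw [hm, Matrix.smul_mul, eq_inv_smul_iff₀ h1, normSq_eq_star, re_eq_star, im_eq_star]
  generalize star ζ = b at *
  rw [blockSolution, blockPlus]
  generalize (d : ℂ) = d at *
  rcases eq_or_eq_neg_of_sq_eq_sq _ _ (hσ.trans (one_pow 2).symm) with rfl | rfl <;> ext i j <;>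
    fin_cases i <;> fin_cases j <;>
    simp [Matrix.mul_apply, Fin.sum_univ_succ]
  all_goals field_simp
  all_goals rw [hdc]
  all_goals push_cast
  all_goals ring_nf
  all_goals try simp only [Complex.I_sq]
  all_goals try ring

section

section SplitCalculus

variable {K : Type*} [Field K]

theorem splitSum_apply (M N : Matrix (Fin 3) (Fin 3) K) (i j : Fin 6) : splitSum K M N i j =
    (∑ a, ∑ b, splitBasis K i (.inl a) * M a b * splitBasisInv K (.inl b) j) +
      ∑ a, ∑ b, splitBasis K i (.inr a) * N a b * splitBasisInv K (.inr b) j := by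
  simp only [splitSum, Matrix.mul_apply, Fintype.sum_sum_type, Matrix.fromBlocks_apply₁₁,
    Matrix.fromBlocks_apply₁₂, Matrix.fromBlocks_apply₂₁, Matrix.fromBlocks_apply₂₂,
    Matrix.zero_apply, mul_zero, Finset.sum_const_zero, add_zero, zero_add, Finset.sum_mul]
  rw [Finset.sum_comm, Finset.sum_comm (f := fun b a => splitBasis K i (.inr a) * _ * _)]

theorem splitSum_smul (c : K) (M N : Matrix (Fin 3) (Fin 3) K) :
    c • splitSum K M N = splitSum K (c • M) (c • N) := by
  ext i j
  simp only [Matrix.smul_apply, splitSum_apply, smul_eq_mul, mul_add, Finset.mul_sum, mul_left_comm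
      c,
    mul_assoc]

/-- The involution is the sum of the reflections in the first basis vectors. -/
theorem splitSum_sign [NeZero (2 : K)] :
    splitSum K (blockSign (-1)) (blockSign (-1)) = involutionMatrix K := by
  have h2 : (1 + 1 : K) ≠ 0 := by
    rw [one_add_one_eq_two]
    exact NeZero.ne 2
  rw [splitSum_eq]
  ext i j
  fin_cases i <;> fin_cases j <;>
    simp [blockSign, involutionMatrix, ← one_add_one_eq_two, h2]

end SplitCalculus

theorem splitSum_map_ofReal (M N : Matrix (Fin 3) (Fin 3) ℝ) :
    (splitSum ℝ M N).map Complex.ofReal =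
      splitSum ℂ (M.map Complex.ofReal) (N.map Complex.ofReal) := by
  rw [splitSum_eq, splitSum_eq]
  ext i j
  fin_cases i <;> fin_cases j <;> simp

theorem hasDerivAt_splitSum {M N : ℂ → Matrix (Fin 3) (Fin 3) ℂ} {M' N' : Matrix (Fin 3) (Fin 3) ℂ}
    {z : ℂ} (hM : ∀ a b, HasDerivAt (fun w => M w a b) (M' a b) z)
    (hN : ∀ a b, HasDerivAt (fun w => N w a b) (N' a b) z) (i j : Fin 6) :
    HasDerivAt (fun w => splitSum ℂ (M w) (N w) i j) (splitSum ℂ M' N' i j) z := by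
  simp only [splitSum_apply]
  exact (HasDerivAt.fun_sum fun a _ => HasDerivAt.fun_sum fun b _ =>
    ((hM a b).const_mul _).mul_const _).fun_add (HasDerivAt.fun_sum fun a _ =>
      HasDerivAt.fun_sum fun b _ => ((hN a b).const_mul _).mul_const _)

theorem differentiable_splitSum {M N : ℂ → Matrix (Fin 3) (Fin 3) ℂ}
    (hM : ∀ a b, Differentiable ℂ fun w => M w a b)
    (hN : ∀ a b, Differentiable ℂ fun w => N w a b) (i j : Fin 6) :
    Differentiable ℂ fun w => splitSum ℂ (M w) (N w) i j := by
  simp only [splitSum_apply]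
  fun_prop

theorem contDiffOn_splitSum {U : Set ℂ} {M N : ℂ → Matrix (Fin 3) (Fin 3) ℝ}
    (hM : ∀ a b, ContDiffOn ℝ ∞ (fun w => M w a b) U)
    (hN : ∀ a b, ContDiffOn ℝ ∞ (fun w => N w a b) U) (i j : Fin 6) :
    ContDiffOn ℝ ∞ (fun w => splitSum ℝ (M w) (N w) i j) U := by
  simp only [splitSum_apply]
  exact (ContDiffOn.sum fun a _ => ContDiffOn.sum fun b _ =>
    (contDiffOn_const.mul (hM a b)).mul contDiffOn_const).add (ContDiffOn.sum fun a _ =>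
      ContDiffOn.sum fun b _ => (contDiffOn_const.mul (hN a b)).mul contDiffOn_const)

/-- The potential preserves both subspaces. -/
theorem potentialMatrix_exampleB :
    potentialMatrix exampleB = splitSum ℂ (blockPotential (-1)) (blockPotential 1) := by
  have h0 : (finSumFinEquiv (m := 2) (n := 4)).symm 0 = .inl 0 := rfl
  have h1 : (finSumFinEquiv (m := 2) (n := 4)).symm 1 = .inl 1 := rfl
  have h2 : (finSumFinEquiv (m := 2) (n := 4)).symm 2 = .inr 0 := rfl
  have h3 : (finSumFinEquiv (m := 2) (n := 4)).symm 3 = .inr 1 := rfl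
  have h4 : (finSumFinEquiv (m := 2) (n := 4)).symm 4 = .inr 2 := rfl
  have h5 : (finSumFinEquiv (m := 2) (n := 4)).symm 5 = .inr 3 := rfl
  rw [splitSum_eq]
  ext i j
  rw [potentialMatrix, Matrix.reindex_apply, Matrix.submatrix_apply]
  fin_cases i <;> fin_cases j <;>
    simp [h0, h1, h2, h3, h4, h5, exampleB, blockPotential, Matrix.mul_apply,
      Matrix.diagonal_apply] <;> ring

theorem hasDerivAt_blockSolution (σ c z : ℂ) (i j : Fin 3) :
    HasDerivAt (fun w => blockSolution σ (c * w) i j)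
      ((c • (blockSolution σ (c * z) * blockPotential σ)) i j) z := by
  have h1 : HasDerivAt (fun w => c * w) c z := by simpa using (hasDerivAt_id z).const_mul c
  have h := ((hasDerivAt_const z ((1 : Matrix (Fin 3) (Fin 3) ℂ) i j)).add
    (h1.mul_const (blockPotential σ i j))).add
      (((h1.pow 2).div_const 2).mul_const ((blockPotential σ * blockPotential σ) i j))
  refine (h.congr_deriv ?_).congr_of_eventuallyEq (.of_forall fun w => ?_)
  · rw [blockSolution_eq, Matrix.add_mul, Matrix.add_mul, Matrix.smul_mul, Matrix.smul_mul,
      blockPotential_cube, smul_zero, add_zero, Matrix.one_mul]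
    simp only [Matrix.smul_apply, Matrix.add_apply, smul_eq_mul]
    push_cast
    ring
  · refine (congrFun₂ (blockSolution_eq σ (c * w)) i j).trans ?_
    simp [Matrix.add_apply, Matrix.smul_apply]

section Sign

variable {K : Type*} [Field K]

theorem det_blockSign (s : K) : (blockSign s).det = s := by
  simp [blockSign, Fin.prod_univ_succ]

theorem blockSign_mul (s t : K) : blockSign s * blockSign t = blockSign (s * t) := by
  rw [blockSign, blockSign, Matrix.diagonal_mul_diagonal, blockSign]
  congr 1
  ext i
  fin_cases i <;> simp

theorem blockSign_one : blockSign (1 : K) = 1 := by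
  rw [blockSign, ← Matrix.diagonal_one]
  congr 1
  ext i
  fin_cases i <;> simp

theorem blockSign_isometry {s : K} (hs : s ^ 2 = 1) (σ : K) :
    (blockSign s)ᵀ * splitMetric σ * blockSign s = splitMetric σ := by
  rw [blockSign, splitMetric, Matrix.diagonal_transpose, Matrix.diagonal_mul_diagonal,
    Matrix.diagonal_mul_diagonal]
  congr 1
  ext i
  fin_cases i <;> simp
  linear_combination σ * hs

end Sign

theorem blockSign_map_ofReal (s : ℝ) :
    (blockSign s).map Complex.ofReal = blockSign (s : ℂ) := by
  ext i j
  fin_cases i <;> fin_cases j <;> simp [blockSign]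

theorem isometry_mul {n R : Type*} [Fintype n] [CommRing R] {S A B : Matrix n n R}
    (hA : Aᵀ * S * A = S) (hB : Bᵀ * S * B = S) : (A * B)ᵀ * S * (A * B) = S := by
  calc (A * B)ᵀ * S * (A * B) = Bᵀ * (Aᵀ * S * A) * B := by
        simp only [Matrix.transpose_mul, Matrix.mul_assoc]
    _ = S := by rw [hA, hB]

theorem blockSign_conj_blockReal (σ : ℝ) (ζ : ℂ) :
    blockSign (-1) * blockReal σ ζ * blockSign (-1) = blockReal σ (-ζ) := by
  ext i j
  fin_cases i <;> fin_cases j <;>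
    simp [blockSign, blockReal, Matrix.mul_apply, Matrix.diagonal_apply]

theorem blockSign_conj_blockPlus (σ d b : ℂ) :
    blockSign (-1) * blockPlus σ d b * blockSign (-1) = blockPlus σ d (-b) := by
  ext i j
  fin_cases i <;> fin_cases j <;>
    simp [blockSign, blockPlus, Matrix.mul_apply, Matrix.diagonal_apply] <;> ring

end

/-- The sign of `1 - r²/2`. -/
noncomputable def exampleSign (z : ℂ) : ℝ := |1 - ‖z‖ ^ 2 / 2| / (1 - ‖z‖ ^ 2 / 2)

/-- The solution of `dG = G η`, `G(0) = 1`. -/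
noncomputable def exampleSolution (l z : ℂ) : Matrix (Fin 6) (Fin 6) ℂ :=
  splitSum ℂ (blockSolution (-1) (l⁻¹ * z)) (blockSolution 1 (l⁻¹ * z))

/-- The extended frame: `blockReal` on both invariant subspaces. The two reflections make it an
element of `SO⁺(1,5)` for `r² > 2` as well. -/
noncomputable def exampleFrame (l z : ℂ) : Matrix (Fin 6) (Fin 6) ℝ :=
  splitSum ℝ (blockReal (-1) (l⁻¹ * z) * blockSign (exampleSign z))
    (blockReal 1 (l⁻¹ * z) * blockSign (exampleSign z))

/-- The holomorphic factor of the Iwasawa splitting. -/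
noncomputable def examplePlus (l z : ℂ) : Matrix (Fin 6) (Fin 6) ℂ :=
  splitSum ℂ
    (blockSign (exampleSign z : ℂ) *
      blockPlus (-1) ((1 - ‖z‖ ^ 2 / 2 : ℝ) : ℂ) (l * star z))
    (blockSign (exampleSign z : ℂ) *
      blockPlus 1 ((1 + ‖z‖ ^ 2 / 2 : ℝ) : ℂ) (l * star z))

theorem one_sub_ne_zero_of_mem {z : ℂ} (hz : z ∈ exampleU) : 1 - ‖z‖ ^ 2 / 2 ≠ 0 := fun h =>
  hz (by linear_combination (1 + ‖z‖ ^ 2 / 2) * h)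

theorem one_add_normSq_div_two_pos (z : ℂ) : 0 < 1 + ‖z‖ ^ 2 / 2 := by positivity

theorem exampleSign_sq {z : ℂ} (hz : z ∈ exampleU) : exampleSign z ^ 2 = 1 := by
  rw [exampleSign, div_pow, sq_abs, div_self (pow_ne_zero 2 (one_sub_ne_zero_of_mem hz))]

theorem isOpen_exampleU : IsOpen exampleU :=
  isOpen_ne_fun (by fun_prop) continuous_const

theorem isSOPlus_exampleFrame {l : ℂ} (hl : ‖l‖ = 1) {z : ℂ} (hz : z ∈ exampleU) :
    IsSOPlus (exampleFrame l z) := by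
  have hs := exampleSign_sq hz
  have h1 : (1 + -1 * (Complex.normSq (l⁻¹ * z) / 2) : ℝ) ≠ 0 := by
    rw [normSq_inv_mul hl, neg_one_mul, ← sub_eq_add_neg]
    exact one_sub_ne_zero_of_mem hz
  have h2 : (1 + 1 * (Complex.normSq (l⁻¹ * z) / 2) : ℝ) ≠ 0 := by
    rw [normSq_inv_mul hl, one_mul]
    exact (one_add_normSq_div_two_pos z).ne'
  refine ⟨splitSum_isometry (isometry_mul (blockReal_isometry (by norm_num) h1)
    (blockSign_isometry hs _)) (isometry_mul (blockReal_isometry (by norm_num) h2)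
    (blockSign_isometry hs _)), ?_, ?_⟩
  · rw [exampleFrame, det_splitSum, Matrix.det_mul, Matrix.det_mul, det_blockSign,
      det_blockReal (by norm_num) h1, det_blockReal (by norm_num) h2, one_mul, ← sq, hs]
  · have h3 : exampleFrame l z 0 0 =
        |1 - ‖z‖ ^ 2 / 2| * ((1 - ‖z‖ ^ 2 / 2) ^ 2)⁻¹ * (1 + ‖z‖ ^ 2 / 2) := by
      rw [exampleFrame, splitSum_eq]
      have hn := one_sub_ne_zero_of_mem hz
      simp only [exampleSign, blockReal, blockSign, normSq_inv_mul hl]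
      simp [Matrix.mul_apply, Matrix.diagonal_apply, ← sub_eq_add_neg]
      field_simp
    rw [h3]
    have := abs_pos.2 (one_sub_ne_zero_of_mem hz)
    have := pow_pos (one_add_normSq_div_two_pos z) 1
    have := sq_pos_of_ne_zero (one_sub_ne_zero_of_mem hz)
    positivity

theorem involution_conj_splitSum {K : Type*} [Field K] [NeZero (2 : K)]
    (M N : Matrix (Fin 3) (Fin 3) K) :
    involutionMatrix K * splitSum K M N * involutionMatrix K =
      splitSum K (blockSign (-1) * M * blockSign (-1)) (blockSign (-1) * N * blockSign (-1)) := by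
  rw [← splitSum_sign, splitSum_mul, splitSum_mul]

theorem blockSign_comm {K : Type*} [Field K] (s t : K) :
    blockSign s * blockSign t = blockSign t * blockSign s := by
  rw [blockSign_mul, mul_comm, blockSign_mul]

theorem involution_conj_exampleFrame (l z : ℂ) :
    involutionMatrix ℝ * exampleFrame l z * involutionMatrix ℝ = exampleFrame (-l) z := by
  have h : (-l)⁻¹ * z = -(l⁻¹ * z) := by rw [inv_neg, neg_mul]
  rw [exampleFrame, exampleFrame, involution_conj_splitSum, h, ← blockSign_conj_blockReal,
    ← blockSign_conj_blockReal]
  simp only [Matrix.mul_assoc, blockSign_comm (exampleSign z)]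

theorem involution_conj_examplePlus (l z : ℂ) :
    involutionMatrix ℂ * examplePlus l z * involutionMatrix ℂ = examplePlus (-l) z := by
  rw [examplePlus, examplePlus, involution_conj_splitSum, neg_mul, ← blockSign_conj_blockPlus,
    ← blockSign_conj_blockPlus]
  simp only [← Matrix.mul_assoc, blockSign_comm (exampleSign z : ℂ)]

theorem differentiable_blockSign_mul_blockPlus (s σ d c : ℂ) (i j : Fin 3) :
    Differentiable ℂ fun l => (blockSign s * blockPlus σ d (l * c)) i j := by
  simp only [blockSign, Matrix.diagonal_mul, blockPlus]
  fin_cases i <;> fin_cases j <;> simp <;> fun_prop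

theorem isSOComplex_examplePlus (l : ℂ) {z : ℂ} (hz : z ∈ exampleU) :
    IsSOComplex (examplePlus l z) := by
  have hs : (exampleSign z : ℂ) ^ 2 = 1 := by exact_mod_cast exampleSign_sq hz
  have h1 : ((1 - ‖z‖ ^ 2 / 2 : ℝ) : ℂ) ≠ 0 :=
    Complex.ofReal_ne_zero.2 (one_sub_ne_zero_of_mem hz)
  have h2 : ((1 + ‖z‖ ^ 2 / 2 : ℝ) : ℂ) ≠ 0 :=
    Complex.ofReal_ne_zero.2 (one_add_normSq_div_two_pos z).ne'
  refine ⟨splitSum_isometry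
    (isometry_mul (blockSign_isometry hs _) (blockPlus_isometry (by norm_num) h1 _))
    (isometry_mul (blockSign_isometry hs _) (blockPlus_isometry (by norm_num) h2 _)), ?_⟩
  rw [examplePlus, det_splitSum, Matrix.det_mul, Matrix.det_mul, det_blockSign,
    det_blockPlus h1, det_blockPlus h2, mul_one, ← sq, hs]

theorem exampleSolution_factor {l : ℂ} (hl : ‖l‖ = 1) {z : ℂ} (hz : z ∈ exampleU) :
    exampleSolution l z = (exampleFrame l z).map Complex.ofReal * examplePlus l z := by
  have hs : (exampleSign z : ℂ) * exampleSign z = 1 := by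
    rw [← sq]
    exact_mod_cast exampleSign_sq hz
  have e1 : (1 + -1 * (Complex.normSq (l⁻¹ * z) / 2) : ℝ) = 1 - ‖z‖ ^ 2 / 2 := by
    rw [normSq_inv_mul hl, neg_one_mul, ← sub_eq_add_neg]
  have e2 : (1 + 1 * (Complex.normSq (l⁻¹ * z) / 2) : ℝ) = 1 + ‖z‖ ^ 2 / 2 := by
    rw [normSq_inv_mul hl, one_mul]
  have h1 := blockSolution_factor (σ := -1) (by norm_num) (e1 ▸ one_sub_ne_zero_of_mem hz)
  have h2 := blockSolution_factor (σ := 1) (by norm_num)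
    (e2 ▸ (one_add_normSq_div_two_pos z).ne')
  rw [e1, star_inv_mul hl, Complex.ofReal_neg, Complex.ofReal_one] at h1
  rw [e2, star_inv_mul hl, Complex.ofReal_one] at h2
  have e : ∀ M N : Matrix (Fin 3) (Fin 3) ℂ, M * blockSign (exampleSign z : ℂ) *
      (blockSign (exampleSign z : ℂ) * N) = M * N := fun M N => by
    rw [Matrix.mul_assoc, ← Matrix.mul_assoc (blockSign _) (blockSign _), blockSign_mul, hs,
      blockSign_one, Matrix.one_mul]
  have em : ∀ M : Matrix (Fin 3) (Fin 3) ℝ, (M * blockSign (exampleSign z)).map Complex.ofReal =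
      M.map Complex.ofReal * blockSign (exampleSign z : ℂ) := fun M => by
    rw [← blockSign_map_ofReal]
    exact Matrix.map_mul (f := Complex.ofRealHom)
  rw [exampleSolution, exampleFrame, examplePlus, splitSum_map_ofReal, splitSum_mul,
    em, em, e, e, h1, h2]

/-- The unit timelike vector of the plane `Y ∧ Ŷ`, up to sign, as a function of `ζ = λ⁻¹ z`. It
lies in the first invariant subspace. -/
noncomputable def timelikeUnit (ζ : ℂ) : Fin 6 → ℝ :=
  (1 - Complex.normSq ζ / 2)⁻¹ • ![1 + Complex.normSq ζ / 2, 0, -ζ.im, -ζ.re, ζ.im, ζ.re]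

/-- The unit spacelike vector of the plane `Y ∧ Ŷ` orthogonal to `timelikeUnit`. It lies in the
second invariant subspace. -/
noncomputable def spacelikeUnit (ζ : ℂ) : Fin 6 → ℝ :=
  (1 + Complex.normSq ζ / 2)⁻¹ • ![0, 1 - Complex.normSq ζ / 2, ζ.im, ζ.re, ζ.im, ζ.re]

theorem wedge_example {l : ℂ} (hl : ‖l‖ = 1) {z : ℂ} (hz : z ∈ exampleU) :
    wedge (exampleY l z) (exampleYh l z) =
      wedge (timelikeUnit (l⁻¹ * z)) (spacelikeUnit (l⁻¹ * z)) := by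
  have h1 := one_sub_ne_zero_of_mem hz
  have h2 := (one_add_normSq_div_two_pos z).ne'
  have h3 : 1 - ‖z‖ ^ 4 / 4 = (1 - ‖z‖ ^ 2 / 2) * (1 + ‖z‖ ^ 2 / 2) := by ring
  have e : ∀ v w : Fin 6 → ℝ, ((1 - ‖z‖ ^ 2 / 2) * (1 + ‖z‖ ^ 2 / 2)) •
      ((1 - ‖z‖ ^ 2 / 2)⁻¹ • v) = (1 + ‖z‖ ^ 2 / 2) • v ∧
      ((1 - ‖z‖ ^ 2 / 2) * (1 + ‖z‖ ^ 2 / 2)) • ((1 + ‖z‖ ^ 2 / 2)⁻¹ • w) =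
        (1 - ‖z‖ ^ 2 / 2) • w := fun v w => by
    rw [smul_smul, smul_smul, mul_inv_cancel_right₀ h2, mul_right_comm, mul_inv_cancel₀ h1, one_mul]
    exact ⟨rfl, rfl⟩
  have hY : modelLift (l⁻¹ * z) = ((1 - ‖z‖ ^ 2 / 2) * (1 + ‖z‖ ^ 2 / 2)) •
      (timelikeUnit (l⁻¹ * z) - spacelikeUnit (l⁻¹ * z)) := by
    rw [modelLift, timelikeUnit, spacelikeUnit, normSq_inv_mul hl, smul_sub, (e _ 0).1, (e 0 _).2]
    ext i
    fin_cases i <;> simp [-Complex.mul_re, -Complex.mul_im] <;> ring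
  have hYh : modelDualLift (l⁻¹ * z) = ((1 - ‖z‖ ^ 2 / 2) * (1 + ‖z‖ ^ 2 / 2)) •
      (timelikeUnit (l⁻¹ * z) + spacelikeUnit (l⁻¹ * z)) := by
    rw [modelDualLift, timelikeUnit, spacelikeUnit, normSq_inv_mul hl, smul_add, (e _ 0).1,
      (e 0 _).2]
    ext i
    fin_cases i <;> simp [-Complex.mul_re, -Complex.mul_im] <;> ring
  have h4 : (√2 / 2) ^ 2 = 1 / 2 := by
    rw [div_pow, Real.sq_sqrt zero_le_two]
    norm_num
  have h5 : √2 / (2 * (1 - ‖z‖ ^ 4 / 4)) * ((1 - ‖z‖ ^ 2 / 2) * (1 + ‖z‖ ^ 2 / 2)) = √2 / 2 := by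
    rw [h3, ← div_div, div_mul_cancel₀ _ (mul_ne_zero h1 h2)]
  rw [exampleY_eq hl, exampleYh_eq hl, hY, hYh, smul_smul, smul_smul, h5]
  ext i j
  simp only [wedge, Matrix.sub_apply, Matrix.vecMulVec_apply, Pi.smul_apply, Pi.add_apply,
    Pi.sub_apply, smul_eq_mul]
  linear_combination 2 * (timelikeUnit (l⁻¹ * z) i * spacelikeUnit (l⁻¹ * z) j -
    timelikeUnit (l⁻¹ * z) j * spacelikeUnit (l⁻¹ * z) i) * h4

theorem exampleFrame_col_zero (l z : ℂ) :
    (exampleFrame l z).col 0 = exampleSign z • timelikeUnit (l⁻¹ * z) := by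
  ext i
  rw [Matrix.col_apply, exampleFrame, splitSum_eq]
  fin_cases i <;> simp [blockReal, blockSign, timelikeUnit, ← sub_eq_add_neg] <;> ring

theorem exampleFrame_col_one (l z : ℂ) :
    (exampleFrame l z).col 1 = exampleSign z • spacelikeUnit (l⁻¹ * z) := by
  ext i
  rw [Matrix.col_apply, exampleFrame, splitSum_eq]
  fin_cases i <;> simp [blockReal, blockSign, spacelikeUnit, ← sub_eq_add_neg] <;> ring

/-- The first two columns of the extended frame span the plane `Y ∧ Ŷ`. -/
theorem wedge_example_eq_frame {l : ℂ} (hl : ‖l‖ = 1) {z : ℂ} (hz : z ∈ exampleU) :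
    wedge (exampleY l z) (exampleYh l z) =
      wedge ((exampleFrame l z).col 0) ((exampleFrame l z).col 1) := by
  rw [wedge_example hl hz, exampleFrame_col_zero, exampleFrame_col_one]
  ext i j
  simp only [wedge, Matrix.sub_apply, Matrix.vecMulVec_apply, Pi.smul_apply, smul_eq_mul]
  linear_combination (-(timelikeUnit (l⁻¹ * z) i * spacelikeUnit (l⁻¹ * z) j -
    timelikeUnit (l⁻¹ * z) j * spacelikeUnit (l⁻¹ * z) i)) * exampleSign_sq hz

theorem exampleFrame_zero (l : ℂ) : exampleFrame l 0 = 1 := by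
  have h : exampleSign 0 = 1 := by simp [exampleSign]
  have h1 : ∀ σ, blockReal σ 0 = 1 := fun σ => by
    ext i j
    fin_cases i <;> fin_cases j <;> simp [blockReal]
  rw [exampleFrame, h, mul_zero, h1, h1, blockSign_one, Matrix.one_mul, splitSum_one]

theorem contDiffOn_exampleSign : ContDiffOn ℝ ∞ exampleSign exampleU := fun z hz => by
  have h : ContDiffAt ℝ ∞ (fun w : ℂ => 1 - ‖w‖ ^ 2 / 2) z :=
    contDiffAt_const.sub (((contDiff_norm_sq ℝ).contDiffAt).div_const 2)
  exact ((h.abs (one_sub_ne_zero_of_mem hz)).div h (one_sub_ne_zero_of_mem hz)).contDiffWithinAt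

theorem contDiffOn_exampleFrame {l : ℂ} (hl : ‖l‖ = 1) (i j : Fin 6) :
    ContDiffOn ℝ ∞ (fun z => exampleFrame l z i j) exampleU := by
  have hk : ContDiff ℝ ∞ fun z : ℂ => l⁻¹ * z := contDiff_const.mul contDiff_id
  have hu : ContDiff ℝ ∞ fun z : ℂ => (l⁻¹ * z).re := Complex.reCLM.contDiff.comp hk
  have hv : ContDiff ℝ ∞ fun z : ℂ => (l⁻¹ * z).im := Complex.imCLM.contDiff.comp hk
  have hn : ContDiff ℝ ∞ fun z : ℂ => Complex.normSq (l⁻¹ * z) := by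
    simp only [Complex.normSq_apply]
    fun_prop
  have hb : ∀ σ : ℝ, (∀ z ∈ exampleU, 1 + σ * (Complex.normSq (l⁻¹ * z) / 2) ≠ 0) → ∀ a b,
      ContDiffOn ℝ ∞ (fun z => (blockReal σ (l⁻¹ * z) * blockSign (exampleSign z)) a b)
        exampleU := fun σ h a b => by
    have hd : ContDiffOn ℝ ∞ (fun z => (1 + σ * (Complex.normSq (l⁻¹ * z) / 2))⁻¹) exampleU :=
      ContDiffOn.inv (ContDiff.contDiffOn (by fun_prop)) h
    have hs : ContDiffOn ℝ ∞ (fun z => ![exampleSign z, 1, 1] b) exampleU := by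
      fin_cases b
      exacts [contDiffOn_exampleSign, contDiffOn_const, contDiffOn_const]
    simp only [blockSign, Matrix.mul_diagonal, blockReal, Matrix.smul_apply, smul_eq_mul]
    refine (hd.mul (ContDiff.contDiffOn ?_)).mul hs
    fin_cases a <;> fin_cases b <;> simp [-Complex.mul_re, -Complex.mul_im, -map_mul] <;>
      fun_prop
  refine contDiffOn_splitSum (hb _ fun z hz => ?_) (hb _ fun z hz => ?_) i j
  · rw [normSq_inv_mul hl, neg_one_mul, ← sub_eq_add_neg]
    exact one_sub_ne_zero_of_mem hz
  · rw [normSq_inv_mul hl, one_mul]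
    exact (one_add_normSq_div_two_pos z).ne'

/-- The potential is constant and nilpotent, so that the solution is polynomial in `z / λ`, and it
splits explicitly on each of the two invariant subspaces. -/
theorem isAssociatedFamily_example :
    IsAssociatedFamily (fun _ => exampleB) exampleU
      (fun l z => wedge (exampleY l z) (exampleYh l z)) := by
  refine ⟨exampleSolution, exampleFrame, examplePlus, fun l _ => ⟨?_, fun z i j => ?_⟩,
    fun z hz => ?_, fun l hl => ⟨exampleFrame_zero l, contDiffOn_exampleFrame hl,
      fun z hz => wedge_example_eq_frame hl hz⟩⟩
  · simp only [exampleSolution, blockSolution_eq]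
    simp [splitSum_one]
  · rw [potentialMatrix_exampleB, exampleSolution, splitSum_mul, splitSum_smul]
    exact hasDerivAt_splitSum (fun a b => hasDerivAt_blockSolution _ _ _ a b)
      (fun a b => hasDerivAt_blockSolution _ _ _ a b) i j
  · refine
      { real_mem := fun l hl => isSOPlus_exampleFrame hl hz
        real_twisted := fun l _ => involution_conj_exampleFrame l z
        plus_holomorphic := fun i j => ?_
        plus_mem := fun l _ => isSOComplex_examplePlus l hz
        plus_twisted := fun l _ => involution_conj_examplePlus l z
        plus_zero := ?_
        factor := fun l hl => exampleSolution_factor hl hz }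
    · exact (differentiable_splitSum (fun a b => differentiable_blockSign_mul_blockPlus _ _ _ _ a b)
        (fun a b => differentiable_blockSign_mul_blockPlus _ _ _ _ a b) i j).diffContOnCl
    · have hs : (exampleSign z : ℂ) ^ 2 = 1 := by exact_mod_cast exampleSign_sq hz
      rw [Matrix.det_fin_two, examplePlus, splitSum_eq]
      simp [blockSign, blockPlus, ← sq, hs]

section

/-! ### Harmonicity -/

/-- The Laplacian is `4 ∂_z ∂_z̄`. -/
theorem laplacian_eq_of_hasWirtingerAt {g : ℂ → ℝ} {z : ℂ} (hg : ContDiffAt ℝ 2 g z) {a b : ℂ → ℂ}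
    {a' b' c c' : ℂ} (h : ∀ᶠ w in 𝓝 z, HasWirtingerAt (fun w => (g w : ℂ)) (a w) (b w) w)
    (ha : HasWirtingerAt a a' c z) (hb : HasWirtingerAt b c' b' z) :
    (Δ g z : ℂ) = 2 * (c + c') := by
  have hG : ContDiffAt ℝ 2 (Complex.ofRealCLM ∘ g) z := Complex.ofRealCLM.contDiff.contDiffAt.comp z
      hg
  have h1 : (Δ g z : ℂ) = Δ (Complex.ofRealCLM ∘ g) z :=
    (hg.laplacian_CLM_comp_left (l := Complex.ofRealCLM)).symm
  have hd : DifferentiableAt ℝ (fderiv ℝ (Complex.ofRealCLM ∘ g)) z :=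
    (hG.fderiv_right (m := 1) (by norm_num)).differentiableAt (by norm_num)
  have key : ∀ v : ℂ, fderiv ℝ (fderiv ℝ (Complex.ofRealCLM ∘ g)) z v v =
      v * (v * a' + (starRingEnd ℂ) v * c) +
        (starRingEnd ℂ) v * (v * c' + (starRingEnd ℂ) v * b') := fun v => by
    have e1 : HasFDerivAt (fun w => fderiv ℝ (Complex.ofRealCLM ∘ g) w v) _ z :=
      hd.hasFDerivAt.clm_apply (hasFDerivAt_const v z)
    have e2 : HasWirtingerAt (fun w => v * a w + (starRingEnd ℂ) v * b w) _ _ z :=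
      ((hasWirtingerAt_const v z).mul ha).add ((hasWirtingerAt_const ((starRingEnd ℂ) v) z).mul hb)
    have e3 : (fun w => fderiv ℝ (Complex.ofRealCLM ∘ g) w v) =ᶠ[𝓝 z]
        fun w => v * a w + (starRingEnd ℂ) v * b w := h.mono fun w hw => by
      have : fderiv ℝ (Complex.ofRealCLM ∘ g) w = _ := HasFDerivAt.fderiv hw
      change fderiv ℝ (Complex.ofRealCLM ∘ g) w v = _
      rw [this, wirtingerMap_apply]
      rfl
    have e4 := congrArg (fun L => L v) (e1.unique (HasFDerivAt.congr_of_eventuallyEq e2 e3))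
    simp [wirtingerMap_apply] at e4
    rw [e4]
    ring
  rw [h1, congrFun (InnerProductSpace.laplacian_eq_iteratedFDeriv_complexPlane _) z,
    iteratedFDeriv_two_apply, iteratedFDeriv_two_apply]
  simp only [Matrix.cons_val_zero, Matrix.cons_val_one, key, map_one, Complex.conj_I]
  linear_combination (a' - c - c' + b') * Complex.I_sq

theorem laplacian_mul {f g : ℂ → ℝ} {z : ℂ} (hf : ContDiffAt ℝ 2 f z) (hg : ContDiffAt ℝ 2 g z) :
    Δ (fun w => f w * g w) z = Δ f z * g z + f z * Δ g z +
      2 * (fderiv ℝ f z 1 * fderiv ℝ g z 1 + fderiv ℝ f z Complex.I * fderiv ℝ g z Complex.I) := by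
  have hf1 : ∀ᶠ w in 𝓝 z, DifferentiableAt ℝ f w :=
    (hf.eventually (by simp)).mono fun w hw => hw.differentiableAt (by norm_num)
  have hg1 : ∀ᶠ w in 𝓝 z, DifferentiableAt ℝ g w :=
    (hg.eventually (by simp)).mono fun w hw => hw.differentiableAt (by norm_num)
  have hf2 : DifferentiableAt ℝ (fderiv ℝ f) z :=
    (hf.fderiv_right (m := 1) (by norm_num)).differentiableAt (by norm_num)
  have hg2 : DifferentiableAt ℝ (fderiv ℝ g) z :=
    (hg.fderiv_right (m := 1) (by norm_num)).differentiableAt (by norm_num)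
  have h : fderiv ℝ (fun w => f w * g w) =ᶠ[𝓝 z]
      fun w => f w • fderiv ℝ g w + g w • fderiv ℝ f w := by
    filter_upwards [hf1, hg1] with w hw1 hw2
    exact fderiv_fun_mul hw1 hw2
  have h2 := ((hf1.self_of_nhds.hasFDerivAt.smul hg2.hasFDerivAt).add
    (hg1.self_of_nhds.hasFDerivAt.smul hf2.hasFDerivAt)).congr_of_eventuallyEq h
  simp only [InnerProductSpace.laplacian_eq_iteratedFDeriv_complexPlane, iteratedFDeriv_two_apply,
    h2.fderiv]
  simp
  ring

section Unit

variable (σ α β γ : ℂ) {ζ : ℂ} (h0 : 1 + σ * (ζ * star ζ / 2) ≠ 0)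

theorem hasWirtingerAt_one_add :
    HasWirtingerAt (fun w => 1 + σ * (w * star w / 2)) (σ * (star ζ / 2)) (σ * (ζ / 2)) ζ :=
  ((hasWirtingerAt_const 1 ζ).add ((hasWirtingerAt_const σ ζ).mul
    (((hasWirtingerAt_id ζ).mul (hasWirtingerAt_star ζ)).mul
      (hasWirtingerAt_const (2⁻¹ : ℂ) ζ)))).congr (by ring) (by ring)

/-- The functions `α (2/d - 1) + β ζ/d + γ ζ̄/d`, where `d = 1 + σ |ζ|²/2`. The components of
`timelikeUnit` (`σ = -1`) and of `spacelikeUnit` (`σ = 1`) have this form. -/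
noncomputable def unitComponent (ζ : ℂ) : ℂ :=
  α * (2 * (1 + σ * (ζ * star ζ / 2))⁻¹ - 1) + β * ζ * (1 + σ * (ζ * star ζ / 2))⁻¹ +
    γ * star ζ * (1 + σ * (ζ * star ζ / 2))⁻¹

/-- `∂/∂ζ` of `unitComponent`. -/
noncomputable def unitComponentDz (ζ : ℂ) : ℂ :=
  (β - σ * star ζ * α - σ * (star ζ * star ζ) / 2 * γ) *
    ((1 + σ * (ζ * star ζ / 2))⁻¹ * (1 + σ * (ζ * star ζ / 2))⁻¹)

/-- `∂/∂ζ̄` of `unitComponent`. -/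
noncomputable def unitComponentDzbar (ζ : ℂ) : ℂ :=
  (γ - σ * ζ * α - σ * (ζ * ζ) / 2 * β) *
    ((1 + σ * (ζ * star ζ / 2))⁻¹ * (1 + σ * (ζ * star ζ / 2))⁻¹)

variable {σ}
include h0

theorem hasWirtingerAt_unitComponent : HasWirtingerAt (unitComponent σ α β γ)
    (unitComponentDz σ α β γ ζ) (unitComponentDzbar σ α β γ ζ) ζ := by
  have hid := hasWirtingerAt_id ζ
  have hst := hasWirtingerAt_star ζ
  have hc := fun c : ℂ => hasWirtingerAt_const c ζ
  have ht := (hasWirtingerAt_one_add σ (ζ := ζ)).inv h0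
  refine ((((hc α).mul (((hc 2).mul ht).sub (hc 1))).add (((hc β).mul hid).mul ht)).add
    (((hc γ).mul hst).mul ht)).congr ?_ ?_
  · rw [unitComponentDz]
    obtain ⟨d, hd⟩ : ∃ d, d = 1 + σ * (ζ * star ζ / 2) := ⟨_, rfl⟩
    rw [← hd] at h0 ⊢
    generalize star ζ = b at *
    field_simp
    rw [hd]
    ring
  · rw [unitComponentDzbar]
    obtain ⟨d, hd⟩ : ∃ d, d = 1 + σ * (ζ * star ζ / 2) := ⟨_, rfl⟩
    rw [← hd] at h0 ⊢
    generalize star ζ = b at *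
    field_simp
    rw [hd]
    ring

/-- `unitComponent` is an eigenfunction of `∂_ζ ∂_ζ̄`, up to the factor `d²`. -/
theorem hasWirtingerAt_unitComponentDz (hσ : σ ^ 2 = 1) :
    ∃ a, HasWirtingerAt (unitComponentDz σ α β γ) a
      (-(σ * (1 + σ * (ζ * star ζ / 2))⁻¹ ^ 2) * unitComponent σ α β γ ζ) ζ := by
  have hst := hasWirtingerAt_star ζ
  have hc := fun c : ℂ => hasWirtingerAt_const c ζ
  have ht := (hasWirtingerAt_one_add σ (ζ := ζ)).inv h0
  refine ⟨_, ((((hc β).sub (((hc σ).mul hst).mul (hc α))).sub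
    ((((hc σ).mul (hst.mul hst)).mul (hc 2⁻¹)).mul (hc γ))).mul (ht.mul ht)).congr rfl ?_⟩
  rw [unitComponent]
  obtain ⟨d, hd⟩ : ∃ d, d = 1 + σ * (ζ * star ζ / 2) := ⟨_, rfl⟩
  rw [← hd] at h0 ⊢
  generalize star ζ = b at *
  rcases eq_or_eq_neg_of_sq_eq_sq _ _ (hσ.trans (one_pow 2).symm) with rfl | rfl <;>
  · field_simp
    rw [hd]
    ring

theorem hasWirtingerAt_unitComponentDzbar (hσ : σ ^ 2 = 1) :
    ∃ b, HasWirtingerAt (unitComponentDzbar σ α β γ)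
      (-(σ * (1 + σ * (ζ * star ζ / 2))⁻¹ ^ 2) * unitComponent σ α β γ ζ) b ζ := by
  have hid := hasWirtingerAt_id ζ
  have hc := fun c : ℂ => hasWirtingerAt_const c ζ
  have ht := (hasWirtingerAt_one_add σ (ζ := ζ)).inv h0
  refine ⟨_, ((((hc γ).sub (((hc σ).mul hid).mul (hc α))).sub
    ((((hc σ).mul (hid.mul hid)).mul (hc 2⁻¹)).mul (hc β))).mul (ht.mul ht)).congr ?_ rfl⟩
  rw [unitComponent]
  obtain ⟨d, hd⟩ : ∃ d, d = 1 + σ * (ζ * star ζ / 2) := ⟨_, rfl⟩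
  rw [← hd] at h0 ⊢
  generalize star ζ = b at *
  rcases eq_or_eq_neg_of_sq_eq_sq _ _ (hσ.trans (one_pow 2).symm) with rfl | rfl <;>
  · field_simp
    rw [hd]
    ring

end Unit

/-- The components of the two unit vectors are pointwise eigenfunctions of the Laplacian, with
a common factor. -/
theorem laplacian_unitComponent {σ : ℝ} (hσ : σ ^ 2 = 1) (α β γ : ℂ) {l z : ℂ} (hl : ‖l‖ = 1)
    (h0 : 1 + σ * (‖z‖ ^ 2 / 2) ≠ 0) {g : ℂ → ℝ} (hg : ContDiffAt ℝ 2 g z)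
    (h : ∀ᶠ w in 𝓝 z, (g w : ℂ) = unitComponent σ α β γ (l⁻¹ * w)) :
    Δ g z = -(4 * σ * (1 + σ * (‖z‖ ^ 2 / 2))⁻¹ ^ 2) * g z := by
  have hσc : (σ : ℂ) ^ 2 = 1 := by exact_mod_cast hσ
  have hd : ∀ w, 1 + (σ : ℂ) * (l⁻¹ * w * star (l⁻¹ * w) / 2) =
      ((1 + σ * (‖w‖ ^ 2 / 2) : ℝ) : ℂ) := fun w => by
    rw [← normSq_eq_star, normSq_inv_mul hl]
    push_cast
    ring
  have h1 : ∀ᶠ w in 𝓝 z, 1 + (σ : ℂ) * (l⁻¹ * w * star (l⁻¹ * w) / 2) ≠ 0 := by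
    simp only [hd, Complex.ofReal_ne_zero]
    exact ContinuousAt.eventually_ne (by fun_prop) h0
  have hl1 : l⁻¹ * (starRingEnd ℂ) l⁻¹ = 1 := by
    rw [Complex.mul_conj, Complex.normSq_eq_norm_sq, norm_inv, hl]
    simp
  obtain ⟨a', ha⟩ := hasWirtingerAt_unitComponentDz α β γ h1.self_of_nhds hσc
  obtain ⟨b', hb⟩ := hasWirtingerAt_unitComponentDzbar α β γ h1.self_of_nhds hσc
  have h2 : ∀ᶠ w in 𝓝 z, HasWirtingerAt (fun w => (g w : ℂ))
      (l⁻¹ * unitComponentDz σ α β γ (l⁻¹ * w))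
      ((starRingEnd ℂ) l⁻¹ * unitComponentDzbar σ α β γ (l⁻¹ * w)) w := by
    filter_upwards [h1, h.eventually_nhds] with w hw hw'
    exact HasFDerivAt.congr_of_eventuallyEq
      (hasWirtingerAt_unitComponent α β γ hw).comp_mul_left hw'
  have h3 := laplacian_eq_of_hasWirtingerAt hg h2
    ((hasWirtingerAt_const l⁻¹ z).mul ha.comp_mul_left)
    ((hasWirtingerAt_const ((starRingEnd ℂ) l⁻¹) z).mul hb.comp_mul_left)
  refine Complex.ofReal_injective (h3.trans ?_)
  rw [hd, ← h.self_of_nhds]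
  push_cast
  simp only [smul_eq_mul]
  linear_combination (-(4 * σ * (1 + σ * ((‖z‖ : ℂ) ^ 2 / 2))⁻¹ ^ 2) * g z) * hl1

end

theorem mink_eq_dotProduct (x y : Fin 6 → ℝ) : mink x y = x ⬝ᵥ metricMatrix ℝ *ᵥ y := by
  simp [mink, metricMatrix, dotProduct, Matrix.mulVec_diagonal, Fin.sum_univ_succ]

theorem mink_mulVec_self {X : Matrix (Fin 6) (Fin 6) ℝ}
    (hX : Xᵀ * metricMatrix ℝ + metricMatrix ℝ * X = 0) (x : Fin 6 → ℝ) : mink x (X *ᵥ x) = 0 := by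
  have h1 : mink x (X *ᵥ x) = x ⬝ᵥ (metricMatrix ℝ * X) *ᵥ x := by
    rw [mink_eq_dotProduct, Matrix.mulVec_mulVec]
  have h2 : mink (X *ᵥ x) x = x ⬝ᵥ (Xᵀ * metricMatrix ℝ) *ᵥ x := by
    rw [mink_eq_dotProduct, ← Matrix.mulVec_mulVec, Matrix.dotProduct_mulVec x,
        Matrix.vecMul_transpose]
  have h3 : mink (X *ᵥ x) x + mink x (X *ᵥ x) = 0 := by
    rw [h1, h2, ← dotProduct_add, ← Matrix.add_mulVec, hX, Matrix.zero_mulVec, dotProduct_zero]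
  rw [mink_comm (X *ᵥ x)] at h3
  linarith

theorem bivectorInner_wedge (a b c d : Fin 6 → ℝ) :
    bivectorInner (wedge a b) (wedge c d) =
      2 * (mink a c * mink b d - mink a d * mink b c) := by
  simp only [bivectorInner, metricMatrix, Matrix.trace, Matrix.diag_apply,
    Matrix.mul_apply, wedge, Matrix.transpose_apply, Matrix.sub_apply, Matrix.vecMulVec_apply, mink]
  simp [Fin.sum_univ_succ]
  ring

theorem bivectorInner_add_left (A B C : Matrix (Fin 6) (Fin 6) ℝ) :
    bivectorInner (A + B) C = bivectorInner A C + bivectorInner B C := by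
  simp [bivectorInner, Matrix.add_mul]

theorem bivectorInner_smul_left (c : ℝ) (A C : Matrix (Fin 6) (Fin 6) ℝ) :
    bivectorInner (c • A) C = c * bivectorInner A C := by
  simp [bivectorInner]

theorem bivectorInner_add_right (A B C : Matrix (Fin 6) (Fin 6) ℝ) :
    bivectorInner A (B + C) = bivectorInner A B + bivectorInner A C := by
  simp [bivectorInner, Matrix.mul_add, Matrix.add_mul]

/-- The infinitesimal action of a matrix on bivectors. -/
theorem mul_wedge_add (X : Matrix (Fin 6) (Fin 6) ℝ) (a b : Fin 6 → ℝ) :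
    X * wedge a b + wedge a b * Xᵀ = wedge (X *ᵥ a) b + wedge a (X *ᵥ b) := by
  simp only [wedge, Matrix.mul_sub, Matrix.sub_mul, Matrix.mul_vecMulVec, Matrix.vecMulVec_mul,
    Matrix.vecMul_transpose]
  abel

/-- The derivative of a vector function along `v`. -/
noncomputable def vecDeriv (e : ℂ → Fin 6 → ℝ) (z v : ℂ) : Fin 6 → ℝ :=
  fun i => fderiv ℝ (fun w => e w i) z v

theorem mink_vecDeriv {e f : ℂ → Fin 6 → ℝ} {z : ℂ} {c : ℝ}
    (he : ∀ i, DifferentiableAt ℝ (fun w => e w i) z)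
    (hf : ∀ i, DifferentiableAt ℝ (fun w => f w i) z) (h : ∀ᶠ w in 𝓝 z, mink (e w) (f w) = c) (v :
        ℂ) :
    mink (vecDeriv e z v) (f z) + mink (e z) (vecDeriv f z v) = 0 := by
  have h1 := ((he 0).hasFDerivAt.mul (hf 0).hasFDerivAt).neg.add
    (HasFDerivAt.fun_sum (u := Finset.univ) fun (i : Fin 5) _ =>
      (he i.succ).hasFDerivAt.mul (hf i.succ).hasFDerivAt)
  have h2 := congrArg (fun L => L v)
    (h1.unique ((hasFDerivAt_const c z).congr_of_eventuallyEq h))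
  simp only [add_apply, neg_apply, smul_apply, smul_eq_mul, zero_apply, sum_apply,
    Finset.sum_add_distrib] at h2
  simp only [mink, vecDeriv]
  simp only [mul_comm (fderiv ℝ _ z v)]
  linarith

/-- A plane field spanned by two orthogonal vector functions of constant length, which take values
in orthogonal subspaces and are pointwise eigenfunctions of the Laplacian, is harmonic. -/
theorem tension_wedge_eq_zero {e f : ℂ → Fin 6 → ℝ} {z : ℂ}
    (he : ∀ i, ContDiffAt ℝ 2 (fun w => e w i) z) (hf : ∀ i, ContDiffAt ℝ 2 (fun w => f w i) z)
    {c c' : ℝ} (hee : ∀ᶠ w in 𝓝 z, mink (e w) (e w) = c) (hff : ∀ᶠ w in 𝓝 z, mink (f w) (f w) = c')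
    (hef : ∀ v w, mink (e v) (f w) = 0) {k k' : ℝ} (hΔe : ∀ i, Δ (fun w => e w i) z = k * e z i)
    (hΔf : ∀ i, Δ (fun w => f w i) z = k' * f z i) {X : Matrix (Fin 6) (Fin 6) ℝ}
    (hX : Xᵀ * metricMatrix ℝ + metricMatrix ℝ * X = 0) :
    bivectorInner (Matrix.of fun i j => Δ (fun w => wedge (e w) (f w) i j) z)
      (X * wedge (e z) (f z) + wedge (e z) (f z) * Xᵀ) = 0 := by
  have hΔ : (Matrix.of fun i j => Δ (fun w => wedge (e w) (f w) i j) z) =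
      (k + k') • wedge (e z) (f z) + (2 : ℝ) • (wedge (vecDeriv e z 1) (vecDeriv f z 1) +
        wedge (vecDeriv e z Complex.I) (vecDeriv f z Complex.I)) := by
    ext i j
    have h1 : (fun w => wedge (e w) (f w) i j) =
        (fun w => e w i * f w j) - fun w => f w i * e w j := rfl
    rw [Matrix.of_apply, h1, ContDiffAt.laplacian_sub ((he i).mul (hf j)) ((hf i).mul (he j)),
      laplacian_mul (he i) (hf j), laplacian_mul (hf i) (he j), hΔe, hΔe, hΔf, hΔf]
    simp only [wedge, vecDeriv, Matrix.add_apply, Matrix.smul_apply, Matrix.sub_apply,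
      Matrix.vecMulVec_apply, smul_eq_mul]
    ring
  have hde : ∀ i, DifferentiableAt ℝ (fun w => e w i) z := fun i =>
    (he i).differentiableAt (by norm_num)
  have hdf : ∀ i, DifferentiableAt ℝ (fun w => f w i) z := fun i =>
    (hf i).differentiableAt (by norm_num)
  have h1 : ∀ v, mink (vecDeriv e z v) (e z) = 0 := fun v => by
    have := mink_vecDeriv hde hde hee v
    rw [mink_comm (e z)] at this
    linarith
  have h2 : ∀ v, mink (vecDeriv f z v) (f z) = 0 := fun v => by
    have := mink_vecDeriv hdf hdf hff v
    rw [mink_comm (f z)] at this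
    linarith
  have hc : ∀ x : Fin 6 → ℝ, ∀ v, vecDeriv (fun _ => x) z v = 0 := fun x v => by
    ext i
    simp [vecDeriv]
  have h3 : ∀ v, mink (vecDeriv e z v) (f z) = 0 := fun v => by
    have := mink_vecDeriv hde (f := fun _ => f z) (fun i => differentiableAt_const _)
      (.of_forall fun w => hef w z) v
    rw [hc] at this
    simpa [mink] using this
  have h4 : ∀ v, mink (vecDeriv f z v) (e z) = 0 := fun v => by
    have := mink_vecDeriv hdf (f := fun _ => e z) (fun i => differentiableAt_const _)
      (.of_forall fun w => (mink_comm _ _).trans (hef z w)) v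
    rw [hc] at this
    simpa [mink] using this
  rw [hΔ, mul_wedge_add]
  simp only [bivectorInner_add_left, bivectorInner_add_right, bivectorInner_smul_left,
    bivectorInner_wedge, h1, h2, h3, h4, hef, mink_comm (f z) (e z), mink_mulVec_self hX]
  ring

theorem mink_timelikeUnit {ζ : ℂ} (h : 1 - Complex.normSq ζ / 2 ≠ 0) :
    mink (timelikeUnit ζ) (timelikeUnit ζ) = -1 := by
  rw [timelikeUnit, mink_smul_left, mink_smul_right, inv_mul_eq_iff_eq_mul₀ h,
    inv_mul_eq_iff_eq_mul₀ h]
  have := Complex.normSq_apply ζ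
  simp only [mink, Fin.sum_univ_succ]
  simp
  linear_combination -2 * this

theorem mink_spacelikeUnit {ζ : ℂ} (h : 1 + Complex.normSq ζ / 2 ≠ 0) :
    mink (spacelikeUnit ζ) (spacelikeUnit ζ) = 1 := by
  rw [spacelikeUnit, mink_smul_left, mink_smul_right, inv_mul_eq_iff_eq_mul₀ h,
    inv_mul_eq_iff_eq_mul₀ h]
  have := Complex.normSq_apply ζ
  simp only [mink, Fin.sum_univ_succ]
  simp
  linear_combination -2 * this

theorem mink_timelikeUnit_spacelikeUnit (ζ ξ : ℂ) :
    mink (timelikeUnit ζ) (spacelikeUnit ξ) = 0 := by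
  rw [timelikeUnit, spacelikeUnit, mink_smul_left, mink_smul_right]
  simp [mink, Fin.sum_univ_succ]

theorem timelikeUnit_eq_unitComponent (i : Fin 6) : ∃ α β γ : ℂ, ∀ ζ : ℂ,
    1 - Complex.normSq ζ / 2 ≠ 0 →
      (timelikeUnit ζ i : ℂ) = unitComponent ((-1 : ℝ) : ℂ) α β γ ζ := by
  refine ⟨![1, 0, 0, 0, 0, 0] i,
    ![0, 0, Complex.I / 2, -(1 / 2), -(Complex.I / 2), 1 / 2] i,
    ![0, 0, -(Complex.I / 2), -(1 / 2), Complex.I / 2, 1 / 2] i, fun ζ h => ?_⟩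
  have h1 := im_eq_star ζ
  have h2 := re_eq_star ζ
  have h3 : (1 : ℂ) - ζ * star ζ / 2 ≠ 0 := by
    rw [← normSq_eq_star]
    exact_mod_cast h
  have h4 : (1 : ℂ) + ((-1 : ℝ) : ℂ) * (ζ * star ζ / 2) = 1 - ζ * star ζ / 2 := by
    push_cast
    ring
  have h5 : ((1 - Complex.normSq ζ / 2 : ℝ) : ℂ) = 1 - ζ * star ζ / 2 := by
    push_cast
    rw [normSq_eq_star]
  have h6 : ((1 + Complex.normSq ζ / 2 : ℝ) : ℂ) = 2 - (1 - ζ * star ζ / 2) := by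
    push_cast
    rw [normSq_eq_star]
    ring
  simp only [timelikeUnit, Pi.smul_apply, smul_eq_mul, Complex.ofReal_mul, Complex.ofReal_inv, h5,
    unitComponent, h4]
  generalize (1 : ℂ) - ζ * star ζ / 2 = d at *
  generalize 1 + Complex.normSq ζ / 2 = d' at *
  generalize star ζ = b at *
  fin_cases i <;> simp [h1, h2, h6] <;> field_simp <;> ring

theorem spacelikeUnit_eq_unitComponent (i : Fin 6) : ∃ α β γ : ℂ, ∀ ζ : ℂ,
    (spacelikeUnit ζ i : ℂ) = unitComponent ((1 : ℝ) : ℂ) α β γ ζ := by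
  refine ⟨![0, 1, 0, 0, 0, 0] i,
    ![0, 0, -(Complex.I / 2), 1 / 2, -(Complex.I / 2), 1 / 2] i,
    ![0, 0, Complex.I / 2, 1 / 2, Complex.I / 2, 1 / 2] i, fun ζ => ?_⟩
  have h1 := im_eq_star ζ
  have h2 := re_eq_star ζ
  have h4 : (1 : ℂ) + ((1 : ℝ) : ℂ) * (ζ * star ζ / 2) = 1 + ζ * star ζ / 2 := by
    push_cast
    ring
  have h5 : ((1 + Complex.normSq ζ / 2 : ℝ) : ℂ) = 1 + ζ * star ζ / 2 := by
    push_cast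
    rw [normSq_eq_star]
  have h3 : (1 : ℂ) + ζ * star ζ / 2 ≠ 0 := by
    rw [← h5]
    exact_mod_cast (by have := Complex.normSq_nonneg ζ; positivity :
      1 + Complex.normSq ζ / 2 ≠ 0)
  have h6 : ((1 - Complex.normSq ζ / 2 : ℝ) : ℂ) = 2 - (1 + ζ * star ζ / 2) := by
    push_cast
    rw [normSq_eq_star]
    ring
  simp only [spacelikeUnit, Pi.smul_apply, smul_eq_mul, Complex.ofReal_mul, Complex.ofReal_inv, h5,
    unitComponent, h4]
  generalize (1 : ℂ) + ζ * star ζ / 2 = d at *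
  generalize 1 - Complex.normSq ζ / 2 = d' at *
  generalize star ζ = b at *
  fin_cases i <;> simp [h1, h2, h6] <;> field_simp <;> ring

theorem contDiffAt_timelikeUnit {ζ : ℂ} (h : 1 - Complex.normSq ζ / 2 ≠ 0) (i : Fin 6) :
    ContDiffAt ℝ 2 (fun w => timelikeUnit w i) ζ := by
  have hu : ContDiff ℝ 2 Complex.re := Complex.reCLM.contDiff
  have hv : ContDiff ℝ 2 Complex.im := Complex.imCLM.contDiff
  have hn : ContDiff ℝ 2 fun w : ℂ => Complex.normSq w := by
    simp only [Complex.normSq_apply]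
    fun_prop
  have hd : ContDiff ℝ 2 fun w : ℂ => 1 - Complex.normSq w / 2 := by fun_prop
  refine (hd.contDiffAt.inv h).mul (ContDiff.contDiffAt ?_)
  fin_cases i <;> simp <;> fun_prop

theorem contDiff_spacelikeUnit (i : Fin 6) :
    ContDiff ℝ 2 (fun w => spacelikeUnit w i) := by
  have hu : ContDiff ℝ 2 Complex.re := Complex.reCLM.contDiff
  have hv : ContDiff ℝ 2 Complex.im := Complex.imCLM.contDiff
  have hn : ContDiff ℝ 2 fun w : ℂ => Complex.normSq w := by
    simp only [Complex.normSq_apply]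
    fun_prop
  have hd : ContDiff ℝ 2 fun w : ℂ => 1 + Complex.normSq w / 2 := by fun_prop
  refine (hd.inv fun w => ?_).mul ?_
  · have := Complex.normSq_nonneg w
    positivity
  fin_cases i <;> simp <;> fun_prop

theorem isHarmonicMapOn_example {l : ℂ} (hl : ‖l‖ = 1) :
    IsHarmonicMapOn exampleU (fun z => wedge (exampleY l z) (exampleYh l z)) where
  mem z hz := ⟨exampleFrame l z, isSOPlus_exampleFrame hl hz, wedge_example_eq_frame hl hz⟩
  smooth i j := by
    refine ContDiffOn.congr (f := fun z => exampleFrame l z i 0 * exampleFrame l z j 1 -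
      exampleFrame l z i 1 * exampleFrame l z j 0) ?_ fun z hz => ?_
    · exact ((contDiffOn_exampleFrame hl i 0).mul (contDiffOn_exampleFrame hl j 1)).sub
        ((contDiffOn_exampleFrame hl i 1).mul (contDiffOn_exampleFrame hl j 0))
    · rw [wedge_example_eq_frame hl hz]
      rfl
  tension z hz X hX := by
    have hk : ContDiff ℝ 2 fun z : ℂ => l⁻¹ * z := contDiff_const.mul contDiff_id
    have hU : ∀ᶠ w in 𝓝 z, w ∈ exampleU := isOpen_exampleU.mem_nhds hz
    have h1 : ∀ w ∈ exampleU, 1 - Complex.normSq (l⁻¹ * w) / 2 ≠ 0 := fun w hw => by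
      rw [normSq_inv_mul hl]
      exact one_sub_ne_zero_of_mem hw
    have he : ∀ i, ContDiffAt ℝ 2 (fun w => timelikeUnit (l⁻¹ * w) i) z := fun i =>
      (contDiffAt_timelikeUnit (h1 z hz) i).comp z hk.contDiffAt
    have hf : ∀ i, ContDiffAt ℝ 2 (fun w => spacelikeUnit (l⁻¹ * w) i) z := fun i =>
      ((contDiff_spacelikeUnit i).comp hk).contDiffAt
    have hΔ : (Matrix.of fun i j => Δ (fun w => wedge (exampleY l w) (exampleYh l w) i j) z) =
        Matrix.of fun i j =>
          Δ (fun w => wedge (timelikeUnit (l⁻¹ * w)) (spacelikeUnit (l⁻¹ * w)) i j) z := by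
      ext i j
      exact (InnerProductSpace.laplacian_congr_nhds
        (hU.mono fun w hw => congrFun₂ (wedge_example hl hw) i j)).self_of_nhds
    rw [hΔ, wedge_example hl hz]
    refine tension_wedge_eq_zero (e := fun w => timelikeUnit (l⁻¹ * w))
      (f := fun w => spacelikeUnit (l⁻¹ * w)) he hf (hU.mono fun w hw => mink_timelikeUnit (h1 w
          hw))
      (.of_forall fun w => mink_spacelikeUnit ?_) (fun v w => mink_timelikeUnit_spacelikeUnit _ _)
      (k := -(4 * -1 * (1 + -1 * (‖z‖ ^ 2 / 2))⁻¹ ^ 2))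
      (k' := -(4 * 1 * (1 + 1 * (‖z‖ ^ 2 / 2))⁻¹ ^ 2)) (fun i => ?_) (fun i => ?_) hX
    · rw [normSq_inv_mul hl]
      exact (one_add_normSq_div_two_pos w).ne'
    · obtain ⟨α, β, γ, h⟩ := timelikeUnit_eq_unitComponent i
      refine laplacian_unitComponent (σ := -1) (by norm_num) α β γ hl ?_ (he i)
        (hU.mono fun w hw => h _ (h1 w hw))
      rw [neg_one_mul, ← sub_eq_add_neg]
      exact one_sub_ne_zero_of_mem hz
    · obtain ⟨α, β, γ, h⟩ := spacelikeUnit_eq_unitComponent i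
      refine laplacian_unitComponent (σ := 1) (by norm_num) α β γ hl ?_ (hf i)
        (.of_forall fun w => h _)
      rw [one_mul]
      exact (one_add_normSq_div_two_pos z).ne'

/-- Points of the exceptional curve are limits of points of `exampleU`, along rays. -/
theorem mem_closure_exampleU {z₀ : ℂ} (h0 : 1 - ‖z₀‖ ^ 4 / 4 = 0) : z₀ ∈ closure exampleU := by
  have h1 : Filter.Tendsto (fun t : ℝ => t • z₀) (𝓝[>] 1) (𝓝 z₀) := by
    have : Filter.Tendsto (fun t : ℝ => t • z₀) (𝓝 1) (𝓝 ((1 : ℝ) • z₀)) :=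
      Continuous.tendsto (by fun_prop) 1
    rw [one_smul] at this
    exact this.mono_left nhdsWithin_le_nhds
  refine mem_closure_of_tendsto h1 ?_
  filter_upwards [self_mem_nhdsWithin] with t ht
  have h2 : 1 < t := ht
  have h3 : 1 < t ^ 4 := one_lt_pow₀ h2 (by norm_num)
  have h4 : 1 - ‖t • z₀‖ ^ 4 / 4 ≠ 0 := by
    rw [norm_smul, mul_pow, Real.norm_of_nonneg (by linarith)]
    have : ‖z₀‖ ^ 4 = 4 := by linarith
    rw [this]
    linarith
  exact h4

/-- Two entries of `Y ∧ Ŷ` are `Im ζ / (1 - r²/2)` and `Re ζ / (1 - r²/2)`, `ζ = λ⁻¹ z`, and at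
least one of them is unbounded near a point of the exceptional curve. -/
theorem not_tendsto_example {l : ℂ} (hl : ‖l‖ = 1) {z₀ : ℂ} (h0 : 1 - ‖z₀‖ ^ 4 / 4 = 0)
    (A : Matrix (Fin 6) (Fin 6) ℝ) :
    ¬Filter.Tendsto (fun z => wedge (exampleY l z) (exampleYh l z)) (𝓝[exampleU] z₀) (𝓝 A) := by
  intro hA
  have : (𝓝[exampleU] z₀).NeBot := mem_closure_iff_nhdsWithin_neBot.1 (mem_closure_exampleU h0)
  have hr : ‖z₀‖ ^ 2 = 2 := by
    have h1 : (‖z₀‖ ^ 2 - 2) * (‖z₀‖ ^ 2 + 2) = 0 := by linear_combination -4 * h0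
    have h2 : ‖z₀‖ ^ 2 + 2 ≠ 0 := by positivity
    have := (mul_eq_zero.1 h1).resolve_right h2
    linarith
  have key : ∀ (i : Fin 6) (g : ℂ → ℝ), Continuous g →
      (∀ z ∈ exampleU, (1 - ‖z‖ ^ 2 / 2) * wedge (exampleY l z) (exampleYh l z) 0 i = g z) →
      g z₀ = 0 := fun i g hg h => by
    have h1 : Filter.Tendsto (fun z : ℂ => 1 - ‖z‖ ^ 2 / 2) (𝓝[exampleU] z₀) (𝓝 0) := by
      have : Filter.Tendsto (fun z : ℂ => 1 - ‖z‖ ^ 2 / 2) (𝓝 z₀) (𝓝 (1 - ‖z₀‖ ^ 2 / 2)) :=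
        Continuous.tendsto (by fun_prop) z₀
      rw [hr, div_self two_ne_zero, sub_self] at this
      exact this.mono_left nhdsWithin_le_nhds
    have h2 := h1.mul ((hA.apply_nhds 0).apply_nhds i)
    rw [zero_mul] at h2
    refine tendsto_nhds_unique ((hg.tendsto z₀).mono_left nhdsWithin_le_nhds) (h2.congr' ?_)
    filter_upwards [self_mem_nhdsWithin] with z hz using h z hz
  have hk : Continuous fun z : ℂ => l⁻¹ * z := by fun_prop
  have e : ∀ z ∈ exampleU, (1 - ‖z‖ ^ 2 / 2) * wedge (exampleY l z) (exampleYh l z) 0 2 =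
      (l⁻¹ * z).im ∧ (1 - ‖z‖ ^ 2 / 2) * wedge (exampleY l z) (exampleYh l z) 0 3 =
      (l⁻¹ * z).re := fun z hz => by
    have h1 := one_sub_ne_zero_of_mem hz
    have h2 := (one_add_normSq_div_two_pos z).ne'
    rw [wedge_example hl hz]
    simp only [wedge, Matrix.sub_apply, Matrix.vecMulVec_apply, timelikeUnit, spacelikeUnit,
      normSq_inv_mul hl, Pi.smul_apply, smul_eq_mul]
    generalize (l⁻¹ * z).im = v
    generalize (l⁻¹ * z).re = u
    generalize 1 - ‖z‖ ^ 2 / 2 = d at *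
    generalize 1 + ‖z‖ ^ 2 / 2 = d' at *
    constructor <;> simp <;> field_simp
  have hv := key 2 _ (Complex.continuous_im.comp hk) fun z hz => (e z hz).1
  have hu := key 3 _ (Complex.continuous_re.comp hk) fun z hz => (e z hz).2
  have h1 := normSq_inv_mul hl z₀
  rw [Complex.normSq_apply, hr] at h1
  simp only [Function.comp_apply] at hu hv
  rw [hu, hv] at h1
  norm_num at h1

end WillmorePair

theorem mainTheorem4 :
    -- the associated family generated by the potential is `Y ∧ Ŷ`
    WillmorePair.IsAssociatedFamily (fun _ => WillmorePair.exampleB) WillmorePair.exampleU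
      (fun l z => WillmorePair.wedge (WillmorePair.exampleY l z) (WillmorePair.exampleYh l z)) ∧
    ∀ l : ℂ, ‖l‖ = 1 →
      ∃ y yh : OnePoint ℂ → EuclideanSpace ℝ (Fin 5),
        -- `y` and `yh` are `[Y]` and `[Ŷ]`, extended to the whole sphere
        (∀ z ∈ WillmorePair.exampleU,
          y z = WillmorePair.toSphere (WillmorePair.exampleY l z) ∧
          yh z = WillmorePair.toSphere (WillmorePair.exampleYh l z)) ∧
        -- `Y ∧ Ŷ` is an isotropic harmonic map
        WillmorePair.IsHarmonicMapOn WillmorePair.exampleU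
          (fun z => WillmorePair.wedge (WillmorePair.exampleY l z)
            (WillmorePair.exampleYh l z)) ∧
        WillmorePair.IsAdjointTransformOn WillmorePair.exampleU (fun z => y z)
          (WillmorePair.exampleYh l) ∧
        -- `[Y]` and `[Ŷ]` are conformally equivalent
        WillmorePair.ConformallyEquivalentOn Set.univ
          (fun p => WillmorePair.coneLift (y p)) (fun p => WillmorePair.coneLift (yh p)) ∧
        -- `[Y]` is an H-totally isotropic Willmore immersion, with the stated metric
        WillmorePair.IsHTotallyIsotropic 2 y ∧
        WillmorePair.IsWillmoreImmersion y ∧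
        (∀ z : ℂ,
          WillmorePair.mink
            (WillmorePair.dz (WillmorePair.complexLift fun w : ℂ => y w) z)
            (WillmorePair.dzbar (WillmorePair.complexLift fun w : ℂ => y w) z) =
          (((2 + ‖z‖ ^ 4 / 2) / (1 + ‖z‖ ^ 2 / 2) ^ 4 : ℝ) : ℂ)) ∧
        -- `[Y]` is conformally equivalent to the minimal surface `x`
        WillmorePair.IsMinimalSurfaceOn {z | z ≠ 0} (WillmorePair.exampleX l) ∧
        WillmorePair.ConformallyEquivalentOn {z : ℂ | z ≠ 0}
          (fun z => WillmorePair.coneLift (y z))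
          (fun z => WillmorePair.stereoLift (WillmorePair.exampleX l z)) ∧
        -- `Y ∧ Ŷ` has no definition on the curve `r⁴ = 4`: there `[Y] = [Ŷ]`, and `Y ∧ Ŷ` has
        -- no limit in the symmetric space
        (∀ z₀ : ℂ, 1 - ‖z₀‖ ^ 4 / 4 = 0 →
          y z₀ = yh z₀ ∧
          ¬ ∃ A ∈ WillmorePair.symmetricSpace,
            Filter.Tendsto
              (fun z => WillmorePair.wedge (WillmorePair.exampleY l z)
                (WillmorePair.exampleYh l z))
              (nhdsWithin z₀ WillmorePair.exampleU) (nhds A)) ∧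
        -- nevertheless `[Ŷ]` is also a Willmore immersion of the whole sphere
        WillmorePair.IsWillmoreImmersion yh := by
  open WillmorePair in
  exact ⟨isAssociatedFamily_example, fun l hl => ⟨exampleSurface l, exampleDual l,
    fun z hz => ⟨exampleSurface_eq_toSphere hl hz, exampleDual_eq_toSphere hl hz⟩,
    isHarmonicMapOn_example hl, isAdjointTransformOn_example hl,
    conformallyEquivalentOn_exampleDual l,
    isHTotallyIsotropic_of_isIsotropicSurface (exampleSurface_isotropic hl),
    isWillmoreImmersion_of_isIsotropicSurface (by norm_num) (exampleSurface_isotropic hl),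
    metric_exampleSurface hl, isMinimalSurfaceOn_exampleX hl, conformallyEquivalentOn_exampleX hl,
    fun z₀ h0 => ⟨exampleSurface_eq_exampleDual hl h0, fun ⟨A, _, hA⟩ =>
      not_tendsto_example hl h0 A hA⟩,
    isWillmoreImmersion_of_isIsotropicSurface (by norm_num) (exampleDual_isotropic hl)⟩⟩
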